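/- For a finite directed multigraph $G$ (parallel arcs are allowed), a strong component of $G$ is an inclusion-maximal induced subgraph in which every vertex is reachable from every other vertex by a directed path; its size is its number of vertices. Bounded Size Strong Component Arc (respectively Vertex) Deletion is the following problem: given a finite directed multigraph $G$ and integers $k,s\ge 0$, find a set $S$ of at most $k$ arcs (respectively vertices) of $G$ such that every strong component of $G-S$ has at most $s$ vertices, or report that no such set exists. Theorem. There is an algorithm that solves Bounded Size Strong Component Arc Deletion, and there is an algorithm that solves Bounded Size Strong Component Vertex Deletion, each in time $4^k\,(ks+k+s)!\cdot n^{O(1)}$ on $n$-vertex directed multigraphs $G$ and integers $k,s\ge 0$. Here $G$ is given by its adjacency matrix (the number of parallel arcs for each ordered pair of vertices), and time is counted on a random access machine with unit costs, with addition and subtraction as its arithmetic operations. -/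

import Mathlib

/-! ## Multi-digraphs and their strong components -/

/-- A directed multigraph with vertex set `V` and arc set `A`: every arc has a tail and a head.
Parallel arcs, and arcs in both directions between two vertices, are allowed. -/
structure MultiDigraph (V A : Type) where
  /-- the tail of an arc -/
  src : A → V
  /-- the head of an arc -/
  tgt : A → V

namespace MultiDigraph

variable {V A : Type}

/-- There is an arc from `u` to `v`. -/
def Adj (G : MultiDigraph V A) (u v : V) : Prop :=
  ∃ a : A, G.src a = u ∧ G.tgt a = v

/-- There is a directed path (possibly of length zero) from `u` to `v`. -/
def Reachable (G : MultiDigraph V A) (u v : V) : Prop :=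
  Relation.ReflTransGen G.Adj u v

/-- `G` is strong: every vertex can be reached from every other vertex. -/
def Strong (G : MultiDigraph V A) : Prop :=
  ∀ u v : V, u ≠ v → G.Reachable u v

/-- The subgraph of `G` induced by the vertex set `C`. -/
def induce (G : MultiDigraph V A) (C : Set V) :
    MultiDigraph {v : V // v ∈ C} {a : A // G.src a ∈ C ∧ G.tgt a ∈ C} where
  src a := ⟨G.src a.1, a.2.1⟩
  tgt a := ⟨G.tgt a.1, a.2.2⟩

/-- `C` is the vertex set of a strong component of `G`, that is, of an inclusion-maximal strong
induced subgraph. -/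
def IsStrongComponent (G : MultiDigraph V A) (C : Set V) : Prop :=
  Maximal (fun D : Set V => D.Nonempty ∧ (G.induce D).Strong) C

/-- Every strong component of `G` has at most `s` vertices. -/
def StrongComponentsBounded (G : MultiDigraph V A) (s : ℕ) : Prop :=
  ∀ C : Set V, G.IsStrongComponent C → C.encard ≤ s

/-- `G - S` for a set `S` of arcs. -/
def deleteArcs (G : MultiDigraph V A) (S : Set A) : MultiDigraph V {a : A // a ∉ S} where
  src a := G.src a.1
  tgt a := G.tgt a.1

/-- `G - S` for a set `S` of vertices. -/
def deleteVertices (G : MultiDigraph V A) (S : Set V) :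
    MultiDigraph {v : V // v ∈ Sᶜ} {a : A // G.src a ∈ Sᶜ ∧ G.tgt a ∈ Sᶜ} :=
  G.induce Sᶜ

/-- `S` is a solution of the instance `(G, k, s)` of Bounded Size Strong Component Vertex
Deletion. -/
def IsVertexSolution (G : MultiDigraph V A) (k s : ℕ) (S : Finset V) : Prop :=
  S.card ≤ k ∧ (G.deleteVertices (S : Set V)).StrongComponentsBounded s

/-- `S` is a solution of the instance `(G, k, s)` of Bounded Size Strong Component Arc
Deletion. -/
def IsArcSolution (G : MultiDigraph V A) (k s : ℕ) (S : Finset A) : Prop :=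
  S.card ≤ k ∧ (G.deleteArcs (S : Set A)).StrongComponentsBounded s

end MultiDigraph

/-! ## Random access programs with unit costs

The machine has variables and arrays, indexed by natural numbers, whose cells hold natural numbers;
a program mentions finitely many of them. Array cells are addressed indirectly. The arithmetic
operations are addition and truncated subtraction (no multiplication), and every operation, every
access and every test takes one unit of time. -/

namespace RAM

/-- A memory content. -/
structure State where
  /-- the values of the variables -/
  var : ℕ → ℕ
  /-- `arr a i` is the content of cell `i` of array `a` -/
  arr : ℕ → ℕ → ℕ

/-- Change the value of variable `x` to `v`. -/
def State.setVar (σ : State) (x v : ℕ) : State where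
  var := Function.update σ.var x v
  arr := σ.arr

/-- Change the content of cell `i` of array `a` to `v`. -/
def State.setArr (σ : State) (a i v : ℕ) : State where
  var := σ.var
  arr := Function.update σ.arr a (Function.update (σ.arr a) i v)

/-- Arithmetic expressions. -/
inductive Expr where
  | const (m : ℕ) : Expr
  | var (x : ℕ) : Expr
  | read (a : ℕ) (i : Expr) : Expr
  | add (e f : Expr) : Expr
  | sub (e f : Expr) : Expr

/-- The value of an expression. -/
def Expr.eval (σ : State) : Expr → ℕ
  | .const m => m
  | .var x => σ.var x
  | .read a i => σ.arr a (i.eval σ)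
  | .add e f => e.eval σ + f.eval σ
  | .sub e f => e.eval σ - f.eval σ

/-- The time for evaluating an expression: one unit for each constant, access and operation. -/
def Expr.cost : Expr → ℕ
  | .const _ => 1
  | .var _ => 1
  | .read _ i => i.cost + 1
  | .add e f => e.cost + f.cost + 1
  | .sub e f => e.cost + f.cost + 1

/-- Programs. Tests are on whether the value of an expression is nonzero. -/
inductive Prog where
  | skip : Prog
  | assign (x : ℕ) (e : Expr) : Prog
  | write (a : ℕ) (i e : Expr) : Prog
  | seq (p q : Prog) : Prog
  | cond (e : Expr) (p q : Prog) : Prog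
  | loop (e : Expr) (p : Prog) : Prog

/-- `Run p σ t τ`: started in memory `σ`, the program `p` halts after exactly `t` units of time,
with memory `τ`. -/
inductive Run : Prog → State → ℕ → State → Prop where
  | skip (σ : State) : Run .skip σ 1 σ
  | assign (x : ℕ) (e : Expr) (σ : State) :
      Run (.assign x e) σ (e.cost + 1) (σ.setVar x (e.eval σ))
  | write (a : ℕ) (i e : Expr) (σ : State) :
      Run (.write a i e) σ (i.cost + e.cost + 1) (σ.setArr a (i.eval σ) (e.eval σ))
  | seq {p q : Prog} {σ τ ρ : State} {t u : ℕ} (hp : Run p σ t τ) (hq : Run q τ u ρ) :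
      Run (.seq p q) σ (t + u) ρ
  | cond_true {e : Expr} {p q : Prog} {σ τ : State} {t : ℕ} (he : e.eval σ ≠ 0)
      (hp : Run p σ t τ) : Run (.cond e p q) σ (e.cost + 1 + t) τ
  | cond_false {e : Expr} {p q : Prog} {σ τ : State} {t : ℕ} (he : e.eval σ = 0)
      (hq : Run q σ t τ) : Run (.cond e p q) σ (e.cost + 1 + t) τ
  | loop_true {e : Expr} {p : Prog} {σ τ ρ : State} {t u : ℕ} (he : e.eval σ ≠ 0)
      (hp : Run p σ t τ) (hl : Run (.loop e p) τ u ρ) :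
      Run (.loop e p) σ (e.cost + 1 + t + u) ρ
  | loop_false {e : Expr} {p : Prog} {σ : State} (he : e.eval σ = 0) :
      Run (.loop e p) σ (e.cost + 1) σ

/-- The initial memory for the instance `(G, k, s)`, where `G` has the vertices `0, …, n - 1`:
variables `0`, `1`, `2` hold `n`, `k`, `s`, and array `0` holds the adjacency matrix of `G`, row by
row, so that cell `u * n + v` holds the number of arcs from `u` to `v`. All else is zero. -/
noncomputable def input {n : ℕ} {A : Type} (G : MultiDigraph (Fin n) A) (k s : ℕ) : State where
  var x := if x = 0 then n else if x = 1 then k else if x = 2 then s else 0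
  arr a i := if a = 0 then
    Set.ncard {e : A | (G.src e : ℕ) * n + (G.tgt e : ℕ) = i} else 0

/-- The final memory `τ` is a correct answer to the instance `(G, k, s)` of Bounded Size Strong
Component Vertex Deletion: either variable `0` holds `1` and the first `n` cells of array `1` hold
the characteristic vector of a solution, or variable `0` holds `0` and there is no solution. -/
def VertexAnswer {n : ℕ} {A : Type} (G : MultiDigraph (Fin n) A) (k s : ℕ) (τ : State) : Prop :=
  (τ.var 0 = 1 ∧ ∃ S : Finset (Fin n), G.IsVertexSolution k s S ∧
    ∀ v : Fin n, τ.arr 1 v = if v ∈ S then 1 else 0) ∨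
  (τ.var 0 = 0 ∧ ¬ ∃ S : Finset (Fin n), G.IsVertexSolution k s S)

/-- The final memory `τ` is a correct answer to the instance `(G, k, s)` of Bounded Size Strong
Component Arc Deletion: either variable `0` holds `1` and there is a solution `S` such that cell
`u * n + v` of array `1` holds the number of arcs from `u` to `v` in `S`, for all `u` and `v`, or
variable `0` holds `0` and there is no solution. -/
def ArcAnswer {n : ℕ} {A : Type} (G : MultiDigraph (Fin n) A) (k s : ℕ) (τ : State) : Prop :=
  (τ.var 0 = 1 ∧ ∃ S : Finset A, G.IsArcSolution k s S ∧
    ∀ u v : Fin n, τ.arr 1 ((u : ℕ) * n + v) =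
      Set.ncard {e : A | e ∈ S ∧ G.src e = u ∧ G.tgt e = v}) ∨
  (τ.var 0 = 0 ∧ ¬ ∃ S : Finset A, G.IsArcSolution k s S)

end RAM

/-! The algorithm is iterative compression over the vertices. `rowsCap i` keeps the arcs with tail
below `i`. Given a solution for `i`, the tails of its arcs together with the vertex `i` form a set
of at most `k + 1` terminals. After any deletion in the next graph, a strong component without
terminals uses only arcs that the old solution keeps, so it lies in an old component and is small.
Only the components through terminals need attention.

Let `D` be a solution for `i + 1`. The components of the graph without `D` that meet a terminal are
numbered topologically from 1 to at most `k + 1` (`exists_labels`), and they are guessed vertex by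
vertex. If only a proper part `K` of a component is known, a flow that starts with the arcs leaving
`K` and ends in `K` yields at most `k + 1` candidate arcs, one of which has an end in the component
outside `K` (`exists_cand`, `card_cand`). So an index with `2 * (k + 1)` values names a new vertex,
and a component costs at most `s` indices.

Once the components are known, it suffices to find arcs of capacity at most `k` that cut each class
off from itself and from all classes with smaller numbers: this leaves only small components
(`Labels.small`), and `D` does it (`Labels.valid`). This is a skew separator problem, solved as for
feedback arc sets. For the class with the largest number take the minimum cut furthest from the
sources. Some optimal separator contains its source side (`Valid.push`). For an arc that crosses it,
either the arc is deleted or its head joins the sources (`Valid.branch`). If `κ` is the remaining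
budget and `μ` a lower bound for the cut, each such bit lowers `2 * κ - μ` (`Progress.branch`), so
`2 * k` bits suffice for all classes together.

The guesses are digits of an advice, and all advices are tried in turn; a final verification makes
the answers sound. With `m = (k + 1) * s` there are `(2 * (k + 1)) ^ m * 2 ^ (2 * m + 2 * k) = 4 ^ k
* (8 * (k + 1)) ^ m` advices. By `pow_le_factorial_mul` this is at most `4 ^ k * m! * 3 ^ (8 * (k +
1))`. The last factor, times any fixed power of `k + 1`, is a constant times `k!` at most, and `m! *
k! ≤ (k * s + k + s)!`. To keep a single try polynomial in `n` and `k`, `s` is replaced by `min s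
n`.

For vertex deletion every vertex `v` is split into an arc from `v` to `v + n` of capacity one, all
other arcs get the unaffordable capacity `k + 1`, and only first halves count for the size. A
component with at least two vertices contains both halves or none (`TwinArcs.conn`), so classes grow
by pairs and each index still pays for one unit of size. Both problems thus become one capacity
problem, `Solves`.

On the machine side, `Cmd` has only bounded loops, so that `exec` is a total function and the time
is polynomial in the loop bounds (`compile_run`, `time_poly`). `Ang` expresses that suitable advice
leads from one state to another; `Same` is the frame condition. An attempt clears its scratch memory
first, so its outcome depends on the lasting memory and the advice only. This supports the invariant
`Core` of the main loop: if a solution exists, then a successful advice has not been passed yet. -/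

/-! ## A language of bounded loops -/

open RAM (State Expr Prog Run)

/-- the variable that bounds the addresses of all writes -/
notation "vSZ" => 7
/-- the array of advice digits -/
notation "aDIG" => 5
/-- the pointer to the next index digit -/
notation "vPA" => 12
/-- the pointer to the next bit -/
notation "vPB" => 13

/-- Programs all of whose loops are bounded by the value of a variable. -/
inductive Cmd where
  | skip : Cmd
  | assign (x : ℕ) (e : Expr) : Cmd
  | write (a : ℕ) (i e : Expr) : Cmd
  | seq (p q : Cmd) : Cmd
  | cond (e : Expr) (p q : Cmd) : Cmd
  | loop (x b : ℕ) (p : Cmd) : Cmd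

infixr:60 " ;; " => Cmd.seq

namespace Cmd

/-- Apply `f 0`, …, `f (m - 1)` in this order. -/
def iter (f : ℕ → State → State) : ℕ → State → State
  | 0, σ => σ
  | i + 1, σ => f i (iter f i σ)

/-- The effect of a bounded program. A write to an address that is too large has no effect. -/
def exec : Cmd → State → State
  | skip, σ => σ
  | assign x e, σ => σ.setVar x (e.eval σ)
  | write a i e, σ => if i.eval σ < σ.var vSZ then σ.setArr a (i.eval σ) (e.eval σ) else σ
  | seq p q, σ => exec q (exec p σ)
  | cond e p q, σ => if e.eval σ = 0 then exec q σ else exec p σ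
  | loop x b p, σ => (iter (fun i τ => exec p (τ.setVar x i)) (σ.var b) σ).setVar x (σ.var b)

/-- The translation to programs of the random access machine. -/
def compile : Cmd → Prog
  | skip => .skip
  | assign x e => .assign x e
  | write a i e => .cond (.sub (.var vSZ) i) (.write a i e) .skip
  | seq p q => .seq p.compile q.compile
  | cond e p q => .cond e p.compile q.compile
  | loop x b p => .seq (.assign x (.const 0))
      (.loop (.sub (.var b) (.var x)) (.seq p.compile (.assign x (.add (.var x) (.const 1)))))

/-- A bound on the running time if every loop is executed at most `B` times. -/
def time (B : ℕ) : Cmd → ℕ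
  | skip => 1
  | assign _ e => e.cost + 1
  | write _ i e => i.cost + 3 + (i.cost + e.cost + 1)
  | seq p q => time B p + time B q
  | cond e p q => e.cost + 1 + (time B p + time B q)
  | loop _ _ p => 2 + (B * (time B p + 8) + 4)

/-- The program may assign to variable `y`. -/
def wv : Cmd → ℕ → Bool
  | skip, _ => false
  | assign x _, y => Nat.beq x y
  | write _ _ _, _ => false
  | seq p q, y => wv p y || wv q y
  | cond _ p q, y => wv p y || wv q y
  | loop x _ p, y => Nat.beq x y || wv p y

/-- The program may write to array `b`. -/
def wa : Cmd → ℕ → Bool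
  | skip, _ => false
  | assign _ _, _ => false
  | write a _ _, b => Nat.beq a b
  | seq p q, b => wa p b || wa q b
  | cond _ p q, b => wa p b || wa q b
  | loop _ _ p, b => wa p b

/-- Loops are bounded by variables from `l`, which are never changed, and loop variables are
changed only by their loops. -/
def wf (l : List ℕ) : Cmd → Bool
  | skip => true
  | assign x _ => !l.elem x
  | write _ _ _ => true
  | seq p q => wf l p && wf l q
  | cond _ p q => wf l p && wf l q
  | loop x b p => l.elem b && (!l.elem x) && (!wv p x) && wf l p

/-- The test `wv` is a Boolean that evaluates on concrete programs, so that most frame conditions in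
the sequel are proved by `rfl`. -/
theorem exec_var (p : Cmd) (σ : State) (y : ℕ) (h : p.wv y = false) :
    (p.exec σ).var y = σ.var y := by
  induction p generalizing σ with
  | skip => rfl
  | assign x e =>
    have : x ≠ y := fun e => by simp [wv, e] at h
    simp [exec, State.setVar, Function.update_of_ne (Ne.symm this)]
  | write a i e => simp only [exec]; split <;> rfl
  | seq p q hp hq =>
    simp only [wv, Bool.or_eq_false_iff] at h
    simp only [exec]; rw [hq _ h.2, hp _ h.1]
  | cond e p q hp hq =>
    simp only [wv, Bool.or_eq_false_iff] at h
    simp only [exec]; split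
    · exact hq _ h.2
    · exact hp _ h.1
  | loop x b p hp =>
    simp only [wv, Bool.or_eq_false_iff] at h
    have hx : y ≠ x := fun e => by simp [e] at h
    simp only [exec, State.setVar, Function.update_of_ne hx]
    generalize σ.var b = m
    induction m with
    | zero => rfl
    | succ i ih =>
      simp only [iter]
      rw [hp _ h.2]
      simpa [State.setVar, Function.update_of_ne hx] using ih

theorem exec_arr (p : Cmd) (σ : State) (b : ℕ) (h : p.wa b = false) :
    (p.exec σ).arr b = σ.arr b := by
  induction p generalizing σ with
  | skip => rfl
  | assign x e => rfl
  | write a i e =>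
    have : b ≠ a := fun e => by simp [wa, e] at h
    simp only [exec]; split
    · simp [State.setArr, Function.update_of_ne this]
    · rfl
  | seq p q hp hq =>
    simp only [wa, Bool.or_eq_false_iff] at h
    simp only [exec]; rw [hq _ h.2, hp _ h.1]
  | cond e p q hp hq =>
    simp only [wa, Bool.or_eq_false_iff] at h
    simp only [exec]; split
    · exact hq _ h.2
    · exact hp _ h.1
  | loop x c p hp =>
    simp only [wa] at h
    simp only [exec, State.setVar]
    generalize σ.var c = m
    induction m with
    | zero => rfl
    | succ i ih =>
      simp only [iter]
      rw [hp _ h]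
      exact ih

/-- Writes are guarded by `vSZ`. Hence clearing the cells below `vSZ` really clears all scratch
memory. -/
theorem exec_arr_ge (p : Cmd) (σ : State) (a j : ℕ) (h : p.wv vSZ = false) (hj : σ.var vSZ ≤ j) :
    (p.exec σ).arr a j = σ.arr a j := by
  induction p generalizing σ with
  | skip => rfl
  | assign x e => rfl
  | write b i e =>
    simp only [exec]; split
    · rename_i hi
      simp only [State.setArr, Function.update_apply]
      have : j ≠ i.eval σ := by omega
      split
      · rename_i hab; subst hab; rw [Function.update_of_ne this]
      · rfl
    · rfl
  | seq p q hp hq =>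
    simp only [wv, Bool.or_eq_false_iff] at h
    simp only [exec]
    rw [hq _ h.2 (by rw [exec_var _ _ _ h.1]; exact hj), hp _ h.1 hj]
  | cond e p q hp hq =>
    simp only [wv, Bool.or_eq_false_iff] at h
    simp only [exec]; split
    · exact hq _ h.2 hj
    · exact hp _ h.1 hj
  | loop x c p hp =>
    simp only [wv, Bool.or_eq_false_iff] at h
    have hx : vSZ ≠ x := fun e => by simp [← e] at h
    simp only [exec, State.setVar]
    generalize σ.var c = m
    suffices (iter (fun i τ => p.exec (τ.setVar x i)) m σ).arr a j = σ.arr a j ∧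
      (iter (fun i τ => p.exec (τ.setVar x i)) m σ).var vSZ = σ.var vSZ from this.1
    induction m with
    | zero => exact ⟨rfl, rfl⟩
    | succ i ih =>
      simp only [iter]
      have h1 : ((iter (fun i τ => p.exec (τ.setVar x i)) i σ).setVar x i).var vSZ = σ.var vSZ := by
        simpa [State.setVar, Function.update_of_ne hx] using ih.2
      refine ⟨?_, ?_⟩
      · rw [hp _ h.2 (by rw [h1]; exact hj)]; exact ih.1
      · rw [exec_var _ _ _ h.2, h1]

/-- The loop bounds in `l` are never assigned, so their initial values still bound the loops inside
loops. -/
theorem compile_run (l : List ℕ) (B : ℕ) (p : Cmd) (hp : p.wf l = true) (σ : State)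
    (hB : ∀ b ∈ l, σ.var b ≤ B) :
    (∃ t, Run p.compile σ t (p.exec σ) ∧ t ≤ p.time B) ∧
      ∀ b ∈ l, (p.exec σ).var b = σ.var b := by
  induction p generalizing σ with
  | skip => exact ⟨⟨_, Run.skip σ, le_rfl⟩, fun _ _ => rfl⟩
  | assign x e =>
    refine ⟨⟨_, Run.assign x e σ, le_rfl⟩, fun b hb => exec_var _ _ _ ?_⟩
    have : x ≠ b := fun e => by simp [wf, e] at hp; exact hp hb
    simp only [wv]
    exact Bool.eq_false_iff.2 fun h => this (Nat.eq_of_beq_eq_true h)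
  | write a i e =>
    refine ⟨?_, fun b hb => exec_var _ _ _ rfl⟩
    by_cases h : i.eval σ < σ.var vSZ
    · simp only [exec, if_pos h]
      refine ⟨_, Run.cond_true (by simp only [Expr.eval]; omega) (Run.write a i e σ), ?_⟩
      simp only [Expr.cost, time]; omega
    · simp only [exec, if_neg h]
      refine ⟨_, Run.cond_false (by simp only [Expr.eval]; omega) (Run.skip σ), ?_⟩
      simp only [Expr.cost, time]; omega
  | seq p q ihp ihq =>
    simp only [wf, Bool.and_eq_true] at hp
    obtain ⟨⟨t, ht, htB⟩, hb⟩ := ihp hp.1 σ hB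
    obtain ⟨⟨u, hu, huB⟩, hb'⟩ := ihq hp.2 (p.exec σ) (fun b h => by rw [hb b h]; exact hB b h)
    exact ⟨⟨_, Run.seq ht hu, Nat.add_le_add htB huB⟩, fun b h => (hb' b h).trans (hb b h)⟩
  | cond e p q ihp ihq =>
    simp only [wf, Bool.and_eq_true] at hp
    by_cases h : e.eval σ = 0
    · obtain ⟨⟨t, ht, htB⟩, hb⟩ := ihq hp.2 σ hB
      simp only [exec, if_pos h]
      exact ⟨⟨_, Run.cond_false h ht, by simp only [time]; omega⟩, hb⟩
    · obtain ⟨⟨t, ht, htB⟩, hb⟩ := ihp hp.1 σ hB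
      simp only [exec, if_neg h]
      exact ⟨⟨_, Run.cond_true h ht, by simp only [time]; omega⟩, hb⟩
  | loop x b p ih =>
    simp only [wf, Bool.and_eq_true, Bool.not_eq_true', List.elem_eq_mem, decide_eq_true_eq,
      decide_eq_false_iff_not] at hp
    obtain ⟨⟨⟨hbl, hxl⟩, hpx⟩, hpw⟩ := hp
    have hne : ∀ c ∈ l, c ≠ x := fun c hc e => hxl (e ▸ hc)
    set m := σ.var b with hm
    set it := fun j => iter (fun i τ => p.exec (τ.setVar x i)) j σ with hit
    have hset : ∀ (ρ : State) (v c : ℕ), c ≠ x → (ρ.setVar x v).var c = ρ.var c := fun ρ v c hc => by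
      simp [State.setVar, Function.update_of_ne hc]
    have hvars : ∀ j, ∀ c ∈ l, (it j).var c = σ.var c := by
      intro j
      induction j with
      | zero => exact fun _ _ => rfl
      | succ j ihj =>
        intro c hc
        have := (ih hpw ((it j).setVar x j) (fun c hc => by
          rw [hset _ _ _ (hne c hc), ihj c hc]; exact hB c hc)).2 c hc
        simp only [hit, iter] at this ⊢
        rw [this, hset _ _ _ (hne c hc)]
        exact ihj c hc
    refine ⟨?_, fun c hc => ?_⟩
    -- Induction on the number `d` of remaining rounds, because `Run.loop_true` puts a round in
    -- front of a run. The test costs 3 + 1 and the increment 3 + 1, hence 8 per round and 4 for the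
    -- last test.
    · have key : ∀ d j, j + d = m → ∃ t, Run (.loop (.sub (.var b) (.var x))
          (.seq p.compile (.assign x (.add (.var x) (.const 1))))) ((it j).setVar x j) t
          ((it m).setVar x m) ∧ t ≤ d * (p.time B + 8) + 4 := by
        intro d
        induction d with
        | zero =>
          intro j hj
          obtain rfl : j = m := by omega
          refine ⟨_, Run.loop_false ?_, by simp [Expr.cost]⟩
          simp only [Expr.eval]
          rw [hset _ _ _ (hne b hbl), hvars _ b hbl]
          simp [State.setVar, hm]
        | succ d ihd =>
          intro j hj
          obtain ⟨t, ht, htB⟩ := ihd (j + 1) (by omega)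
          obtain ⟨⟨u, hu, huB⟩, -⟩ := ih hpw ((it j).setVar x j) (fun c hc => by
            rw [hset _ _ _ (hne c hc), hvars j c hc]; exact hB c hc)
          have hxv : (p.exec ((it j).setVar x j)).var x = j := by
            rw [exec_var _ _ _ hpx]; simp [State.setVar]
          have h2 := Run.seq hu (Run.assign x (.add (.var x) (.const 1)) _)
          have h3 : (p.exec ((it j).setVar x j)).setVar x
              ((Expr.add (.var x) (.const 1)).eval (p.exec ((it j).setVar x j))) =
              (it (j + 1)).setVar x (j + 1) := by
            simp only [Expr.eval, hxv]; rfl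
          rw [h3] at h2
          refine ⟨_, Run.loop_true ?_ h2 ht, ?_⟩
          · simp only [Expr.eval]
            rw [hset _ _ _ (hne b hbl), hvars _ b hbl]
            simp [State.setVar]; omega
          · simp only [Expr.cost]
            rw [add_mul]; omega
      obtain ⟨t, ht, htB⟩ := key m 0 (by omega)
      refine ⟨_, Run.seq (Run.assign x (.const 0) σ) ht, ?_⟩
      simp only [Expr.cost, time]
      have : m * (p.time B + 8) ≤ B * (p.time B + 8) := Nat.mul_le_mul_right _ (hB b hbl)
      omega
    · simp only [exec]
      rw [hset _ _ _ (hne c hc)]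
      exact hvars m c hc

theorem time_poly (p : Cmd) : ∃ c, ∀ B, 1 ≤ B → p.time B ≤ c * B ^ c := by
  have pw : ∀ B a b : ℕ, 1 ≤ B → a ≤ b → B ^ a ≤ B ^ b := fun B a b h h' => Nat.pow_le_pow_right h h'
  have hc : ∀ d B : ℕ, 1 ≤ B → d ≤ d * B ^ d := fun d B h =>
    Nat.le_mul_of_pos_right _ (Nat.pow_pos h)
  induction p with
  | skip => exact ⟨1, fun B h => hc 1 B h⟩
  | assign x e => exact ⟨e.cost + 1, fun B h => hc _ B h⟩
  | write a i e => exact ⟨i.cost + 3 + (i.cost + e.cost + 1), fun B h => hc _ B h⟩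
  | seq p q hp hq =>
    obtain ⟨c, h⟩ := hp; obtain ⟨d, h'⟩ := hq
    refine ⟨c + d, fun B hB => ?_⟩
    have h1 := h B hB; have h2 := h' B hB
    have h3 := Nat.mul_le_mul_left c (pw B c (c + d) hB (by omega))
    have h4 := Nat.mul_le_mul_left d (pw B d (c + d) hB (by omega))
    simp only [time]; rw [add_mul]; omega
  | cond e p q hp hq =>
    obtain ⟨c, h⟩ := hp; obtain ⟨d, h'⟩ := hq
    refine ⟨e.cost + 1 + (c + d), fun B hB => ?_⟩
    have h1 := h B hB; have h2 := h' B hB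
    have h3 := Nat.mul_le_mul_left c (pw B c (e.cost + 1 + (c + d)) hB (by omega))
    have h4 := Nat.mul_le_mul_left d (pw B d (e.cost + 1 + (c + d)) hB (by omega))
    have h5 : e.cost + 1 ≤ (e.cost + 1) * B ^ (e.cost + 1 + (c + d)) :=
      Nat.le_mul_of_pos_right _ (Nat.pow_pos hB)
    simp only [time]; rw [add_mul _ (c + d), add_mul c d]; omega
  | loop x b p hp =>
    obtain ⟨c, h⟩ := hp
    -- Initial assignment and last test cost 6, and each of at most `B` rounds costs 8 besides its
    -- body: 14 in all.
    refine ⟨c + 14, fun B hB => ?_⟩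
    have h1 := Nat.mul_le_mul_left B (h B hB)
    have h2 : B * (c * B ^ c) ≤ c * B ^ (c + 14) := by
      calc B * (c * B ^ c) = c * B ^ (c + 1) := by ring
        _ ≤ _ := Nat.mul_le_mul_left _ (pw B _ _ hB (by omega))
    have h3 : 8 * B ≤ 8 * B ^ (c + 14) := by
      have := pw B 1 (c + 14) hB (by omega)
      rw [pow_one] at this; omega
    have h4 : 1 ≤ B ^ (c + 14) := Nat.pow_pos hB
    simp only [time]
    rw [add_mul c 14, mul_add]; omega

/-! ### Frame conditions and a loop rule -/

/-- `τ` agrees with `σ` on all variables and arrays that `p` does not change. -/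
def Same (p : Cmd) (σ τ : State) : Prop :=
  (∀ y, p.wv y = false → τ.var y = σ.var y) ∧ ∀ a, p.wa a = false → τ.arr a = σ.arr a

theorem same_exec (p : Cmd) (σ : State) : Same p σ (p.exec σ) :=
  ⟨fun y h => exec_var p σ y h, fun a h => exec_arr p σ a h⟩

/-- The invariant describes the state before the loop variable is set. `Same` is handed to the step,
so that invariants need not mention what the loop leaves alone. -/
theorem loop_rule {x b : ℕ} {p : Cmd} {σ : State} (Inv : ℕ → State → Prop) (h0 : Inv 0 σ)
    (hs : ∀ i τ, i < σ.var b → Same (loop x b p) σ τ → Inv i τ →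
      Inv (i + 1) (p.exec (τ.setVar x i))) :
    ∃ τ, Inv (σ.var b) τ ∧ Same (loop x b p) σ τ ∧
      (loop x b p).exec σ = τ.setVar x (σ.var b) := by
  refine ⟨iter (fun i τ => p.exec (τ.setVar x i)) (σ.var b) σ, ?_, ?_, rfl⟩
  all_goals
    suffices ∀ j ≤ σ.var b, Inv j (iter (fun i τ => p.exec (τ.setVar x i)) j σ) ∧
      Same (loop x b p) σ (iter (fun i τ => p.exec (τ.setVar x i)) j σ) by
      first | exact (this _ le_rfl).1 | exact (this _ le_rfl).2
    intro j
    induction j with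
    | zero => exact fun _ => ⟨h0, fun _ _ => rfl, fun _ _ => rfl⟩
    | succ j ih =>
      intro hj
      obtain ⟨h1, h2⟩ := ih (by omega)
      refine ⟨hs j _ (by omega) h2 h1, fun y hy => ?_, fun a ha => ?_⟩
      · have hy' := hy
        simp only [wv, Bool.or_eq_false_iff] at hy'
        have hx : y ≠ x := fun e => by simp [e] at hy'
        simp only [iter]
        rw [exec_var _ _ _ hy'.2, ← h2.1 y hy]
        simp [State.setVar, Function.update_of_ne hx]
      · simp only [iter]
        rw [exec_arr p _ _ ha, ← h2.2 a ha]
        rfl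

/-! ### Advice -/

/-- Replace the array of advice digits. -/
def setDig (σ : State) (f : ℕ → ℕ) : State where
  var := σ.var
  arr := Function.update σ.arr aDIG f

def exprNoDig : Expr → Bool
  | .const _ => true
  | .var _ => true
  | .read a i => !Nat.beq a aDIG && exprNoDig i
  | .add e f => exprNoDig e && exprNoDig f
  | .sub e f => exprNoDig e && exprNoDig f

/-- The program neither reads nor writes the advice. -/
def noDig : Cmd → Bool
  | skip => true
  | assign _ e => exprNoDig e
  | write a i e => !Nat.beq a aDIG && exprNoDig i && exprNoDig e
  | seq p q => noDig p && noDig q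
  | cond e p q => exprNoDig e && noDig p && noDig q
  | loop _ _ p => noDig p

theorem eval_setDig (e : Expr) (h : exprNoDig e = true) (σ : State) (f : ℕ → ℕ) :
    e.eval (setDig σ f) = e.eval σ := by
  induction e with
  | const m => rfl
  | var x => rfl
  | read a i ih =>
    simp only [exprNoDig, Bool.and_eq_true, Bool.not_eq_true'] at h
    have : a ≠ aDIG := fun e => by simp [e] at h
    simp only [Expr.eval, ih h.2]
    simp [setDig, Function.update_of_ne this]
  | add e g ih ih' =>
    simp only [exprNoDig, Bool.and_eq_true] at h
    simp only [Expr.eval, ih h.1, ih' h.2]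
  | sub e g ih ih' =>
    simp only [exprNoDig, Bool.and_eq_true] at h
    simp only [Expr.eval, ih h.1, ih' h.2]

theorem exec_setDig (p : Cmd) (h : p.noDig = true) (σ : State) (f : ℕ → ℕ) :
    p.exec (setDig σ f) = setDig (p.exec σ) f := by
  induction p generalizing σ with
  | skip => rfl
  | assign x e => simp only [exec, eval_setDig e h]; rfl
  | write a i e =>
    simp only [noDig, Bool.and_eq_true, Bool.not_eq_true'] at h
    have ha : a ≠ aDIG := fun e => by simp [e] at h
    simp only [exec, eval_setDig i h.1.2, eval_setDig e h.2]
    have : (setDig σ f).var vSZ = σ.var vSZ := rfl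
    rw [this]
    split
    · simp only [setDig, State.setArr, Function.update_of_ne ha, State.mk.injEq, true_and]
      rw [Function.update_comm ha]
    · rfl
  | seq p q hp hq =>
    simp only [noDig, Bool.and_eq_true] at h
    simp only [exec, hp h.1, hq h.2]
  | cond e p q hp hq =>
    simp only [noDig, Bool.and_eq_true] at h
    simp only [exec, eval_setDig e h.1.1, hp h.1.2, hq h.2]
    split <;> rfl
  | loop x b p hp =>
    simp only [noDig] at h
    simp only [exec]
    have : (setDig σ f).var b = σ.var b := rfl
    rw [this]
    generalize σ.var b = m
    have : iter (fun i τ => p.exec (τ.setVar x i)) m (setDig σ f) =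
        setDig (iter (fun i τ => p.exec (τ.setVar x i)) m σ) f := by
      induction m with
      | zero => rfl
      | succ i ih =>
        simp only [iter]
        rw [ih, ← hp h]; rfl
    rw [this]; rfl

/-- The digits `f` continue the list `l` from position `i` on. -/
def Matches (f : ℕ → ℕ) (i : ℕ) (l : List ℕ) : Prop := ∀ j (h : j < l.length), f (i + j) = l[j]

/-- For suitable advice, the program leads from `σ` to `τ`. Index digits are less than `r`. -/
def Ang (r : ℕ) (p : Cmd) (σ τ : State) : Prop :=
  Same p σ τ ∧ ∃ l l' : List ℕ, (∀ d ∈ l, d < r) ∧ (∀ d ∈ l', d < 2) ∧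
    τ.var vPA = σ.var vPA + l.length ∧ τ.var vPB = σ.var vPB + l'.length ∧
    ∀ f, Matches f (σ.var vPA) l → Matches f (σ.var vPB) l' →
      p.exec (setDig σ f) = setDig τ f

theorem Matches.left {f : ℕ → ℕ} {i : ℕ} {l l' : List ℕ} (h : Matches f i (l ++ l')) :
    Matches f i l := fun j hj => by
  rw [h j (by simp; omega), List.getElem_append_left]

theorem Matches.right {f : ℕ → ℕ} {i : ℕ} {l l' : List ℕ} (h : Matches f i (l ++ l')) :
    Matches f (i + l.length) l' := fun j hj => by
  have := h (l.length + j) (by simp; omega)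
  rw [← add_assoc] at this
  rw [this, List.getElem_append_right (by omega)]
  simp

theorem Same.seq {p q : Cmd} {σ τ ρ : State} (h : Same p σ τ) (h' : Same q τ ρ) :
    Same (p ;; q) σ ρ := by
  refine ⟨fun y hy => ?_, fun a ha => ?_⟩
  · simp only [wv, Bool.or_eq_false_iff] at hy
    rw [h'.1 y hy.2, h.1 y hy.1]
  · simp only [wa, Bool.or_eq_false_iff] at ha
    rw [h'.2 a ha.2, h.2 a ha.1]

/-- The pointers record how much advice has been consumed, so the digits of `q` start where those of
`p` end and the two lists can be concatenated. -/
theorem Ang.seq {r : ℕ} {p q : Cmd} {σ τ ρ : State} (h : Ang r p σ τ) (h' : Ang r q τ ρ) :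
    Ang r (p ;; q) σ ρ := by
  obtain ⟨hs, l, l', h1, h2, h3, h4, h5⟩ := h
  obtain ⟨hs', m, m', g1, g2, g3, g4, g5⟩ := h'
  refine ⟨hs.seq hs', l ++ m, l' ++ m', ?_, ?_, ?_, ?_, fun f hf hf' => ?_⟩
  · intro d hd; rcases List.mem_append.1 hd with hd | hd
    exacts [h1 d hd, g1 d hd]
  · intro d hd; rcases List.mem_append.1 hd with hd | hd
    exacts [h2 d hd, g2 d hd]
  · rw [g3, h3, List.length_append]; omega
  · rw [g4, h4, List.length_append]; omega
  · simp only [exec]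
    rw [h5 f hf.left hf'.left]
    exact g5 f (h3 ▸ hf.right) (h4 ▸ hf'.right)

/-- Deterministic parts consume no digits; their `Ang` statement is just `exec_setDig`. -/
theorem Ang.of_noDig {r : ℕ} {p : Cmd} (h : p.noDig = true) (ha : p.wv vPA = false)
    (hb : p.wv vPB = false) (σ : State) : Ang r p σ (p.exec σ) :=
  ⟨same_exec p σ, [], [], by simp, by simp, by rw [exec_var _ _ _ ha]; rfl, by rw [exec_var _ _ _ hb]; rfl,
    fun f _ _ => exec_setDig p h σ f⟩

theorem Ang.cond_true {r : ℕ} {e : Expr} {p q : Cmd} {σ τ : State} (hd : exprNoDig e = true)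
    (he : e.eval σ ≠ 0) (h : Ang r p σ τ) : Ang r (cond e p q) σ τ := by
  obtain ⟨hs, l, l', h1, h2, h3, h4, h5⟩ := h
  refine ⟨⟨fun y hy => hs.1 y ?_, fun a ha => hs.2 a ?_⟩, l, l', h1, h2, h3, h4,
    fun f hf hf' => ?_⟩
  · simp only [wv, Bool.or_eq_false_iff] at hy; exact hy.1
  · simp only [wa, Bool.or_eq_false_iff] at ha; exact ha.1
  simp only [exec, eval_setDig e hd, if_neg he]
  exact h5 f hf hf'

theorem Ang.cond_false {r : ℕ} {e : Expr} {p q : Cmd} {σ τ : State} (hd : exprNoDig e = true)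
    (he : e.eval σ = 0) (h : Ang r q σ τ) : Ang r (cond e p q) σ τ := by
  obtain ⟨hs, l, l', h1, h2, h3, h4, h5⟩ := h
  refine ⟨⟨fun y hy => hs.1 y ?_, fun a ha => hs.2 a ?_⟩, l, l', h1, h2, h3, h4,
    fun f hf hf' => ?_⟩
  · simp only [wv, Bool.or_eq_false_iff] at hy; exact hy.2
  · simp only [wa, Bool.or_eq_false_iff] at ha; exact ha.2
  simp only [exec, eval_setDig e hd, if_pos he]
  exact h5 f hf hf'

theorem Ang.skip {r : ℕ} (σ : State) : Ang r Cmd.skip σ σ := Ang.of_noDig rfl rfl rfl σ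

/-- Read the next index digit. -/
def getIdx (x : ℕ) : Cmd :=
  assign x (.read aDIG (.var vPA)) ;; assign vPA (.add (.var vPA) (.const 1))

/-- Read the next bit. -/
def getBit (x : ℕ) : Cmd :=
  assign x (.read aDIG (.var vPB)) ;; assign vPB (.add (.var vPB) (.const 1))

theorem ang_getIdx {r x d : ℕ} (hx : x ≠ vPA) (hx' : x ≠ vPB) (hd : d < r) (σ : State) :
    Ang r (getIdx x) σ ((σ.setVar x d).setVar vPA (σ.var vPA + 1)) := by
  refine ⟨⟨fun y hy => ?_, fun _ _ => rfl⟩, [d], [], by simpa using hd, by simp, ?_, ?_,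
    fun f hf _ => ?_⟩
  · simp only [getIdx, wv, Bool.or_eq_false_iff] at hy
    have h1 : y ≠ x := fun e => by simp [e] at hy
    have h2 : y ≠ vPA := fun e => by simp [e] at hy
    simp [State.setVar, Function.update_of_ne h1, Function.update_of_ne h2]
  · simp [State.setVar]
  · simp [State.setVar, Function.update_of_ne (Ne.symm hx')]
  · have := hf 0 (by simp)
    simp at this
    simp [getIdx, exec, Expr.eval, State.setVar, setDig, this, Function.update_of_ne (Ne.symm hx)]

theorem ang_getBit {r x d : ℕ} (hx : x ≠ vPA) (hx' : x ≠ vPB) (hd : d < 2) (σ : State) :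
    Ang r (getBit x) σ ((σ.setVar x d).setVar vPB (σ.var vPB + 1)) := by
  refine ⟨⟨fun y hy => ?_, fun _ _ => rfl⟩, [], [d], by simp, by simpa using hd, ?_, ?_,
    fun f _ hf => ?_⟩
  · simp only [getBit, wv, Bool.or_eq_false_iff] at hy
    have h1 : y ≠ x := fun e => by simp [e] at hy
    have h2 : y ≠ vPB := fun e => by simp [e] at hy
    simp [State.setVar, Function.update_of_ne h1, Function.update_of_ne h2]
  · simp [State.setVar, Function.update_of_ne (Ne.symm hx)]
  · simp [State.setVar]
  · have := hf 0 (by simp)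
    simp at this
    simp [getBit, exec, Expr.eval, State.setVar, setDig, this, Function.update_of_ne (Ne.symm hx')]

/-- As in `loop_rule`, but each round may choose its successor state; the digits that justify the
choices are collected along the rounds. -/
theorem ang_loop {r x b : ℕ} {p : Cmd} {σ : State} (Inv : ℕ → State → Prop) (h0 : Inv 0 σ)
    (hxa : x ≠ vPA) (hxb : x ≠ vPB)
    (hs : ∀ i τ, i < σ.var b → Same (loop x b p) σ τ → Inv i τ →
      ∃ ρ, Ang r p (τ.setVar x i) ρ ∧ Inv (i + 1) ρ) :
    ∃ τ, Inv (σ.var b) τ ∧ Same (loop x b p) σ τ ∧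
      Ang r (loop x b p) σ (τ.setVar x (σ.var b)) := by
  suffices ∀ j ≤ σ.var b, ∃ τ, Inv j τ ∧ Same (loop x b p) σ τ ∧
      ∃ l l' : List ℕ, (∀ d ∈ l, d < r) ∧ (∀ d ∈ l', d < 2) ∧
      τ.var vPA = σ.var vPA + l.length ∧ τ.var vPB = σ.var vPB + l'.length ∧
      ∀ f, Matches f (σ.var vPA) l → Matches f (σ.var vPB) l' →
      iter (fun i τ => exec p (τ.setVar x i)) j (setDig σ f) = setDig τ f by
    obtain ⟨τ, h1, h2, l, l', h3, h4, h5, h6, h7⟩ := this _ le_rfl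
    refine ⟨τ, h1, h2, ⟨fun y hy => ?_, h2.2⟩, l, l', h3, h4, ?_, ?_, fun f hf hf' => ?_⟩
    · rw [← h2.1 y hy]
      have hy' := hy
      simp only [wv, Bool.or_eq_false_iff] at hy'
      have hx : y ≠ x := fun e => by simp [e] at hy'
      simp [State.setVar, Function.update_of_ne hx]
    · simpa [State.setVar, Function.update_of_ne (Ne.symm hxa)] using h5
    · simpa [State.setVar, Function.update_of_ne (Ne.symm hxb)] using h6
    · simp only [exec]
      have : (setDig σ f).var b = σ.var b := rfl
      rw [this, h7 f hf hf']; rfl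
  intro j
  induction j with
  | zero => exact fun _ => ⟨σ, h0, ⟨fun _ _ => rfl, fun _ _ => rfl⟩, [], [], by simp, by simp, rfl,
      rfl, fun f _ _ => rfl⟩
  | succ j ih =>
    intro hj
    obtain ⟨τ, h1, h2, l, l', h3, h4, h5, h6, h7⟩ := ih (by omega)
    obtain ⟨ρ, ⟨hsm, m, m', g3, g4, g5, g6, g7⟩, hI⟩ := hs j τ (by omega) h2 h1
    have ea : (τ.setVar x j).var vPA = τ.var vPA := by
      simp [State.setVar, Function.update_of_ne (Ne.symm hxa)]
    have eb : (τ.setVar x j).var vPB = τ.var vPB := by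
      simp [State.setVar, Function.update_of_ne (Ne.symm hxb)]
    rw [ea] at g5 g7; rw [eb] at g6 g7
    have hex : ∀ f, Matches f (σ.var vPA) (l ++ m) → Matches f (σ.var vPB) (l' ++ m') →
        iter (fun i τ => exec p (τ.setVar x i)) (j + 1) (setDig σ f) = setDig ρ f := by
      intro f hf hf'
      simp only [iter]
      rw [h7 f hf.left hf'.left]
      exact g7 f (h5 ▸ hf.right) (h6 ▸ hf'.right)
    refine ⟨ρ, hI, ?_, l ++ m, l' ++ m', ?_, ?_, ?_, ?_, hex⟩
    · refine ⟨fun y hy => ?_, fun a ha => ?_⟩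
      · have hy' := hy
        simp only [wv, Bool.or_eq_false_iff] at hy'
        have hx : y ≠ x := fun e => by simp [e] at hy'
        rw [hsm.1 y hy'.2, ← h2.1 y hy]
        simp [State.setVar, Function.update_of_ne hx]
      · rw [hsm.2 a ha, ← h2.2 a ha]; rfl
    · intro d hd; rcases List.mem_append.1 hd with hd | hd
      exacts [h3 d hd, g3 d hd]
    · intro d hd; rcases List.mem_append.1 hd with hd | hd
      exacts [h4 d hd, g4 d hd]
    · rw [g5, h5, List.length_append]; omega
    · rw [g6, h6, List.length_append]; omega

end Cmd

/-! ## Cuts -/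

open Finset Classical

/-- The total capacity of the arcs leaving `R` in a network on the vertices `0, …, M - 1`. -/
noncomputable def cut (M : ℕ) (c : ℕ → ℕ → ℕ) (R : Set ℕ) : ℕ :=
  ∑ u ∈ range M, ∑ v ∈ range M, if u ∈ R ∧ v ∉ R then c u v else 0

/-- The total capacity of a set of arcs. -/
noncomputable def cost (N : ℕ) (c : ℕ → ℕ → ℕ) (D : ℕ → ℕ → Prop) : ℕ :=
  ∑ u ∈ range N, ∑ v ∈ range N, if D u v then c u v else 0

theorem dsum_le {M : ℕ} {f g : ℕ → ℕ → ℕ} (h : ∀ u < M, ∀ v < M, f u v ≤ g u v) :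
    ∑ u ∈ range M, ∑ v ∈ range M, f u v ≤ ∑ u ∈ range M, ∑ v ∈ range M, g u v :=
  sum_le_sum fun u hu => sum_le_sum fun v hv => h u (mem_range.1 hu) v (mem_range.1 hv)

theorem dsum_add {M : ℕ} {f g : ℕ → ℕ → ℕ} :
    ∑ u ∈ range M, ∑ v ∈ range M, (f u v + g u v) =
      ∑ u ∈ range M, ∑ v ∈ range M, f u v + ∑ u ∈ range M, ∑ v ∈ range M, g u v := by
  simp only [sum_add_distrib]

theorem dsum_congr {M : ℕ} {f g : ℕ → ℕ → ℕ} (h : ∀ u < M, ∀ v < M, f u v = g u v) :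
    ∑ u ∈ range M, ∑ v ∈ range M, f u v = ∑ u ∈ range M, ∑ v ∈ range M, g u v :=
  sum_congr rfl fun u hu => sum_congr rfl fun v hv => h u (mem_range.1 hu) v (mem_range.1 hv)

theorem dsum_single {M a b : ℕ} (ha : a < M) (hb : b < M) (y : ℕ) :
    ∑ u ∈ range M, ∑ v ∈ range M, (if u = a ∧ v = b then y else 0) = y := by
  rw [sum_eq_single a, sum_eq_single b]
  · simp
  · intro v _ hv; simp [hv]
  · intro h; simp at h; omega
  · intro u _ hu; simp [hu]
  · intro h; simp at h; omega

theorem le_dsum {M a b : ℕ} {f : ℕ → ℕ → ℕ} (ha : a < M) (hb : b < M) :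
    f a b ≤ ∑ u ∈ range M, ∑ v ∈ range M, f u v := by
  rw [← dsum_single ha hb (f a b)]
  exact dsum_le fun u _ v _ => by split <;> simp_all

/-- Moving one unit from an arc to its reverse changes every cut by a difference of indicators of
the two ends. Along an augmenting path these differences telescope. -/
theorem cut_augment {M a b : ℕ} {c c' : ℕ → ℕ → ℕ} (ha : a < M) (hb : b < M)
    (h : ∀ u < M, ∀ v < M, c' u v + (if u = a ∧ v = b then 1 else 0) =
      c u v + (if u = b ∧ v = a then 1 else 0)) (R : Set ℕ) :
    cut M c' R + (if a ∈ R then 1 else 0) = cut M c R + (if b ∈ R then 1 else 0) := by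
  have key : cut M c' R + (if a ∈ R ∧ b ∉ R then 1 else 0) =
      cut M c R + (if b ∈ R ∧ a ∉ R then 1 else 0) := by
    rw [← dsum_single ha hb (if a ∈ R ∧ b ∉ R then 1 else 0),
      ← dsum_single hb ha (if b ∈ R ∧ a ∉ R then 1 else 0)]
    unfold cut
    rw [← dsum_add, ← dsum_add]
    refine dsum_congr fun u hu v hv => ?_
    have := h u hu v hv
    by_cases h1 : u = a ∧ v = b
    · obtain ⟨rfl, rfl⟩ := h1
      by_cases h2 : u = v ∧ v = u
      · obtain ⟨rfl, -⟩ := h2; simp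
      · simp only [and_self, if_true, h2, if_false] at this ⊢
        split <;> omega
    · by_cases h2 : u = b ∧ v = a
      · obtain ⟨rfl, rfl⟩ := h2
        simp only [and_self, if_true, h1, if_false] at this ⊢
        split <;> omega
      · simp only [h1, h2, if_false] at this ⊢
        split <;> omega
  by_cases h1 : a ∈ R <;> by_cases h2 : b ∈ R <;> simp_all

/-! ### Maximum flows and furthest minimum cuts -/

/-- `r` is the residual network of a flow of value `lam` in `net` from the sources `S` to the sinks
`X`, and unless `lam` exceeds `k`, the vertices with mark zero form the largest minimum cut. -/
structure FlowSpec (M : ℕ) (net : ℕ → ℕ → ℕ) (S X : Set ℕ) (k : ℕ) (r : ℕ → ℕ → ℕ) (lam : ℕ)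
    (mark : ℕ → ℕ) : Prop where
  cut_eq : ∀ R : Set ℕ, S ⊆ R → (∀ v < M, v ∈ X → v ∉ R) → cut M net R = lam + cut M r R
  symm : ∀ u < M, ∀ v < M, r u v + r v u = net u v + net v u
  le : lam ≤ k + 1
  sink : lam ≤ k → ∀ v < M, v ∈ X → mark v ≠ 0
  source : lam ≤ k → ∀ v < M, v ∈ S → mark v = 0
  closed : lam ≤ k → ∀ u < M, ∀ v < M, mark u = 0 → mark v ≠ 0 → r u v = 0
  far : lam ≤ k → ∀ R : Set ℕ, S ⊆ R → (∀ v < M, v ∈ X → v ∉ R) →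
    (∀ u < M, ∀ v < M, u ∈ R → v ∉ R → r u v = 0) → ∀ v < M, v ∈ R → mark v = 0

namespace FlowSpec

variable {M k lam : ℕ} {net r : ℕ → ℕ → ℕ} {S X : Set ℕ} {mark : ℕ → ℕ}

theorem cut_mark (h : FlowSpec M net S X k r lam mark) (hl : lam ≤ k) (hS : ∀ v ∈ S, v < M) :
    cut M net {v | mark v = 0} = lam := by
  rw [h.cut_eq {v | mark v = 0} (fun v hv => h.source hl v (hS v hv) hv) (fun v hv hx => h.sink hl v hv hx)]
  have : cut M r {v | mark v = 0} = 0 := by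
    unfold cut
    refine sum_eq_zero fun u hu => sum_eq_zero fun v hv => ?_
    split
    · rename_i h'; exact h.closed hl u (mem_range.1 hu) v (mem_range.1 hv) h'.1 h'.2
    · rfl
  omega

/-- Up to the constant `lam`, cuts may be measured in the residual network. There nothing leaves the
unmarked set, so what leaves the union leaves `R`. This replaces submodularity. -/
theorem cut_union_le (h : FlowSpec M net S X k r lam mark) (hl : lam ≤ k)
    {R : Set ℕ} (hR : S ⊆ R) (hX : ∀ v < M, v ∈ X → v ∉ R) :
    cut M net (R ∪ {v | mark v = 0}) ≤ cut M net R := by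
  rw [h.cut_eq R hR hX, h.cut_eq _ (hR.trans Set.subset_union_left)
    (fun v hv hx => by
      rintro (h1 | h1)
      · exact hX v hv hx h1
      · exact h.sink hl v hv hx h1)]
  refine Nat.add_le_add_left (dsum_le fun u hu v hv => ?_) _
  by_cases h1 : u ∈ R ∪ {v | mark v = 0} ∧ v ∉ R ∪ {v | mark v = 0}
  · rw [if_pos h1]
    obtain ⟨h2, h3⟩ := h1
    simp only [Set.mem_union, Set.mem_ofPred_eq, not_or] at h2 h3
    by_cases h4 : mark u = 0
    · rw [h.closed hl u hu v hv h4 h3.2]; exact Nat.zero_le _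
    · rw [if_pos ⟨h2.resolve_right h4, h3.1⟩]
  · rw [if_neg h1]; exact Nat.zero_le _

theorem le_cut (h : FlowSpec M net S X k r lam mark)
    {R : Set ℕ} (hR : S ⊆ R) (hX : ∀ v < M, v ∈ X → v ∉ R) : lam ≤ cut M net R := by
  rw [h.cut_eq R hR hX]; omega

/-- A cut of capacity `lam` has residual capacity zero and is then contained in the unmarked set by
`far`. -/
theorem lt_cut (h : FlowSpec M net S X k r lam mark) (hl : lam ≤ k)
    {R : Set ℕ} (hR : S ⊆ R) (hX : ∀ v < M, v ∈ X → v ∉ R) {w : ℕ} (hw : w < M) (hwR : w ∈ R)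
    (hm : mark w ≠ 0) : lam + 1 ≤ cut M net R := by
  rw [h.cut_eq R hR hX]
  by_contra hlt
  refine hm (h.far hl R hR hX (fun u hu v hv hu' hv' => ?_) w hw hwR)
  have : (if u ∈ R ∧ v ∉ R then r u v else 0) ≤ cut M r R :=
    le_dsum (f := fun u v => if u ∈ R ∧ v ∉ R then r u v else 0) hu hv
  rw [if_pos ⟨hu', hv'⟩] at this
  omega

end FlowSpec

/-- The network with the additional vertex `N`, from which the arcs that leave `K` start. -/
noncomputable def netcap (N : ℕ) (c : ℕ → ℕ → ℕ) (K : Set ℕ) (u v : ℕ) : ℕ :=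
  if v < N then
    if u < N then (if u ∈ K then 0 else c u v)
    else if u = N ∧ v ∉ K then ∑ x ∈ range N, (if x ∈ K then c x v else 0) else 0
  else 0

/-- The arc from `u` to `v` leaves `B`, or leaves `K` without entering `B`. -/
def Cross (B K : Set ℕ) (u v : ℕ) : Prop :=
  (u ∈ B ∧ v ∉ B) ∨ (u ∈ K ∧ v ∉ K ∧ v ∉ B)

theorem cut_netcap {N : ℕ} {c : ℕ → ℕ → ℕ} {K B R : Set ℕ} (hN : N ∈ R)
    (hR : ∀ v < N, v ∈ R ↔ v ∈ B) (hK : ∀ v < N, v ∈ K → v ∉ B) :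
    cut (N + 1) (netcap N c K) R = cost N c (Cross B K) := by
  have h1 : ∀ u, ∑ v ∈ range (N + 1), (if u ∈ R ∧ v ∉ R then netcap N c K u v else 0) =
      ∑ v ∈ range N, (if u ∈ R ∧ v ∉ R then netcap N c K u v else 0) := by
    intro u
    rw [sum_range_succ]
    simp [hN]
  unfold cut cost
  rw [sum_congr rfl fun u _ => h1 u, sum_range_succ]
  have h2 : ∑ v ∈ range N, (if N ∈ R ∧ v ∉ R then netcap N c K N v else 0) =
      ∑ x ∈ range N, ∑ v ∈ range N, (if x ∈ K ∧ v ∉ K ∧ v ∉ B then c x v else 0) := by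
    rw [sum_comm]
    refine sum_congr rfl fun v hv => ?_
    have hv := mem_range.1 hv
    have hx := hR v hv
    by_cases h3 : v ∈ B <;> by_cases h4 : v ∈ K <;> simp [netcap, hv, hN, hx, h3, h4]
  rw [h2, ← dsum_add]
  refine dsum_congr fun u hu v hv => ?_
  have hu' := hR u hu
  have hv' := hR v hv
  have hk := hK u hu
  have hk' := hK v hv
  have hn : netcap N c K u v = if u ∈ K then 0 else c u v := by simp [netcap, hu, hv]
  rw [hn]
  simp only [Cross, hu', hv']
  clear hR hK h1 h2 hn hu' hv'
  by_cases h3 : u ∈ B <;> by_cases h4 : u ∈ K <;> by_cases h5 : v ∈ B <;> by_cases h6 : v ∈ K <;>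
    simp_all

theorem cost_mono {N : ℕ} {c : ℕ → ℕ → ℕ} {D D' : ℕ → ℕ → Prop}
    (h : ∀ u < N, ∀ v < N, D u v → 0 < c u v → D' u v) : cost N c D ≤ cost N c D' := by
  refine dsum_le fun u hu v hv => ?_
  by_cases h1 : D u v
  · rw [if_pos h1]
    by_cases h2 : 0 < c u v
    · rw [if_pos (h u hu v hv h1 h2)]
    · omega
  · simp [h1]

/-! ## Strong components -/

/-- There is an arc of positive capacity outside of `D`. -/
def Edge (N : ℕ) (c : ℕ → ℕ → ℕ) (D : ℕ → ℕ → Prop) (u v : ℕ) : Prop :=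
  u < N ∧ v < N ∧ 0 < c u v ∧ ¬ D u v

def Reach (N : ℕ) (c : ℕ → ℕ → ℕ) (D : ℕ → ℕ → Prop) : ℕ → ℕ → Prop :=
  Relation.ReflTransGen (Edge N c D)

def Conn (N : ℕ) (c : ℕ → ℕ → ℕ) (D : ℕ → ℕ → Prop) (u v : ℕ) : Prop :=
  Reach N c D u v ∧ Reach N c D v u

/-- The number of elements of `S` that are less than `n`. -/
noncomputable def wt (n : ℕ) (S : Set ℕ) : ℕ := ((range n).filter (· ∈ S)).card

/-- All strong components have weight at most `s`. -/
def SmallComps (N n s : ℕ) (c : ℕ → ℕ → ℕ) (D : ℕ → ℕ → Prop) : Prop :=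
  ∀ u < N, wt n {v | Conn N c D u v} ≤ s

theorem wt_mono {n : ℕ} {S S' : Set ℕ} (h : ∀ v < n, v ∈ S → v ∈ S') : wt n S ≤ wt n S' := by
  refine card_le_card fun v hv => ?_
  simp only [mem_filter, mem_range] at hv ⊢
  exact ⟨hv.1, h v hv.1 hv.2⟩

section

variable {N n s k : ℕ} {c : ℕ → ℕ → ℕ} {D : ℕ → ℕ → Prop}

theorem Conn.refl (u : ℕ) : Conn N c D u u := ⟨.refl, .refl⟩

theorem Conn.symm {u v : ℕ} (h : Conn N c D u v) : Conn N c D v u := ⟨h.2, h.1⟩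

theorem Conn.trans {u v w : ℕ} (h : Conn N c D u v) (h' : Conn N c D v w) : Conn N c D u w :=
  ⟨h.1.trans h'.1, h'.2.trans h.2⟩

theorem Reach.lt {u v : ℕ} (h : Reach N c D u v) (hu : u < N) : v < N := by
  cases h.cases_tail with
  | inl h => omega
  | inr h => obtain ⟨w, -, hw⟩ := h; exact hw.2.1

/-- A walk from inside of `P` to outside of `P` within a strong component contains an arc that
leaves `P`. -/
theorem exists_exit {t x y : ℕ} (P : Set ℕ) (hxy : Reach N c D x y) (hx : Conn N c D t x)
    (hy : Conn N c D t y) (hxP : x ∈ P) (hyP : y ∉ P) :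
    ∃ u v, Edge N c D u v ∧ Conn N c D t u ∧ Conn N c D t v ∧ u ∈ P ∧ v ∉ P := by
  induction hxy with
  | refl => exact absurd hxP hyP
  | @tail b d hb hbd ih =>
    have hcb : Conn N c D t b :=
      ⟨hx.1.trans hb, (Relation.ReflTransGen.single hbd).trans hy.2⟩
    by_cases hbP : b ∈ P
    · exact ⟨b, d, hbd, hcb, hy, hbP, hyP⟩
    · exact ih hcb hbP

/-! ### Candidates for the extension of a component -/

/-- The candidate pairs for the extension of `K`. -/
def Cand (N k : ℕ) (net r : ℕ → ℕ → ℕ) (lam : ℕ) (mark : ℕ → ℕ) (u v : ℕ) : Prop :=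
  (lam ≤ k ∧ mark u = 0 ∧ mark v ≠ 0 ∧ 0 < net u v) ∨ (k < lam ∧ u = N ∧ r u v < net u v)

/-- If the flow is small, the component or its arcs out of `K` cross the furthest minimum cut. If it
exceeds `k`, the solution cannot block it, and some flow must enter the component directly from `K`.
-/
theorem exists_cand {K : Set ℕ} {t x lam : ℕ} {r : ℕ → ℕ → ℕ} {mark : ℕ → ℕ}
    (hcost : cost N c D ≤ k)
    (hF : FlowSpec (N + 1) (netcap N c K) {N} {v | v < N ∧ v ∈ K} k r lam mark)
    (htK : t ∈ K) (hKN : ∀ v ∈ K, v < N) (hK : ∀ v ∈ K, Conn N c D t v)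
    (hx : Conn N c D t x) (hxK : x ∉ K) :
    ∃ u v, u < N + 1 ∧ v < N + 1 ∧ Cand N k (netcap N c K) r lam mark u v ∧
      ((u < N ∧ Conn N c D t u ∧ u ∉ K) ∨ (v < N ∧ Conn N c D t v ∧ v ∉ K)) := by
  have htN := hKN t htK
  by_cases hl : lam ≤ k
  · have hmK : ∀ v ∈ K, mark v ≠ 0 := fun v hv => hF.sink hl v (by have := hKN v hv; omega)
      ⟨hKN v hv, hv⟩
    -- If the component contains an unmarked vertex, its walk back to `t` crosses the cut, and the
    -- tail of the crossing arc is unmarked and hence outside `K`. Otherwise an arc of the component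
    -- that leaves `K` becomes an arc from `N` to a marked vertex.
    by_cases h1 : ∃ y, Conn N c D t y ∧ mark y = 0
    · obtain ⟨y, hy, hy0⟩ := h1
      obtain ⟨u, w, he, hu, hw, hu0, hw0⟩ := exists_exit {v | mark v = 0} hy.2 hy (Conn.refl t) hy0
        (hmK t htK)
      have huK : u ∉ K := fun h => hmK u h hu0
      refine ⟨u, w, by have := he.1; omega, by have := he.2.1; omega,
        Or.inl ⟨hl, hu0, hw0, ?_⟩, Or.inl ⟨he.1, hu, huK⟩⟩
      simp [netcap, he.1, he.2.1, huK, he.2.2.1]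
    · push Not at h1
      obtain ⟨y, w, he, hy, hw, hyK, hwK⟩ := exists_exit K hx.1 (Conn.refl t) hx htK hxK
      refine ⟨N, w, by omega, by have := he.2.1; omega,
        Or.inl ⟨hl, hF.source hl N (by omega) rfl, h1 w hw, ?_⟩, Or.inr ⟨he.2.1, hw, hwK⟩⟩
      simp only [netcap, he.2.1, if_true, lt_irrefl, if_false, hwK, not_false_eq_true, and_self]
      refine lt_of_lt_of_le he.2.2.1 ?_
      refine le_trans ?_ (single_le_sum (fun _ _ => Nat.zero_le _) (mem_range.2 he.1))
      rw [if_pos hyK]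
  · by_contra hno
    push Not at hno
    -- Suppose that no candidate helps, and consider the cut formed by `N` and the vertices that are
    -- reachable from `t` but cannot return.
    set B : Set ℕ := {v | Reach N c D t v ∧ ¬ Conn N c D t v} with hB
    have hKB : ∀ v < N, v ∈ K → v ∉ B := fun v _ hv h => h.2 (hK v hv)
    have hBN : ∀ v ∈ B, v < N := fun v hv => hv.1.lt htN
    have hcut := hF.cut_eq ({N} ∪ B) (by simp) (fun v _ hv h => by
      rcases h with h | h
      · have := hv.1; simp at h; omega
      · exact hKB v hv.1 hv.2 h)
    rw [cut_netcap (B := B) (by simp) (fun v hv => by simp; omega) hKB] at hcut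
    -- An arc outside `D` cannot leave `B`: its head would be reachable, hence in the component, and
    -- then its tail could return to `t`. So apart from `D` only arcs from `K` to the rest of the
    -- component cross.
    have h1 : cost N c (Cross B K) ≤ cost N c D +
        ∑ v ∈ range N, if v ∉ K ∧ Conn N c D t v then netcap N c K N v else 0 := by
      have h2 : ∑ v ∈ range N, (if v ∉ K ∧ Conn N c D t v then netcap N c K N v else 0) =
          ∑ u ∈ range N, ∑ v ∈ range N,
            if v ∉ K ∧ Conn N c D t v then (if u ∈ K then c u v else 0) else 0 := by
        rw [sum_comm]
        refine sum_congr rfl fun v hv => ?_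
        by_cases h3 : v ∉ K ∧ Conn N c D t v
        · simp [h3, netcap, mem_range.1 hv]
        · simp [h3]
      rw [h2]
      unfold cost
      rw [← dsum_add]
      refine dsum_le fun u hu v hv => ?_
      by_cases h3 : Cross B K u v
      swap
      · simp [h3]
      by_cases h4 : D u v
      · simp [h3, h4]
      by_cases h5 : 0 < c u v
      swap
      · simp [Nat.eq_zero_of_not_pos h5]
      have he : Edge N c D u v := ⟨hu, hv, h5, h4⟩
      rcases h3 with ⟨h6, h7⟩ | ⟨h6, h7, h8⟩
      · exfalso
        have hr : Reach N c D t v := h6.1.tail he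
        have : Conn N c D t v := by by_contra h; exact h7 ⟨hr, h⟩
        exact h6.2 ⟨h6.1, (Relation.ReflTransGen.single he).trans this.2⟩
      · have hr : Reach N c D t v := (hK u h6).1.tail he
        have : Conn N c D t v := by by_contra h; exact h8 ⟨hr, h⟩
        rw [if_pos (⟨h7, this⟩ : v ∉ K ∧ Conn N c D t v), if_pos h6]
        split <;> omega
    -- The arcs from `N` into the component are no candidates, so they carry no flow and keep their
    -- capacity in `r`. With `hcut` this gives `lam ≤ cost N c D ≤ k`, a contradiction.
    have h2 : ∑ v ∈ range N, (if v ∉ K ∧ Conn N c D t v then netcap N c K N v else 0) ≤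
        cut (N + 1) r ({N} ∪ B) := by
      unfold cut
      rw [sum_range_succ]
      refine le_trans ?_ (Nat.le_add_left _ _)
      rw [sum_range_succ]
      refine le_trans (sum_le_sum fun v hv => ?_) (Nat.le_add_right _ _)
      have hv := mem_range.1 hv
      by_cases h3 : v ∉ K ∧ Conn N c D t v
      swap
      · simp [h3]
      rw [if_pos h3, if_pos ⟨by simp, by simp [hB, h3.2]; omega⟩]
      by_contra hlt
      exact h3.1 ((hno N v (by omega) (by omega) (Or.inr ⟨by omega, rfl, by omega⟩)).2 hv h3.2)
    omega

/-- In the first case the candidates have positive capacity and cross a cut of capacity at most `k`.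
In the second case each of them carries at least one of the at most `k + 1` units that leave `N`. -/
theorem card_cand {K : Set ℕ} {S X : Set ℕ} {lam : ℕ} {r : ℕ → ℕ → ℕ} {mark : ℕ → ℕ}
    (hF : FlowSpec (N + 1) (netcap N c K) S X k r lam mark) (hS : ∀ v ∈ S, v < N + 1)
    (hS' : S ⊆ {N}) (hX : ∀ v ∈ X, v < N) :
    (∑ u ∈ range (N + 1), ∑ v ∈ range (N + 1),
      if Cand N k (netcap N c K) r lam mark u v then 1 else 0) ≤ k + 1 := by
  by_cases hl : lam ≤ k
  · refine le_trans (dsum_le fun u _ v _ => ?_)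
      ((hF.cut_mark hl hS).le.trans (hl.trans (Nat.le_succ k)))
    by_cases h : Cand N k (netcap N c K) r lam mark u v
    · rcases h with h | h
      · rw [if_pos (show Cand N k (netcap N c K) r lam mark u v from Or.inl h),
          if_pos ⟨h.2.1, h.2.2.1⟩]
        exact h.2.2.2
      · omega
    · simp [h]
  · have h1 := hF.cut_eq {N} hS' (fun v _ hv h => by have := hX v hv; simp at h; omega)
    have h2 : ∀ c' : ℕ → ℕ → ℕ, cut (N + 1) c' {N} = ∑ v ∈ range N, c' N v := by
      intro c'
      unfold cut
      rw [sum_range_succ, sum_eq_zero, sum_range_succ]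
      · simp only [Set.mem_singleton_iff, not_true_eq_false, and_false, if_false, add_zero, zero_add]
        refine sum_congr rfl fun v hv => ?_
        have := mem_range.1 hv
        rw [if_pos ⟨trivial, by omega⟩]
      · intro u hu
        have := mem_range.1 hu
        refine sum_eq_zero fun v _ => ?_
        rw [if_neg]; simp; omega
    rw [h2, h2] at h1
    have h3 := hF.le
    refine le_trans ?_ h3
    -- As no arc of the network enters `N`, `symm` bounds the residual capacity `r N v` by the
    -- capacity.
    have h4 : ∑ v ∈ range N, (r N v + if r N v < netcap N c K N v then 1 else 0) ≤
        ∑ v ∈ range N, netcap N c K N v := by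
      refine sum_le_sum fun v hv => ?_
      have hv := mem_range.1 hv
      have h5 := hF.symm N (by omega) v (by omega)
      have h6 : netcap N c K v N = 0 := by simp [netcap]
      split <;> omega
    rw [sum_add_distrib] at h4
    rw [sum_range_succ, sum_eq_zero, sum_range_succ]
    · have h5 : ¬ Cand N k (netcap N c K) r lam mark N N := by
        rintro (h | h)
        · omega
        · simp [netcap] at h
      rw [if_neg h5]
      have h6 : ∑ v ∈ range N, (if Cand N k (netcap N c K) r lam mark N v then 1 else 0) ≤
          ∑ v ∈ range N, if r N v < netcap N c K N v then 1 else 0 := by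
        refine sum_le_sum fun v _ => ?_
        by_cases h : Cand N k (netcap N c K) r lam mark N v
        · rcases h with h | h
          · omega
          · rw [if_pos h.2.2]; split <;> omega
        · simp [h]
      omega
    · intro u hu
      have := mem_range.1 hu
      refine sum_eq_zero fun v _ => if_neg ?_
      rintro (h | h) <;> omega

/-! ## A topological order of strong components -/

theorem exists_rank (N : ℕ) (c : ℕ → ℕ → ℕ) (D : ℕ → ℕ → Prop) (T : Finset ℕ)
    (hT : ∀ v ∈ T, v < N) :
    ∃ rank : ℕ → ℕ, (∀ u v, Conn N c D u v → rank u = rank v) ∧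
      (∀ u ∈ T, ∀ v ∈ T, rank u = rank v → Conn N c D u v) ∧
      (∀ u ∈ T, ∀ v ∈ T, Reach N c D u v → ¬ Conn N c D u v → rank u < rank v) ∧
      ∀ v ∈ T, rank v < T.card := by
  set rs : ℕ → Finset ℕ := fun u => (range N).filter (Reach N c D u) with hrs
  set rep : ℕ → ℕ := fun u => sInf {v | Conn N c D u v} with hrep
  -- Earlier components reach more vertices. Ties are broken by the least member of the component as
  -- the lower digit in base `N + 1`, which makes the key injective on components.
  set key : ℕ → ℕ := fun u => (N - (rs u).card) * (N + 1) + rep u with hkey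
  have hrepm : ∀ u, Conn N c D u (rep u) := fun u =>
    Nat.sInf_mem (s := {v | Conn N c D u v}) ⟨u, Conn.refl u⟩
  have hreple : ∀ u, rep u ≤ u := fun u => Nat.sInf_le (Conn.refl u)
  have hcard : ∀ u, (rs u).card ≤ N := fun u => by
    simpa using card_le_card (filter_subset (Reach N c D u) (range N))
  have hkc : ∀ u v, Conn N c D u v → key u = key v := by
    intro u v h
    have h1 : rs u = rs v := by
      ext x; simp only [hrs, mem_filter]
      exact and_congr_right fun _ => ⟨fun h' => h.2.trans h', fun h' => h.1.trans h'⟩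
    have h2 : rep u = rep v := by
      simp only [hrep]; congr 1; ext x
      exact ⟨fun h' => h.symm.trans h', fun h' => h.trans h'⟩
    simp only [hkey, h1, h2]
  have hinj : ∀ u < N, ∀ v < N, key u = key v → Conn N c D u v := by
    intro u hu v hv h
    have h1 := hreple u; have h2 := hreple v
    have h3 : rep u = rep v := by
      have := congrArg (· % (N + 1)) h
      simp only [hkey] at this
      rwa [Nat.mul_add_mod_self_right, Nat.mul_add_mod_self_right, Nat.mod_eq_of_lt (by omega),
        Nat.mod_eq_of_lt (by omega)] at this
    exact (hrepm u).trans (h3 ▸ (hrepm v).symm)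
  have hlt : ∀ u < N, ∀ v < N, Reach N c D u v → ¬ Conn N c D u v → key u < key v := by
    intro u hu v hv h h'
    have h1 : (rs v).card < (rs u).card := by
      refine card_lt_card ⟨fun x hx => ?_, fun hs => ?_⟩
      · simp only [hrs, mem_filter] at hx ⊢; exact ⟨hx.1, h.trans hx.2⟩
      · have : u ∈ rs v := hs (by simp only [hrs, mem_filter, mem_range]; exact ⟨hu, .refl⟩)
        simp only [hrs, mem_filter] at this
        exact h' ⟨h, this.2⟩
    have h2 := hcard u; have h3 := hreple u
    have h4 : (N - (rs u).card + 1) * (N + 1) ≤ (N - (rs v).card) * (N + 1) :=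
      Nat.mul_le_mul_right _ (by omega)
    simp only [hkey]; rw [add_mul] at h4; omega
  -- Counting the smaller keys that occur on `T` compresses the keys to ranks below the size of `T`.
  refine ⟨fun v => ((T.image key).filter (· < key v)).card, fun u v h => by dsimp only; rw [hkc u v h], ?_, ?_, ?_⟩
  all_goals
    have hmono : ∀ u ∈ T, ∀ v ∈ T, key u < key v →
        ((T.image key).filter (· < key u)).card < ((T.image key).filter (· < key v)).card := by
      intro u hu v hv h
      refine card_lt_card ⟨fun x hx => ?_, fun hs => ?_⟩
      · simp only [mem_filter] at hx ⊢; exact ⟨hx.1, by omega⟩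
      · have : key u ∈ (T.image key).filter (· < key u) :=
          hs (by simp only [mem_filter]; exact ⟨mem_image_of_mem _ hu, h⟩)
        simp at this
  · intro u hu v hv h
    rcases lt_trichotomy (key u) (key v) with h1 | h1 | h1
    · exact absurd h (hmono u hu v hv h1).ne
    · exact hinj u (hT u hu) v (hT v hv) h1
    · exact absurd h (hmono v hv u hu h1).ne'
  · exact fun u hu v hv h h' => hmono u hu v hv (hlt u (hT u hu) v (hT v hv) h h')
  · intro v hv
    refine lt_of_lt_of_le (card_lt_card ⟨filter_subset _ _, fun hs => ?_⟩) card_image_le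
    have := hs (mem_image_of_mem key hv)
    simp at this

/-- `lab` numbers the strong components that meet `T` in topological order, from `1` on. -/
structure Labels (N : ℕ) (c : ℕ → ℕ → ℕ) (D : ℕ → ℕ → Prop) (T : ℕ → Prop) (lab : ℕ → ℕ) :
    Prop where
  pos : ∀ v < N, 0 < lab v ↔ ∃ t < N, T t ∧ Conn N c D t v
  conn : ∀ u < N, ∀ v < N, 0 < lab u → lab u = lab v → Conn N c D u v
  congr : ∀ u < N, ∀ v < N, Conn N c D u v → lab u = lab v
  lt : ∀ u < N, ∀ v < N, 0 < lab u → 0 < lab v → Reach N c D u v → ¬ Conn N c D u v →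
    lab u < lab v

theorem exists_labels (N k : ℕ) (c : ℕ → ℕ → ℕ) (D : ℕ → ℕ → Prop) (T : ℕ → Prop)
    (hT : ((range N).filter T).card ≤ k + 1) :
    ∃ lab : ℕ → ℕ, Labels N c D T lab ∧ ∀ v < N, lab v ≤ k + 1 := by
  obtain ⟨rank, h1, h2, h3, h4⟩ := exists_rank N c D ((range N).filter T) (by simp; tauto)
  have hmem : ∀ t, t ∈ (range N).filter T ↔ t < N ∧ T t := by simp
  simp only [hmem] at h2 h3 h4
  have hle : ∀ t, t < N ∧ T t → rank t + 1 ≤ k + 1 := fun t ht => by have := h4 t ht; omega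
  -- Label `0` is reserved for components without terminals, hence the shift by one.
  set lab : ℕ → ℕ := fun v => if ∃ t < N, T t ∧ Conn N c D t v then rank v + 1 else 0 with hlab
  have hl0 : ∀ v, 0 < lab v ↔ ∃ t < N, T t ∧ Conn N c D t v := fun v => by
    simp only [hlab]; split <;> simp_all
  have hl1 : ∀ v, 0 < lab v → lab v = rank v + 1 := fun v hv => if_pos ((hl0 v).1 hv)
  refine ⟨lab, ⟨fun v _ => hl0 v, ?_, ?_, ?_⟩, ?_⟩
  · intro u hu v hv h h'
    obtain ⟨t, ht, hT, htu⟩ := (hl0 u).1 h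
    obtain ⟨t', ht', hT', htv⟩ := (hl0 v).1 (h' ▸ h)
    have h5 := hl1 u h
    have h6 := hl1 v (h' ▸ h)
    have : rank t = rank t' := by rw [h1 t u htu, h1 t' v htv]; omega
    exact (htu.symm.trans (h2 t ⟨ht, hT⟩ t' ⟨ht', hT'⟩ this)).trans htv
  · intro u _ v _ h
    have : (∃ t < N, T t ∧ Conn N c D t u) ↔ ∃ t < N, T t ∧ Conn N c D t v :=
      ⟨fun ⟨t, ht, hT, h'⟩ => ⟨t, ht, hT, h'.trans h⟩,
        fun ⟨t, ht, hT, h'⟩ => ⟨t, ht, hT, h'.trans h.symm⟩⟩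
    simp only [hlab, this, h1 u v h]
  · intro u hu v hv h h' hr hc
    obtain ⟨t, ht, hT, htu⟩ := (hl0 u).1 h
    obtain ⟨t', ht', hT', htv⟩ := (hl0 v).1 h'
    have := h3 t ⟨ht, hT⟩ t' ⟨ht', hT'⟩ ((htu.1.trans hr).trans htv.2)
      fun h => hc ((htu.symm.trans h).trans htv)
    rw [h1 t u htu, h1 t' v htv] at this
    rw [hl1 u h, hl1 v h']
    omega
  · intro v hv
    by_cases h : 0 < lab v
    · obtain ⟨t, ht, hT, h'⟩ := (hl0 v).1 h
      rw [hl1 v h, ← h1 t v h']; exact hle t ⟨ht, hT⟩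
    · omega

/-! ## Separating the numbered classes -/

/-- Some arcs of total capacity at most `κ` cut the classes `1, …, p` off from themselves and from
the classes with smaller numbers; `B0` can be reached from class `p`. -/
def Valid (N : ℕ) (c : ℕ → ℕ → ℕ) (lab : ℕ → ℕ) (p : ℕ) (B0 : Set ℕ) (κ : ℕ) : Prop :=
  ∃ (D : ℕ → ℕ → Prop) (Bs : ℕ → Set ℕ), cost N c D ≤ κ ∧ B0 ⊆ Bs p ∧
    ∀ j, 1 ≤ j → j ≤ p → (∀ v < N, v ∈ Bs j → lab v = 0 ∨ j < lab v) ∧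
      ∀ u < N, ∀ v < N, Cross (Bs j) {x | lab x = j} u v → 0 < c u v → D u v

/-- For class `j` take the vertices outside of it that it reaches. The topological order keeps the
smaller classes out. An arc outside `D` that left this set would lead back into the class, and its
tail would belong to the class. -/
theorem Labels.valid {T : ℕ → Prop} {lab : ℕ → ℕ} (h : Labels N c D T lab)
    (hD : cost N c D ≤ k) (p : ℕ) : Valid N c lab p ∅ k := by
  refine ⟨D, fun j => {v | lab v ≠ j ∧ ∃ u < N, lab u = j ∧ Reach N c D u v}, hD, by simp,
    fun j hj _ => ⟨?_, ?_⟩⟩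
  · rintro v hv ⟨h1, u, hu, h2, h3⟩
    by_contra h4
    have h5 := h.lt u hu v hv (by omega) (by omega) h3
      fun h' => h1 (by rw [← h.congr u hu v hv h', h2])
    omega
  · intro u hu v hv h1 h2
    by_contra h3
    have he : Edge N c D u v := ⟨hu, hv, h2, h3⟩
    rcases h1 with ⟨⟨h4, x, hx, h5, h6⟩, h7⟩ | ⟨h4, h5, h6⟩
    · have h8 : lab v = j := by
        by_contra h8
        exact h7 ⟨h8, x, hx, h5, h6.tail he⟩
      have h9 := h.conn x hx v hv (by omega) (by omega)
      exact h4 (by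
        rw [← h5]; exact (h.congr x hx u hu ⟨h6, (Relation.ReflTransGen.single he).trans h9.2⟩).symm)
    · exact h6 ⟨h5, u, hu, h4, .single he⟩

/-- The sources of the network for class `p`. -/
def srcs (N : ℕ) (B0 : Set ℕ) : Set ℕ := {v | v = N ∨ (v < N ∧ v ∈ B0)}

/-- The classes from `lo` to `p`. -/
def snks (N : ℕ) (lab : ℕ → ℕ) (lo p : ℕ) : Set ℕ := {v | v < N ∧ lo ≤ lab v ∧ lab v ≤ p}

variable {lab : ℕ → ℕ} {p lam κ : ℕ} {B0 : Set ℕ} {r : ℕ → ℕ → ℕ} {mark : ℕ → ℕ}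

/-- The sources `B0` concern only the current class and are dropped when the next smaller class is
taken up. -/
theorem Valid.pred (h : Valid N c lab (p + 1) B0 κ) : Valid N c lab p ∅ κ := by
  obtain ⟨D, Bs, h1, h2, h3⟩ := h
  exact ⟨D, Bs, h1, by simp, fun j hj hj' => h3 j hj (by omega)⟩

theorem Valid.cut_le (h : Valid N c lab p B0 κ) (hp : 1 ≤ p) :
    ∃ R : Set ℕ, srcs N B0 ⊆ R ∧ (∀ v < N + 1, v ∈ snks N lab 1 p → v ∉ R) ∧
      cut (N + 1) (netcap N c {x | lab x = p}) R ≤ κ := by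
  obtain ⟨D, Bs, h1, h2, h3⟩ := h
  obtain ⟨h4, h5⟩ := h3 p hp le_rfl
  refine ⟨{N} ∪ Bs p, ?_, ?_, ?_⟩
  · rintro v (hv | hv)
    · exact Or.inl hv
    · exact Or.inr (h2 hv.2)
  · rintro v - ⟨hv, h6, h7⟩ (h8 | h8)
    · simp at h8; omega
    · have := h4 v hv h8; omega
  · rw [cut_netcap (B := Bs p) (by simp) (fun v hv => by simp; omega)
      (fun v hv h6 h7 => by have := h4 v hv h7; simp at h6; omega)]
    exact (cost_mono h5).trans h1

/-- By `cut_union_le`, adding the unmarked vertices to `Bs p` does not make its cut dearer, so the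
old crossing arcs can be exchanged for the new ones. The sets of the smaller classes absorb the new
set and class `p` itself. They may do so because all labels there are `0` or at least `p`; this is
why large numbers are treated first. -/
theorem Valid.push (h : Valid N c lab p B0 κ) (hp : 1 ≤ p) (hl : lam ≤ k)
    (hF : FlowSpec (N + 1) (netcap N c {x | lab x = p}) (srcs N B0) (snks N lab 1 p) k r lam mark) :
    Valid N c lab p (B0 ∪ {v | v < N ∧ mark v = 0}) κ := by
  obtain ⟨D, Bs, h1, h2, h3⟩ := h
  obtain ⟨h4, h5⟩ := h3 p hp le_rfl
  set Cp : Set ℕ := {x | lab x = p} with hCp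
  set B' : Set ℕ := Bs p ∪ {v | v < N ∧ mark v = 0} with hB'
  have hB'l : ∀ v < N, v ∈ B' → lab v = 0 ∨ p < lab v := by
    rintro v hv (h6 | h6)
    · exact h4 v hv h6
    · by_contra h7
      exact hF.sink hl v (by omega) ⟨hv, by omega, by omega⟩ h6.2
  have hcut : cost N c (Cross B' Cp) ≤ cost N c (Cross (Bs p) Cp) := by
    have h6 : srcs N B0 ⊆ {N} ∪ Bs p := by
      rintro v (hv | hv)
      · exact Or.inl hv
      · exact Or.inr (h2 hv.2)
    have h7 := hF.cut_union_le hl h6 (by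
      rintro v - ⟨hv, h6, h7⟩ (h8 | h8)
      · simp at h8; omega
      · have := h4 v hv h8; omega)
    have h8 := cut_netcap (N := N) (c := c) (K := Cp) (B := Bs p) (R := {N} ∪ Bs p) (by simp)
      (fun v hv => by simp; omega)
      (fun v hv h6 h7 => by have := h4 v hv h7; simp [hCp] at h6; omega)
    have h9 := cut_netcap (N := N) (c := c) (K := Cp) (B := B')
      (R := {N} ∪ Bs p ∪ {v | mark v = 0}) (by simp)
      (fun v hv => by
        have : v ≠ N := by omega
        simp only [hB', Set.mem_union, Set.mem_singleton_iff, Set.mem_ofPred_eq]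
        tauto)
      (fun v hv h6 h7 => by have := hB'l v hv h7; simp [hCp] at h6; omega)
    rwa [h8, h9] at h7
  refine ⟨fun u v => (D u v ∧ ¬ Cross (Bs p) Cp u v) ∨ Cross B' Cp u v,
    fun j => if j = p then B' else Bs j ∪ B' ∪ Cp, ?_, ?_, fun j hj hjp => ?_⟩
  · refine le_trans ?_ h1
    have h6 : cost N c (fun u v => (D u v ∧ ¬ Cross (Bs p) Cp u v) ∨ Cross B' Cp u v) ≤
        cost N c (fun u v => D u v ∧ ¬ Cross (Bs p) Cp u v) + cost N c (Cross B' Cp) := by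
      unfold cost
      rw [← dsum_add]
      refine dsum_le fun u _ v _ => ?_
      by_cases h7 : D u v ∧ ¬ Cross (Bs p) Cp u v <;> by_cases h8 : Cross B' Cp u v <;>
        simp [h7, h8]
    have h7 : cost N c (fun u v => D u v ∧ ¬ Cross (Bs p) Cp u v) + cost N c (Cross (Bs p) Cp) ≤
        cost N c D := by
      unfold cost
      rw [← dsum_add]
      refine dsum_le fun u hu v hv => ?_
      by_cases h8 : Cross (Bs p) Cp u v
      · by_cases h9 : 0 < c u v
        · simp [h8, h5 u hu v hv h8 h9]
        · simp [Nat.eq_zero_of_not_pos h9]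
      · simp [h8]
    omega
  · simp only [if_true]
    exact Set.union_subset_union_left _ h2
  · by_cases hjp' : j = p
    · subst hjp'
      simp only [if_true]
      exact ⟨hB'l, fun u _ v _ h6 _ => Or.inr h6⟩
    · simp only [hjp', if_false]
      obtain ⟨h6, h7⟩ := h3 j hj hjp
      refine ⟨?_, ?_⟩
      · rintro v hv ((h8 | h8) | h8)
        · exact h6 v hv h8
        · have := hB'l v hv h8; omega
        · simp [hCp] at h8; omega
      · intro u hu v hv h8 h9
        have hj' : j < p := by omega
        -- With a tail in `B' ∪ Cp`, the arc crosses the new cut for class `p`. Otherwise it crosses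
        -- the old set of class `j`, and it is not among the arcs given up, whose tails lie in `Bs p
        -- ∪ Cp`.
        by_cases h10 : u ∈ B' ∪ Cp
        · right
          have h11 : v ∉ Bs j ∪ B' ∪ Cp := by
            rcases h8 with h8 | h8
            · exact h8.2
            · exact h8.2.2
          rcases h10 with h10 | h10
          · exact Or.inl ⟨h10, fun h => h11 (Or.inl (Or.inr h))⟩
          · exact Or.inr ⟨h10, fun h => h11 (Or.inr h), fun h => h11 (Or.inl (Or.inr h))⟩
        · left
          refine ⟨h7 u hu v hv ?_ h9, ?_⟩
          · rcases h8 with ⟨(h8 | h8) | h8, h11⟩ | ⟨h8, h11, h12⟩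
            · exact Or.inl ⟨h8, fun h => h11 (Or.inl (Or.inl h))⟩
            · exact absurd (Or.inl h8) h10
            · exact absurd (Or.inr h8) h10
            · exact Or.inr ⟨h8, h11, fun h => h12 (Or.inl (Or.inl h))⟩
          · rintro (h | h)
            · exact h10 (Or.inl (Or.inl h.1))
            · exact h10 (Or.inr h.1)

/-! ### Branching on an arc of the furthest minimum cut -/

/-- The arcs represented by the arc from `u` to `w` of the network for class `p`. -/
def Pre (N : ℕ) (lab : ℕ → ℕ) (p u w x y : ℕ) : Prop :=
  y = w ∧ (x = u ∨ (u = N ∧ lab x = p))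

/-- Capacities after the removal of these arcs. -/
noncomputable def without (c : ℕ → ℕ → ℕ) (P : ℕ → ℕ → Prop) (x y : ℕ) : ℕ :=
  if P x y then 0 else c x y

/-- An arc from `N` merges all arcs from class `p` to its head; any other arc of positive capacity
stands for itself. -/
theorem cost_pre {u w : ℕ} (hu : u < N + 1) (hpos : 0 < netcap N c {x | lab x = p} u w) :
    cost N c (Pre N lab p u w) = netcap N c {x | lab x = p} u w := by
  have hw : w < N := by by_contra h; simp [netcap, h] at hpos
  unfold cost
  rw [sum_comm, sum_eq_single w]
  · by_cases hN : u < N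
    · have : lab u ≠ p := fun h => by simp [netcap, hw, hN, h] at hpos
      rw [sum_eq_single u]
      · simp [Pre, netcap, hw, hN, this]
      · intro x _ hx
        have : u ≠ N := by omega
        simp [Pre, hx, this]
      · simp [hN]
    · have hN : u = N := by omega
      subst hN
      have : lab w ≠ p := fun h => by simp [netcap, h] at hpos
      simp only [netcap, hw, if_true, lt_irrefl, if_false, Set.mem_ofPred_eq, this,
        not_false_eq_true, and_self]
      refine sum_congr rfl fun x hx => ?_
      have := mem_range.1 hx
      have : x ≠ u := by omega
      simp [Pre, this]
  · intro y _ hy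
    exact sum_eq_zero fun x _ => by simp [Pre, hy]
  · simp [hw]

/-- Once the unmarked vertices lie in `Bs p`, either `w` lies there too and may become a source, or
all arcs behind `(u, w)` cross and thus belong to `D`; deleting them is paid for out of `κ`. -/
theorem Valid.branch (h : Valid N c lab p B0 κ) (hp : 1 ≤ p) (hl : lam ≤ k)
    (hF : FlowSpec (N + 1) (netcap N c {x | lab x = p}) (srcs N B0) (snks N lab 1 p) k r lam mark)
    {u w : ℕ} (hu : u < N + 1) (hmu : mark u = 0)
    (hpos : 0 < netcap N c {x | lab x = p} u w) :
    Valid N c lab p ((B0 ∪ {v | v < N ∧ mark v = 0}) ∪ {w}) κ ∨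
      ∃ κ', κ' + netcap N c {x | lab x = p} u w = κ ∧
        Valid N (without c (Pre N lab p u w)) lab p B0 κ' := by
  obtain ⟨D, Bs, h1, h2, h3⟩ := h.push hp hl hF
  have hw : w < N := by by_contra h; simp [netcap, h] at hpos
  by_cases hwB : w ∈ Bs p
  · left
    exact ⟨D, Bs, h1, Set.union_subset h2 (by simpa using hwB), h3⟩
  · right
    have hD : ∀ x < N, ∀ y < N, Pre N lab p u w x y → 0 < c x y → D x y := by
      rintro x hx y hy ⟨rfl, hxu⟩ hc
      refine (h3 p hp le_rfl).2 x hx y hy ?_ hc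
      rcases hxu with rfl | ⟨rfl, hxu⟩
      · exact Or.inl ⟨h2 (Or.inr ⟨hx, hmu⟩), hwB⟩
      · refine Or.inr ⟨hxu, fun h => ?_, hwB⟩
        simp only [Set.mem_ofPred_eq] at h
        simp [netcap, h] at hpos
    have hc : cost N (without c (Pre N lab p u w)) D + netcap N c {x | lab x = p} u w =
        cost N c D := by
      rw [← cost_pre hu hpos]
      unfold cost
      rw [← dsum_add]
      refine dsum_congr fun x hx y hy => ?_
      by_cases h4 : Pre N lab p u w x y
      · by_cases h5 : 0 < c x y
        · simp [without, h4, hD x hx y hy h4 h5]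
        · simp [without, h4, Nat.eq_zero_of_not_pos h5]
      · simp [without, h4]
    refine ⟨κ - netcap N c {x | lab x = p} u w, by omega, D, Bs, by omega,
      Set.subset_union_left.trans h2, fun j hj hjp => ⟨(h3 j hj hjp).1, fun x hx y hy h4 h5 => ?_⟩⟩
    refine (h3 j hj hjp).2 x hx y hy h4 ?_
    by_contra h6
    have : c x y = 0 := by omega
    simp [without, this] at h5

/-- The deletion reduces only the entry `(u, w)` of the network, so no cut loses more than the
capacity of this entry. -/
theorem cut_without {u w : ℕ} (hu : u < N + 1) (R : Set ℕ)
    (hpos : 0 < netcap N c {x | lab x = p} u w) :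
    cut (N + 1) (netcap N c {x | lab x = p}) R ≤
      cut (N + 1) (netcap N (without c (Pre N lab p u w)) {x | lab x = p}) R +
        netcap N c {x | lab x = p} u w := by
  have hw : w < N := by by_contra h; simp [netcap, h] at hpos
  rw [← dsum_single hu (by omega : w < N + 1) (netcap N c {x | lab x = p} u w)]
  unfold cut
  rw [← dsum_add]
  refine dsum_le fun x hx y hy => ?_
  suffices netcap N c {x | lab x = p} x y ≤
      netcap N (without c (Pre N lab p u w)) {x | lab x = p} x y +
        if x = u ∧ y = w then netcap N c {x | lab x = p} u w else 0 by
    split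
    · exact this
    · exact Nat.zero_le _
  by_cases h1 : x = u ∧ y = w
  · obtain ⟨rfl, rfl⟩ := h1; simp
  rw [if_neg h1, add_zero]
  by_cases hyN : y < N
  swap
  · simp [netcap, hyN]
  by_cases hxN : x < N
  · by_cases hxp : lab x = p
    · simp [netcap, hyN, hxN, hxp]
    · have : ¬ Pre N lab p u w x y := by
        rintro ⟨h, h' | h'⟩
        · exact h1 ⟨h', h⟩
        · exact hxp h'.2
      simp [netcap, hyN, hxN, hxp, without, this]
  · have hxe : x = N := by omega
    subst hxe
    simp only [netcap, hyN, if_true, lt_irrefl, if_false, Set.mem_ofPred_eq]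
    split
    swap
    · exact le_rfl
    refine sum_le_sum fun z hz => ?_
    have hz := mem_range.1 hz
    split
    swap
    · exact le_rfl
    have : ¬ Pre x lab p u w z y := by
      rintro ⟨h, h' | h'⟩
      · rename_i h2 h3
        subst h'
        simp [netcap, hz, h3] at hpos
      · exact h1 ⟨h'.1.symm, h⟩
    simp [without, this]

/-- A set of arcs that keeps the classes apart leaves only small strong components. -/
theorem Labels.small {T : ℕ → Prop} {c0 : ℕ → ℕ → ℕ} {D0 D1 : ℕ → ℕ → Prop}
    (h : Labels N c D T lab) (hs : SmallComps N n s c D) (h0 : SmallComps N n s c0 D0)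
    (hlab : ∀ v < N, lab v ≤ k + 1)
    (hT : ∀ u v, Edge N c D1 u v → ¬ T u → Edge N c0 D0 u v)
    (hcl : ∀ p, 1 ≤ p → p ≤ k + 1 → ∃ B : Set ℕ, (∀ v < N, v ∈ B → lab v = 0 ∨ p < lab v) ∧
      ∀ u < N, ∀ v < N, Cross B {x | lab x = p} u v → 0 < c u v → D1 u v) :
    SmallComps N n s c D1 := by
  intro u hu
  by_cases h1 : ∃ x < N, Conn N c D1 u x ∧ 0 < lab x
  · obtain ⟨x, hx, hux, hxl⟩ := h1
    obtain ⟨B, hB, hcr⟩ := hcl (lab x) hxl (hlab x hx)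
    refine le_trans (wt_mono fun v _ hv => ?_) (hs x hx)
    have hvN : v < N := hv.1.lt hu
    -- A walk from `x` either stays in its class or enters `B`, which it can never leave (`hstay`).
    -- Since `x` is not in `B`, the component of `x` stays in the class, that is, in one component
    -- of the graph without `D`.
    have hmem : ∀ y, Reach N c D1 x y → y ∈ B ∨ lab y = lab x := by
      intro y hy
      induction hy with
      | refl => exact Or.inr rfl
      | @tail y z _ hyz ih =>
        by_contra hz
        push Not at hz
        refine hyz.2.2.2 (hcr y hyz.1 z hyz.2.1 ?_ hyz.2.2.1)
        rcases ih with ih | ih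
        · exact Or.inl ⟨ih, hz.1⟩
        · exact Or.inr ⟨ih, hz.2, hz.1⟩
    have hstay : ∀ y, Reach N c D1 v y → v ∈ B → y ∈ B := by
      intro y hy hvB
      induction hy with
      | refl => exact hvB
      | @tail y z _ hyz ih =>
        by_contra hz
        exact hyz.2.2.2 (hcr y hyz.1 z hyz.2.1 (Or.inl ⟨ih, hz⟩) hyz.2.2.1)
    have hxv : Conn N c D1 x v := hux.symm.trans hv
    rcases hmem v hxv.1 with h2 | h2
    · have := hB x hx (hstay x hxv.2 h2); omega
    · exact h.conn x hx v hvN hxl h2.symm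
  · push Not at h1
    refine le_trans (wt_mono fun v _ hv => ?_) (h0 u hu)
    have hnT : ∀ y < N, Conn N c D1 u y → ¬ T y := fun y hy hc ht => by
      have := h1 y hy hc
      have := (h.pos y hy).2 ⟨y, hy, ht, Conn.refl y⟩
      omega
    -- A component without positive labels contains no terminal, so by `hT` each of its arcs is
    -- present in the old instance as well.
    have key : ∀ x y, Conn N c D1 u x → Reach N c D1 x y → Conn N c D1 u y →
        Reach N c0 D0 x y := by
      intro x y hx hxy
      induction hxy with
      | refl => exact fun _ => .refl
      | @tail y z hy hyz ih =>
        intro hz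
        have hcy : Conn N c D1 u y :=
          ⟨hx.1.trans hy, (Relation.ReflTransGen.single hyz).trans hz.2⟩
        exact (ih hcy).tail (hT y z hyz (hnT y hyz.1 hcy))
    exact ⟨key u v (Conn.refl u) hv.1 hv, key v u hv hv.2 (Conn.refl u)⟩

end

set_option autoImplicit false

/-! ## Variables and arrays -/

notation "vN" => 4
notation "vM" => 5
notation "vKP" => 6
notation "vL" => 8
notation "vTK" => 9
notation "vOFF" => 10
notation "vRM" => 11
notation "vROWS" => 14
notation "vRUN" => 15
notation "vANS" => 16
notation "vU" => 20
notation "vV" => 21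
notation "vZ" => 22
notation "vCUR" => 23
notation "vNEXT" => 24
notation "vFND" => 25
notation "vLAM" => 26
notation "vSTOP" => 27
notation "vIT" => 28
notation "aROW" => 2
notation "aCAP" => 3
notation "aDOLD" => 4
notation "aRAD" => 6
notation "aCUR" => 10
notation "aNET" => 11
notation "aRES" => 12
notation "aMARK" => 13
notation "aNXT" => 14
notation "aSRC" => 15
notation "aSNK" => 16
notation "aLAB" => 17
notation "aCAND" => 18
notation "aDNEW" => 19
notation "aREACH" => 20
notation "aBASE" => 21
notation "aTERM" => 22

section

@[simp] theorem var_setVar (σ : State) (x v y : ℕ) :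
    (σ.setVar x v).var y = if y = x then v else σ.var y := by
  simp [State.setVar, Function.update_apply]

@[simp] theorem arr_setVar (σ : State) (x v : ℕ) : (σ.setVar x v).arr = σ.arr := rfl

@[simp] theorem var_setArr (σ : State) (a i v : ℕ) : (σ.setArr a i v).var = σ.var := rfl

@[simp] theorem arr_setArr (σ : State) (a i v b : ℕ) :
    (σ.setArr a i v).arr b = if b = a then Function.update (σ.arr a) i v else σ.arr b := by
  simp only [State.setArr, Function.update_apply]

@[simp] theorem exec_skip (σ : State) : Cmd.skip.exec σ = σ := rfl

@[simp] theorem exec_assign (σ : State) (x : ℕ) (e : Expr) :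
    (Cmd.assign x e).exec σ = σ.setVar x (e.eval σ) := rfl

@[simp] theorem exec_write (σ : State) (a : ℕ) (i e : Expr) :
    (Cmd.write a i e).exec σ =
      if i.eval σ < σ.var vSZ then σ.setArr a (i.eval σ) (e.eval σ) else σ := rfl

@[simp] theorem exec_seq (σ : State) (p q : Cmd) : (p ;; q).exec σ = q.exec (p.exec σ) := rfl

@[simp] theorem exec_cond (σ : State) (e : Expr) (p q : Cmd) :
    (Cmd.cond e p q).exec σ = if e.eval σ = 0 then q.exec σ else p.exec σ := rfl

attribute [simp] Expr.eval

end

/-- The cell `(u, v)` of a matrix with rows of length `M`. -/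
def mat (M : ℕ) (f : ℕ → ℕ) (u v : ℕ) : ℕ := f (u * M + v)

theorem cell_inj {M u v a b : ℕ} (hv : v < M) (hb : b < M) (h : u * M + v = a * M + b) :
    u = a ∧ v = b := by
  have hM : 0 < M := by omega
  have h1 : (M * u + v) / M = (M * a + b) / M := by rw [mul_comm M, mul_comm M, h]
  rw [Nat.mul_add_div hM, Nat.mul_add_div hM, Nat.div_eq_of_lt hv, Nat.div_eq_of_lt hb] at h1
  simp only [add_zero] at h1
  subst h1
  exact ⟨rfl, by omega⟩

theorem cell_lt {M u v : ℕ} (hu : u < M) (hv : v < M) : u * M + v < M * M := by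
  calc u * M + v < u * M + M := by omega
    _ = (u + 1) * M := by ring
    _ ≤ M * M := Nat.mul_le_mul_right _ hu

theorem mat_update {M : ℕ} (f : ℕ → ℕ) {a b u v : ℕ} (x : ℕ) (hb : b < M) (hv : v < M) :
    mat M (Function.update f (a * M + b) x) u v = if u = a ∧ v = b then x else mat M f u v := by
  unfold mat
  rw [Function.update_apply]
  by_cases h : u * M + v = a * M + b
  · have := cell_inj hv hb h
    simp [this]
  · rw [if_neg h, if_neg]
    rintro ⟨rfl, rfl⟩; exact h rfl

namespace Cmd

/-- The variables and arrays that describe the instance are not changed. -/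
def safe (p : Cmd) : Bool :=
  [0, 1, 3, vN, vM, vKP, vSZ, vL, vTK, vOFF, vRM, vROWS].all (fun y => !p.wv y) &&
    [aROW, aCAP, aDOLD].all (fun a => !p.wa a)

end Cmd

open Cmd

/-- The constants for an instance with `N` vertices, of which those below `n` have weight one. -/
structure Env (N n k s : ℕ) (σ : State) : Prop where
  n_eq : σ.var 0 = n
  k_eq : σ.var 1 = k
  s_eq : σ.var 3 = s
  N_eq : σ.var vN = N
  M_eq : σ.var vM = N + 1
  kp : σ.var vKP = k + 1
  sz : (N + 1) * (N + 1) ≤ σ.var vSZ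
  tk : σ.var vTK = 2 * k + 1
  off : σ.var vOFF = N - n
  rm : σ.var vRM = (k + 1) * s
  row : ∀ u ≤ N, σ.arr aROW u = u * (N + 1)
  cand : 2 * (k + 1) ≤ σ.var vSZ

theorem Env.same {N n k s : ℕ} {σ τ : State} {p : Cmd} (h : Env N n k s σ) (hS : Same p σ τ)
    (hp : p.safe = true) : Env N n k s τ := by
  simp only [safe, List.all_cons, List.all_nil, Bool.and_eq_true, Bool.not_eq_true'] at hp
  obtain ⟨⟨h0, h1, h2, h3, h4, h5, h6, h7, h8, h9, h10, h11, -⟩, ⟨g1, g2, g3, -⟩⟩ := hp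
  constructor
  · rw [hS.1 _ h0]; exact h.n_eq
  · rw [hS.1 _ h1]; exact h.k_eq
  · rw [hS.1 _ h2]; exact h.s_eq
  · rw [hS.1 _ h3]; exact h.N_eq
  · rw [hS.1 _ h4]; exact h.M_eq
  · rw [hS.1 _ h5]; exact h.kp
  · rw [hS.1 _ h6]; exact h.sz
  · rw [hS.1 _ h8]; exact h.tk
  · rw [hS.1 _ h9]; exact h.off
  · rw [hS.1 _ h10]; exact h.rm
  · rw [hS.2 _ g1]; exact h.row
  · rw [hS.1 _ h6]; exact h.cand

theorem Env.setVar {N n k s : ℕ} {σ : State} (h : Env N n k s σ) (x v : ℕ)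
    (hx : x ∉ [0, 1, 3, vN, vM, vKP, vSZ, vL, vTK, vOFF, vRM, vROWS]) :
    Env N n k s (σ.setVar x v) := by
  refine h.same (p := Cmd.assign x (.const v)) (same_exec _ σ) ?_
  simp only [List.mem_cons, List.not_mem_nil, or_false, not_or] at hx
  simp only [safe, wv, wa, List.all_cons, List.all_nil, Bool.not_false, Bool.and_true, Bool.and_eq_true,
    Bool.not_eq_true']
  have : ∀ y, x ≠ y → Nat.beq x y = false := fun y hy =>
    Bool.eq_false_iff.2 fun h => hy (Nat.eq_of_beq_eq_true h)
  refine ⟨?_, ?_, ?_, ?_, ?_, ?_, ?_, ?_, ?_, ?_, ?_, ?_⟩ <;> apply this <;> tauto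

/-- Invariants for two nested loops. -/
theorem loop2_rule {x y b d : ℕ} {p : Cmd} {σ : State} (Inv : ℕ → ℕ → State → Prop)
    (hx : p.wv x = false) (hxy : x ≠ y) (hxd : x ≠ d) (hyd : y ≠ d) (hd : p.wv d = false)
    (hInv : ∀ i j τ z v, z = x ∨ z = y → Inv i j τ → Inv i j (τ.setVar z v))
    (h0 : Inv 0 0 σ)
    (hrow : ∀ i τ, i < σ.var b → Inv i (σ.var d) τ → Inv (i + 1) 0 τ)
    (hs : ∀ i j τ, i < σ.var b → j < σ.var d → Same (loop x b (loop y d p)) σ τ →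
      τ.var x = i → τ.var y = j → Inv i j τ → Inv i (j + 1) (p.exec τ)) :
    Inv (σ.var b) 0 ((loop x b (loop y d p)).exec σ) := by
  obtain ⟨τ, h1, h2, h3⟩ := loop_rule (x := x) (b := b) (p := loop y d p) (σ := σ)
    (fun i τ => Inv i 0 τ) h0 (fun i τ hi hS hI => by
      have hdw : (loop x b (loop y d p)).wv d = false := by
        have h1 : Nat.beq x d = false :=
          Bool.eq_false_iff.2 fun h => hxd (Nat.eq_of_beq_eq_true h)
        have h2 : Nat.beq y d = false :=
          Bool.eq_false_iff.2 fun h => hyd (Nat.eq_of_beq_eq_true h)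
        simp [wv, hd, h1, h2]
      have hdv : (τ.setVar x i).var d = σ.var d := by
        rw [var_setVar, if_neg (Ne.symm hxd), hS.1 d hdw]
      obtain ⟨ρ, g1, g2, g3⟩ := loop_rule (x := y) (b := d) (p := p) (σ := τ.setVar x i)
        (fun j ρ => Inv i j ρ) (hInv _ _ _ _ _ (Or.inl rfl) hI) (fun j ρ hj hS' hI' => by
          rw [hdv] at hj
          refine hs i j _ hi hj ⟨fun z hz => ?_, fun a ha => ?_⟩ ?_ ?_
            (hInv _ _ _ _ _ (Or.inr rfl) hI')
          · have hz' := hz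
            simp only [wv, Bool.or_eq_false_iff] at hz'
            have hzx : z ≠ x := fun e => by simp [e] at hz'
            have hzy : z ≠ y := fun e => by simp [e] at hz'
            rw [var_setVar, if_neg hzy, hS'.1 z (by simp only [wv, Bool.or_eq_false_iff]; exact hz'.2),
              var_setVar, if_neg hzx, hS.1 z hz]
          · rw [arr_setVar, hS'.2 a ha, arr_setVar, hS.2 a ha]
          · rw [var_setVar, if_neg hxy, hS'.1 x (by
              simp only [wv, hx, Bool.or_false]
              exact Bool.eq_false_iff.2 fun h => hxy (Nat.eq_of_beq_eq_true h).symm), var_setVar, if_pos rfl]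
          · simp)
      rw [g3]
      rw [hdv] at g1
      exact hInv _ _ _ _ _ (Or.inr rfl) (hrow i ρ hi g1))
  rw [h3]
  exact hInv _ _ _ _ _ (Or.inl rfl) h1

/-- Read a matrix entry. -/
def rd (a u v : ℕ) : Expr := .read a (.add (.read aROW (.var u)) (.var v))

/-- Write a matrix entry. -/
def wr (a u v : ℕ) (e : Expr) : Cmd := .write a (.add (.read aROW (.var u)) (.var v)) e

/-- The starts of the rows are looked up in the table `aROW`, since the machine cannot multiply. -/
theorem eval_rd {N n k s : ℕ} {σ : State} (h : Env N n k s σ) {a u v : ℕ} (hu : σ.var u < N + 1) :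
    (rd a u v).eval σ = mat (N + 1) (σ.arr a) (σ.var u) (σ.var v) := by
  simp [rd, mat, h.row _ (Nat.lt_succ_iff.1 hu)]

theorem exec_wr {N n k s : ℕ} {σ : State} (h : Env N n k s σ) {a u v : ℕ} {e : Expr}
    (hu : σ.var u < N + 1) (hv : σ.var v < N + 1) :
    (wr a u v e).exec σ = σ.setArr a (σ.var u * (N + 1) + σ.var v) (e.eval σ) := by
  simp only [wr, exec_write, Expr.eval, h.row _ (Nat.lt_succ_iff.1 hu)]
  rw [if_pos ((cell_lt hu hv).trans_le h.sz)]

theorem Env.lt_sz {N n k s : ℕ} {σ : State} (h : Env N n k s σ) {u : ℕ} (hu : u < N + 1) :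
    u < σ.var vSZ := by
  have := h.sz
  have h1 : (N + 1) * 1 ≤ (N + 1) * (N + 1) := Nat.mul_le_mul_left _ (by omega)
  omega

/-! ## Marking the vertices that reach a sink -/

/-- Vertex `u` is marked with one plus the length of some walk to a sink, of which `nxt u` is the
second vertex. -/
structure Marked (M : ℕ) (r : ℕ → ℕ → ℕ) (X : Set ℕ) (mark nxt : ℕ → ℕ) : Prop where
  sink : ∀ v < M, mark v = 1 ↔ v ∈ X
  next : ∀ u < M, 2 ≤ mark u → nxt u < M ∧ mark (nxt u) + 1 = mark u ∧ 0 < r u (nxt u)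
  le : ∀ u < M, mark u ≤ ((range M).filter (mark · ≠ 0)).card

/-- The new mark and the number of marked vertices both exceed old values by one, which preserves
`le`. That field bounds the length of the walk followed by an augmentation. -/
theorem Marked.step {M : ℕ} {r : ℕ → ℕ → ℕ} {X : Set ℕ} {mark nxt : ℕ → ℕ}
    (h : Marked M r X mark nxt) {u v : ℕ} (hu : u < M) (hv : v < M) (hmu : mark u = 0)
    (hmv : mark v ≠ 0) (hr : 0 < r u v) :
    Marked M r X (Function.update mark u (mark v + 1)) (Function.update nxt u v) := by
  have hne : v ≠ u := fun e => hmv (e ▸ hmu)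
  have hcard : ((range M).filter (Function.update mark u (mark v + 1) · ≠ 0)).card =
      ((range M).filter (mark · ≠ 0)).card + 1 := by
    rw [← card_insert_of_notMem (a := u) (by simp [hmu])]
    congr 1
    ext x
    by_cases hx : x = u
    · subst hx; simp [hu]
    · simp [hx]
  refine ⟨fun w hw => ?_, fun w hw h2 => ?_, fun w hw => ?_⟩
  · by_cases hwu : w = u
    · subst hwu
      rw [Function.update_self, ← h.sink w hw]; omega
    · rw [Function.update_of_ne hwu]; exact h.sink w hw
  · by_cases hwu : w = u
    · subst hwu
      rw [Function.update_self, Function.update_self, Function.update_of_ne hne]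
      exact ⟨hv, rfl, hr⟩
    · rw [Function.update_of_ne hwu] at h2 ⊢
      rw [Function.update_of_ne hwu]
      obtain ⟨h3, h4, h5⟩ := h.next w hw h2
      have : nxt w ≠ u := fun e => by rw [e] at h4; omega
      rw [Function.update_of_ne this]
      exact ⟨h3, h4, h5⟩
  · rw [hcard]
    by_cases hwu : w = u
    · subst hwu
      rw [Function.update_self]
      have := h.le v hv; omega
    · rw [Function.update_of_ne hwu]
      have := h.le w hw; omega

/-- Every vertex with an arc to a marked vertex is marked. -/
def MarkClosed (M : ℕ) (r : ℕ → ℕ → ℕ) (mark : ℕ → ℕ) : Prop :=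
  ∀ u < M, ∀ v < M, 0 < r u v → mark v ≠ 0 → mark u ≠ 0

def markBody : Cmd :=
  cond (.read aMARK (.var vU)) skip (cond (.read aMARK (.var vV)) (cond (rd aRES vU vV)
    (write aMARK (.var vU) (.add (.read aMARK (.var vV)) (.const 1)) ;;
      write aNXT (.var vU) (.var vV)) skip) skip)

def markRound : Cmd := loop vU vM (loop vV vM markBody)

def marking : Cmd :=
  loop vZ vM (write aMARK (.var vZ) (.read aSNK (.var vZ))) ;; loop vZ vM markRound

variable {N n k s : ℕ} {σ : State}

/-- Marks made during a round are used in the same round, so its effect is only bracketed: all tails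
of arcs to previously marked vertices get marked, and nothing new if the marks were closed already.
-/
theorem markRound_spec (h : Env N n k s σ) {X : Set ℕ}
    (hM : Marked (N + 1) (mat (N + 1) (σ.arr aRES)) X (σ.arr aMARK) (σ.arr aNXT)) :
    Marked (N + 1) (mat (N + 1) (σ.arr aRES)) X ((markRound.exec σ).arr aMARK)
        ((markRound.exec σ).arr aNXT) ∧
      (∀ v < N + 1, σ.arr aMARK v ≠ 0 → (markRound.exec σ).arr aMARK v ≠ 0) ∧
      (∀ u < N + 1, ∀ v < N + 1, 0 < mat (N + 1) (σ.arr aRES) u v → σ.arr aMARK v ≠ 0 →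
        (markRound.exec σ).arr aMARK u ≠ 0) ∧
      (MarkClosed (N + 1) (mat (N + 1) (σ.arr aRES)) (σ.arr aMARK) →
        ∀ v < N + 1, (markRound.exec σ).arr aMARK v ≠ 0 → σ.arr aMARK v ≠ 0) := by
  have key := loop2_rule (x := vU) (y := vV) (b := vM) (d := vM) (p := markBody) (σ := σ)
    (fun i j τ => Marked (N + 1) (mat (N + 1) (σ.arr aRES)) X (τ.arr aMARK) (τ.arr aNXT) ∧
      (∀ v < N + 1, σ.arr aMARK v ≠ 0 → τ.arr aMARK v ≠ 0) ∧
      (∀ u < N + 1, ∀ v < N + 1, (u < i ∨ (u = i ∧ v < j)) →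
        0 < mat (N + 1) (σ.arr aRES) u v → σ.arr aMARK v ≠ 0 → τ.arr aMARK u ≠ 0) ∧
      (MarkClosed (N + 1) (mat (N + 1) (σ.arr aRES)) (σ.arr aMARK) →
        ∀ v < N + 1, τ.arr aMARK v ≠ 0 → σ.arr aMARK v ≠ 0))
    rfl (by decide) (by decide) (by decide) rfl (fun _ _ _ _ _ _ h => h)
    ⟨hM, fun _ _ h => h, fun u _ v _ h => by omega, fun _ _ _ h => h⟩
    (fun i τ _ ⟨h1, h2, h3, h4⟩ =>
      ⟨h1, h2, fun u hu v hv huv => h3 u hu v hv (by rw [h.M_eq]; omega), h4⟩)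
    (fun i j τ hi hj hS hx hy ⟨h1, h2, h3, h4⟩ => by
      rw [h.M_eq] at hi hj
      have hE : Env N n k s τ := h.same hS rfl
      have hr : τ.arr aRES = σ.arr aRES := hS.2 _ rfl
      have hend : ∀ ρ : State, (∀ v < N + 1, τ.arr aMARK v ≠ 0 → ρ.arr aMARK v ≠ 0) →
          (0 < mat (N + 1) (σ.arr aRES) i j → σ.arr aMARK j ≠ 0 → ρ.arr aMARK i ≠ 0) →
          (MarkClosed (N + 1) (mat (N + 1) (σ.arr aRES)) (σ.arr aMARK) →
            ∀ v < N + 1, ρ.arr aMARK v ≠ 0 → σ.arr aMARK v ≠ 0) →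
          (∀ v < N + 1, σ.arr aMARK v ≠ 0 → ρ.arr aMARK v ≠ 0) ∧
          (∀ u < N + 1, ∀ v < N + 1, (u < i ∨ (u = i ∧ v < j + 1)) →
            0 < mat (N + 1) (σ.arr aRES) u v → σ.arr aMARK v ≠ 0 → ρ.arr aMARK u ≠ 0) ∧
          (MarkClosed (N + 1) (mat (N + 1) (σ.arr aRES)) (σ.arr aMARK) →
            ∀ v < N + 1, ρ.arr aMARK v ≠ 0 → σ.arr aMARK v ≠ 0) := by
        refine fun ρ g1 g2 g3 => ⟨fun v hv hv' => g1 v hv (h2 v hv hv'),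
          fun u hu v hv huv ha hb => ?_, g3⟩
        by_cases he : u = i ∧ v = j
        · obtain ⟨rfl, rfl⟩ := he; exact g2 ha hb
        · exact g1 u hu (h3 u hu v hv (by omega) ha hb)
      simp only [markBody, exec_cond, Expr.eval, hx, hy, exec_skip]
      by_cases c1 : τ.arr aMARK i = 0
      swap
      · rw [if_neg c1]; exact ⟨h1, hend τ (fun _ _ h => h) (fun _ _ => c1) h4⟩
      rw [if_pos c1]
      by_cases c2 : τ.arr aMARK j = 0
      · rw [if_pos c2]
        exact ⟨h1, hend τ (fun _ _ h => h) (fun _ h' => absurd c2 (h2 j hj h')) h4⟩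
      rw [if_neg c2, eval_rd hE (by omega), hx, hy, hr]
      by_cases c3 : mat (N + 1) (σ.arr aRES) i j = 0
      · rw [if_pos c3]
        exact ⟨h1, hend τ (fun _ _ h => h) (fun h' => by omega) h4⟩
      rw [if_neg c3]
      have hsz := hE.lt_sz hi
      simp only [exec_seq, exec_write, Expr.eval, hx, hy, hsz, if_true, var_setArr]
      refine ⟨?_, hend _ ?_ ?_ ?_⟩
      · simpa using h1.step hi hj c1 c2 (by omega)
      · intro v hv hv'
        simp only [arr_setArr]
        by_cases hvi : v = i <;> simp [hvi, hv']
      · intro _ _; simp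
      · intro hcl v hv hv'
        simp only [arr_setArr] at hv'
        by_cases hvi : v = i
        · subst hvi
          exact absurd c1 (h2 v hv (hcl v hv j hj (by omega) (h4 hcl j hj c2)))
        · refine h4 hcl v hv ?_
          simpa [Function.update_of_ne hvi] using hv')
  rw [h.M_eq] at key
  exact ⟨key.1, key.2.1, fun u hu v hv => key.2.2.1 u hu v hv (by omega), key.2.2.2⟩

/-- A round after which the marks are not closed has marked some new vertex, so `N + 1` rounds
suffice. -/
theorem marking_spec (h : Env N n k s σ) {X : Set ℕ}
    (hX : ∀ v < N + 1, σ.arr aSNK v = if v ∈ X then 1 else 0) :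
    Marked (N + 1) (mat (N + 1) (σ.arr aRES)) X ((marking.exec σ).arr aMARK)
        ((marking.exec σ).arr aNXT) ∧
      MarkClosed (N + 1) (mat (N + 1) (σ.arr aRES)) ((marking.exec σ).arr aMARK) := by
  obtain ⟨τ, h1, h2, h3⟩ := loop_rule (x := vZ) (b := vM)
    (p := write aMARK (.var vZ) (.read aSNK (.var vZ))) (σ := σ)
    (fun i τ => ∀ v < i, τ.arr aMARK v = σ.arr aSNK v) (by simp) (fun i τ hi hS hI => by
      rw [h.M_eq] at hi
      have hE : Env N n k s τ := h.same hS rfl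
      have hr : τ.arr aSNK = σ.arr aSNK := hS.2 _ rfl
      intro v hv
      have := hE.lt_sz hi
      simp only [exec_write, Expr.eval, var_setVar, if_true, arr_setVar]
      simp only [show (vSZ : ℕ) ≠ vZ by decide, if_false, this, if_true, arr_setArr, arr_setVar, hr]
      by_cases hvi : v = i
      · simp [hvi]
      · simp [Function.update_of_ne hvi, hI v (by omega)])
  simp only [marking, exec_seq]
  rw [h3]
  generalize hσ' : τ.setVar vZ (σ.var vM) = σ'
  have hE : Env N n k s σ' := by
    rw [← hσ']; exact (h.same h2 rfl).setVar _ _ (by decide)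
  have hr : σ'.arr aRES = σ.arr aRES := by rw [← hσ']; exact h2.2 _ rfl
  have hm : ∀ v < N + 1, σ'.arr aMARK v = if v ∈ X then 1 else 0 := by
    intro v hv
    rw [← hX v hv, ← hσ', arr_setVar, h1 v (by rw [h.M_eq]; omega)]
  have hM0 : Marked (N + 1) (mat (N + 1) (σ.arr aRES)) X (σ'.arr aMARK) (σ'.arr aNXT) := by
    refine ⟨fun v hv => ?_, fun v hv h' => ?_, fun u hu => ?_⟩
    · rw [hm v hv]; split <;> simp_all
    · rw [hm v hv] at h'; split at h' <;> omega
    · by_cases h0 : σ'.arr aMARK u = 0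
      · omega
      · have : 0 < ((range (N + 1)).filter (σ'.arr aMARK · ≠ 0)).card :=
          card_pos.2 ⟨u, by simp only [mem_filter, mem_range]; exact ⟨hu, h0⟩⟩
        have := hm u hu
        split at this <;> omega
  obtain ⟨ρ, g1, g2, g3⟩ := loop_rule (x := vZ) (b := vM) (p := markRound) (σ := σ')
    (fun i τ => Marked (N + 1) (mat (N + 1) (σ.arr aRES)) X (τ.arr aMARK) (τ.arr aNXT) ∧
      (i ≤ ((range (N + 1)).filter (τ.arr aMARK · ≠ 0)).card ∨
        MarkClosed (N + 1) (mat (N + 1) (σ.arr aRES)) (τ.arr aMARK)))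
    ⟨hM0, Or.inl (Nat.zero_le _)⟩ (fun i τ hi hS ⟨hI, hI'⟩ => by
      have hEτ : Env N n k s (τ.setVar vZ i) := (hE.same hS rfl).setVar _ _ (by decide)
      have hrτ : (τ.setVar vZ i).arr aRES = σ.arr aRES := by rw [← hr]; exact hS.2 _ rfl
      have := markRound_spec (X := X) hEτ (by rw [hrτ]; exact hI)
      rw [hrτ] at this
      obtain ⟨k1, k2, k3, k4⟩ := this
      refine ⟨k1, ?_⟩
      by_cases hc : MarkClosed (N + 1) (mat (N + 1) (σ.arr aRES))
          ((markRound.exec (τ.setVar vZ i)).arr aMARK)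
      · exact Or.inr hc
      left
      have hnc : ¬ MarkClosed (N + 1) (mat (N + 1) (σ.arr aRES)) (τ.arr aMARK) := by
        intro hcl
        refine hc fun u hu v hv hr0 hv' => k2 u hu (hcl u hu v hv hr0 (k4 hcl v hv hv'))
      have hi' := hI'.resolve_right hnc
      refine Nat.succ_le_of_lt (lt_of_le_of_lt hi' (card_lt_card ⟨fun v hv => ?_, fun hs => hc ?_⟩))
      · simp only [mem_filter, mem_range] at hv ⊢
        exact ⟨hv.1, k2 v hv.1 hv.2⟩
      · intro u hu v hv hr0 hv'
        refine k3 u hu v hv hr0 ?_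
        have := hs (show v ∈ _ by simp only [mem_filter, mem_range]; exact ⟨hv, hv'⟩)
        simp only [mem_filter] at this
        exact this.2)
  rw [g3]
  refine ⟨g1.1, ?_⟩
  rcases g1.2 with h4 | h4
  · rw [hE.M_eq] at h4
    intro u hu v hv _ _
    have h5 : (range (N + 1)).filter (ρ.arr aMARK · ≠ 0) = range (N + 1) :=
      eq_of_subset_of_card_le (filter_subset _ _) (by rw [card_range]; exact h4)
    have : u ∈ (range (N + 1)).filter (ρ.arr aMARK · ≠ 0) := by rw [h5]; simpa using hu
    exact (mem_filter.1 this).2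
  · exact h4

/-! ## Augmenting paths -/

def findSource : Cmd :=
  assign vFND (.const 0) ;;
  loop vV vM (cond (.read aSRC (.var vV)) (cond (.read aMARK (.var vV))
    (assign vCUR (.var vV) ;; assign vFND (.const 1)) skip) skip)

theorem findSource_spec (h : Env N n k s σ) :
    ((findSource.exec σ).var vFND = 0 ∧
      ∀ v < N + 1, σ.arr aSRC v ≠ 0 → σ.arr aMARK v = 0) ∨
    ((findSource.exec σ).var vFND = 1 ∧ (findSource.exec σ).var vCUR < N + 1 ∧
      σ.arr aSRC ((findSource.exec σ).var vCUR) ≠ 0 ∧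
      σ.arr aMARK ((findSource.exec σ).var vCUR) ≠ 0) := by
  simp only [findSource, exec_seq, exec_assign]
  generalize hσ' : σ.setVar vFND ((Expr.const 0).eval σ) = σ'
  have hM : σ'.var vM = N + 1 := by rw [← hσ']; simpa using h.M_eq
  have ha : σ'.arr = σ.arr := by rw [← hσ']; rfl
  obtain ⟨τ, h1, h2, h3⟩ := loop_rule (x := vV) (b := vM)
    (p := cond (.read aSRC (.var vV)) (cond (.read aMARK (.var vV))
      (assign vCUR (.var vV) ;; assign vFND (.const 1)) skip) skip) (σ := σ')
    (fun i τ => (τ.var vFND = 0 ∧ ∀ v < i, σ.arr aSRC v ≠ 0 → σ.arr aMARK v = 0) ∨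
      (τ.var vFND = 1 ∧ τ.var vCUR < N + 1 ∧
      σ.arr aSRC (τ.var vCUR) ≠ 0 ∧ σ.arr aMARK (τ.var vCUR) ≠ 0))
    (Or.inl ⟨by rw [← hσ']; simp, by simp⟩) (fun i τ hi hS hI => by
      rw [hM] at hi
      have e1 : τ.arr aSRC = σ.arr aSRC := by rw [← ha]; exact hS.2 _ rfl
      have e2 : τ.arr aMARK = σ.arr aMARK := by rw [← ha]; exact hS.2 _ rfl
      simp only [exec_cond, Expr.eval, var_setVar, if_true, arr_setVar, e1, e2, exec_skip]
      by_cases c1 : σ.arr aSRC i = 0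
      · simp only [c1, if_true]
        rcases hI with hI | hI
        · left
          refine ⟨by simpa using hI.1, fun v hv => ?_⟩
          by_cases hvi : v = i
          · subst hvi; exact fun h' => absurd c1 h'
          · exact hI.2 v (by omega)
        · right; simpa using hI
      · by_cases c2 : σ.arr aMARK i = 0
        · simp only [c1, c2, if_true, if_false]
          rcases hI with hI | hI
          · left
            refine ⟨by simpa using hI.1, fun v hv => ?_⟩
            by_cases hvi : v = i
            · subst hvi; exact fun _ => c2
            · exact hI.2 v (by omega)
          · right; simpa using hI
        · right
          simpa [c1, c2] using hi)
  rw [h3]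
  rw [hM] at h1
  simpa using h1

def augBody : Cmd :=
  cond (.sub (.read aMARK (.var vCUR)) (.const 1))
    (assign vNEXT (.read aNXT (.var vCUR)) ;;
      wr aRES vCUR vNEXT (.sub (rd aRES vCUR vNEXT) (.const 1)) ;;
      wr aRES vNEXT vCUR (.add (rd aRES vNEXT vCUR) (.const 1)) ;;
      assign vCUR (.var vNEXT)) skip

def augPath : Cmd := loop vZ vM augBody

theorem augBody_spec (hE : Env N n k s σ) (h1 : σ.var vCUR < N + 1)
    (h2 : σ.arr aNXT (σ.var vCUR) < N + 1) (hm : 2 ≤ σ.arr aMARK (σ.var vCUR)) {a b : ℕ}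
    (ha : σ.var vCUR = a) (hb : σ.arr aNXT a = b) {f : ℕ → ℕ}
    (hf : f = Function.update (σ.arr aRES) (a * (N + 1) + b)
      (mat (N + 1) (σ.arr aRES) a b - 1)) :
    (augBody.exec σ).var vCUR = b ∧ (augBody.exec σ).arr aRES =
      Function.update f (b * (N + 1) + a) (mat (N + 1) f b a + 1) := by
  rw [ha] at h1 h2 hm
  rw [hb] at h2
  simp only [augBody, exec_cond, Expr.eval, exec_skip, ha]
  rw [if_neg (by omega)]
  generalize hρ : (assign vNEXT (.read aNXT (.var vCUR))).exec σ = ρ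
  have hEρ : Env N n k s ρ := by rw [← hρ]; exact hE.same (same_exec _ _) rfl
  have r1 : ρ.var vCUR = a := by rw [← hρ]; simp [ha]
  have r2 : ρ.var vNEXT = b := by rw [← hρ]; simp [ha, hb]
  have r3 : ρ.arr = σ.arr := by rw [← hρ]; simp
  rw [exec_seq, hρ, exec_seq, exec_wr hEρ (by rw [r1]; exact h1) (by rw [r2]; exact h2)]
  simp only [Expr.eval]
  rw [eval_rd hEρ (by rw [r1]; exact h1), r1, r2, r3]
  generalize hρ' : ρ.setArr aRES (a * (N + 1) + b) (mat (N + 1) (σ.arr aRES) a b - 1) = ρ'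
  have hEρ' : Env N n k s ρ' := by
    rw [← hρ']
    exact hEρ.same (p := write aRES (.const 0) (.const 0))
      ⟨fun _ _ => rfl, fun c hc => by
        have : c ≠ aRES := fun e => by simp [e, wa] at hc
        simp [this]⟩ rfl
  have r1' : ρ'.var vCUR = a := by rw [← hρ']; exact r1
  have r2' : ρ'.var vNEXT = b := by rw [← hρ']; exact r2
  have r3' : ρ'.arr aRES = f := by rw [← hρ', arr_setArr, if_pos rfl, r3, hf]
  rw [exec_seq, exec_wr hEρ' (by rw [r2']; exact h2) (by rw [r1']; exact h1)]
  simp only [Expr.eval]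
  rw [eval_rd hEρ' (by rw [r2']; exact h2), r1', r2', r3']
  simp [r2', r3']

theorem augPath_spec (h : Env N n k s σ) {X : Set ℕ}
    (hM : Marked (N + 1) (mat (N + 1) (σ.arr aRES)) X (σ.arr aMARK) (σ.arr aNXT))
    (hc : σ.var vCUR < N + 1) (hcm : σ.arr aMARK (σ.var vCUR) ≠ 0) :
    (∀ u < N + 1, ∀ v < N + 1, mat (N + 1) ((augPath.exec σ).arr aRES) u v +
      mat (N + 1) ((augPath.exec σ).arr aRES) v u =
      mat (N + 1) (σ.arr aRES) u v + mat (N + 1) (σ.arr aRES) v u) ∧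
    ∀ R : Set ℕ, σ.var vCUR ∈ R → (∀ v < N + 1, v ∈ X → v ∉ R) →
      cut (N + 1) (mat (N + 1) (σ.arr aRES)) R =
        1 + cut (N + 1) (mat (N + 1) ((augPath.exec σ).arr aRES)) R := by
  set r := mat (N + 1) (σ.arr aRES) with hr
  -- The mark of the current vertex falls in each round until it is one. The arcs used so far have
  -- tails with larger marks, so arcs from vertices with marks up to the current one have lost
  -- nothing, and the next arc of the walk still has positive residual capacity.
  obtain ⟨τ, h1, h2, h3⟩ := loop_rule (x := vZ) (b := vM)
    (p := augBody) (σ := σ)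
    (fun i τ => τ.var vCUR < N + 1 ∧ σ.arr aMARK (τ.var vCUR) ≠ 0 ∧
      (σ.arr aMARK (τ.var vCUR) = 1 ∨ σ.arr aMARK (τ.var vCUR) + i ≤ N + 1) ∧
      (∀ u < N + 1, ∀ v < N + 1, mat (N + 1) (τ.arr aRES) u v +
        mat (N + 1) (τ.arr aRES) v u = r u v + r v u) ∧
      (∀ u < N + 1, ∀ v < N + 1, σ.arr aMARK u ≤ σ.arr aMARK (τ.var vCUR) →
        r u v ≤ mat (N + 1) (τ.arr aRES) u v) ∧
      ∀ R : Set ℕ, cut (N + 1) r R + (if τ.var vCUR ∈ R then 1 else 0) =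
        cut (N + 1) (mat (N + 1) (τ.arr aRES)) R + if σ.var vCUR ∈ R then 1 else 0)
    ⟨hc, hcm, by
      right
      refine (hM.le _ hc).trans ?_
      refine (card_le_card (filter_subset _ _)).trans ?_
      rw [card_range], fun _ _ _ _ => rfl, fun _ _ _ _ _ => le_rfl, fun _ => rfl⟩
    (fun i τ hi hS ⟨k1, k2, k3, k4, k5, k6⟩ => by
      rw [h.M_eq] at hi
      have hE : Env N n k s τ := h.same hS rfl
      have e1 : τ.arr aMARK = σ.arr aMARK := hS.2 _ rfl
      have e2 : τ.arr aNXT = σ.arr aNXT := hS.2 _ rfl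
      set a := τ.var vCUR with ha
      have hEα : Env N n k s (τ.setVar vZ i) := hE.setVar _ _ (by decide)
      have ha' : (τ.setVar vZ i).var vCUR = a := by simp [ha]
      by_cases c1 : σ.arr aMARK a = 1
      · have hex : augBody.exec (τ.setVar vZ i) = τ.setVar vZ i := by
          simp [augBody, e1, ← ha, c1]
        rw [hex, ha', arr_setVar]
        exact ⟨k1, k2, Or.inl c1, k4, k5, k6⟩
      · obtain ⟨g1, g2, g3⟩ := hM.next a k1 (by omega)
        set b := σ.arr aNXT a with hb
        have hab : a ≠ b := fun e => by rw [← e] at g2; omega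
        set f1 := Function.update (τ.arr aRES) (a * (N + 1) + b)
          (mat (N + 1) (τ.arr aRES) a b - 1) with hf1
        obtain ⟨x1, x2⟩ := augBody_spec (f := f1) (b := b) hEα (by rw [ha']; exact k1)
          (by rw [ha', arr_setVar, e2]; exact g1) (by rw [ha', arr_setVar, e1]; omega) ha'
          (by rw [arr_setVar, e2]) (by rw [arr_setVar, hf1])
        rw [x1, x2]
        set f2 := Function.update f1 (b * (N + 1) + a) (mat (N + 1) f1 b a + 1) with hf2
        have hm1 : ∀ u < N + 1, ∀ v < N + 1, mat (N + 1) f1 u v =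
            if u = a ∧ v = b then mat (N + 1) (τ.arr aRES) a b - 1
            else mat (N + 1) (τ.arr aRES) u v := fun u _ v hv => by
          rw [hf1, mat_update _ _ g1 hv]
        have hm2 : ∀ u < N + 1, ∀ v < N + 1, mat (N + 1) f2 u v =
            if u = b ∧ v = a then mat (N + 1) (τ.arr aRES) b a + 1
            else if u = a ∧ v = b then mat (N + 1) (τ.arr aRES) a b - 1
            else mat (N + 1) (τ.arr aRES) u v := fun u hu v hv => by
          rw [hf2, mat_update _ _ k1 hv, hm1 b g1 a k1,
            if_neg (show ¬ (b = a ∧ a = b) from fun h => hab h.2), hm1 u hu v hv]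
        have hpos : 0 < mat (N + 1) (τ.arr aRES) a b := lt_of_lt_of_le g3 (k5 a k1 b g1 le_rfl)
        refine ⟨g1, by omega, by omega, fun u hu v hv => ?_, fun u hu v hv hle => ?_, fun R => ?_⟩
        · rw [← k4 u hu v hv, hm2 u hu v hv, hm2 v hv u hu]
          by_cases h1 : u = a ∧ v = b
          · obtain ⟨rfl, rfl⟩ := h1
            simp [hab, hab.symm]; omega
          · by_cases h2 : u = b ∧ v = a
            · obtain ⟨rfl, rfl⟩ := h2
              simp [hab, hab.symm]; omega
            · have h3 : ¬ (v = b ∧ u = a) := fun h => h1 ⟨h.2, h.1⟩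
              have h4 : ¬ (v = a ∧ u = b) := fun h => h2 ⟨h.2, h.1⟩
              simp [h1, h2, h3, h4]
        · have h1 := k5 u hu v hv (by omega)
          rw [hm2 u hu v hv]
          have h2 : ¬ (u = a ∧ v = b) := fun h => by rw [h.1] at hle; omega
          rw [if_neg h2]
          split
          · rename_i h3; rw [h3.1, h3.2] at h1 ⊢; omega
          · exact h1
        · have h1 := cut_augment (M := N + 1) (a := a) (b := b) (c := mat (N + 1) (τ.arr aRES))
            (c' := mat (N + 1) f2) k1 g1 (fun u hu v hv => by
              rw [hm2 u hu v hv]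
              by_cases h1 : u = a ∧ v = b
              · obtain ⟨rfl, rfl⟩ := h1
                simp [hab, hab.symm]; omega
              · by_cases h2 : u = b ∧ v = a
                · obtain ⟨rfl, rfl⟩ := h2
                  simp [hab, hab.symm]
                · simp [h1, h2]) R
          have h2 := k6 R
          omega)
  have hout : augPath.exec σ = τ.setVar vZ (σ.var vM) := h3
  rw [hout, arr_setVar]
  obtain ⟨k1, k2, k3, k4, k5, k6⟩ := h1
  refine ⟨k4, fun R hR hX => ?_⟩
  rw [h.M_eq] at k3
  have h7 : τ.var vCUR ∈ X := (hM.sink _ k1).1 (by omega)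
  have h8 := k6 R
  rw [if_pos hR, if_neg (hX _ k1 h7)] at h8
  omega

/-! ## Flows -/

def flowStep : Cmd :=
  cond (.var vSTOP) skip (marking ;; findSource ;;
    cond (.var vFND) (augPath ;; assign vLAM (.add (.var vLAM) (.const 1)))
      (assign vSTOP (.const 1)))

def flow : Cmd :=
  loop vZ vSZ (write aRES (.var vZ) (.read aNET (.var vZ))) ;;
  assign vLAM (.const 0) ;; assign vSTOP (.const 0) ;; loop vIT vKP flowStep

theorem flow_spec (h : Env N n k s σ) {S X : Set ℕ}
    (hS : ∀ v < N + 1, σ.arr aSRC v ≠ 0 ↔ v ∈ S)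
    (hX : ∀ v < N + 1, σ.arr aSNK v = if v ∈ X then 1 else 0) :
    FlowSpec (N + 1) (mat (N + 1) (σ.arr aNET)) S X k
      (mat (N + 1) ((flow.exec σ).arr aRES)) ((flow.exec σ).var vLAM)
      ((flow.exec σ).arr aMARK) := by
  obtain ⟨σ₁, h1, h2, h3⟩ := loop_rule (x := vZ) (b := vSZ)
    (p := write aRES (.var vZ) (.read aNET (.var vZ))) (σ := σ)
    (fun i τ => ∀ v < i, τ.arr aRES v = σ.arr aNET v) (by simp) (fun i τ hi hS hI => by
      have hr : τ.arr aNET = σ.arr aNET := hS.2 _ rfl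
      have hz : τ.var vSZ = σ.var vSZ := hS.1 _ rfl
      intro v hv
      simp only [exec_write, Expr.eval, var_setVar, if_true, arr_setVar]
      simp only [show (vSZ : ℕ) ≠ vZ by decide, if_false, hz, hi, if_true, arr_setArr, arr_setVar, hr]
      by_cases hvi : v = i
      · simp [hvi]
      · simp [Function.update_of_ne hvi, hI v (by omega)])
  simp only [flow, exec_seq]
  rw [h3]
  generalize hσ' : (assign vSTOP (.const 0)).exec ((assign vLAM (.const 0)).exec
    (σ₁.setVar vZ (σ.var vSZ))) = σ'
  have hE : Env N n k s σ' := by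
    rw [← hσ']
    exact (((h.same h2 rfl).setVar _ _ (by decide)).same (same_exec _ _) rfl).same
      (same_exec _ _) rfl
  have e1 : ∀ a, a ≠ aRES → σ'.arr a = σ.arr a := by
    intro a ha
    rw [← hσ']
    simp only [exec_assign, arr_setVar]
    exact h2.2 a (by simp only [wa]; exact Bool.eq_false_iff.2 fun h => ha (Nat.eq_of_beq_eq_true h).symm)
  have e2 : ∀ u < N + 1, ∀ v < N + 1, mat (N + 1) (σ'.arr aRES) u v =
      mat (N + 1) (σ.arr aNET) u v := by
    intro u hu v hv
    rw [← hσ']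
    exact h1 _ ((cell_lt hu hv).trans_le h.sz)
  have e3 : σ'.var vLAM = 0 ∧ σ'.var vSTOP = 0 := by rw [← hσ']; simp
  set net := mat (N + 1) (σ.arr aNET) with hnet
  -- Either every round so far has sent one unit, or the process has stopped with closed marks that
  -- contain no source.
  obtain ⟨τ, k1, k2, k3⟩ := loop_rule (x := vIT) (b := vKP) (p := flowStep) (σ := σ')
    (fun i τ => τ.var vLAM ≤ i ∧
      (∀ R : Set ℕ, S ⊆ R → (∀ v < N + 1, v ∈ X → v ∉ R) →
        cut (N + 1) net R = τ.var vLAM + cut (N + 1) (mat (N + 1) (τ.arr aRES)) R) ∧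
      (∀ u < N + 1, ∀ v < N + 1, mat (N + 1) (τ.arr aRES) u v + mat (N + 1) (τ.arr aRES) v u =
        net u v + net v u) ∧
      ((τ.var vSTOP = 0 ∧ τ.var vLAM = i) ∨ (τ.var vSTOP = 1 ∧
        Marked (N + 1) (mat (N + 1) (τ.arr aRES)) X (τ.arr aMARK) (τ.arr aNXT) ∧
        MarkClosed (N + 1) (mat (N + 1) (τ.arr aRES)) (τ.arr aMARK) ∧
        ∀ v < N + 1, v ∈ S → τ.arr aMARK v = 0)))
    ⟨by omega, fun R _ _ => by
      rw [e3.1, zero_add]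
      exact dsum_congr fun u hu v hv => by rw [e2 u hu v hv],
      fun u hu v hv => by rw [e2 u hu v hv, e2 v hv u hu], Or.inl ⟨e3.2, e3.1⟩⟩
    (fun i τ hi hSm ⟨g1, g2, g3, g4⟩ => by
      have hEτ : Env N n k s (τ.setVar vIT i) := (hE.same hSm rfl).setVar _ _ (by decide)
      have hsrc : τ.arr aSRC = σ.arr aSRC := by rw [← e1 aSRC (by decide)]; exact hSm.2 _ rfl
      have hsnk : τ.arr aSNK = σ.arr aSNK := by rw [← e1 aSNK (by decide)]; exact hSm.2 _ rfl
      simp only [flowStep, exec_cond, Expr.eval, var_setVar]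
      simp only [show (vSTOP : ℕ) ≠ vIT by decide, if_false]
      rcases g4 with ⟨g4, g5⟩ | g4
      swap
      · rw [if_neg (by omega)]
        exact ⟨by simp; omega, by simpa using g2, by simpa using g3, Or.inr (by simpa using g4)⟩
      rw [if_pos g4]
      simp only [exec_seq, exec_cond]
      generalize hα : τ.setVar vIT i = α at hEτ
      have a1 : α.arr = τ.arr := by rw [← hα]; rfl
      have a2 : α.var vLAM = τ.var vLAM := by rw [← hα]; simp
      have a3 : α.var vSTOP = 0 := by rw [← hα]; simpa using g4
      obtain ⟨m1, m2⟩ := marking_spec (X := X) hEτ (by rw [a1, hsnk]; exact hX)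
      have hEβ : Env N n k s (marking.exec α) := hEτ.same (same_exec _ _) rfl
      have b1 : (marking.exec α).arr aRES = τ.arr aRES := by rw [← a1]; exact exec_arr _ _ _ rfl
      have b2 : (marking.exec α).var vLAM = τ.var vLAM := by rw [← a2]; exact exec_var _ _ _ rfl
      have b3 : (marking.exec α).var vSTOP = 0 := by rw [← a3]; exact exec_var _ _ _ rfl
      have b4 : (marking.exec α).arr aSRC = σ.arr aSRC := by
        rw [← hsrc, ← a1]; exact exec_arr _ _ _ rfl
      rw [a1, ← b1] at m1 m2
      generalize marking.exec α = β at *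
      have f := findSource_spec hEβ
      have hEγ : Env N n k s (findSource.exec β) := hEβ.same (same_exec _ _) rfl
      have c1 : (findSource.exec β).arr = β.arr := by ext a; rw [exec_arr _ _ _ rfl]
      have c2 : (findSource.exec β).var vLAM = τ.var vLAM := by rw [← b2]; exact exec_var _ _ _ rfl
      have c3 : (findSource.exec β).var vSTOP = 0 := by rw [← b3]; exact exec_var _ _ _ rfl
      rw [← c1] at m1 m2 f
      generalize findSource.exec β = γ at *
      rw [← b1, ← c1] at g2 g3
      rw [← c1] at b4
      rcases f with ⟨f1, f2⟩ | ⟨f1, f2, f3, f4⟩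
      · rw [if_pos (by simpa using f1)]
        refine ⟨by simp; omega, by simpa [c2] using g2, by simpa using g3, Or.inr ?_⟩
        refine ⟨by simp, by simpa using m1, by simpa using m2, fun v hv hvS => ?_⟩
        simp only [exec_assign, arr_setVar]
        exact f2 v hv (by rw [b4]; exact (hS v hv).2 hvS)
      · rw [if_neg (by simp [f1])]
        obtain ⟨p1, p2⟩ := augPath_spec (X := X) hEγ m1 f2 f4
        have d2 : (augPath.exec γ).var vLAM = τ.var vLAM := by rw [← c2]; exact exec_var _ _ _ rfl
        have d3 : (augPath.exec γ).var vSTOP = 0 := by rw [← c3]; exact exec_var _ _ _ rfl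
        generalize augPath.exec γ = δ at *
        have hsrcS : γ.var vCUR ∈ S := (hS _ f2).1 (by rw [← b4]; exact f3)
        simp only [exec_assign, Expr.eval, arr_setVar, var_setVar]
        simp only [if_true, show (vSTOP : ℕ) ≠ vLAM by decide, if_false, d2]
        refine ⟨by omega, fun R hR hXR => ?_, fun u hu v hv => ?_, Or.inl ⟨d3, by omega⟩⟩
        · rw [g2 R hR hXR, p2 R (hR hsrcS) hXR]; omega
        · rw [p1 u hu v hv, g3 u hu v hv])
  rw [k3]
  obtain ⟨k4, k5, k6, k7⟩ := k1
  rw [hE.kp] at k4 k7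
  have hl : (τ.setVar vIT (σ'.var vKP)).var vLAM = τ.var vLAM := by simp
  rw [hl, arr_setVar]
  -- Without stopping, the `k + 1` rounds would have produced the value `k + 1`.
  have hhalt : τ.var vLAM ≤ k →
        Marked (N + 1) (mat (N + 1) (τ.arr aRES)) X (τ.arr aMARK) (τ.arr aNXT) ∧
        MarkClosed (N + 1) (mat (N + 1) (τ.arr aRES)) (τ.arr aMARK) ∧
        ∀ v < N + 1, v ∈ S → τ.arr aMARK v = 0 := by
    intro hle
    rcases k7 with k7 | k7
    · omega
    · exact k7.2
  refine ⟨k5, k6, k4, fun hle v hv hvX => ?_, fun hle => (hhalt hle).2.2, fun hle u hu v hv hu0 hv0 => ?_,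
    fun hle R hSR hXR hcl v hv hvR => ?_⟩
  · rw [((hhalt hle).1.sink v hv).2 hvX]; omega
  · by_contra hne
    exact (hhalt hle).2.1 u hu v hv (Nat.pos_of_ne_zero hne) hv0 hu0
  · by_contra hne
    have hM := (hhalt hle).1
    -- From a marked vertex the pointers lead along positive residual arcs, with falling marks, to a
    -- sink. A set without leaving residual arcs that contains a marked vertex would therefore
    -- contain a sink.
    have key : ∀ d, ∀ v < N + 1, v ∈ R → τ.arr aMARK v = d + 1 → False := by
      intro d
      induction d with
      | zero => exact fun v hv hvR h1 => hXR v hv ((hM.sink v hv).1 h1) hvR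
      | succ d ih =>
        intro v hv hvR h1
        obtain ⟨q1, q2, q3⟩ := hM.next v hv (by omega)
        refine ih _ q1 ?_ (by omega)
        by_contra hnR
        have := hcl v hv _ q1 hvR hnR
        omega
    exact key (τ.arr aMARK v - 1) v hv hvR (by omega)

notation "vP" => 29
notation "vLO" => 30
notation "vACC" => 31
notation "vX" => 32
notation "vD" => 33
notation "vB" => 34
notation "vGO" => 35
notation "vT" => 36
notation "vG" => 37
notation "vCNT" => 38
notation "vW" => 39
notation "vSU" => 40
notation "vSV" => 41
notation "vDONE" => 42
notation "vQ" => 43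
notation "vJ" => 44
notation "vOK" => 45
notation "vCOST" => 46
notation "aORIG" => 23

/-! ## Loops that fill arrays -/

/-- Nonzero if and only if the two values differ. -/
def neq (e f : Expr) : Expr := .add (.sub e f) (.sub f e)

theorem eval_neq (e f : Expr) : (neq e f).eval σ = 0 ↔ e.eval σ = f.eval σ := by
  simp only [neq, Expr.eval]; omega

/-- For loops whose round `i` writes cell `i` alone. The body may use that this cell still has its
original content. -/
theorem fill1 {x b a : ℕ} {p : Cmd} (val : ℕ → ℕ)
    (hbody : ∀ i τ, i < σ.var b → Same (loop x b p) σ τ → τ.arr a i = σ.arr a i →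
      (p.exec (τ.setVar x i)).arr a = Function.update (τ.arr a) i (val i)) (v : ℕ) :
    ((loop x b p).exec σ).arr a v = if v < σ.var b then val v else σ.arr a v := by
  obtain ⟨τ, h1, h2, h3⟩ := loop_rule (x := x) (b := b) (p := p) (σ := σ)
    (fun i τ => ∀ v, τ.arr a v = if v < i then val v else σ.arr a v) (by simp)
    (fun i τ hi hS hI v => by
      rw [hbody i τ hi hS (by rw [hI]; simp), Function.update_apply, hI]
      split_ifs <;> first | rfl | omega | (subst_vars; rfl))
  rw [h3, arr_setVar]; exact h1 v

theorem fill2 {x y b d a : ℕ} {p : Cmd} (hE : Env N n k s σ)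
    (hx : p.wv x = false) (hxy : x ≠ y) (hxd : x ≠ d) (hyd : y ≠ d) (hd : p.wv d = false)
    (hsafe : (loop x b (loop y d p)).safe = true)
    (hdN : σ.var d ≤ N + 1) (val : ℕ → ℕ → ℕ)
    (hbody : ∀ i j τ, i < σ.var b → j < σ.var d → Env N n k s τ →
      Same (loop x b (loop y d p)) σ τ → τ.var x = i → τ.var y = j →
      mat (N + 1) (τ.arr a) i j = mat (N + 1) (σ.arr a) i j →
      (p.exec τ).arr a = Function.update (τ.arr a) (i * (N + 1) + j) (val i j))
    (u v : ℕ) (hv : v < N + 1) :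
    mat (N + 1) (((loop x b (loop y d p)).exec σ).arr a) u v =
      if u < σ.var b ∧ v < σ.var d then val u v else mat (N + 1) (σ.arr a) u v := by
  have := loop2_rule (x := x) (y := y) (b := b) (d := d) (p := p) (σ := σ)
    (fun i j τ => ∀ u v, v < N + 1 → mat (N + 1) (τ.arr a) u v =
      if v < σ.var d ∧ (u < i ∨ (u = i ∧ v < j)) then val u v else mat (N + 1) (σ.arr a) u v)
    hx hxy hxd hyd hd (fun _ _ _ _ _ _ h => h) (by simp)
    (fun i τ hi hI u v hv => by
      rw [hI u v hv]
      split_ifs <;> first | rfl | omega)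
    (fun i j τ hi hj hS h1 h2 hI u v hv => by
      rw [hbody i j τ hi hj (hE.same hS hsafe) hS h1 h2 (by rw [hI i j (by omega)]; simp),
        mat_update _ _ (by omega) hv, hI u v hv]
      split_ifs <;> first | rfl | omega | simp_all)
  rw [this u v hv]
  split_ifs <;> first | rfl | omega

/-! ## The network of a class -/

def netBody : Cmd :=
  cond (.sub (.var vN) (.var vU)) (cond (.sub (.var vN) (.var vV))
    (cond (neq (.read aLAB (.var vU)) (.var vP)) (wr aNET vU vV (rd aCUR vU vV))
      (wr aNET vU vV (.const 0))) (wr aNET vU vV (.const 0))) (wr aNET vU vV (.const 0))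

def rowBody : Cmd :=
  assign vACC (.const 0) ;;
    loop vX vN (cond (neq (.read aLAB (.var vX)) (.var vP)) skip
      (assign vACC (.add (.var vACC) (rd aCUR vX vV)))) ;;
    cond (neq (.read aLAB (.var vV)) (.var vP)) (wr aNET vN vV (.var vACC)) skip

def buildNet : Cmd := loop vU vM (loop vV vM netBody) ;; loop vV vN rowBody

theorem netBody_spec (h : Env N n k s σ) (u v : ℕ) (hv : v < N + 1) (hu : u < N + 1) :
    mat (N + 1) (((loop vU vM (loop vV vM netBody)).exec σ).arr aNET) u v =
      if u < N ∧ v < N ∧ σ.arr aLAB u ≠ σ.var vP then mat (N + 1) (σ.arr aCUR) u v else 0 := by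
  rw [fill2 (N := N) (n := n) (k := k) (s := s) h rfl (by decide) (by decide) (by decide) rfl rfl
    h.M_eq.le
    (fun u v => if u < N ∧ v < N ∧ σ.arr aLAB u ≠ σ.var vP then mat (N + 1) (σ.arr aCUR) u v else 0)
    (fun i j τ hi hj hE hS hx hy _ => ?_) u v hv]
  · rw [h.M_eq, if_pos ⟨hu, hv⟩]
  · rw [h.M_eq] at hi hj
    have e1 : τ.arr aLAB = σ.arr aLAB := hS.2 _ rfl
    have e2 : τ.arr aCUR = σ.arr aCUR := hS.2 _ rfl
    have e3 : τ.var vP = σ.var vP := hS.1 _ rfl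
    have w : ∀ e, (wr aNET vU vV e).exec τ = τ.setArr aNET (i * (N + 1) + j) (e.eval τ) := fun e => by
      rw [exec_wr hE (by omega) (by omega), hx, hy]
    simp only [netBody, exec_cond, w, eval_rd hE (show τ.var vU < N + 1 by omega), eval_neq]
    simp only [Expr.eval, hx, hy, hE.N_eq, e1, e2, e3]
    by_cases c1 : i < N <;> by_cases c2 : j < N <;> by_cases c3 : σ.arr aLAB i = σ.var vP <;>
      simp [c1, c2, c3, show ∀ a b, a < b → b - a ≠ 0 by omega,
        show ∀ a b, ¬ a < b → b - a = 0 by omega]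

theorem buildNet_spec (h : Env N n k s σ) (u v : ℕ) (hu : u < N + 1) (hv : v < N + 1) :
    mat (N + 1) ((buildNet.exec σ).arr aNET) u v =
      netcap N (mat (N + 1) (σ.arr aCUR)) {x | σ.arr aLAB x = σ.var vP} u v := by
  simp only [buildNet, exec_seq]
  generalize hσ' : (loop vU vM (loop vV vM netBody)).exec σ = σ'
  have hS' : Same (loop vU vM (loop vV vM netBody)) σ σ' := by rw [← hσ']; exact same_exec _ _
  have hE : Env N n k s σ' := h.same hS' rfl
  have e1 : σ'.arr aLAB = σ.arr aLAB := hS'.2 _ rfl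
  have e2 : σ'.arr aCUR = σ.arr aCUR := hS'.2 _ rfl
  have e3 : σ'.var vP = σ.var vP := hS'.1 _ rfl
  have hn : ∀ u < N + 1, ∀ v < N + 1, mat (N + 1) (σ'.arr aNET) u v =
      if u < N ∧ v < N ∧ σ.arr aLAB u ≠ σ.var vP then mat (N + 1) (σ.arr aCUR) u v else 0 :=
    fun u hu v hv => by rw [← hσ']; exact netBody_spec h u v hv hu
  obtain ⟨τ, h1, h2, h3⟩ := loop_rule (x := vV) (b := vN) (p := rowBody) (σ := σ')
    (fun i τ => ∀ u < N + 1, ∀ v < N + 1, mat (N + 1) (τ.arr aNET) u v =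
      if u = N ∧ v < i ∧ σ.arr aLAB v ≠ σ.var vP then
        ∑ x ∈ range N, (if σ.arr aLAB x = σ.var vP then mat (N + 1) (σ.arr aCUR) x v else 0)
      else if u < N ∧ v < N ∧ σ.arr aLAB u ≠ σ.var vP then mat (N + 1) (σ.arr aCUR) u v else 0)
    (fun u hu v hv => by rw [hn u hu v hv]; simp) (fun j τ hj hS hI => by
      rw [hE.N_eq] at hj
      have hEτ : Env N n k s (τ.setVar vV j) := (hE.same hS rfl).setVar _ _ (by decide)
      have f1 : τ.arr aLAB = σ.arr aLAB := by rw [← e1]; exact hS.2 _ rfl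
      have f2 : τ.arr aCUR = σ.arr aCUR := by rw [← e2]; exact hS.2 _ rfl
      have f3 : τ.var vP = σ.var vP := by rw [← e3]; exact hS.1 _ rfl
      simp only [rowBody, exec_seq]
      generalize hα : (assign vACC (.const 0)).exec (τ.setVar vV j) = α
      have hSα : Same (assign vACC (.const 0)) (τ.setVar vV j) α := by rw [← hα]; exact same_exec _ _
      have hEα : Env N n k s α := hEτ.same hSα rfl
      have a1 : α.arr = τ.arr := by rw [← hα]; simp
      have a2 : α.var vP = σ.var vP := by rw [← hα]; simpa using f3
      have a3 : α.var vV = j := by rw [← hα]; simp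
      have a4 : α.var vACC = 0 := by rw [← hα]; simp
      obtain ⟨β, g1, g2, g3⟩ := loop_rule (x := vX) (b := vN)
        (p := cond (neq (.read aLAB (.var vX)) (.var vP)) skip
          (assign vACC (.add (.var vACC) (rd aCUR vX vV)))) (σ := α)
        (fun i β => β.var vACC = ∑ x ∈ range i,
          (if σ.arr aLAB x = σ.var vP then mat (N + 1) (σ.arr aCUR) x j else 0))
        (by simpa using a4) (fun i β hi hSβ hIβ => by
          rw [hEα.N_eq] at hi
          have hEβ : Env N n k s (β.setVar vX i) := (hEα.same hSβ rfl).setVar _ _ (by decide)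
          have b1 : β.arr aLAB = σ.arr aLAB := by rw [← f1, ← a1]; exact hSβ.2 _ rfl
          have b2 : β.arr aCUR = σ.arr aCUR := by rw [← f2, ← a1]; exact hSβ.2 _ rfl
          have b3 : β.var vP = σ.var vP := by rw [← a2]; exact hSβ.1 _ rfl
          have b4 : β.var vV = j := by rw [← a3]; exact hSβ.1 _ rfl
          simp only [exec_cond, eval_neq]
          have : (rd aCUR vX vV).eval (β.setVar vX i) = mat (N + 1) (σ.arr aCUR) i j := by
            rw [eval_rd hEβ (by simp; omega)]; simp [b2, b4]
          rw [sum_range_succ, ← hIβ]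
          by_cases c : σ.arr aLAB i = σ.var vP
          · simp [b1, b3, c, this]
          · simp [b1, b3, c])
      rw [g3]
      generalize hγ : β.setVar vX (α.var vN) = γ
      have hEγ : Env N n k s γ := by rw [← hγ]; exact (hEα.same g2 rfl).setVar _ _ (by decide)
      have c1 : γ.arr = τ.arr := by
        rw [← hγ, arr_setVar]; ext a : 1; rw [g2.2 a rfl, a1]
      have c2 : γ.var vP = σ.var vP := by rw [← hγ, ← a2]; simpa using g2.1 _ rfl
      have c3 : γ.var vV = j := by rw [← hγ, ← a3]; simpa using g2.1 _ rfl
      have c4 : γ.var vACC = ∑ x ∈ range N,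
          (if σ.arr aLAB x = σ.var vP then mat (N + 1) (σ.arr aCUR) x j else 0) := by
        rw [← hγ, hEα.N_eq] at *; simpa using g1
      have w : (wr aNET vN vV (.var vACC)).exec γ =
          γ.setArr aNET (N * (N + 1) + j) (γ.var vACC) := by
        rw [exec_wr hEγ (by rw [hEγ.N_eq]; omega) (by omega), hEγ.N_eq, c3]; rfl
      simp only [exec_cond, eval_neq, w, exec_skip]
      simp only [Expr.eval, c1, c2, c3, f1]
      intro u hu v hv
      by_cases c : σ.arr aLAB j = σ.var vP
      · rw [if_pos c, c1, hI u hu v hv]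
        by_cases huv : u = N ∧ v = j
        · obtain ⟨rfl, rfl⟩ := huv; simp [c]
        · have : (u = N ∧ v < j ∧ σ.arr aLAB v ≠ σ.var vP) ↔
              (u = N ∧ v < j + 1 ∧ σ.arr aLAB v ≠ σ.var vP) := by
            constructor
            · rintro ⟨h1, h2, h3⟩; exact ⟨h1, by omega, h3⟩
            · rintro ⟨h1, h2, h3⟩; exact ⟨h1, by omega, h3⟩
          simp only [this]
      · rw [if_neg c, arr_setArr, if_pos rfl, mat_update _ _ (by omega) hv, c1, hI u hu v hv, c4]
        by_cases huv : u = N ∧ v = j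
        · obtain ⟨rfl, rfl⟩ := huv; simp [c]
        · have : (u = N ∧ v < j ∧ σ.arr aLAB v ≠ σ.var vP) ↔
              (u = N ∧ v < j + 1 ∧ σ.arr aLAB v ≠ σ.var vP) := by
            constructor
            · rintro ⟨h1, h2, h3⟩; exact ⟨h1, by omega, h3⟩
            · rintro ⟨h1, h2, h3⟩; exact ⟨h1, by omega, h3⟩
          simp only [this, huv, if_false])
  rw [h3, arr_setVar, h1 u hu v hv, hE.N_eq]
  unfold netcap
  by_cases c1 : v < N
  · by_cases c2 : u < N
    · have : u ≠ N := by omega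
      by_cases c3 : σ.arr aLAB u = σ.var vP <;> simp [c1, c2, c3, this]
    · have : u = N := by omega
      subst this
      by_cases c3 : σ.arr aLAB v = σ.var vP
      · simp [c3]
      · rw [if_pos ⟨rfl, c1, c3⟩, if_pos c1, if_neg (by omega), if_pos ⟨rfl, c3⟩]
        exact sum_congr rfl fun x _ => by congr
  · simp [c1]

def setSources : Cmd :=
  loop vV vN (write aSRC (.var vV) (.read aBASE (.var vV))) ;; write aSRC (.var vN) (.const 1)

def setSinks : Cmd :=
  loop vV vN (cond (.sub (.var vLO) (.read aLAB (.var vV))) (write aSNK (.var vV) (.const 0))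
    (cond (.sub (.read aLAB (.var vV)) (.var vP)) (write aSNK (.var vV) (.const 0))
      (write aSNK (.var vV) (.const 1)))) ;; write aSNK (.var vN) (.const 0)

theorem setSources_spec (h : Env N n k s σ) (v : ℕ) (hv : v < N + 1) :
    (setSources.exec σ).arr aSRC v ≠ 0 ↔ v ∈ srcs N {v | σ.arr aBASE v ≠ 0} := by
  simp only [setSources, exec_seq]
  have key := fill1 (x := vV) (b := vN) (a := aSRC)
    (p := write aSRC (.var vV) (.read aBASE (.var vV))) (σ := σ) (fun v => σ.arr aBASE v)
    (fun i τ hi hS _ => by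
      rw [h.N_eq] at hi
      have hE : Env N n k s τ := h.same hS rfl
      have := hE.lt_sz (show i < N + 1 by omega)
      have e : τ.arr aBASE = σ.arr aBASE := hS.2 _ rfl
      simp [this, e])
  generalize hτ : (loop vV vN (write aSRC (.var vV) (.read aBASE (.var vV)))).exec σ = τ at *
  have hE : Env N n k s τ := by rw [← hτ]; exact h.same (same_exec _ _) rfl
  have := hE.lt_sz (Nat.lt_succ_self N)
  simp only [exec_write, Expr.eval, hE.N_eq, this, if_true, arr_setArr]
  by_cases hvN : v = N
  · subst hvN; simp [srcs]
  · have : v < N := by omega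
    simp [srcs, hvN, this, key, h.N_eq]

theorem setSinks_spec (h : Env N n k s σ) (v : ℕ) (hv : v < N + 1) :
    (setSinks.exec σ).arr aSNK v =
      if v ∈ snks N (σ.arr aLAB) (σ.var vLO) (σ.var vP) then 1 else 0 := by
  simp only [setSinks, exec_seq]
  have key := fill1 (x := vV) (b := vN) (a := aSNK)
    (p := cond (.sub (.var vLO) (.read aLAB (.var vV))) (write aSNK (.var vV) (.const 0))
    (cond (.sub (.read aLAB (.var vV)) (.var vP)) (write aSNK (.var vV) (.const 0))
      (write aSNK (.var vV) (.const 1)))) (σ := σ)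
    (fun v => if σ.var vLO ≤ σ.arr aLAB v ∧ σ.arr aLAB v ≤ σ.var vP then 1 else 0)
    (fun i τ hi hS _ => by
      rw [h.N_eq] at hi
      have hE : Env N n k s τ := h.same hS rfl
      have := hE.lt_sz (show i < N + 1 by omega)
      have e : τ.arr aLAB = σ.arr aLAB := hS.2 _ rfl
      have e1 : τ.var vLO = σ.var vLO := hS.1 _ rfl
      have e2 : τ.var vP = σ.var vP := hS.1 _ rfl
      simp only [exec_cond, exec_write, Expr.eval, var_setVar, if_true, arr_setVar, e]
      simp only [show (vLO : ℕ) ≠ vV by decide, show (vP : ℕ) ≠ vV by decide,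
        show (vSZ : ℕ) ≠ vV by decide, if_false, e1, e2, this, if_true]
      by_cases c1 : σ.var vLO ≤ σ.arr aLAB i <;> by_cases c2 : σ.arr aLAB i ≤ σ.var vP <;>
        simp [c1, c2, show ∀ a b, ¬ a ≤ b → a - b ≠ 0 by omega,
        show ∀ a b, a ≤ b → a - b = 0 by omega])
  generalize hτ : (loop vV vN (cond (.sub (.var vLO) (.read aLAB (.var vV)))
    (write aSNK (.var vV) (.const 0))
    (cond (.sub (.read aLAB (.var vV)) (.var vP)) (write aSNK (.var vV) (.const 0))
      (write aSNK (.var vV) (.const 1))))).exec σ = τ at *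
  have hE : Env N n k s τ := by rw [← hτ]; exact h.same (same_exec _ _) rfl
  have := hE.lt_sz (Nat.lt_succ_self N)
  simp only [exec_write, Expr.eval, hE.N_eq, this, if_true, arr_setArr]
  by_cases hvN : v = N
  · subst hvN; simp [snks]
  · have : v < N := by omega
    simp [snks, hvN, this, key, h.N_eq]

theorem FlowSpec.congr {M lam : ℕ} {net net' r : ℕ → ℕ → ℕ} {S X : Set ℕ} {mark : ℕ → ℕ}
    (h : FlowSpec M net S X k r lam mark) (he : ∀ u < M, ∀ v < M, net u v = net' u v) :
    FlowSpec M net' S X k r lam mark := by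
  refine { h with cut_eq := fun R h1 h2 => ?_, symm := fun u hu v hv => ?_ }
  · rw [← h.cut_eq R h1 h2]
    exact dsum_congr fun u hu v hv => by rw [he u hu v hv]
  · rw [h.symm u hu v hv, he u hu v hv, he v hv u hu]

def netflow : Cmd := buildNet ;; setSources ;; setSinks ;; flow

theorem netflow_spec (h : Env N n k s σ) {c : ℕ → ℕ → ℕ} {lab : ℕ → ℕ} {p lo : ℕ} {B0 : Set ℕ}
    (hc : mat (N + 1) (σ.arr aCUR) = c) (hlab : σ.arr aLAB = lab) (hp : σ.var vP = p)
    (hlo : σ.var vLO = lo) (hB : {v | σ.arr aBASE v ≠ 0} = B0) :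
    (∀ u < N + 1, ∀ v < N + 1, mat (N + 1) ((netflow.exec σ).arr aNET) u v =
      netcap N c {x | lab x = p} u v) ∧
    FlowSpec (N + 1) (netcap N c {x | lab x = p}) (srcs N B0) (snks N lab lo p) k
      (mat (N + 1) ((netflow.exec σ).arr aRES)) ((netflow.exec σ).var vLAM)
      ((netflow.exec σ).arr aMARK) := by
  subst hc hlab hp hlo hB
  have h1 := buildNet_spec h
  simp only [netflow, exec_seq]
  have hS : Same buildNet σ (buildNet.exec σ) := same_exec _ _
  generalize buildNet.exec σ = α at *
  have hE : Env N n k s α := h.same hS rfl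
  have a1 : α.arr aLAB = σ.arr aLAB := hS.2 _ rfl
  have a2 : α.arr aBASE = σ.arr aBASE := hS.2 _ rfl
  have a3 : α.var vP = σ.var vP := hS.1 _ rfl
  have a4 : α.var vLO = σ.var vLO := hS.1 _ rfl
  have h2 := setSources_spec hE
  have hS2 : Same setSources α (setSources.exec α) := same_exec _ _
  generalize setSources.exec α = β at *
  have hE2 : Env N n k s β := hE.same hS2 rfl
  have b1 : β.arr aLAB = σ.arr aLAB := by rw [← a1]; exact hS2.2 _ rfl
  have b3 : β.var vP = σ.var vP := by rw [← a3]; exact hS2.1 _ rfl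
  have b4 : β.var vLO = σ.var vLO := by rw [← a4]; exact hS2.1 _ rfl
  have b5 : β.arr aNET = α.arr aNET := hS2.2 _ rfl
  have h3 := setSinks_spec hE2
  have hS3 : Same setSinks β (setSinks.exec β) := same_exec _ _
  generalize setSinks.exec β = γ at *
  have hE3 : Env N n k s γ := hE2.same hS3 rfl
  have c5 : γ.arr aNET = α.arr aNET := by rw [← b5]; exact hS3.2 _ rfl
  have c6 : γ.arr aSRC = β.arr aSRC := hS3.2 _ rfl
  have h4 := flow_spec hE3 (S := srcs N {v | σ.arr aBASE v ≠ 0})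
    (X := snks N (σ.arr aLAB) (σ.var vLO) (σ.var vP))
    (fun v hv => by rw [c6, h2 v hv, a2]) (fun v hv => by rw [h3 v hv, b1, b3, b4])
  have d5 : (flow.exec γ).arr aNET = α.arr aNET := by rw [← c5]; exact exec_arr _ _ _ rfl
  refine ⟨fun u hu v hv => by rw [d5]; exact h1 u v hu hv, h4.congr fun u hu v hv => ?_⟩
  rw [c5]; exact h1 u v hu hv

/-! ## Candidates -/

/-- Both ends of the arc are stored, one after the other, and a digit selects a single end. This is
why indices have `2 * (k + 1)` values. -/
def pushCand : Cmd :=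
  write aCAND (.var vCNT) (.var vU) ;; write aCAND (.add (.var vCNT) (.const 1)) (.var vV) ;;
    assign vCNT (.add (.var vCNT) (.const 2))

def candBody : Cmd :=
  cond (.sub (.var vLAM) (.var 1))
    (cond (.sub (.var vN) (.var vU)) skip
      (cond (.sub (rd aNET vU vV) (rd aRES vU vV)) pushCand skip))
    (cond (.read aMARK (.var vU)) skip
      (cond (.read aMARK (.var vV)) (cond (rd aNET vU vV) pushCand skip) skip))

def cands : Cmd := assign vCNT (.const 0) ;; loop vU vM (loop vV vM candBody)

theorem candBody_exec {τ : State} (h : Env N n k s τ) {net r : ℕ → ℕ → ℕ} {mark : ℕ → ℕ} {lam i j : ℕ}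
    (hi : τ.var vU = i) (hj : τ.var vV = j) (hiN : i < N + 1)
    (hnet : mat (N + 1) (τ.arr aNET) i j = net i j)
    (hr : mat (N + 1) (τ.arr aRES) i j = r i j) (hm : τ.arr aMARK = mark) (hl : τ.var vLAM = lam) :
    candBody.exec τ = if Cand N k net r lam mark i j then pushCand.exec τ else τ := by
  have hiN' : τ.var vU < N + 1 := by omega
  simp only [candBody, exec_cond, Expr.eval, eval_rd h hiN', hi, hj, hnet, hr, hm, hl, h.k_eq, h.N_eq,
    exec_skip]
  generalize pushCand.exec τ = ρ
  unfold Cand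
  by_cases c1 : lam ≤ k
  · have e1 : lam - k = 0 := by omega
    have e2 : ¬ k < lam := by omega
    simp only [e1, if_true, c1, true_and, e2, false_and, or_false]
    by_cases c2 : mark i = 0 <;> by_cases c3 : mark j = 0 <;> by_cases c4 : net i j = 0 <;>
      simp [c2, c3, c4, Nat.pos_iff_ne_zero]
  · have e1 : lam - k ≠ 0 := by omega
    have e2 : k < lam := by omega
    simp only [e1, if_false, c1, false_and, e2, true_and, false_or]
    by_cases c2 : N - i = 0
    · have : i = N := by omega
      subst this
      by_cases c3 : r i j < net i j
      · have : net i j - r i j ≠ 0 := by omega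
        simp [c3, this]
      · have : net i j - r i j = 0 := by omega
        simp [c3, this]
    · have : i ≠ N := by omega
      simp [c2, this]

/-- The bound on the number of candidates does two things: no write is lost at the address guard,
and every stored position is an admissible digit. -/
theorem cands_spec (h : Env N n k s σ) {net r : ℕ → ℕ → ℕ} {mark : ℕ → ℕ} {lam : ℕ}
    (hnet : ∀ u < N + 1, ∀ v < N + 1, mat (N + 1) (σ.arr aNET) u v = net u v)
    (hr : mat (N + 1) (σ.arr aRES) = r) (hm : σ.arr aMARK = mark) (hl : σ.var vLAM = lam)
    (hc : (∑ u ∈ range (N + 1), ∑ v ∈ range (N + 1),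
      if Cand N k net r lam mark u v then 1 else 0) ≤ k + 1) {u v : ℕ} (hu : u < N + 1)
    (hv : v < N + 1) (huv : Cand N k net r lam mark u v) :
    (∃ d < 2 * (k + 1), (cands.exec σ).arr aCAND d = u) ∧
      ∃ d < 2 * (k + 1), (cands.exec σ).arr aCAND d = v := by
  set C : Finset (ℕ × ℕ) := (range (N + 1) ×ˢ range (N + 1)).filter
    (fun q => Cand N k net r lam mark q.1 q.2) with hC
  have hCc : C.card ≤ k + 1 := by
    rw [hC, card_filter, sum_product]; exact hc
  simp only [cands, exec_seq]
  generalize hσ' : (assign vCNT (.const 0)).exec σ = σ'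
  have hS' : Same (assign vCNT (.const 0)) σ σ' := by rw [← hσ']; exact same_exec _ _
  have hE : Env N n k s σ' := h.same hS' rfl
  have e0 : σ'.var vCNT = 0 := by rw [← hσ']; simp
  have e1 : σ'.arr aNET = σ.arr aNET := hS'.2 _ rfl
  have e2 : σ'.arr aRES = σ.arr aRES := hS'.2 _ rfl
  have e3 : σ'.arr aMARK = σ.arr aMARK := hS'.2 _ rfl
  have e4 : σ'.var vLAM = σ.var vLAM := hS'.1 _ rfl
  -- The counter is twice the number of candidates that precede the current pair lexicographically.
  have key := loop2_rule (x := vU) (y := vV) (b := vM) (d := vM) (p := candBody) (σ := σ')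
    (fun i j τ => τ.var vCNT =
        2 * (C.filter (fun q => q.1 < i ∨ (q.1 = i ∧ q.2 < j))).card ∧
      ∀ u v, (u, v) ∈ C.filter (fun q => q.1 < i ∨ (q.1 = i ∧ q.2 < j)) →
        (∃ d < τ.var vCNT, τ.arr aCAND d = u) ∧ ∃ d < τ.var vCNT, τ.arr aCAND d = v)
    rfl (by decide) (by decide) (by decide) rfl
    (fun i j τ z v hz hI => by
      have : (vCNT : ℕ) ≠ z := by rcases hz with rfl | rfl <;> decide
      simpa [this] using hI)
    ⟨by rw [e0]; simp, by simp⟩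
    (fun i τ hi hI => by
      have : C.filter (fun q => q.1 < i + 1 ∨ (q.1 = i + 1 ∧ q.2 < 0)) =
          C.filter (fun q => q.1 < i ∨ (q.1 = i ∧ q.2 < σ'.var vM)) := by
        refine filter_congr fun q hq => ?_
        simp only [hC, mem_filter, mem_product, mem_range] at hq
        rw [hE.M_eq]; omega
      rw [this]; exact hI)
    (fun i j τ hi hj hS hx hy hI => by
      rw [hE.M_eq] at hi hj
      have hEτ : Env N n k s τ := hE.same hS rfl
      rw [candBody_exec (net := net) (r := r) (mark := mark) (lam := lam) hEτ hx hy hi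
        (by rw [hS.2 aNET rfl, e1]; exact hnet i hi j hj)
        (by rw [hS.2 aRES rfl, e2, hr]) (by rw [hS.2 aMARK rfl, e3, hm])
        (by rw [hS.1 vLAM rfl, e4, hl])]
      obtain ⟨hI1, hI2⟩ := hI
      set P := C.filter (fun q => q.1 < i ∨ (q.1 = i ∧ q.2 < j)) with hP
      have hPm : ∀ q : ℕ × ℕ, q ∈ C.filter (fun q => q.1 < i ∨ (q.1 = i ∧ q.2 < j + 1)) ↔
          q ∈ P ∨ (q = (i, j) ∧ Cand N k net r lam mark i j) := by
        rintro ⟨a, b⟩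
        simp only [hP, mem_filter, hC, mem_product, mem_range, Prod.mk.injEq]
        constructor
        · rintro ⟨h1, h2⟩
          by_cases h3 : a = i ∧ b = j
          · obtain ⟨rfl, rfl⟩ := h3; exact Or.inr ⟨⟨rfl, rfl⟩, h1.2⟩
          · exact Or.inl ⟨h1, by omega⟩
        · rintro (⟨h1, h2⟩ | ⟨⟨rfl, rfl⟩, h2⟩)
          · exact ⟨h1, by omega⟩
          · exact ⟨⟨⟨hi, hj⟩, h2⟩, by omega⟩
      by_cases c : Cand N k net r lam mark i j
      · have hP' : C.filter (fun q => q.1 < i ∨ (q.1 = i ∧ q.2 < j + 1)) = insert (i, j) P := by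
          ext q; rw [hPm, mem_insert]; tauto
        have hnot : (i, j) ∉ P := by simp [hP]
        have hle : P.card + 1 ≤ k + 1 := by
          rw [← card_insert_of_notMem hnot, ← hP']
          exact (card_le_card (filter_subset _ _)).trans hCc
        have hsz := hEτ.cand
        have h1 : τ.var vCNT < τ.var vSZ := by omega
        have h2 : τ.var vCNT + 1 < τ.var vSZ := by omega
        rw [if_pos c, hP', card_insert_of_notMem hnot]
        simp only [pushCand, exec_seq, exec_write, Expr.eval, h1, if_true, var_setArr, h2, exec_assign,
          var_setVar, arr_setVar, arr_setArr, hx, hy]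
        refine ⟨by omega, fun a b hab => ?_⟩
        rcases mem_insert.1 hab with hab | hab
        · obtain ⟨rfl, rfl⟩ := Prod.mk.inj hab
          exact ⟨⟨τ.var vCNT, by omega, by simp⟩, ⟨τ.var vCNT + 1, by omega, by simp⟩⟩
        · obtain ⟨⟨d, hd, hd'⟩, e, he, he'⟩ := hI2 a b hab
          refine ⟨⟨d, by omega, ?_⟩, e, by omega, ?_⟩
          · rw [Function.update_of_ne (by omega), Function.update_of_ne (by omega), hd']
          · rw [Function.update_of_ne (by omega), Function.update_of_ne (by omega), he']
      · have hP' : C.filter (fun q => q.1 < i ∨ (q.1 = i ∧ q.2 < j + 1)) = P := by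
          ext q; rw [hPm]; tauto
        rw [if_neg c, hP']; exact ⟨hI1, hI2⟩)
  rw [hE.M_eq] at key
  obtain ⟨h1, h2⟩ := key
  have hle : (C.filter (fun q => q.1 < N + 1 ∨ (q.1 = N + 1 ∧ q.2 < 0))).card ≤ C.card :=
    card_le_card (filter_subset _ _)
  obtain ⟨⟨d, hd, hd'⟩, e, he, he'⟩ := h2 u v (by simp [hC, huv]; omega)
  exact ⟨⟨d, by omega, hd'⟩, e, by omega, he'⟩

/-! ## Twins -/

/-- The other half of a split vertex. -/
def twin (N n v : ℕ) : ℕ := if v < n then v + (N - n) else v - (N - n)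

/-- Either no vertex is split, or all are. -/
def SplitSize (N n : ℕ) : Prop := N = n ∨ N = 2 * n

theorem twin_lt (hN : SplitSize N n) {v : ℕ} (hv : v < N) : twin N n v < N := by
  unfold twin; rcases hN with rfl | rfl <;> split <;> omega

theorem twin_twin (hN : SplitSize N n) {v : ℕ} (hv : v < N) : twin N n (twin N n v) = v := by
  unfold twin; rcases hN with rfl | rfl <;> split <;> split <;> omega

theorem lt_or_twin_lt (hN : SplitSize N n) {v : ℕ} (hv : v < N) : v < n ∨ twin N n v < n := by
  unfold twin; rcases hN with rfl | rfl <;> split <;> omega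

/-- All arcs that leave the first half of a split vertex, or enter its second half, are between its
two halves. -/
def TwinArcs (N n : ℕ) (c : ℕ → ℕ → ℕ) : Prop :=
  ∀ u < N, twin N n u ≠ u → (∀ v < N, 0 < c u v → v = twin N n u) ∨
    (∀ v < N, 0 < c v u → v = twin N n u)

/-- In a component with at least two vertices every vertex has an arc to, and an arc from, some
vertex of the component. For half of a split vertex, one of these arcs must join it to its twin. -/
theorem TwinArcs.conn {c : ℕ → ℕ → ℕ} {D : ℕ → ℕ → Prop} (h : TwinArcs N n c) {t x v : ℕ} (ht : t < N)
    (hx : Conn N c D t x) (hxt : x ≠ t) (hv : Conn N c D t v) : Conn N c D t (twin N n v) := by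
  by_cases htw : twin N n v = v
  · rwa [htw]
  have hvN : v < N := hv.1.lt ht
  obtain ⟨y, hy, hyv⟩ : ∃ y, Conn N c D v y ∧ y ≠ v := by
    by_cases hvt : v = t
    · exact ⟨x, hv.symm.trans hx, by omega⟩
    · exact ⟨t, hv.symm, by omega⟩
  rcases h v hvN htw with h1 | h1
  · rcases hy.1.cases_head with h2 | ⟨z, h2, h3⟩
    · exact absurd h2.symm hyv
    · rw [← h1 z h2.2.1 h2.2.2.1]
      exact hv.trans ⟨.single h2, h3.trans hy.2⟩
  · rcases hy.2.cases_tail with h2 | ⟨z, h3, h2⟩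
    · exact absurd h2.symm hyv
    · rw [← h1 z h2.1 h2.2.2.1]
      exact hv.trans ⟨hy.1.trans h3, .single h2⟩

/-- One of `w` and its twin is below `n`, hence counted, and both are new because `K` is closed
under twins. -/
theorem wt_add_twin (hN : SplitSize N n) {K : Set ℕ} {w : ℕ} (hw : w < N) (hwK : w ∉ K)
    (hK : ∀ v ∈ K, twin N n v ∈ K) : wt n K + 1 ≤ wt n (K ∪ {w, twin N n w}) := by
  have htK : twin N n w ∉ K := fun h => hwK (twin_twin hN hw ▸ hK _ h)
  obtain ⟨x, hx, hxK, hxm⟩ : ∃ x < n, x ∉ K ∧ x ∈ ({w, twin N n w} : Set ℕ) := by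
    rcases lt_or_twin_lt hN hw with h | h
    · exact ⟨w, h, hwK, by simp⟩
    · exact ⟨_, h, htK, by simp⟩
  unfold wt
  rw [← card_insert_of_notMem (a := x) (by simp [hxK])]
  refine card_le_card fun y hy => ?_
  simp only [mem_insert, mem_filter, mem_range] at hy ⊢
  rcases hy with rfl | hy
  · exact ⟨hx, Or.inr hxm⟩
  · exact ⟨hy.1, Or.inl hy.2⟩

theorem wt_le {K : Set ℕ} : wt n K ≤ n := by
  unfold wt; exact (card_le_card (filter_subset _ _)).trans (by simp)

/-- Give the label `vP` to the twin of a vertex. -/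
def labelTwin (x : ℕ) : Cmd :=
  cond (.sub (.var 0) (.var x)) (write aLAB (.add (.var x) (.var vOFF)) (.var vP))
    (write aLAB (.sub (.var x) (.var vOFF)) (.var vP))

theorem exec_labelTwin (h : Env N n k s σ) (hN : SplitSize N n) {x : ℕ} (hx : σ.var x < N) :
    (labelTwin x).exec σ = σ.setArr aLAB (twin N n (σ.var x)) (σ.var vP) := by
  have h1 := h.lt_sz ((twin_lt hN hx).trans (Nat.lt_succ_self N))
  unfold twin at h1 ⊢
  simp only [labelTwin, exec_cond, Expr.eval, exec_write, h.n_eq, h.off]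
  by_cases c : σ.var x < n
  · rw [if_pos c] at h1
    rw [if_neg (by omega), if_pos c, if_pos h1]
  · rw [if_neg c] at h1
    rw [if_pos (by omega), if_neg c, if_pos h1]

/-! ## Growing a class -/

def growRest : Cmd :=
  assign vW (.read aCAND (.var vD)) ;; write aLAB (.var vW) (.var vP) ;; labelTwin vW

def growStep : Cmd := (netflow ;; cands) ;; getIdx vD ;; growRest

/-- With no base vertices and `vLO = vP`, the only source is `N` and the sinks are exactly the
class, which is the situation of `exists_cand`. The digit is the position of a candidate end that
lies in the component. -/
theorem growStep_spec (h : Env N n k s σ) (hN : SplitSize N n) {c : ℕ → ℕ → ℕ} {D : ℕ → ℕ → Prop}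
    (hc : mat (N + 1) (σ.arr aCUR) = c) (hcost : cost N c D ≤ k) (hbase : ∀ v, σ.arr aBASE v = 0)
    {p : ℕ} (hp : σ.var vP = p) (hlo : σ.var vLO = p) {K : Set ℕ} {L : ℕ → ℕ}
    (hlab : σ.arr aLAB = fun v => if v ∈ K then p else L v) (hL : ∀ v, L v ≠ p) {t x : ℕ}
    (htK : t ∈ K) (hKN : ∀ v ∈ K, v < N) (hK : ∀ v ∈ K, Conn N c D t v) (hx : Conn N c D t x)
    (hxK : x ∉ K) :
    ∃ w ρ, w < N ∧ Conn N c D t w ∧ w ∉ K ∧ Ang (2 * (k + 1)) growStep σ ρ ∧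
      (ρ.arr aLAB = fun v => if v ∈ K ∪ {w, twin N n w} then p else L v) ∧
      ρ.var vPA = σ.var vPA + 1 ∧ ρ.var vPB = σ.var vPB := by
  have hKp : {x | σ.arr aLAB x = p} = K := by
    ext v; simp only [Set.mem_ofPred_eq, hlab]
    by_cases hv : v ∈ K <;> simp [hv, hL v]
  have hS0 : srcs N ∅ = {N} := by ext v; simp [srcs]
  have hX0 : snks N (σ.arr aLAB) p p = {v | v < N ∧ v ∈ K} := by
    ext v
    rw [← hKp]; simp only [snks, Set.mem_ofPred_eq]; omega
  obtain ⟨hnet, hF⟩ := netflow_spec h hc rfl hp hlo (B0 := ∅) (by ext v; simp [hbase])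
  rw [hKp, hS0, hX0] at hF
  rw [hKp] at hnet
  have hA1 : Ang (2 * (k + 1)) (netflow ;; cands) σ ((netflow ;; cands).exec σ) :=
    Ang.of_noDig rfl rfl rfl σ
  have hEn : Env N n k s (netflow.exec σ) := h.same (same_exec _ _) rfl
  obtain ⟨u, v, hu, hv, hC, hor⟩ := exists_cand hcost hF htK hKN hK hx hxK
  obtain ⟨hd1, hd2⟩ := cands_spec hEn hnet rfl rfl rfl
    (card_cand hF (by simp) subset_rfl (fun v hv => hv.1)) hu hv hC
  obtain ⟨w, d, hw, hcw, hwK, hd, hdw⟩ : ∃ w d, w < N ∧ Conn N c D t w ∧ w ∉ K ∧ d < 2 * (k + 1) ∧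
      ((netflow ;; cands).exec σ).arr aCAND d = w := by
    rcases hor with ⟨h1, h2, h3⟩ | ⟨h1, h2, h3⟩
    · obtain ⟨d, hd, hd'⟩ := hd1; exact ⟨u, d, h1, h2, h3, hd, hd'⟩
    · obtain ⟨d, hd, hd'⟩ := hd2; exact ⟨v, d, h1, h2, h3, hd, hd'⟩
  have hS := hA1.1
  have hEα : Env N n k s ((netflow ;; cands).exec σ) := h.same hS rfl
  generalize (netflow ;; cands).exec σ = α at *
  have a1 : α.arr aLAB = σ.arr aLAB := hS.2 _ rfl
  have a2 : α.var vP = p := by rw [← hp]; exact hS.1 _ rfl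
  have a3 : α.var vPA = σ.var vPA := hS.1 _ rfl
  have a4 : α.var vPB = σ.var vPB := hS.1 _ rfl
  have hA2 := ang_getIdx (r := 2 * (k + 1)) (x := vD) (d := d) (by decide) (by decide) hd α
  have hEβ := hEα.same hA2.1 rfl
  generalize hβ : (α.setVar vD d).setVar vPA (α.var vPA + 1) = β at *
  have hA3 : Ang (2 * (k + 1)) growRest β (growRest.exec β) := Ang.of_noDig rfl rfl rfl β
  have b1 : β.arr = α.arr := by rw [← hβ]; simp
  have b2 : β.var vP = p := by rw [← hβ]; simpa using a2
  have b3 : β.var vPA = σ.var vPA + 1 := by rw [← hβ]; simpa using a3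
  have b4 : β.var vPB = σ.var vPB := by rw [← hβ]; simpa using a4
  have b5 : β.var vD = d := by rw [← hβ]; simp
  refine ⟨w, _, hw, hcw, hwK, hA1.seq (hA2.seq hA3), ?_, ?_, ?_⟩
  · have hwsz := hEβ.lt_sz (hw.trans (Nat.lt_succ_self N))
    have hex : (assign vW (.read aCAND (.var vD)) ;; write aLAB (.var vW) (.var vP)).exec β =
        (β.setVar vW w).setArr aLAB w p := by
      simp [b5, b1, hdw, hwsz, b2]
    have : growRest.exec β = (labelTwin vW).exec ((β.setVar vW w).setArr aLAB w p) := by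
      rw [← hex]; rfl
    rw [this, exec_labelTwin (N := N) (n := n) (k := k) (s := s) ?_ hN (by simpa using hw)]
    · funext y
      simp only [arr_setArr, if_true, var_setArr, var_setVar, arr_setVar, b1, a1, hlab,
        Function.update_apply, show (vP : ℕ) ≠ vW by decide, if_false, b2]
      by_cases h1 : y = twin N n w
      · simp [h1]
      · by_cases h2 : y = w
        · simp [h2]
        · simp [h1, h2]
    · rw [← hex]; exact hEβ.same (same_exec _ _) rfl
  · rw [← b3]; exact exec_var _ _ _ rfl
  · rw [← b4]; exact exec_var _ _ _ rfl

/-- A bit decides whether the class grows further, and only if it does is an index consumed. -/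
def growLoop : Cmd :=
  loop vG vN (cond (.var vGO) (getBit vGO ;; cond (.var vGO) growStep skip) skip)

/-- The first vertices of a class. -/
def startClass : Cmd :=
  (assign vP (.add (.var vD) (.const 1)) ;; assign vLO (.var vP) ;; write aLAB (.var vT) (.var vP)) ;;
    getBit vGO ;; cond (.var vGO) (labelTwin vT) skip

/-- A terminal with a label belongs to the class of an earlier terminal and consumes no advice. -/
def classBody : Cmd :=
  cond (.read aTERM (.var vT)) (cond (.read aLAB (.var vT)) skip
    (getIdx vD ;; startClass ;; growLoop)) skip

def labelling : Cmd := loop vT vN classBody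

/-- Each growth raises the weight, which starts at one and never exceeds `s`. So there are at most
`s - 1` growths, each with a bit and an index, and one more bit to stop. -/
theorem growLoop_spec (h : Env N n k s σ) (hN : SplitSize N n) {c : ℕ → ℕ → ℕ} {D : ℕ → ℕ → Prop}
    (hc : mat (N + 1) (σ.arr aCUR) = c) (hcost : cost N c D ≤ k) (hbase : ∀ v, σ.arr aBASE v = 0)
    {p : ℕ} (hp : σ.var vP = p) (hlo : σ.var vLO = p) {K : Set ℕ} {L : ℕ → ℕ}
    (hlab : σ.arr aLAB = fun v => if v ∈ K then p else L v) (hL : ∀ v, L v ≠ p) {t : ℕ}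
    (ht : t < N) (htK : t ∈ K) (hK : ∀ v ∈ K, Conn N c D t v) (hs : 1 ≤ s)
    (hws : wt n {v | Conn N c D t v} ≤ s)
    (hgo : (σ.var vGO = 0 ∧ K = {v | Conn N c D t v}) ∨
      (σ.var vGO ≠ 0 ∧ 1 ≤ wt n K ∧ (∀ v ∈ K, twin N n v ∈ K) ∧
        ∀ v, Conn N c D t v → Conn N c D t (twin N n v))) :
    ∃ ρ, Ang (2 * (k + 1)) growLoop σ ρ ∧
      (ρ.arr aLAB = fun v => if Conn N c D t v then p else L v) ∧
      ρ.var vPA + 1 ≤ σ.var vPA + s ∧ ρ.var vPB ≤ σ.var vPB + s := by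
  have hlt : ∀ v, Conn N c D t v → v < N := fun v hv => hv.1.lt ht
  obtain ⟨τ, hI, hS, hA⟩ := ang_loop (r := 2 * (k + 1)) (x := vG) (b := vN)
    (p := cond (.var vGO) (getBit vGO ;; cond (.var vGO) growStep skip) skip) (σ := σ)
    (fun g τ => ∃ K : Set ℕ, (τ.arr aLAB = fun v => if v ∈ K then p else L v) ∧ t ∈ K ∧
      (∀ v ∈ K, Conn N c D t v) ∧
      ((τ.var vGO = 0 ∧ K = {v | Conn N c D t v} ∧ τ.var vPA + 1 ≤ σ.var vPA + s ∧
        τ.var vPB ≤ σ.var vPB + s) ∨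
      (τ.var vGO ≠ 0 ∧ g + 1 ≤ wt n K ∧ (∀ v ∈ K, twin N n v ∈ K) ∧
        (∀ v, Conn N c D t v → Conn N c D t (twin N n v)) ∧
        τ.var vPA = σ.var vPA + g ∧ τ.var vPB = σ.var vPB + g)))
    ⟨K, hlab, htK, hK, by
      rcases hgo with ⟨h1, h2⟩ | ⟨h1, h2, h3, h4⟩
      · exact Or.inl ⟨h1, h2, by omega, by omega⟩
      · exact Or.inr ⟨h1, by omega, h3, h4, rfl, rfl⟩⟩
    (by decide) (by decide)
    (fun g τ hg hS ⟨K, hlab, htK, hK, hor⟩ => by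
      have hE : Env N n k s (τ.setVar vG g) := (h.same hS rfl).setVar _ _ (by decide)
      have f1 : mat (N + 1) ((τ.setVar vG g).arr aCUR) = c := by
        rw [← hc, arr_setVar, hS.2 _ rfl]
      have f2 : ∀ v, (τ.setVar vG g).arr aBASE v = 0 := by
        rw [arr_setVar, hS.2 _ rfl]; exact hbase
      have f3 : (τ.setVar vG g).var vP = p := by
        rw [var_setVar, if_neg (by decide), hS.1 _ rfl]; exact hp
      have f4 : (τ.setVar vG g).var vLO = p := by
        rw [var_setVar, if_neg (by decide), hS.1 _ rfl]; exact hlo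
      have f5 : (τ.setVar vG g).var vGO = τ.var vGO := by simp
      have f6 : (τ.setVar vG g).var vPA = τ.var vPA := by simp
      have f7 : (τ.setVar vG g).var vPB = τ.var vPB := by simp
      have f8 : (τ.setVar vG g).arr aLAB = _ := hlab
      rcases hor with ⟨h1, h2, h3, h4⟩ | ⟨h1, h2, h3, h4, h5, h6⟩
      · refine ⟨_, Ang.cond_false rfl ?_ (Ang.skip _), K, f8, htK, hK, Or.inl ⟨?_, h2, ?_, ?_⟩⟩
        · simpa using h1
        · rw [f5, h1]
        · rw [f6]; exact h3
        · rw [f7]; exact h4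
      · generalize τ.setVar vG g = α at *
        have hwK : wt n K ≤ wt n {v | Conn N c D t v} := wt_mono fun v _ hv => hK v hv
        by_cases hKe : K = {v | Conn N c D t v}
        · have hA1 := ang_getBit (r := 2 * (k + 1)) (x := vGO) (d := 0) (by decide) (by decide)
            (by omega) α
          refine ⟨_, Ang.cond_true rfl ?_ (hA1.seq (Ang.cond_false rfl ?_ (Ang.skip _))), K, f8, htK,
            hK, Or.inl ⟨?_, hKe, ?_, ?_⟩⟩
          · simp only [Expr.eval, f5]; exact h1
          · simp
          · simp
          · simp [f6]; omega
          · simp [f7]; omega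
        · obtain ⟨x, hx, hxK⟩ : ∃ x, Conn N c D t x ∧ x ∉ K := by
            by_contra hno
            push Not at hno
            exact hKe (Set.Subset.antisymm hK hno)
          have hA1 := ang_getBit (r := 2 * (k + 1)) (x := vGO) (d := 1) (by decide) (by decide)
            (by omega) α
          have hEβ := hE.same hA1.1 rfl
          have hgo1 : ((α.setVar vGO 1).setVar vPB (α.var vPB + 1)).var vGO = 1 := by simp
          obtain ⟨w, ρ, hw, hcw, hwK', hA2, hl2, hpa, hpb⟩ := growStep_spec hEβ hN (c := c) (D := D)
            (by simpa using f1) hcost (by simpa using f2) (p := p) (by simpa using f3)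
            (by simpa using f4) (K := K) (L := L) (by simpa using f8) hL htK
            (fun v hv => hlt v (hK v hv)) hK hx hxK
          have hgo : ρ.var vGO = 1 := by rw [hA2.1.1 _ rfl, hgo1]
          refine ⟨ρ, Ang.cond_true rfl ?_ (hA1.seq (Ang.cond_true rfl ?_ hA2)), K ∪ {w, twin N n w},
            hl2.trans (funext fun v => by congr), Or.inl htK, ?_, Or.inr ⟨by omega, ?_, ?_, h4, ?_, ?_⟩⟩
          · simp only [Expr.eval, f5]; exact h1
          · simp only [Expr.eval, hgo1]; decide
          · rintro v (hv | rfl | rfl)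
            · exact hK v hv
            · exact hcw
            · exact h4 _ hcw
          · have := wt_add_twin hN hw hwK' h3; omega
          · rintro v (hv | rfl | rfl)
            · exact Or.inl (h3 v hv)
            · simp
            · rw [twin_twin hN hw]; simp
          · rw [hpa]; simp [f6]; omega
          · rw [hpb]; simp [f7]; omega)
  obtain ⟨K', h1, h2, h3, h4⟩ := hI
  refine ⟨_, hA, ?_, ?_⟩
  -- The loop is long enough: a class still growing after `N` rounds would have weight above `n`.
  · rcases h4 with ⟨-, h5, -⟩ | ⟨-, h5, -⟩
    · rw [arr_setVar, h1, h5]; rfl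
    · have := wt_le (n := n) (K := K')
      rw [h.N_eq] at h5
      rcases hN with h | h <;> omega
  · rcases h4 with ⟨-, -, h5⟩ | ⟨-, h5, -⟩
    · simpa using h5
    · have := wt_le (n := n) (K := K')
      rw [h.N_eq] at h5
      rcases hN with h | h <;> omega

/-- One index for the number of the class is added to the `s - 1` for its growth, and one bit for
the twin of `t` to the `s` others; `1 ≤ s` makes this at most `2 * s` bits. -/
theorem classRun_spec (h : Env N n k s σ) (hN : SplitSize N n) {c : ℕ → ℕ → ℕ} {D : ℕ → ℕ → Prop}
    (hc : mat (N + 1) (σ.arr aCUR) = c) (htw : TwinArcs N n c) (hcost : cost N c D ≤ k)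
    (hbase : ∀ v, σ.arr aBASE v = 0) {p : ℕ} (hp1 : 1 ≤ p) (hpk : p ≤ k + 1) {L : ℕ → ℕ}
    (hlab : σ.arr aLAB = L) (hL : ∀ v, L v ≠ p) {t : ℕ} (ht : t < N) (htv : σ.var vT = t) (hs : 1 ≤ s)
    (hws : wt n {v | Conn N c D t v} ≤ s) :
    ∃ ρ, Ang (2 * (k + 1)) (getIdx vD ;; startClass ;; growLoop) σ ρ ∧
      (ρ.arr aLAB = fun v => if Conn N c D t v then p else L v) ∧
      ρ.var vPA ≤ σ.var vPA + s ∧ ρ.var vPB ≤ σ.var vPB + 2 * s := by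
  -- `startClass` adds one to the digit, so the number `p` is encoded as `p - 1`.
  have hA1 := ang_getIdx (r := 2 * (k + 1)) (x := vD) (d := p - 1) (by decide) (by decide)
    (by omega) σ
  have hEα := h.same hA1.1 rfl
  have a1 : ((σ.setVar vD (p - 1)).setVar vPA (σ.var vPA + 1)).var vPA = σ.var vPA + 1 := by simp
  have a2 : ((σ.setVar vD (p - 1)).setVar vPA (σ.var vPA + 1)).var vPB = σ.var vPB := by simp
  have a3 : ((σ.setVar vD (p - 1)).setVar vPA (σ.var vPA + 1)).var vT = t := by simpa using htv
  have a4 : ((σ.setVar vD (p - 1)).setVar vPA (σ.var vPA + 1)).var vD = p - 1 := by simp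
  have a5 : ((σ.setVar vD (p - 1)).setVar vPA (σ.var vPA + 1)).arr = σ.arr := by simp
  generalize (σ.setVar vD (p - 1)).setVar vPA (σ.var vPA + 1) = α at *
  set ini := (assign vP (.add (.var vD) (.const 1)) ;; assign vLO (.var vP) ;;
    write aLAB (.var vT) (.var vP)) with hini
  have hA2 : Ang (2 * (k + 1)) ini α (ini.exec α) := Ang.of_noDig rfl rfl rfl α
  have htsz := hEα.lt_sz (ht.trans (Nat.lt_succ_self N))
  have hexi : ini.exec α = ((α.setVar vP p).setVar vLO p).setArr aLAB t p := by
    have : p - 1 + 1 = p := by omega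
    simp [hini, a4, a3, this, htsz]
  have hEβ : Env N n k s (ini.exec α) := hEα.same hA2.1 rfl
  have b0 : ∀ a, a ≠ aLAB → (ini.exec α).arr a = σ.arr a := fun a ha => by
    rw [hexi, arr_setArr, if_neg ha, arr_setVar, arr_setVar, a5]
  have b1 : (ini.exec α).var vPA = σ.var vPA + 1 := by rw [hexi]; simpa using a1
  have b2 : (ini.exec α).var vPB = σ.var vPB := by rw [hexi]; simpa using a2
  have b3 : (ini.exec α).var vT = t := by rw [hexi]; simpa using a3
  have b4 : (ini.exec α).var vP = p := by rw [hexi]; simp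
  have b5 : (ini.exec α).var vLO = p := by rw [hexi]; simp
  have b6 : (ini.exec α).arr aLAB = Function.update L t p := by
    rw [hexi, arr_setArr, if_pos rfl]; simp [a5, hlab]
  generalize ini.exec α = β at *
  -- A component of one vertex need not contain the twin, so the twin is added on demand of a bit
  -- only. All larger components are closed under twins.
  by_cases htriv : ∀ x, Conn N c D t x → x = t
  · have hA3 := ang_getBit (r := 2 * (k + 1)) (x := vGO) (d := 0) (by decide) (by decide)
      (by omega) β
    have hEγ := hEβ.same hA3.1 rfl
    obtain ⟨ρ, hA4, hl, hpa, hpb⟩ := growLoop_spec (K := {t}) (L := L) (c := c) (D := D) (p := p) (t := t)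
      hEγ hN (by simpa [b0] using hc)
      hcost (by simpa [b0] using hbase) (by simpa using b4) (by simpa using b5)
      (by
        simp only [arr_setVar, b6]; funext y
        by_cases hy : y = t <;> simp [hy]) hL ht rfl
      (by rintro v rfl; exact Conn.refl v) hs hws (Or.inl ⟨by simp, by
        ext v; exact ⟨by rintro rfl; exact Conn.refl v, fun hv => htriv v hv⟩⟩)
    refine ⟨ρ, hA1.seq (Ang.seq (hA2.seq (hA3.seq (Ang.cond_false rfl (by simp) (Ang.skip _)))) hA4),
      hl, ?_, ?_⟩
    · simp [b1] at hpa; omega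
    · simp [b2] at hpb; omega
  · push Not at htriv
    obtain ⟨x, hx, hxt⟩ := htriv
    have hcl : ∀ v, Conn N c D t v → Conn N c D t (twin N n v) := fun v hv =>
      htw.conn ht hx hxt hv
    have hA3 := ang_getBit (r := 2 * (k + 1)) (x := vGO) (d := 1) (by decide) (by decide)
      (by omega) β
    have hEγ := hEβ.same hA3.1 rfl
    have g1 : ((β.setVar vGO 1).setVar vPB (β.var vPB + 1)).var vPA = σ.var vPA + 1 := by simpa using b1
    have g2 : ((β.setVar vGO 1).setVar vPB (β.var vPB + 1)).var vPB = σ.var vPB + 1 := by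
      simpa using b2
    have g3 : ((β.setVar vGO 1).setVar vPB (β.var vPB + 1)).var vT = t := by simpa using b3
    have g4 : ((β.setVar vGO 1).setVar vPB (β.var vPB + 1)).var vP = p := by simpa using b4
    have g5 : ((β.setVar vGO 1).setVar vPB (β.var vPB + 1)).var vLO = p := by simpa using b5
    have g6 : ((β.setVar vGO 1).setVar vPB (β.var vPB + 1)).var vGO = 1 := by simp
    have g7 : ((β.setVar vGO 1).setVar vPB (β.var vPB + 1)).arr = β.arr := by simp
    generalize (β.setVar vGO 1).setVar vPB (β.var vPB + 1) = γ at *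
    have hA4 : Ang (2 * (k + 1)) (labelTwin vT) γ ((labelTwin vT).exec γ) :=
      Ang.of_noDig rfl rfl rfl γ
    have hEδ : Env N n k s ((labelTwin vT).exec γ) := hEγ.same hA4.1 rfl
    have hex := exec_labelTwin hEγ hN (x := vT) (by omega)
    rw [g3, g4] at hex
    obtain ⟨ρ, hA5, hl, hpa, hpb⟩ := growLoop_spec (K := {t, twin N n t}) (L := L) (c := c) (D := D)
      (p := p) (t := t) hEδ hN (by simpa [hex, g7, b0] using hc)
      hcost (by simpa [hex, g7, b0] using hbase) (by simpa [hex] using g4) (by simpa [hex] using g5)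
      (by
        simp only [hex, arr_setArr, if_true, g7, b6]; funext y
        simp only [Function.update_apply, Set.mem_insert_iff, Set.mem_singleton_iff]
        by_cases hy : y = t <;> by_cases hy' : y = twin N n t <;> simp [hy, hy']) hL ht (by simp)
      (by
        rintro v (rfl | rfl)
        · exact Conn.refl v
        · exact hcl _ (Conn.refl t)) hs hws (Or.inr ⟨by rw [hex, var_setArr, g6]; decide, by
        have := wt_add_twin hN (K := ∅) ht (by simp) (by simp)
        rw [Set.empty_union] at this; omega, by
        rintro v (rfl | rfl)
        · simp
        · rw [twin_twin hN ht]; simp, hcl⟩)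
    refine ⟨ρ, hA1.seq (Ang.seq (hA2.seq (hA3.seq (Ang.cond_true rfl ?_ hA4))) hA5), hl, ?_, ?_⟩
    · simp [g6]
    · simp [hex, g1] at hpa; omega
    · simp [hex, g2] at hpb; omega

theorem labelling_spec (h : Env N n k s σ) (hN : SplitSize N n) {c : ℕ → ℕ → ℕ} {D : ℕ → ℕ → Prop}
    (hc : mat (N + 1) (σ.arr aCUR) = c) (htw : TwinArcs N n c) (hcost : cost N c D ≤ k)
    (hsm : SmallComps N n s c D) (hbase : ∀ v, σ.arr aBASE v = 0) (hlab0 : ∀ v, σ.arr aLAB v = 0)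
    {lab : ℕ → ℕ} (hlab : Labels N c D (σ.arr aTERM · ≠ 0) lab) (hle : ∀ v < N, lab v ≤ k + 1)
    (hs : 1 ≤ s) (hT : ((range N).filter (σ.arr aTERM · ≠ 0)).card ≤ k + 1) :
    ∃ ρ, Ang (2 * (k + 1)) labelling σ ρ ∧
      (∀ v, ρ.arr aLAB v = if v < N then lab v else 0) ∧
      ρ.var vPA ≤ σ.var vPA + (k + 1) * s ∧ ρ.var vPB ≤ σ.var vPB + 2 * ((k + 1) * s) := by
  -- The classes of the terminals seen so far carry their labels, and the advice consumed is charged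
  -- to these terminals, `s` indices and `2 * s` bits for each.
  obtain ⟨τ, ⟨hI1, hI2, hI3⟩, hS, hA⟩ := ang_loop (r := 2 * (k + 1)) (x := vT) (b := vN)
    (p := classBody) (σ := σ)
    (fun i τ => (∀ v, τ.arr aLAB v =
        if ∃ t < i, t < N ∧ σ.arr aTERM t ≠ 0 ∧ Conn N c D t v then lab v else 0) ∧
      τ.var vPA ≤ σ.var vPA + ((range i).filter (σ.arr aTERM · ≠ 0)).card * s ∧
      τ.var vPB ≤ σ.var vPB + 2 * (((range i).filter (σ.arr aTERM · ≠ 0)).card * s))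
    ⟨fun v => by simpa using hlab0 v, by simp, by simp⟩ (by decide) (by decide)
    (fun t τ ht hS ⟨hI1, hI2, hI3⟩ => by
      rw [h.N_eq] at ht
      have hE : Env N n k s (τ.setVar vT t) := (h.same hS rfl).setVar _ _ (by decide)
      have f1 : mat (N + 1) ((τ.setVar vT t).arr aCUR) = c := by
        rw [← hc, arr_setVar, hS.2 _ rfl]
      have f2 : ∀ v, (τ.setVar vT t).arr aBASE v = 0 := by
        rw [arr_setVar, hS.2 _ rfl]; exact hbase
      have f3 : (τ.setVar vT t).arr aTERM = σ.arr aTERM := by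
        rw [arr_setVar, hS.2 _ rfl]
      have f4 : (τ.setVar vT t).var vT = t := by simp
      have f5 : (τ.setVar vT t).arr aLAB = τ.arr aLAB := by simp
      have f6 : (τ.setVar vT t).var vPA = τ.var vPA := by simp
      have f7 : (τ.setVar vT t).var vPB = τ.var vPB := by simp
      generalize τ.setVar vT t = α at *
      have hex : ∀ v, (∃ t' < t + 1, t' < N ∧ σ.arr aTERM t' ≠ 0 ∧ Conn N c D t' v) ↔
          (∃ t' < t, t' < N ∧ σ.arr aTERM t' ≠ 0 ∧ Conn N c D t' v) ∨
            (σ.arr aTERM t ≠ 0 ∧ Conn N c D t v) := by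
        intro v
        constructor
        · rintro ⟨t', h1, h2⟩
          rcases Nat.lt_succ_iff_lt_or_eq.1 h1 with h3 | rfl
          · exact Or.inl ⟨t', h3, h2⟩
          · exact Or.inr h2.2
        · rintro (⟨t', h1, h2⟩ | h2)
          · exact ⟨t', by omega, h2⟩
          · exact ⟨t, by omega, ht, h2⟩
      have hcard : ((range t).filter (σ.arr aTERM · ≠ 0)).card ≤
          ((range (t + 1)).filter (σ.arr aTERM · ≠ 0)).card :=
        card_le_card (filter_subset_filter _ (range_mono (by omega)))
      have hcs := Nat.mul_le_mul_right s hcard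
      by_cases c1 : σ.arr aTERM t = 0
      · refine ⟨α, Ang.cond_false rfl (by simp [f3, f4, c1]) (Ang.skip _), fun v => ?_, by omega,
          by omega⟩
        rw [f5, hI1 v]
        simp only [hex v, c1, ne_eq, not_true_eq_false, false_and, or_false]
      have hcn : (∀ v < N, Conn N c D t v → lab v = lab t) := fun v hv hcv =>
        (hlab.congr t ht v hv hcv).symm
      have hpt : 0 < lab t := (hlab.pos t ht).2 ⟨t, ht, c1, Conn.refl t⟩
      by_cases c2 : τ.arr aLAB t = 0
      swap
      · refine ⟨α, Ang.cond_true rfl (by simp [f3, f4, c1])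
          (Ang.cond_true rfl (by simp [f4, f5, c2]) (Ang.skip _)), fun v => ?_, by omega, by omega⟩
        rw [f5, hI1 v]
        have c3 : ∃ t' < t, t' < N ∧ σ.arr aTERM t' ≠ 0 ∧ Conn N c D t' t := by
          by_contra h'; exact c2 (by rw [hI1 t, if_neg h'])
        obtain ⟨t', h1, h2, h3, h4⟩ := c3
        have : (∃ t' < t + 1, t' < N ∧ σ.arr aTERM t' ≠ 0 ∧ Conn N c D t' v) ↔
            (∃ t' < t, t' < N ∧ σ.arr aTERM t' ≠ 0 ∧ Conn N c D t' v) := by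
          rw [hex v]
          exact ⟨fun h => h.elim id fun h => ⟨t', h1, h2, h3, h4.trans h.2⟩, Or.inl⟩
        simp only [this]
      -- The number of the class of `t` is still unused: a vertex that carried it would lie in the
      -- same component, and then `t` would be labelled.
      · have hLne : ∀ v, τ.arr aLAB v ≠ lab t := by
          intro v hv
          rw [hI1 v] at hv
          split at hv
          · rename_i hex'
            obtain ⟨t', h1, h2, h3, h4⟩ := hex'
            have hvN := h4.1.lt h2
            have h5 := hlab.conn v hvN t ht (by omega) hv
            have : τ.arr aLAB t = lab t := by
              rw [hI1 t, if_pos ⟨t', h1, h2, h3, h4.trans h5⟩]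
            omega
          · omega
        obtain ⟨ρ, hA, hl, hpa, hpb⟩ := classRun_spec hE hN f1 htw hcost f2 hpt (hle t ht) f5 hLne ht f4
          hs (hsm t ht)
        have hcard' : ((range (t + 1)).filter (σ.arr aTERM · ≠ 0)).card =
            ((range t).filter (σ.arr aTERM · ≠ 0)).card + 1 := by
          rw [range_add_one, filter_insert, if_pos c1, card_insert_of_notMem (by simp)]
        refine ⟨ρ, Ang.cond_true rfl (by simp [f3, f4, c1])
          (Ang.cond_false rfl (by simp [f4, f5, c2]) hA), fun v => ?_, ?_, ?_⟩
        · rw [hl]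
          simp only [hI1 v, hex v]
          by_cases h3 : Conn N c D t v
          · have := hcn v (h3.1.lt ht) h3
            simp [h3, c1, this]
          · simp [h3]
        · rw [hcard', add_mul]; omega
        · rw [hcard', add_mul]; omega)
  rw [h.N_eq] at hI1 hI2 hI3
  have hcs := Nat.mul_le_mul_right s hT
  refine ⟨_, hA, fun v => ?_, by simp; omega, by simp; omega⟩
  rw [arr_setVar, hI1 v]
  by_cases hv : v < N
  · rw [if_pos hv]
    have := hlab.pos v hv
    split
    · rfl
    · rename_i h1
      by_contra h2
      obtain ⟨t, ht, h3, h4⟩ := this.1 (by omega)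
      exact h1 ⟨t, ht, ht, h3, h4⟩
  · rw [if_neg hv, if_neg]
    rintro ⟨t, h1, h2, h3, h4⟩
    exact hv (h4.1.lt h2)

/-! ## Crossing arcs -/

def pickBody : Cmd :=
  cond (.read aMARK (.var vU)) skip (cond (.read aMARK (.var vV)) (cond (rd aNET vU vV)
    (assign vSU (.var vU) ;; assign vSV (.var vV)) skip) skip)

/-- Find an arc of the network that leaves the set of unmarked vertices. -/
def pick : Cmd := loop vU vM (loop vV vM pickBody)

/-- The scan keeps the last such arc; the branching works for any of them. -/
theorem pick_spec (h : Env N n k s σ) {net : ℕ → ℕ → ℕ} {mark : ℕ → ℕ}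
    (hnet : ∀ u < N + 1, ∀ v < N + 1, mat (N + 1) (σ.arr aNET) u v = net u v)
    (hm : σ.arr aMARK = mark) {u v : ℕ} (hu : u < N + 1) (hv : v < N + 1) (hmu : mark u = 0)
    (hmv : mark v ≠ 0) (huv : 0 < net u v) :
    (pick.exec σ).var vSU < N + 1 ∧ (pick.exec σ).var vSV < N + 1 ∧
      mark ((pick.exec σ).var vSU) = 0 ∧ mark ((pick.exec σ).var vSV) ≠ 0 ∧
      0 < net ((pick.exec σ).var vSU) ((pick.exec σ).var vSV) := by
  have key := loop2_rule (x := vU) (y := vV) (b := vM) (d := vM) (p := pickBody) (σ := σ)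
    (fun i j τ => (∃ u < N + 1, ∃ v < N + 1, (u < i ∨ (u = i ∧ v < j)) ∧ mark u = 0 ∧ mark v ≠ 0 ∧
        0 < net u v) →
      (τ.var vSU < N + 1 ∧ τ.var vSV < N + 1 ∧ mark (τ.var vSU) = 0 ∧ mark (τ.var vSV) ≠ 0 ∧
        0 < net (τ.var vSU) (τ.var vSV)))
    rfl (by decide) (by decide) (by decide) rfl
    (fun i j τ z v hz hI => by
      have h1 : (vSU : ℕ) ≠ z := by rcases hz with rfl | rfl <;> decide
      have h2 : (vSV : ℕ) ≠ z := by rcases hz with rfl | rfl <;> decide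
      simpa [h1, h2] using hI)
    (by rintro ⟨u, _, v, _, h, _⟩; omega)
    (fun i τ hi hI ⟨u, hu, v, hv, h1, h2⟩ => hI ⟨u, hu, v, hv, by rw [h.M_eq]; omega, h2⟩)
    (fun i j τ hi hj hS hx hy hI => by
      rw [h.M_eq] at hi hj
      have hE : Env N n k s τ := h.same hS rfl
      have e1 : τ.arr aMARK = mark := by rw [← hm]; exact hS.2 _ rfl
      have e2 : mat (N + 1) (τ.arr aNET) i j = net i j := by
        rw [hS.2 aNET rfl]; exact hnet i hi j hj
      have e3 : (rd aNET vU vV).eval τ = net i j := by rw [eval_rd hE (by omega), hx, hy, e2]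
      rintro ⟨u, hu, v, hv, h1, h2⟩
      have hex : pickBody.exec τ = if mark i = 0 ∧ mark j ≠ 0 ∧ 0 < net i j then
          (τ.setVar vSU i).setVar vSV j else τ := by
        simp only [pickBody, exec_cond, e3, Expr.eval, hx, hy, e1, exec_skip, exec_seq, exec_assign,
          var_setVar, show (vV : ℕ) ≠ vSU by decide, if_false]
        by_cases c1 : mark i = 0 <;> by_cases c2 : mark j = 0 <;> by_cases c3 : net i j = 0 <;>
          simp [c1, c2, c3, Nat.pos_iff_ne_zero]
      rw [hex]
      by_cases c : mark i = 0 ∧ mark j ≠ 0 ∧ 0 < net i j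
      · rw [if_pos c]; simpa using ⟨by omega, by omega, c⟩
      · rw [if_neg c]
        refine hI ⟨u, hu, v, hv, ?_, h2⟩
        by_contra h3
        have : u = i ∧ v = j := by omega
        obtain ⟨rfl, rfl⟩ := this
        exact c h2)
  rw [h.M_eq] at key
  exact key ⟨u, hu, v, hv, by omega, hmu, hmv, huv⟩

def deleteBody : Cmd := wr aCUR vX vSV (.const 0) ;; wr aDNEW vX vSV (.const 1)

/-- Delete the arcs that are represented by the arc `(vSU, vSV)` of the network. -/
def deleteArc : Cmd :=
  loop vX vN (cond (neq (.var vX) (.var vSU)) (cond (.sub (.var vN) (.var vSU))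
    skip (cond (neq (.read aLAB (.var vX)) (.var vP)) skip deleteBody)) deleteBody)

theorem deleteArc_spec (h : Env N n k s σ) {u w p : ℕ} (hu : σ.var vSU = u) (hw : σ.var vSV = w)
    (hp : σ.var vP = p) (huN : u < N + 1) (hwN : w < N + 1) (x y : ℕ) (hy : y < N + 1) :
    (mat (N + 1) ((deleteArc.exec σ).arr aCUR) x y =
      if x < N ∧ Pre N (σ.arr aLAB) p u w x y then 0 else mat (N + 1) (σ.arr aCUR) x y) ∧
    (mat (N + 1) ((deleteArc.exec σ).arr aDNEW) x y =
      if x < N ∧ Pre N (σ.arr aLAB) p u w x y then 1 else mat (N + 1) (σ.arr aDNEW) x y) := by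
  obtain ⟨τ, h1, h2, h3⟩ := loop_rule (x := vX) (b := vN)
    (p := cond (neq (.var vX) (.var vSU)) (cond (.sub (.var vN) (.var vSU))
      skip (cond (neq (.read aLAB (.var vX)) (.var vP)) skip deleteBody)) deleteBody) (σ := σ)
    (fun i τ => ∀ x y, y < N + 1 → (mat (N + 1) (τ.arr aCUR) x y =
      if x < i ∧ Pre N (σ.arr aLAB) p u w x y then 0 else mat (N + 1) (σ.arr aCUR) x y) ∧
    (mat (N + 1) (τ.arr aDNEW) x y =
      if x < i ∧ Pre N (σ.arr aLAB) p u w x y then 1 else mat (N + 1) (σ.arr aDNEW) x y))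
    (by simp) (fun i τ hi hS hI x y hy => by
      rw [h.N_eq] at hi
      have hE : Env N n k s (τ.setVar vX i) := (h.same hS rfl).setVar _ _ (by decide)
      have a1 : (τ.setVar vX i).arr aLAB = σ.arr aLAB := by rw [arr_setVar, hS.2 _ rfl]
      have a2 : (τ.setVar vX i).var vSU = u := by
        rw [var_setVar, if_neg (by decide), hS.1 _ rfl, hu]
      have a3 : (τ.setVar vX i).var vSV = w := by
        rw [var_setVar, if_neg (by decide), hS.1 _ rfl, hw]
      have a4 : (τ.setVar vX i).var vP = p := by
        rw [var_setVar, if_neg (by decide), hS.1 _ rfl, hp]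
      have a5 : (τ.setVar vX i).var vX = i := by simp
      have a6 : (τ.setVar vX i).arr = τ.arr := by simp
      generalize τ.setVar vX i = α at *
      have hdel : deleteBody.exec α =
          (α.setArr aCUR (i * (N + 1) + w) 0).setArr aDNEW (i * (N + 1) + w) 1 := by
        have e1 : (wr aCUR vX vSV (.const 0)).exec α = α.setArr aCUR (i * (N + 1) + w) 0 := by
          rw [exec_wr hE (by omega) (by omega), a5, a3]; rfl
        have hE' : Env N n k s (α.setArr aCUR (i * (N + 1) + w) 0) := by
          rw [← e1]; exact hE.same (same_exec _ _) rfl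
        simp only [deleteBody, exec_seq, e1]
        rw [exec_wr hE' (by rw [var_setArr]; omega) (by rw [var_setArr]; omega), var_setArr, a5, a3]
        rfl
      have hex : (cond (neq (.var vX) (.var vSU)) (cond (.sub (.var vN) (.var vSU))
          skip (cond (neq (.read aLAB (.var vX)) (.var vP)) skip deleteBody)) deleteBody).exec α =
          if i = u ∨ (u = N ∧ σ.arr aLAB i = p) then deleteBody.exec α else α := by
        generalize deleteBody = q
        simp only [exec_cond, eval_neq]
        simp only [Expr.eval, exec_skip, a1, a2, a4, a5, hE.N_eq]
        by_cases c1 : i = u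
        · simp [c1]
        · by_cases c2 : u = N
          · by_cases c3 : σ.arr aLAB i = p <;> simp [c2, c3]
          · have : N - u ≠ 0 := by omega
            simp [c1, c2, this]
      rw [hex]
      obtain ⟨g1, g2⟩ := hI x y hy
      by_cases c : i = u ∨ (u = N ∧ σ.arr aLAB i = p)
      · rw [if_pos c, hdel]
        simp only [arr_setArr, if_true, show (aCUR : ℕ) ≠ aDNEW by decide,
          show (aDNEW : ℕ) ≠ aCUR by decide, if_false, a6]
        rw [mat_update _ _ hwN hy, mat_update _ _ hwN hy, g1, g2]
        by_cases c1 : x = i ∧ y = w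
        · obtain ⟨rfl, rfl⟩ := c1
          have : Pre N (σ.arr aLAB) p u y x y := ⟨rfl, c⟩
          simp [this]
        · have : (x < i + 1 ∧ Pre N (σ.arr aLAB) p u w x y) ↔
              (x < i ∧ Pre N (σ.arr aLAB) p u w x y) :=
            ⟨fun h => ⟨by have := h.2.1; omega, h.2⟩, fun h => ⟨by omega, h.2⟩⟩
          simp only [this, c1, if_false, and_self]
      · rw [if_neg c, a6, g1, g2]
        have : (x < i + 1 ∧ Pre N (σ.arr aLAB) p u w x y) ↔
            (x < i ∧ Pre N (σ.arr aLAB) p u w x y) := by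
          refine ⟨fun h => ⟨?_, h.2⟩, fun h => ⟨by omega, h.2⟩⟩
          have : x ≠ i := by rintro rfl; exact c h.2.2
          omega
        simp only [this, and_self])
  have := h1 x y hy
  rw [h.N_eq] at this
  have e : (deleteArc.exec σ).arr = τ.arr := by unfold deleteArc; rw [h3, arr_setVar]
  rw [e]; exact this

/-- Make the unmarked vertices and the head of the crossing arc sources. -/
def pushSources : Cmd :=
  loop vX vN (cond (.read aMARK (.var vX)) skip (write aBASE (.var vX) (.const 1))) ;;
    write aBASE (.var vSV) (.const 1)

theorem pushSources_spec (h : Env N n k s σ) {w : ℕ} (hw : σ.var vSV = w) (hwN : w < N + 1) :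
    {v | (pushSources.exec σ).arr aBASE v ≠ 0} =
      ({v | σ.arr aBASE v ≠ 0} ∪ {v | v < N ∧ σ.arr aMARK v = 0}) ∪ {w} := by
  simp only [pushSources, exec_seq]
  obtain ⟨τ, h1, h2, h3⟩ := loop_rule (x := vX) (b := vN)
    (p := cond (.read aMARK (.var vX)) skip (write aBASE (.var vX) (.const 1))) (σ := σ)
    (fun i τ => ∀ v, τ.arr aBASE v ≠ 0 ↔ σ.arr aBASE v ≠ 0 ∨ (v < i ∧ σ.arr aMARK v = 0))
    (by simp) (fun i τ hi hS hI v => by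
      rw [h.N_eq] at hi
      have hE : Env N n k s τ := h.same hS rfl
      have := hE.lt_sz (show i < N + 1 by omega)
      have e : τ.arr aMARK = σ.arr aMARK := hS.2 _ rfl
      simp only [exec_cond, Expr.eval, exec_write, exec_skip, var_setVar, if_true, arr_setVar, e,
        show (vSZ : ℕ) ≠ vX by decide, if_false, this]
      by_cases c : σ.arr aMARK i = 0
      · rw [if_pos c, arr_setArr, if_pos rfl, Function.update_apply, arr_setVar]
        by_cases hv : v = i
        · subst hv; simp [c]
        · rw [if_neg hv, hI v]
          have : v < i + 1 ↔ v < i := by omega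
          rw [this]
      · rw [if_neg c, arr_setVar, hI v]
        have : (v < i + 1 ∧ σ.arr aMARK v = 0) ↔ (v < i ∧ σ.arr aMARK v = 0) := by
          refine ⟨fun h => ⟨?_, h.2⟩, fun h => ⟨by omega, h.2⟩⟩
          have : v ≠ i := by rintro rfl; exact c h.2
          omega
        rw [this])
  rw [h3]
  have hE : Env N n k s τ := h.same h2 rfl
  have := hE.lt_sz hwN
  have e : τ.var vSV = w := by rw [← hw]; exact h2.1 _ rfl
  ext v
  simp only [exec_write, Expr.eval, var_setVar, show (vSV : ℕ) ≠ vX by decide,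
    show (vSZ : ℕ) ≠ vX by decide, if_false, e, this, if_true, arr_setArr, arr_setVar,
    Set.mem_ofPred_eq, Function.update_apply, Set.mem_union, Set.mem_singleton_iff]
  by_cases hv : v = w
  · simp [hv]
  · rw [if_neg hv, h1 v, h.N_eq]; simp [hv]

/-! ## Separating the classes -/

theorem netcap_congr {c c' : ℕ → ℕ → ℕ} (h : ∀ u < N, ∀ v < N, c u v = c' u v) (K : Set ℕ) :
    netcap N c K = netcap N c' K := by
  funext u v
  unfold netcap
  by_cases hv : v < N
  · by_cases hu : u < N
    · simp [hv, hu, h u hu v hv]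
    · have : ∑ x ∈ range N, (if x ∈ K then c x v else 0) = ∑ x ∈ range N, if x ∈ K then c' x v else 0 :=
        sum_congr rfl fun x hx => by rw [h x (mem_range.1 hx) v hv]
      simp [hv, hu, this]
  · simp [hv]

theorem cost_congr {c c' : ℕ → ℕ → ℕ} {D D' : ℕ → ℕ → Prop}
    (h : ∀ u < N, ∀ v < N, c u v = c' u v) (hD : ∀ u < N, ∀ v < N, D u v ↔ D' u v) :
    cost N c D = cost N c' D' :=
  dsum_congr fun u hu v hv => by rw [h u hu v hv]; simp only [hD u hu v hv]

theorem Valid.congr {c c' : ℕ → ℕ → ℕ} {lab : ℕ → ℕ} {p κ : ℕ} {B0 : Set ℕ}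
    (h : Valid N c lab p B0 κ) (hc : ∀ u < N, ∀ v < N, c u v = c' u v) : Valid N c' lab p B0 κ := by
  obtain ⟨D, Bs, h1, h2, h3⟩ := h
  refine ⟨D, Bs, by rwa [← cost_congr hc fun _ _ _ _ => Iff.rfl], h2, fun j hj hj' =>
    ⟨(h3 j hj hj').1, fun u hu v hv h4 h5 => (h3 j hj hj').2 u hu v hv h4 ?_⟩⟩
  rwa [hc u hu v hv]

theorem Labels.of_eq {c : ℕ → ℕ → ℕ} {D : ℕ → ℕ → Prop} {T : ℕ → Prop} {lab lab' : ℕ → ℕ}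
    (h : Labels N c D T lab) (he : ∀ v < N, lab' v = lab v) : Labels N c D T lab' := by
  refine ⟨fun v hv => by rw [he v hv]; exact h.pos v hv, fun u hu v hv => ?_, fun u hu v hv => ?_,
    fun u hu v hv => ?_⟩
  · rw [he u hu, he v hv]; exact h.conn u hu v hv
  · rw [he u hu, he v hv]; exact h.congr u hu v hv
  · rw [he u hu, he v hv]; exact h.lt u hu v hv

/-- No arcs lead from class `p` to itself or to smaller classes except within the class. -/
def Closed (N : ℕ) (c : ℕ → ℕ → ℕ) (lab : ℕ → ℕ) (p : ℕ) : Prop :=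
  ∃ B : Set ℕ, (∀ v < N, v ∈ B → lab v = 0 ∨ p < lab v) ∧
    ∀ u < N, ∀ v < N, Cross B {x | lab x = p} u v → c u v = 0

theorem Closed.mono {c c' : ℕ → ℕ → ℕ} {lab : ℕ → ℕ} {p : ℕ} (h : Closed N c lab p)
    (hc : ∀ u < N, ∀ v < N, c' u v ≤ c u v) : Closed N c' lab p := by
  obtain ⟨B, h1, h2⟩ := h
  refine ⟨B, h1, fun u hu v hv h3 => ?_⟩
  have := h2 u hu v hv h3
  have := hc u hu v hv
  omega

/-! ### The potential of the branching -/

/-- The state of the separation of class `p`: arcs of capacity `κ` remain to be deleted, all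
cuts have capacity at least `μ`, and `used` bits have been read. -/
structure Progress (N k : ℕ) (c0 c : ℕ → ℕ → ℕ) (Dn : ℕ → ℕ → Prop) (lab : ℕ → ℕ) (p : ℕ)
    (B0 : Set ℕ) (κ μ used : ℕ) : Prop where
  agree : ∀ x < N, ∀ y < N, c x y = if Dn x y then 0 else c0 x y
  cost_le : cost N c0 Dn + κ ≤ k
  valid : Valid N c lab p B0 κ
  cut_ge : ∀ R : Set ℕ, srcs N B0 ⊆ R → (∀ v < N + 1, v ∈ snks N lab 1 p → v ∉ R) →
    μ ≤ cut (N + 1) (netcap N c {x | lab x = p}) R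
  used_le : used + 2 * κ ≤ 2 * k + μ

namespace Progress

variable {c0 c r : ℕ → ℕ → ℕ} {Dn : ℕ → ℕ → Prop} {lab mark : ℕ → ℕ} {p κ μ used lam u w : ℕ}
  {B0 : Set ℕ}

theorem le_kappa (h : Progress N k c0 c Dn lab p B0 κ μ used) (hp : 1 ≤ p) : μ ≤ κ := by
  obtain ⟨R, h1, h2, h3⟩ := h.valid.cut_le hp
  exact (h.cut_ge R h1 h2).trans h3

theorem lam_le (h : Progress N k c0 c Dn lab p B0 κ μ used) (hp : 1 ≤ p)
    (hF : FlowSpec (N + 1) (netcap N c {x | lab x = p}) (srcs N B0) (snks N lab 1 p) k r lam mark) :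
    lam ≤ κ := by
  obtain ⟨R, h1, h2, h3⟩ := h.valid.cut_le hp
  exact (hF.le_cut h1 h2).trans h3

/-- The unmarked set is a cut between the sources and the sinks of capacity exactly `lam`. -/
theorem mu_le (h : Progress N k c0 c Dn lab p B0 κ μ used) (hl : lam ≤ k)
    (hF : FlowSpec (N + 1) (netcap N c {x | lab x = p}) (srcs N B0) (snks N lab 1 p) k r lam mark) :
    μ ≤ lam := by
  have hS : ∀ v ∈ srcs N B0, v < N + 1 := fun v hv => by rcases hv with h | h <;> omega
  rw [← hF.cut_mark hl hS]
  exact h.cut_ge _ (fun v hv => hF.source hl v (hS v hv) hv) (fun v hv hx => hF.sink hl v hv hx)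

/-- If nothing flows, the unmarked set is a cut of capacity zero and can serve as the set `B`. -/
theorem closed (hp : 1 ≤ p) (hl : lam = 0)
    (hF : FlowSpec (N + 1) (netcap N c {x | lab x = p}) (srcs N B0) (snks N lab 1 p) k r lam mark) :
    Closed N c lab p := by
  have hl' : lam ≤ k := by omega
  have hS : ∀ v ∈ srcs N B0, v < N + 1 := fun v hv => by rcases hv with h | h <;> omega
  have h1 := hF.cut_mark hl' hS
  have hB : ∀ v < N, v ∈ {v | mark v = 0} → lab v = 0 ∨ p < lab v := by
    intro v hv h2
    by_contra h3
    exact hF.sink hl' v (by omega) ⟨hv, by omega, by omega⟩ h2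
  rw [cut_netcap (N := N) (R := {v | mark v = 0}) (B := {v | mark v = 0})
    (hF.source hl' N (by omega) (Or.inl rfl)) (fun _ _ => Iff.rfl)
    (fun v hv h2 h3 => by have := hB v hv h3; simp at h2; omega)] at h1
  refine ⟨{v | mark v = 0}, hB, fun u hu v hv h2 => ?_⟩
  have := le_dsum (f := fun u v => if Cross {v | mark v = 0} {x | lab x = p} u v then c u v else 0)
    hu hv
  simp only [if_pos h2] at this
  unfold cost at h1
  omega

/-- The cut formed by the unmarked set has capacity `lam`, so for nonzero `lam` an arc crosses it.
-/
theorem exists_crossing (h : Progress N k c0 c Dn lab p B0 κ μ used) (hp : 1 ≤ p) (hl : lam ≠ 0)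
    (hF : FlowSpec (N + 1) (netcap N c {x | lab x = p}) (srcs N B0) (snks N lab 1 p) k r lam mark) :
    ∃ u < N + 1, ∃ v < N + 1, mark u = 0 ∧ mark v ≠ 0 ∧ 0 < netcap N c {x | lab x = p} u v := by
  have hl' : lam ≤ k := (h.lam_le hp hF).trans (by have := h.cost_le; omega)
  have hS : ∀ v ∈ srcs N B0, v < N + 1 := fun v hv => by rcases hv with h | h <;> omega
  by_contra hno
  push Not at hno
  refine hl ?_
  rw [← hF.cut_mark hl' hS]
  unfold cut
  refine sum_eq_zero fun u hu => sum_eq_zero fun v hv => ?_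
  split
  · rename_i h1
    have := hno u (mem_range.1 hu) v (mem_range.1 hv) h1.1 h1.2
    omega
  · rfl

/-- Both alternatives lower `2 * κ - μ`. A marked vertex among the sources makes every cut exceed
`lam ≥ μ`. Deleting an arc of capacity `a ≥ 1` lowers the budget by `a` and the cuts by at most `a`.
-/
theorem branch (h : Progress N k c0 c Dn lab p B0 κ μ used) (hp : 1 ≤ p) 
    (hF : FlowSpec (N + 1) (netcap N c {x | lab x = p}) (srcs N B0) (snks N lab 1 p) k r lam mark)
    (hu : u < N + 1) (hmu : mark u = 0) (hmw : mark w ≠ 0)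
    (hpos : 0 < netcap N c {x | lab x = p} u w) :
    Progress N k c0 c Dn lab p ((B0 ∪ {v | v < N ∧ mark v = 0}) ∪ {w}) κ (lam + 1) (used + 1) ∨
      ∃ κ' μ', ∀ c' Dn', (∀ x < N, ∀ y < N, c' x y = if Pre N lab p u w x y then 0 else c x y) →
        (∀ x < N, ∀ y < N, Dn' x y ↔ (Pre N lab p u w x y ∨ Dn x y)) →
        Progress N k c0 c' Dn' lab p B0 κ' μ' (used + 1) := by
  have hl : lam ≤ k := (h.lam_le hp hF).trans (by have := h.cost_le; omega)
  have hμ := h.mu_le hl hF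
  have hw : w < N := by by_contra h; simp [netcap, h] at hpos
  rcases h.valid.branch hp hl hF hu hmu hpos with h1 | ⟨κ', h1, h2⟩
  · left
    refine ⟨h.agree, h.cost_le, h1, fun R hR hX => ?_, by have := h.used_le; omega⟩
    refine hF.lt_cut hl (fun v hv => ?_) hX (w := w) (by omega) (hR (Or.inr ⟨hw, Or.inr rfl⟩)) hmw
    rcases hv with hv | hv
    · exact hR (Or.inl hv)
    · exact hR (Or.inr ⟨hv.1, Or.inl (Or.inl hv.2)⟩)
  · right
    -- By `cut_without` every cut keeps at least this much. A truncated difference is harmless,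
    -- since it only makes the right side of `used_le` larger.
    refine ⟨κ', lam - netcap N c {x | lab x = p} u w, fun c' Dn' hc hD => ?_⟩
    have hcw : ∀ x < N, ∀ y < N, without c (Pre N lab p u w) x y = c' x y := fun x hx y hy => by
      rw [hc x hx y hy]; rfl
    refine ⟨fun x hx y hy => ?_, ?_, h2.congr hcw, fun R hR hX => ?_, ?_⟩
    · rw [hc x hx y hy, h.agree x hx y hy]
      by_cases h3 : Pre N lab p u w x y <;> simp [h3, hD x hx y hy]
    · have h3 : cost N c0 Dn' ≤ cost N c0 Dn + cost N c (Pre N lab p u w) := by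
        unfold cost
        rw [← dsum_add]
        refine dsum_le fun x hx y hy => ?_
        rw [h.agree x hx y hy]
        by_cases h3 : Pre N lab p u w x y <;> by_cases h4 : Dn x y <;> simp [h3, h4, hD x hx y hy]
      rw [cost_pre hu hpos] at h3
      have := h.cost_le
      omega
    · have h3 := cut_without hu R hpos
      rw [netcap_congr hcw] at h3
      have h4 := hF.le_cut hR hX
      omega
    · have := h.used_le
      omega

end Progress

def sepStep : Cmd :=
  cond (.var vDONE) skip (netflow ;; cond (.var vLAM)
    (pick ;; getBit vB ;; cond (.var vB) deleteArc pushSources) (assign vDONE (.const 1)))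

/-- The arcs marked as deleted. -/
def delSet (N : ℕ) (τ : State) (x y : ℕ) : Prop := mat (N + 1) (τ.arr aDNEW) x y ≠ 0

/-- The bit follows the alternative of `Progress.branch` that holds: `0` enlarges the sources and
`1` deletes the arc. When nothing flows, no bit is consumed and `μ` falls back to zero, ready for
the next class. -/
theorem sepStep_spec (h : Env N n k s σ) {rr : ℕ} {c0 : ℕ → ℕ → ℕ} {lab : ℕ → ℕ} {p κ μ used : ℕ}
    (hlab : σ.arr aLAB = lab) (hp1 : 1 ≤ p) (hp : σ.var vP = p) (hlo : σ.var vLO = 1)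
    (hdone : σ.var vDONE = 0)
    (hP : Progress N k c0 (mat (N + 1) (σ.arr aCUR)) (delSet N σ) lab p {v | σ.arr aBASE v ≠ 0}
      κ μ used) :
    ∃ ρ, Ang rr sepStep σ ρ ∧
      (∀ x < N, ∀ y < N, mat (N + 1) (ρ.arr aCUR) x y ≤ mat (N + 1) (σ.arr aCUR) x y) ∧
      (∀ v, N ≤ v → ρ.arr aBASE v ≠ 0 → σ.arr aBASE v ≠ 0) ∧
      ((ρ.var vDONE ≠ 0 ∧ Closed N (mat (N + 1) (ρ.arr aCUR)) lab p ∧ ρ.var vPB = σ.var vPB ∧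
          Progress N k c0 (mat (N + 1) (ρ.arr aCUR)) (delSet N ρ) lab p {v | ρ.arr aBASE v ≠ 0}
            κ 0 used) ∨
        (ρ.var vDONE = 0 ∧ ρ.var vPB = σ.var vPB + 1 ∧ ∃ κ' μ',
          Progress N k c0 (mat (N + 1) (ρ.arr aCUR)) (delSet N ρ) lab p {v | ρ.arr aBASE v ≠ 0}
            κ' μ' (used + 1))) := by
  obtain ⟨hnet, hF⟩ := netflow_spec h rfl hlab hp hlo rfl
  have hA1 : Ang rr netflow σ (netflow.exec σ) := Ang.of_noDig rfl rfl rfl σ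
  have hS := hA1.1
  have hEα : Env N n k s (netflow.exec σ) := h.same hS rfl
  generalize netflow.exec σ = α at *
  have a1 : α.arr aCUR = σ.arr aCUR := hS.2 _ rfl
  have a2 : α.arr aDNEW = σ.arr aDNEW := hS.2 _ rfl
  have a3 : α.arr aBASE = σ.arr aBASE := hS.2 _ rfl
  have a4 : α.arr aLAB = lab := by rw [← hlab]; exact hS.2 _ rfl
  have a5 : α.var vPB = σ.var vPB := hS.1 _ rfl
  have a6 : α.var vDONE = 0 := by rw [← hdone]; exact hS.1 _ rfl
  have a7 : α.var vP = p := by rw [← hp]; exact hS.1 _ rfl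
  have hsk : (Expr.var vDONE).eval σ = 0 := hdone
  by_cases hl : α.var vLAM = 0
  · refine ⟨α.setVar vDONE 1, Ang.cond_false rfl hsk (hA1.seq (Ang.cond_false rfl hl
      (Ang.of_noDig rfl rfl rfl α))), ?_, by simp [a3], Or.inl ⟨by simp, ?_, by simpa using a5, ?_⟩⟩
    · simp [a1]
    · rw [arr_setVar, a1]
      exact Progress.closed hp1 hl hF
    · have h1 := hP.mu_le (by omega) hF
      have h2 : delSet N (α.setVar vDONE 1) = delSet N σ := by
        funext x y; simp only [delSet, arr_setVar, a2]
      rw [h2, arr_setVar, a1, a3]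
      exact ⟨hP.agree, hP.cost_le, hP.valid, fun _ _ _ => Nat.zero_le _, by
        have := hP.used_le; omega⟩
  · obtain ⟨u', hu', w', hw', hmu', hmw', hpos'⟩ := hP.exists_crossing hp1 hl hF
    obtain ⟨hu, hw, hmu, hmw, hpos⟩ := pick_spec hEα hnet rfl hu' hw' hmu' hmw' hpos'
    have hA2 : Ang rr pick α (pick.exec α) := Ang.of_noDig rfl rfl rfl α
    have hS2 := hA2.1
    have hEβ : Env N n k s (pick.exec α) := hEα.same hS2 rfl
    have hm : (pick.exec α).arr aMARK = α.arr aMARK := hS2.2 _ rfl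
    generalize pick.exec α = β at *
    have b1 : β.arr aCUR = σ.arr aCUR := by rw [← a1]; exact hS2.2 _ rfl
    have b2 : β.arr aDNEW = σ.arr aDNEW := by rw [← a2]; exact hS2.2 _ rfl
    have b3 : β.arr aBASE = σ.arr aBASE := by rw [← a3]; exact hS2.2 _ rfl
    have b4 : β.arr aLAB = lab := by rw [← a4]; exact hS2.2 _ rfl
    have b5 : β.var vPB = σ.var vPB := by rw [← a5]; exact hS2.1 _ rfl
    have b6 : β.var vDONE = 0 := by rw [← a6]; exact hS2.1 _ rfl
    have b7 : β.var vP = p := by rw [← a7]; exact hS2.1 _ rfl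
    have hwN : β.var vSV < N := by by_contra h; simp [netcap, h] at hpos
    rcases hP.branch hp1 hF hu hmu hmw hpos with hB | ⟨κ', μ', hB⟩
    · have hA3 := ang_getBit (r := rr) (x := vB) (d := 0) (by decide) (by decide) (by omega) β
      have hEγ := hEβ.same hA3.1 rfl
      have g1 : ((β.setVar vB 0).setVar vPB (β.var vPB + 1)).arr = β.arr := by simp
      have g2 : ((β.setVar vB 0).setVar vPB (β.var vPB + 1)).var vPB = σ.var vPB + 1 := by
        simpa using b5
      have g3 : ((β.setVar vB 0).setVar vPB (β.var vPB + 1)).var vSV = β.var vSV := by simp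
      have g4 : ((β.setVar vB 0).setVar vPB (β.var vPB + 1)).var vDONE = 0 := by simpa using b6
      have g5 : ((β.setVar vB 0).setVar vPB (β.var vPB + 1)).var vB = 0 := by simp
      generalize (β.setVar vB 0).setVar vPB (β.var vPB + 1) = γ at *
      have hA4 : Ang rr pushSources γ (pushSources.exec γ) := Ang.of_noDig rfl rfl rfl γ
      have hps := pushSources_spec hEγ g3 hw
      have hS4 := hA4.1
      generalize pushSources.exec γ = ρ at *
      refine ⟨ρ, Ang.cond_false rfl hsk (hA1.seq (Ang.cond_true rfl hl
        (hA2.seq (hA3.seq (Ang.cond_false rfl g5 hA4))))), ?_, ?_, Or.inr ⟨?_, ?_, κ, α.var vLAM + 1, ?_⟩⟩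
      · rw [hS4.2 aCUR rfl, g1, b1]; exact fun _ _ _ _ => le_rfl
      · intro v hv h1
        have h2 : v ∈ {v | ρ.arr aBASE v ≠ 0} := h1
        rw [hps, g1, b3] at h2
        rcases h2 with (h2 | h2) | h2
        · exact h2
        · have := h2.1; omega
        · simp at h2; omega
      · rw [hS4.1 vDONE rfl, g4]
      · rw [hS4.1 vPB rfl, g2]
      · have h2 : delSet N ρ = delSet N σ := by
          funext x y; simp only [delSet, hS4.2 aDNEW rfl, g1, b2]
        rw [h2, hps, hS4.2 aCUR rfl, g1, b1, b3, hm]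
        exact hB
    · have hA3 := ang_getBit (r := rr) (x := vB) (d := 1) (by decide) (by decide) (by omega) β
      have hEγ := hEβ.same hA3.1 rfl
      have g1 : ((β.setVar vB 1).setVar vPB (β.var vPB + 1)).arr = β.arr := by simp
      have g2 : ((β.setVar vB 1).setVar vPB (β.var vPB + 1)).var vPB = σ.var vPB + 1 := by
        simpa using b5
      have g3 : ((β.setVar vB 1).setVar vPB (β.var vPB + 1)).var vSV = β.var vSV := by simp
      have g3' : ((β.setVar vB 1).setVar vPB (β.var vPB + 1)).var vSU = β.var vSU := by simp
      have g4 : ((β.setVar vB 1).setVar vPB (β.var vPB + 1)).var vDONE = 0 := by simpa using b6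
      have g5 : ((β.setVar vB 1).setVar vPB (β.var vPB + 1)).var vB ≠ 0 := by simp
      have g6 : ((β.setVar vB 1).setVar vPB (β.var vPB + 1)).var vP = p := by simpa using b7
      generalize (β.setVar vB 1).setVar vPB (β.var vPB + 1) = γ at *
      have hA4 : Ang rr deleteArc γ (deleteArc.exec γ) := Ang.of_noDig rfl rfl rfl γ
      have hds := deleteArc_spec hEγ g3' g3 g6 hu hw
      have hS4 := hA4.1
      generalize deleteArc.exec γ = ρ at *
      rw [g1, b1, b2, b4] at hds
      have hd1 : ∀ x < N, ∀ y < N, mat (N + 1) (ρ.arr aCUR) x y =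
          if Pre N lab p (β.var vSU) (β.var vSV) x y then 0 else mat (N + 1) (σ.arr aCUR) x y :=
        fun x hx y hy => by rw [(hds x y (by omega)).1]; simp only [hx, true_and]
      refine ⟨ρ, Ang.cond_false rfl hsk (hA1.seq (Ang.cond_true rfl hl
        (hA2.seq (hA3.seq (Ang.cond_true rfl g5 hA4))))), ?_, ?_, Or.inr ⟨?_, ?_, κ', μ', ?_⟩⟩
      · intro x hx y hy
        rw [hd1 x hx y hy]; split
        · exact Nat.zero_le _
        · exact le_rfl
      · rw [hS4.2 aBASE rfl, g1, b3]; exact fun _ _ h => h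
      · rw [hS4.1 vDONE rfl, g4]
      · rw [hS4.1 vPB rfl, g2]
      · rw [hS4.2 aBASE rfl, g1, b3]
        refine hB _ _ hd1 fun x hx y hy => ?_
        unfold delSet
        rw [(hds x y (by omega)).2]
        by_cases h3 : Pre N lab p (β.var vSU) (β.var vSV) x y <;> simp [h3, hx]

def startSep : Cmd :=
  assign vP (.sub (.var vKP) (.var vQ)) ;; assign vLO (.const 1) ;; assign vDONE (.const 0) ;;
    loop vX vN (write aBASE (.var vX) (.const 0))

def separation : Cmd := loop vQ vKP (startSep ;; loop vJ vTK sepStep)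

theorem startSep_spec (h : Env N n k s σ) (hb : ∀ v, N ≤ v → σ.arr aBASE v = 0) :
    (∀ v, (startSep.exec σ).arr aBASE v = 0) ∧ (startSep.exec σ).var vP = k + 1 - σ.var vQ ∧
      (startSep.exec σ).var vLO = 1 ∧ (startSep.exec σ).var vDONE = 0 := by
  simp only [startSep, exec_seq]
  generalize hα : (assign vDONE (.const 0)).exec ((assign vLO (.const 1)).exec
    ((assign vP (.sub (.var vKP) (.var vQ))).exec σ)) = α
  have hS : Same (assign vP (.sub (.var vKP) (.var vQ)) ;; assign vLO (.const 1) ;;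
      assign vDONE (.const 0)) σ α := by rw [← hα]; exact same_exec _ _
  have hE : Env N n k s α := h.same hS rfl
  have key := fill1 (x := vX) (b := vN) (a := aBASE)
    (p := write aBASE (.var vX) (.const 0)) (σ := α) (fun _ => 0)
    (fun i τ hi hS _ => by
      rw [hE.N_eq] at hi
      have hE' : Env N n k s τ := hE.same hS rfl
      have := hE'.lt_sz (show i < N + 1 by omega)
      simp [this])
  have a1 : α.var vP = k + 1 - σ.var vQ := by rw [← hα]; simp [h.kp]
  have a2 : α.var vLO = 1 := by rw [← hα]; simp
  have a3 : α.var vDONE = 0 := by rw [← hα]; simp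
  refine ⟨fun v => ?_, ?_, ?_, ?_⟩
  · rw [key v, hE.N_eq]
    split
    · rfl
    · rw [hS.2 _ rfl]; exact hb v (by omega)
  · rw [exec_var _ _ _ rfl, a1]
  · rw [exec_var _ _ _ rfl, a2]
  · rw [exec_var _ _ _ rfl, a3]

theorem separation_spec (h : Env N n k s σ) {rr : ℕ} {c0 : ℕ → ℕ → ℕ} {lab : ℕ → ℕ}
    (hlab : σ.arr aLAB = lab) (hb : ∀ v, σ.arr aBASE v = 0)
    (hc0 : ∀ x < N, ∀ y < N, mat (N + 1) (σ.arr aCUR) x y = c0 x y)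
    (hd : ∀ v, σ.arr aDNEW v = 0) (hV : Valid N c0 lab (k + 1) ∅ k) :
    ∃ ρ, Ang rr separation σ ρ ∧
      (∀ x < N, ∀ y < N, mat (N + 1) (ρ.arr aCUR) x y = if delSet N ρ x y then 0 else c0 x y) ∧
      cost N c0 (delSet N ρ) ≤ k ∧
      (∀ p, 1 ≤ p → p ≤ k + 1 → Closed N (mat (N + 1) (ρ.arr aCUR)) lab p) ∧
      ρ.var vPB ≤ σ.var vPB + 2 * k := by
  have hd0 : delSet N σ = fun _ _ => False := by funext x y; simp [delSet, mat, hd]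
  -- Round `q` treats class `k + 1 - q`. The classes treated before stay closed, as arcs are only
  -- removed. With `μ = 0` between classes, the bits used are bounded by twice the budget spent,
  -- which makes the total `2 * k` independent of the number of classes.
  obtain ⟨τ, ⟨hI0, κ, used, hI1, hI2, hI3, hI4, hI5, hI6⟩, hS, hA⟩ := ang_loop (r := rr) (x := vQ)
    (b := vKP) (p := startSep ;; loop vJ vTK sepStep) (σ := σ)
    (fun q τ => (∀ v, N ≤ v → τ.arr aBASE v = 0) ∧ ∃ κ used,
      (∀ x < N, ∀ y < N, mat (N + 1) (τ.arr aCUR) x y = if delSet N τ x y then 0 else c0 x y) ∧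
      cost N c0 (delSet N τ) + κ ≤ k ∧ Valid N (mat (N + 1) (τ.arr aCUR)) lab (k + 1 - q) ∅ κ ∧
      (∀ p, k + 1 - q < p → p ≤ k + 1 → Closed N (mat (N + 1) (τ.arr aCUR)) lab p) ∧
      τ.var vPB = σ.var vPB + used ∧ used + 2 * κ ≤ 2 * k)
    ⟨fun v _ => hb v, k, 0, by simpa [hd0] using hc0, by
      rw [hd0]; simp [cost], hV.congr fun x hx y hy => (hc0 x hx y hy).symm,
      fun p h1 h2 => by omega, rfl, by omega⟩ (by decide) (by decide)
    (fun q τ hq hS ⟨hI0, κ, used, hI1, hI2, hI3, hI4, hI5, hI6⟩ => by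
      rw [h.kp] at hq
      have hE : Env N n k s (τ.setVar vQ q) := (h.same hS rfl).setVar _ _ (by decide)
      have f1 : (τ.setVar vQ q).arr = τ.arr := by simp
      have f2 : (τ.setVar vQ q).var vPB = σ.var vPB + used := by simpa using hI5
      have f3 : (τ.setVar vQ q).var vQ = q := by simp
      have f4 : (τ.setVar vQ q).arr aLAB = lab := by rw [f1, hS.2 aLAB rfl, hlab]
      generalize τ.setVar vQ q = α at *
      have hA1 : Ang rr startSep α (startSep.exec α) := Ang.of_noDig rfl rfl rfl α
      obtain ⟨g1, g2, g3, g4⟩ := startSep_spec hE (by rw [f1]; exact hI0)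
      have hS1 := hA1.1
      have hEβ : Env N n k s (startSep.exec α) := hE.same hS1 rfl
      generalize startSep.exec α = β at *
      have b1 : β.arr aCUR = τ.arr aCUR := by rw [hS1.2 aCUR rfl, f1]
      have b2 : delSet N β = delSet N τ := by
        funext x y; simp only [delSet, hS1.2 aDNEW rfl, f1]
      have b3 : β.arr aLAB = lab := by rw [hS1.2 aLAB rfl, f4]
      have b4 : β.var vPB = σ.var vPB + used := by rw [hS1.1 vPB rfl, f2]
      rw [f3] at g2
      obtain ⟨p, hp⟩ : ∃ p, p = k + 1 - q := ⟨_, rfl⟩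
      have hp1 : 1 ≤ p := by omega
      rw [← hp] at g2 hI3 hI4
      have hB0 : {v | β.arr aBASE v ≠ 0} = ∅ := by ext v; simp [g1]
      obtain ⟨γ, ⟨hJ0, hJ1, hJ2⟩, hS2, hA2⟩ := ang_loop (r := rr) (x := vJ) (b := vTK) (p := sepStep)
        (σ := β)
        (fun j τ => (∀ v, N ≤ v → τ.arr aBASE v = 0) ∧
          (∀ p', p < p' → p' ≤ k + 1 → Closed N (mat (N + 1) (τ.arr aCUR)) lab p') ∧
          ∃ κ μ used, Progress N k c0 (mat (N + 1) (τ.arr aCUR)) (delSet N τ) lab p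
            {v | τ.arr aBASE v ≠ 0} κ μ used ∧ τ.var vPB = σ.var vPB + used ∧
            ((τ.var vDONE = 0 ∧ j ≤ used) ∨
              (τ.var vDONE ≠ 0 ∧ μ = 0 ∧ Closed N (mat (N + 1) (τ.arr aCUR)) lab p)))
        ⟨fun v _ => g1 v, by rw [b1]; exact hI4, κ, 0, used, by
          rw [hB0, b1, b2]
          exact ⟨hI1, hI2, hI3, fun _ _ _ => Nat.zero_le _, by omega⟩, b4, Or.inl ⟨g4, by omega⟩⟩
        (by decide) (by decide)
        (fun j δ hj hSδ ⟨hJ0, hJ1, κ, μ, used, hJ2, hJ3, hJ4⟩ => by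
          have hEδ : Env N n k s (δ.setVar vJ j) := (hEβ.same hSδ rfl).setVar _ _ (by decide)
          have e1 : (δ.setVar vJ j).arr aLAB = lab := by rw [arr_setVar, hSδ.2 aLAB rfl, b3]
          have e2 : (δ.setVar vJ j).var vP = p := by
            rw [var_setVar, if_neg (by decide), hSδ.1 vP rfl, g2]
          have e3 : (δ.setVar vJ j).var vLO = 1 := by
            rw [var_setVar, if_neg (by decide), hSδ.1 vLO rfl, g3]
          have e4 : (δ.setVar vJ j).var vDONE = δ.var vDONE := by simp
          have e5 : (δ.setVar vJ j).var vPB = δ.var vPB := by simp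
          have e6 : (δ.setVar vJ j).arr = δ.arr := by simp
          have e7 : delSet N (δ.setVar vJ j) = delSet N δ := by
            funext x y; simp only [delSet, e6]
          generalize δ.setVar vJ j = ε at *
          rcases hJ4 with ⟨h1, h2⟩ | h1
          · obtain ⟨ρ, hA, hle, hbs, hor⟩ := sepStep_spec hEδ (rr := rr) (c0 := c0) (κ := κ) (μ := μ)
              (used := used) e1 hp1 e2 e3 (by omega) (by rw [e6, e7]; exact hJ2)
            rw [e6] at hle hbs
            have hbs' : ∀ v, N ≤ v → ρ.arr aBASE v = 0 := fun v hv => by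
              by_contra h3; exact hbs v hv h3 (hJ0 v hv)
            have hcl : ∀ p', p < p' → p' ≤ k + 1 → Closed N (mat (N + 1) (ρ.arr aCUR)) lab p' :=
              fun p' h3 h4 => (hJ1 p' h3 h4).mono hle
            rcases hor with ⟨h3, h4, h5, h6⟩ | ⟨h3, h4, κ', μ', h5⟩
            · exact ⟨ρ, hA, hbs', hcl, κ, 0, used, h6, by rw [h5, e5, hJ3],
                Or.inr ⟨h3, rfl, h4⟩⟩
            · exact ⟨ρ, hA, hbs', hcl, κ', μ', used + 1, h5, by rw [h4, e5, hJ3]; omega,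
                Or.inl ⟨h3, by omega⟩⟩
          · refine ⟨ε, Ang.cond_true rfl ?_ (Ang.skip _), by rw [e6]; exact hJ0,
              by rw [e6]; exact hJ1, κ, μ, used, by rw [e6, e7]; exact hJ2, by rw [e5, hJ3], Or.inr ?_⟩
            · simp only [Expr.eval, e4]; exact h1.1
            · rw [e4, e6]; exact h1)
      obtain ⟨κ', μ', used', h1, h2, h3⟩ := hJ2
      rw [hEβ.tk] at h3
      -- `2 * k + 1` unfinished steps would have used as many bits, but `μ ≤ κ` and `used_le` leave
      -- room for only `2 * k`.
      have h4 : μ' = 0 ∧ Closed N (mat (N + 1) (γ.arr aCUR)) lab p := by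
        rcases h3 with ⟨h4, h5⟩ | h4
        · have := h1.used_le; have := h1.le_kappa hp1; have := h1.cost_le; omega
        · exact h4.2
      obtain ⟨rfl, h5⟩ := h4
      refine ⟨_, hA1.seq hA2, by simpa using hJ0, κ', used', ?_⟩
      have e6 : (γ.setVar vJ (β.var vTK)).arr = γ.arr := by simp
      have e7 : delSet N (γ.setVar vJ (β.var vTK)) = delSet N γ := by
        funext x y; simp only [delSet, e6]
      rw [e6, e7]
      refine ⟨h1.agree, h1.cost_le, ?_, fun p' h6 h7 => ?_, by simpa using h2, by
        have := h1.used_le; omega⟩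
      · have := h1.valid
        obtain ⟨p', rfl⟩ : ∃ p', p = p' + 1 := ⟨p - 1, by omega⟩
        rw [show k + 1 - (q + 1) = p' by omega]
        exact this.pred
      · by_cases h8 : p' = p
        · rw [h8]; exact h5
        · exact hJ1 p' (by omega) h7)
  rw [h.kp] at hI4
  have e7 : delSet N (τ.setVar vQ (σ.var vKP)) = delSet N τ := by
    funext x y; simp only [delSet, arr_setVar]
  refine ⟨_, hA, by rw [e7, arr_setVar]; exact hI1, by rw [e7]; omega, fun p h1 h2 => ?_, ?_⟩
  · rw [arr_setVar]; exact hI4 p (by omega) h2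
  · simp; omega

/-! ## Verification -/

/-- There is a walk from `u` to `v` all of whose inner vertices are less than `i`. -/
def Via (R : ℕ → ℕ → Prop) : ℕ → ℕ → ℕ → Prop
  | 0, u, v => R u v
  | i + 1, u, v => Via R i u v ∨ (Via R i u i ∧ Via R i i v)

/-- If `x` is the largest admitted inner vertex, the parts of the two walks that meet at `x` have
smaller inner vertices and form the second alternative of `Via`. Smaller `x` are handled by
induction. -/
theorem Via.trans {R : ℕ → ℕ → Prop} {i u x v : ℕ} (hx : x < i) (h : Via R i u x) (h' : Via R i x v) :
    Via R i u v := by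
  induction i generalizing u x v with
  | zero => omega
  | succ i ih =>
    have key : ∀ u v, x < i → Via R i u x → Via R i x v → Via R i u v :=
      fun u v hx h h' => ih hx h h'
    rcases Nat.lt_succ_iff_lt_or_eq.1 hx with hx | rfl
    · simp only [Via] at h h' ⊢
      rcases h with h | h <;> rcases h' with h' | h'
      · exact Or.inl (key _ _ hx h h')
      · exact Or.inr ⟨key _ _ hx h h'.1, h'.2⟩
      · exact Or.inr ⟨h.1, key _ _ hx h.2 h'⟩
      · exact Or.inr ⟨h.1, h'.2⟩
    · simp only [Via] at h h' ⊢
      exact Or.inr ⟨h.elim id (·.1), h'.elim id (·.2)⟩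

theorem Via.mono {R : ℕ → ℕ → Prop} {i u v : ℕ} (h : R u v) : Via R i u v := by
  induction i with
  | zero => exact h
  | succ i ih => exact Or.inl ih

theorem via_iff_reach {c : ℕ → ℕ → ℕ} {D : ℕ → ℕ → Prop} {u v : ℕ} :
    Via (fun u v => u = v ∨ Edge N c D u v) N u v ↔ Reach N c D u v := by
  constructor
  · have : ∀ i u v, Via (fun u v => u = v ∨ Edge N c D u v) i u v → Reach N c D u v := by
      intro i
      induction i with
      | zero =>
        rintro u v (rfl | h)
        · exact .refl
        · exact .single h
      | succ i ih =>
        rintro u v (h | ⟨h, h'⟩)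
        · exact ih _ _ h
        · exact (ih _ _ h).trans (ih _ _ h')
    exact this N u v
  · intro h
    induction h with
    | refl => exact Via.mono (Or.inl rfl)
    | tail h1 h2 ih => exact ih.trans h2.1 (Via.mono (Or.inr h2))

def reachBody : Cmd :=
  cond (neq (.var vU) (.var vV)) (cond (rd aORIG vU vV) (cond (rd aDNEW vU vV)
    (wr aREACH vU vV (.const 0)) (wr aREACH vU vV (.const 1))) (wr aREACH vU vV (.const 0)))
    (wr aREACH vU vV (.const 1))

def reachInit : Cmd := loop vU vN (loop vV vN reachBody)

def closeBody : Cmd :=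
  cond (rd aREACH vU vZ) (cond (rd aREACH vZ vV) (wr aREACH vU vV (.const 1)) skip) skip

def closeReach : Cmd := loop vZ vN (loop vU vN (loop vV vN closeBody))

theorem reachInit_spec (h : Env N n k s σ) (u v : ℕ) (hu : u < N) (hv : v < N) :
    mat (N + 1) ((reachInit.exec σ).arr aREACH) u v ≠ 0 ↔
      (u = v ∨ Edge N (mat (N + 1) (σ.arr aORIG)) (delSet N σ) u v) := by
  unfold reachInit
  rw [fill2 (N := N) (n := n) (k := k) (s := s) h rfl (by decide) (by decide) (by decide) rfl rfl
    (by rw [h.N_eq]; omega)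
    (fun u v => if u = v ∨ Edge N (mat (N + 1) (σ.arr aORIG)) (delSet N σ) u v then 1 else 0)
    (fun i j τ hi hj hE hS hx hy _ => ?_) u v (by omega)]
  · rw [h.N_eq, if_pos ⟨hu, hv⟩]; simp only [ite_ne_right_iff, ne_eq, one_ne_zero, not_false_eq_true, and_true]
  · rw [h.N_eq] at hi hj
    have e1 : τ.arr aORIG = σ.arr aORIG := hS.2 _ rfl
    have e2 : τ.arr aDNEW = σ.arr aDNEW := hS.2 _ rfl
    have w : ∀ e, (wr aREACH vU vV e).exec τ = τ.setArr aREACH (i * (N + 1) + j) (e.eval τ) :=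
      fun e => by rw [exec_wr hE (by omega) (by omega), hx, hy]
    simp only [reachBody, exec_cond, w, eval_rd hE (show τ.var vU < N + 1 by omega), eval_neq]
    simp only [Expr.eval, hx, hy, e1, e2, Edge, delSet, hi, hj, true_and]
    by_cases c1 : i = j
    · simp [c1]
    · by_cases c2 : mat (N + 1) (σ.arr aORIG) i j = 0 <;>
        by_cases c3 : mat (N + 1) (σ.arr aDNEW) i j = 0 <;> simp [c1, c2, c3, Nat.pos_iff_ne_zero]

/-- The matrix is updated in place, so during round `z` an entry may already reflect longer walks.
Hence entries are bounded from below by `Via R z` and from above by a transitive relation; for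
`Reach` the bounds meet in the end. -/
theorem closeReach_spec (h : Env N n k s σ) {R Q : ℕ → ℕ → Prop}
    (hR : ∀ u < N, ∀ v < N, mat (N + 1) (σ.arr aREACH) u v ≠ 0 ↔ R u v)
    (hRQ : ∀ u v, R u v → Q u v) (hQ : ∀ u v w, Q u v → Q v w → Q u w) :
    ∀ u < N, ∀ v < N, (mat (N + 1) ((closeReach.exec σ).arr aREACH) u v ≠ 0 → Q u v) ∧
      (Via R N u v → mat (N + 1) ((closeReach.exec σ).arr aREACH) u v ≠ 0) := by
  obtain ⟨τ, h1, h2, h3⟩ := loop_rule (x := vZ) (b := vN) (p := loop vU vN (loop vV vN closeBody))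
    (σ := σ)
    (fun z τ => ∀ u < N, ∀ v < N, (mat (N + 1) (τ.arr aREACH) u v ≠ 0 → Q u v) ∧
      (Via R z u v → mat (N + 1) (τ.arr aREACH) u v ≠ 0))
    (fun u hu v hv => ⟨fun h => hRQ _ _ ((hR u hu v hv).1 h), (hR u hu v hv).2⟩)
    (fun z τ hz hS hI => by
      rw [h.N_eq] at hz
      have hE : Env N n k s (τ.setVar vZ z) := (h.same hS rfl).setVar _ _ (by decide)
      have f1 : (τ.setVar vZ z).arr aREACH = τ.arr aREACH := by simp
      have f2 : (τ.setVar vZ z).var vZ = z := by simp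
      rw [← f1] at hI
      generalize τ.setVar vZ z = α at *
      have key := loop2_rule (x := vU) (y := vV) (b := vN) (d := vN) (p := closeBody) (σ := α)
        (fun i j τ => ∀ u < N, ∀ v < N, (mat (N + 1) (τ.arr aREACH) u v ≠ 0 → Q u v) ∧
          (Via R z u v → mat (N + 1) (τ.arr aREACH) u v ≠ 0) ∧
          ((u < i ∨ (u = i ∧ v < j)) → Via R z u z → Via R z z v →
            mat (N + 1) (τ.arr aREACH) u v ≠ 0))
        rfl (by decide) (by decide) (by decide) rfl (fun _ _ _ _ _ _ h => h)
        (fun u hu v hv => ⟨(hI u hu v hv).1, (hI u hu v hv).2, by omega⟩)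
        (fun i τ _ hI u hu v hv => ⟨(hI u hu v hv).1, (hI u hu v hv).2.1, fun h4 => by
          refine (hI u hu v hv).2.2 ?_
          rw [hE.N_eq]; omega⟩)
        (fun i j β hi hj hS hx hy hI => by
          rw [hE.N_eq] at hi hj
          have hEβ : Env N n k s β := hE.same hS rfl
          have b1 : β.var vZ = z := by rw [hS.1 vZ rfl, f2]
          have w : (wr aREACH vU vV (.const 1)).exec β = β.setArr aREACH (i * (N + 1) + j) 1 := by
            rw [exec_wr hEβ (by omega) (by omega), hx, hy]; rfl
          have hex : closeBody.exec β = if mat (N + 1) (β.arr aREACH) i z ≠ 0 ∧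
              mat (N + 1) (β.arr aREACH) z j ≠ 0 then β.setArr aREACH (i * (N + 1) + j) 1 else β := by
            simp only [closeBody, exec_cond, w, eval_rd hEβ (show β.var vU < N + 1 by omega),
              eval_rd hEβ (show β.var vZ < N + 1 by omega), hx, hy, b1, exec_skip]
            by_cases c1 : mat (N + 1) (β.arr aREACH) i z = 0 <;>
              by_cases c2 : mat (N + 1) (β.arr aREACH) z j = 0 <;> simp [c1, c2]
          rw [hex]
          intro u hu v hv
          obtain ⟨g1, g2, g3⟩ := hI u hu v hv
          by_cases c : mat (N + 1) (β.arr aREACH) i z ≠ 0 ∧ mat (N + 1) (β.arr aREACH) z j ≠ 0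
          · rw [if_pos c, arr_setArr, if_pos rfl, mat_update _ _ (by omega) (by omega)]
            by_cases c1 : u = i ∧ v = j
            · rw [if_pos c1]
              obtain ⟨rfl, rfl⟩ := c1
              exact ⟨fun _ => hQ _ _ _ ((hI u hu z hz).1 c.1) ((hI z hz v hv).1 c.2),
                fun _ => one_ne_zero, fun _ _ _ => one_ne_zero⟩
            · rw [if_neg c1]
              exact ⟨g1, g2, fun h4 => g3 (by omega)⟩
          · rw [if_neg c]
            refine ⟨g1, g2, fun h4 h5 h6 => ?_⟩
            by_cases c1 : u = i ∧ v = j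
            · obtain ⟨rfl, rfl⟩ := c1
              exact absurd ⟨(hI u hu z hz).2.1 h5, (hI z hz v hv).2.1 h6⟩ c
            · exact g3 (by omega) h5 h6)
      intro u hu v hv
      obtain ⟨g1, g2, g3⟩ := key u hu v hv
      refine ⟨g1, fun h4 => ?_⟩
      rcases h4 with h4 | ⟨h4, h5⟩
      · exact g2 h4
      · refine g3 ?_ h4 h5
        rw [hE.N_eq]; omega)
  rw [h.N_eq] at h1
  unfold closeReach
  rw [h3, arr_setVar]
  exact h1

def costBody : Cmd :=
  cond (rd aDNEW vU vV) (assign vCOST (.add (.var vCOST) (rd aORIG vU vV))) skip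

def costSum : Cmd := assign vCOST (.const 0) ;; loop vU vN (loop vV vN costBody)

theorem costSum_spec (h : Env N n k s σ) :
    (costSum.exec σ).var vCOST = cost N (mat (N + 1) (σ.arr aORIG)) (delSet N σ) := by
  simp only [costSum, exec_seq]
  generalize hα : (assign vCOST (.const 0)).exec σ = α
  have hS : Same (assign vCOST (.const 0)) σ α := by rw [← hα]; exact same_exec _ _
  have hE : Env N n k s α := h.same hS rfl
  have a1 : α.var vCOST = 0 := by rw [← hα]; simp
  set f : ℕ → ℕ → ℕ := fun u v => if delSet N σ u v then mat (N + 1) (σ.arr aORIG) u v else 0 with hf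
  have key := loop2_rule (x := vU) (y := vV) (b := vN) (d := vN) (p := costBody) (σ := α)
    (fun i j τ => τ.var vCOST = ∑ u ∈ range i, ∑ v ∈ range N, f u v + ∑ v ∈ range j, f i v)
    rfl (by decide) (by decide) (by decide) rfl
    (fun i j τ z v hz hI => by
      have : (vCOST : ℕ) ≠ z := by rcases hz with rfl | rfl <;> decide
      rw [var_setVar, if_neg this]; exact hI)
    (by simp [a1])
    (fun i τ _ hI => by rw [hI, hE.N_eq, sum_range_succ]; simp)
    (fun i j τ hi hj hS' hx hy hI => by
      rw [hE.N_eq] at hi hj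
      have hEτ : Env N n k s τ := hE.same hS' rfl
      have e1 : τ.arr aORIG = σ.arr aORIG := by rw [hS'.2 aORIG rfl, hS.2 aORIG rfl]
      have e2 : τ.arr aDNEW = σ.arr aDNEW := by rw [hS'.2 aDNEW rfl, hS.2 aDNEW rfl]
      simp only [costBody, exec_cond, eval_rd hEτ (show τ.var vU < N + 1 by omega), hx, hy, exec_skip,
        exec_assign, Expr.eval, e1, e2]
      rw [sum_range_succ (fun v => f i v)]
      by_cases c : mat (N + 1) (σ.arr aDNEW) i j = 0
      · rw [if_pos c, hI]; simp [hf, delSet, c]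
      · rw [if_neg c, var_setVar, if_pos rfl, hI]; simp [hf, delSet, c, add_assoc])
  rw [hE.N_eq] at key
  rw [key]
  simp [cost, hf]

def countBody : Cmd :=
  cond (rd aREACH vU vV) (cond (rd aREACH vV vU) (assign vCNT (.add (.var vCNT) (.const 1))) skip) skip

def checkRow : Cmd :=
  assign vCNT (.const 0) ;; loop vV 0 countBody ;;
    cond (.sub (.var vCNT) (.var 3)) (assign vOK (.const 0)) skip

def checkSizes : Cmd := loop vU vN checkRow

theorem checkRow_spec (h : Env N n k s σ) (hn : n ≤ N) {u : ℕ} (hu : u < N) (hx : σ.var vU = u) :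
    (checkRow.exec σ).var vOK = if wt n {v | mat (N + 1) (σ.arr aREACH) u v ≠ 0 ∧
      mat (N + 1) (σ.arr aREACH) v u ≠ 0} ≤ s then σ.var vOK else 0 := by
  simp only [checkRow, exec_seq]
  generalize hα : (assign vCNT (.const 0)).exec σ = α
  have hS : Same (assign vCNT (.const 0)) σ α := by rw [← hα]; exact same_exec _ _
  have hE : Env N n k s α := h.same hS rfl
  have a1 : α.var vCNT = 0 := by rw [← hα]; simp
  set K : Set ℕ := {v | mat (N + 1) (σ.arr aREACH) u v ≠ 0 ∧ mat (N + 1) (σ.arr aREACH) v u ≠ 0}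
    with hK
  obtain ⟨τ, h1, h2, h3⟩ := loop_rule (x := vV) (b := 0) (p := countBody) (σ := α)
    (fun i τ => τ.var vCNT = wt i K) (by simp [a1, wt])
    (fun i τ hi hS' hI => by
      rw [hE.n_eq] at hi
      have hEτ : Env N n k s (τ.setVar vV i) := (hE.same hS' rfl).setVar _ _ (by decide)
      have e1 : (τ.setVar vV i).arr aREACH = σ.arr aREACH := by
        rw [arr_setVar, hS'.2 aREACH rfl, hS.2 aREACH rfl]
      have e2 : (τ.setVar vV i).var vU = u := by
        rw [var_setVar, if_neg (by decide), hS'.1 vU rfl, hS.1 vU rfl, hx]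
      have e3 : (τ.setVar vV i).var vV = i := by simp
      have e4 : (τ.setVar vV i).var vCNT = wt i K := by simpa using hI
      generalize τ.setVar vV i = β at *
      simp only [countBody, exec_cond, eval_rd hEτ (show β.var vU < N + 1 by omega),
        eval_rd hEτ (show β.var vV < N + 1 by omega), e1, e2, e3, exec_skip, exec_assign, Expr.eval]
      have hw : wt (i + 1) K = wt i K + if i ∈ K then 1 else 0 := by
        unfold wt
        rw [range_add_one, filter_insert]
        split
        · rw [card_insert_of_notMem (by simp)]
        · rfl
      rw [hw]
      by_cases c1 : mat (N + 1) (σ.arr aREACH) u i = 0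
      · simp [c1, hK, e4]
      · by_cases c2 : mat (N + 1) (σ.arr aREACH) i u = 0
        · simp [c1, c2, hK, e4]
        · simp [c1, c2, hK, e4])
  rw [h3]
  rw [hE.n_eq] at h1
  have hEτ : Env N n k s τ := hE.same h2 rfl
  have e5 : τ.var vOK = σ.var vOK := by rw [h2.1 vOK rfl, hS.1 vOK rfl]
  simp only [exec_cond, Expr.eval, var_setVar, show (vCNT : ℕ) ≠ vV by decide,
    show (3 : ℕ) ≠ vV by decide, if_false, h1, hEτ.s_eq, exec_skip, exec_assign]
  by_cases c : wt n K ≤ s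
  · rw [if_pos (by omega), if_pos c]; simpa using e5
  · rw [if_neg (by omega), if_neg c]; simp

theorem checkSizes_spec (h : Env N n k s σ) (hn : n ≤ N) :
    (checkSizes.exec σ).var vOK = if ∀ u < N, wt n {v | mat (N + 1) (σ.arr aREACH) u v ≠ 0 ∧
      mat (N + 1) (σ.arr aREACH) v u ≠ 0} ≤ s then σ.var vOK else 0 := by
  obtain ⟨τ, h1, h2, h3⟩ := loop_rule (x := vU) (b := vN) (p := checkRow) (σ := σ)
    (fun i τ => τ.var vOK = if ∀ u < i, wt n {v | mat (N + 1) (σ.arr aREACH) u v ≠ 0 ∧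
      mat (N + 1) (σ.arr aREACH) v u ≠ 0} ≤ s then σ.var vOK else 0) (by simp)
    (fun i τ hi hS hI => by
      rw [h.N_eq] at hi
      have hE : Env N n k s (τ.setVar vU i) := (h.same hS rfl).setVar _ _ (by decide)
      have e : (τ.setVar vU i).var vOK = τ.var vOK := by simp
      rw [checkRow_spec hE hn hi (by simp), arr_setVar, hS.2 aREACH rfl, e, hI]
      by_cases c : wt n {v | mat (N + 1) (σ.arr aREACH) i v ≠ 0 ∧
        mat (N + 1) (σ.arr aREACH) v i ≠ 0} ≤ s
      · rw [if_pos c]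
        congr 1
        refine propext ⟨fun h u hu => ?_, fun h u hu => h u (by omega)⟩
        by_cases hui : u = i
        · rw [hui]; exact c
        · exact h u (by omega)
      · rw [if_neg c, if_neg]
        exact fun h => c (h i (by omega)))
  unfold checkSizes
  rw [h3, var_setVar, if_neg (by decide), h1, h.N_eq]

def verify : Cmd :=
  costSum ;; reachInit ;; closeReach ;; assign vOK (.const 1) ;; checkSizes ;;
    cond (.sub (.var vCOST) (.var 1)) (assign vOK (.const 0)) skip

/-- The arcs of `D` are a solution for the capacities `c`. -/
def Solves (N n k s : ℕ) (c : ℕ → ℕ → ℕ) (D : ℕ → ℕ → Prop) : Prop :=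
  cost N c D ≤ k ∧ SmallComps N n s c D

/-- The verdict concerns only the graph and the deleted arcs, however these were found. The
soundness of positive answers rests on it. -/
theorem verify_spec (h : Env N n k s σ) (hn : n ≤ N) :
    (verify.exec σ).var vOK =
      if Solves N n k s (mat (N + 1) (σ.arr aORIG)) (delSet N σ) then 1 else 0 := by
  have hc := costSum_spec h
  simp only [verify, exec_seq]
  have hS1 := same_exec costSum σ
  generalize costSum.exec σ = α at *
  have hE1 : Env N n k s α := h.same hS1 rfl
  have a1 : α.arr aORIG = σ.arr aORIG := hS1.2 _ rfl
  have a2 : delSet N α = delSet N σ := by funext x y; simp only [delSet, hS1.2 aDNEW rfl]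
  have hr := reachInit_spec hE1
  rw [a1, a2] at hr
  have hS2 := same_exec reachInit α
  generalize reachInit.exec α = β at *
  have hE2 : Env N n k s β := hE1.same hS2 rfl
  set c := mat (N + 1) (σ.arr aORIG) with hcdef
  have hcl := closeReach_spec hE2 (Q := Reach N c (delSet N σ)) (fun u hu v hv => hr u v hu hv)
    (fun u v h => h.elim (fun h => h ▸ .refl) (fun h => .single h)) (fun _ _ _ h h' => h.trans h')
  have hS3 := same_exec closeReach β
  generalize closeReach.exec β = γ at *
  have hE3 : Env N n k s γ := hE2.same hS3 rfl
  have hre : ∀ u < N, ∀ v < N, mat (N + 1) (γ.arr aREACH) u v ≠ 0 ↔ Reach N c (delSet N σ) u v :=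
    fun u hu v hv => ⟨(hcl u hu v hv).1, fun h' => (hcl u hu v hv).2 (via_iff_reach.2 h')⟩
  have hS4 := same_exec (assign vOK (.const 1)) γ
  have d1 : ((assign vOK (.const 1)).exec γ).var vOK = 1 := by simp
  generalize (assign vOK (.const 1)).exec γ = δ at *
  have hE4 : Env N n k s δ := hE3.same hS4 rfl
  have hck := checkSizes_spec hE4 hn
  have hS5 := same_exec checkSizes δ
  generalize checkSizes.exec δ = ε at *
  have hE5 : Env N n k s ε := hE4.same hS5 rfl
  have e1 : ε.var vCOST = cost N c (delSet N σ) := by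
    rw [hS5.1 vCOST rfl, hS4.1 vCOST rfl, hS3.1 vCOST rfl, hS2.1 vCOST rfl, hc]
  have e2 : ε.var vOK = if SmallComps N n s c (delSet N σ) then 1 else 0 := by
    rw [hck, d1, hS4.2 aREACH rfl]
    congr 1
    refine propext (forall₂_congr fun u hu => ?_)
    have : wt n {v | mat (N + 1) (γ.arr aREACH) u v ≠ 0 ∧ mat (N + 1) (γ.arr aREACH) v u ≠ 0} =
        wt n {v | Conn N c (delSet N σ) u v} := by
      refine le_antisymm (wt_mono fun v hv h' => ?_) (wt_mono fun v hv h' => ?_)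
      · exact ⟨(hre u hu v (by omega)).1 h'.1, (hre v (by omega) u hu).1 h'.2⟩
      · exact ⟨(hre u hu v (by omega)).2 h'.1, (hre v (by omega) u hu).2 h'.2⟩
    rw [this]
  simp only [exec_cond, Expr.eval, e1, hE5.k_eq, exec_skip, exec_assign]
  unfold Solves
  by_cases c1 : cost N c (delSet N σ) ≤ k
  · rw [if_pos (by omega), e2]; simp [c1]
  · rw [if_neg (by omega)]; simp [c1]

/-! ## Preparation of an attempt -/

/-- Copy the rows of the capacity matrix up to the current one. -/
def copyCap (a : ℕ) : Cmd :=
  loop vU vM (loop vV vM (cond (.sub (.var vU) (.var vROWS)) (wr a vU vV (.const 0))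
    (wr a vU vV (rd aCAP vU vV))))

/-- The capacities of the arcs with tails less than `i`. -/
def rowsCap (i : ℕ) (c : ℕ → ℕ → ℕ) (u v : ℕ) : ℕ := if u < i then c u v else 0

theorem copyCap_spec (h : Env N n k s σ) {a : ℕ} (ha : (copyCap a).safe = true)
    (ha' : (copyCap a).wa aCAP = false) (u v : ℕ) (hu : u < N + 1) (hv : v < N + 1) :
    mat (N + 1) (((copyCap a).exec σ).arr a) u v =
      rowsCap (σ.var vROWS + 1) (mat (N + 1) (σ.arr aCAP)) u v := by
  unfold copyCap
  rw [fill2 (N := N) (n := n) (k := k) (s := s) h rfl (by decide) (by decide) (by decide) rfl ha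
    (by rw [h.M_eq]) (fun u v => rowsCap (σ.var vROWS + 1) (mat (N + 1) (σ.arr aCAP)) u v)
    (fun i j τ hi hj hE hS hx hy _ => ?_) u v hv]
  · rw [h.M_eq, if_pos ⟨hu, hv⟩]
  · rw [h.M_eq] at hi hj
    have e1 : τ.arr aCAP = σ.arr aCAP := hS.2 _ ha'
    have e2 : τ.var vROWS = σ.var vROWS := hS.1 _ rfl
    have w : ∀ e, (wr a vU vV e).exec τ = τ.setArr a (i * (N + 1) + j) (e.eval τ) :=
      fun e => by rw [exec_wr hE (by omega) (by omega), hx, hy]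
    simp only [exec_cond, w, eval_rd hE (show τ.var vU < N + 1 by omega), rowsCap]
    simp only [Expr.eval, hx, hy, e1, e2]
    by_cases c1 : i < σ.var vROWS + 1
    · rw [if_pos (show i - σ.var vROWS = 0 by omega), if_pos c1]; simp
    · rw [if_neg (show i - σ.var vROWS ≠ 0 by omega), if_neg c1]; simp

def termBody : Cmd :=
  cond (.sub (.var vROWS) (.var vU)) (cond (rd aDOLD vU vV) (cond (rd aCAP vU vV)
    (write aTERM (.var vU) (.const 1)) skip) skip) skip

/-- The terminals: the tails of the arcs of the old solution, and the new vertex. -/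
def terms : Cmd := loop vU vN (loop vV vN termBody) ;; write aTERM (.var vROWS) (.const 1)

theorem terms_spec (h : Env N n k s σ) {i : ℕ} (hi : σ.var vROWS = i) (hiN : i < N)
    (h0 : ∀ v, σ.arr aTERM v = 0) (u : ℕ) :
    (terms.exec σ).arr aTERM u ≠ 0 ↔ u = i ∨ (u < i ∧ ∃ v < N,
      mat (N + 1) (σ.arr aDOLD) u v ≠ 0 ∧ mat (N + 1) (σ.arr aCAP) u v ≠ 0) := by
  have key := loop2_rule (x := vU) (y := vV) (b := vN) (d := vN) (p := termBody) (σ := σ)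
    (fun a b τ => ∀ u, τ.arr aTERM u ≠ 0 ↔ (u < i ∧ ∃ v < N, (u < a ∨ (u = a ∧ v < b)) ∧
      mat (N + 1) (σ.arr aDOLD) u v ≠ 0 ∧ mat (N + 1) (σ.arr aCAP) u v ≠ 0))
    rfl (by decide) (by decide) (by decide) rfl (fun _ _ _ _ _ _ h => h)
    (fun u => by simp [h0])
    (fun a τ _ hI u => by
      rw [hI u, h.N_eq]
      refine and_congr_right fun _ => exists_congr fun v => and_congr_right fun hv => ?_
      have : (u < a ∨ u = a ∧ v < N) ↔ (u < a + 1 ∨ u = a + 1 ∧ v < 0) := by omega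
      rw [this])
    (fun a b τ ha hb hS hx hy hI u => by
      rw [h.N_eq] at ha hb
      have hE : Env N n k s τ := h.same hS rfl
      have e1 : τ.arr aDOLD = σ.arr aDOLD := hS.2 _ rfl
      have e2 : τ.arr aCAP = σ.arr aCAP := hS.2 _ rfl
      have e3 : τ.var vROWS = i := by rw [hS.1 _ rfl, hi]
      have hsz := hE.lt_sz (show a < N + 1 by omega)
      have hex : termBody.exec τ = if a < i ∧ mat (N + 1) (σ.arr aDOLD) a b ≠ 0 ∧
          mat (N + 1) (σ.arr aCAP) a b ≠ 0 then τ.setArr aTERM a 1 else τ := by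
        simp only [termBody, exec_cond, eval_rd hE (show τ.var vU < N + 1 by omega), exec_write,
          exec_skip]
        simp only [Expr.eval, hx, hy, e1, e2, e3, hsz, if_true]
        by_cases c1 : a < i
        · have : i - a ≠ 0 := by omega
          by_cases c2 : mat (N + 1) (σ.arr aDOLD) a b = 0 <;>
            by_cases c3 : mat (N + 1) (σ.arr aCAP) a b = 0 <;> simp [c1, c2, c3, this]
        · have : i - a = 0 := by omega
          simp [c1, this]
      rw [hex]
      have hnew : ∀ v, (u < a ∨ u = a ∧ v < b + 1) ↔ (u < a ∨ u = a ∧ v < b) ∨ (u = a ∧ v = b) := by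
        intro v; omega
      by_cases c : a < i ∧ mat (N + 1) (σ.arr aDOLD) a b ≠ 0 ∧ mat (N + 1) (σ.arr aCAP) a b ≠ 0
      · rw [if_pos c, arr_setArr, if_pos rfl, Function.update_apply]
        by_cases hu : u = a
        · subst hu
          simp only [if_true, ne_eq, one_ne_zero, not_false_eq_true, true_iff]
          exact ⟨c.1, b, hb, Or.inr ⟨trivial, Nat.lt_succ_self b⟩, c.2⟩
        · rw [if_neg hu, hI u]
          refine and_congr_right fun _ => exists_congr fun v => and_congr_right fun hv => ?_
          rw [hnew v]; simp [hu]
      · rw [if_neg c, hI u]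
        refine and_congr_right fun hui => exists_congr fun v => and_congr_right fun hv => ?_
        rw [hnew v]
        refine ⟨fun h => ⟨Or.inl h.1, h.2⟩, fun h => ⟨h.1.resolve_right ?_, h.2⟩⟩
        rintro ⟨rfl, rfl⟩
        exact c ⟨hui, h.2⟩)
  simp only [terms, exec_seq]
  have hS := same_exec (loop vU vN (loop vV vN termBody)) σ
  generalize (loop vU vN (loop vV vN termBody)).exec σ = τ at *
  have hE : Env N n k s τ := h.same hS rfl
  have hsz := hE.lt_sz (show i < N + 1 by omega)
  have e3 : τ.var vROWS = i := by rw [hS.1 _ rfl, hi]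
  rw [h.N_eq] at key
  simp only [exec_write, Expr.eval, e3, hsz, if_true, arr_setArr, Function.update_apply]
  by_cases hu : u = i
  · simp [hu]
  · rw [if_neg hu, key u]
    simp only [hu, false_or]
    refine and_congr_right fun hui => exists_congr fun v => and_congr_right fun hv => ?_
    have : u < N := by omega
    simp [this]

/-- The advice has two zones: indices from position `0`, and bits from position `(k + 1) * s`, which
is held by `vRM`. -/
def prep : Cmd :=
  copyCap aORIG ;; copyCap aCUR ;; terms ;; assign vPA (.const 0) ;; assign vPB (.var vRM)

/-! ## An attempt succeeds with suitable advice -/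

theorem edge_congr {c c' : ℕ → ℕ → ℕ} {D D' : ℕ → ℕ → Prop} (hc : ∀ u < N, ∀ v < N, c u v = c' u v)
    (hD : ∀ u < N, ∀ v < N, D u v ↔ D' u v) : Edge N c D = Edge N c' D' := by
  funext u v
  refine propext (and_congr_right fun hu => and_congr_right fun hv => ?_)
  rw [hc u hu v hv, hD u hu v hv]

theorem SmallComps.congr {c c' : ℕ → ℕ → ℕ} {D D' : ℕ → ℕ → Prop} (h : SmallComps N n s c D)
    (hc : ∀ u < N, ∀ v < N, c u v = c' u v) (hD : ∀ u < N, ∀ v < N, D u v ↔ D' u v) :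
    SmallComps N n s c' D' := by
  simp only [SmallComps, Conn, Reach] at h ⊢
  rwa [← edge_congr hc hD]

theorem Solves.congr {c c' : ℕ → ℕ → ℕ} {D D' : ℕ → ℕ → Prop} (h : Solves N n k s c D)
    (hc : ∀ u < N, ∀ v < N, c u v = c' u v) (hD : ∀ u < N, ∀ v < N, D u v ↔ D' u v) :
    Solves N n k s c' D' :=
  ⟨by rw [← cost_congr hc hD]; exact h.1, h.2.congr hc hD⟩

theorem Reach.mono {c c' : ℕ → ℕ → ℕ} {D : ℕ → ℕ → Prop} (hc : ∀ u < N, ∀ v < N, c u v ≤ c' u v)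
    {u v : ℕ} (h : Reach N c D u v) : Reach N c' D u v := by
  induction h with
  | refl => exact .refl
  | @tail x y _ h ih => exact ih.tail ⟨h.1, h.2.1, h.2.2.1.trans_le (hc x h.1 y h.2.1), h.2.2.2⟩

theorem Solves.mono {c c' : ℕ → ℕ → ℕ} {D : ℕ → ℕ → Prop} (h : Solves N n k s c' D)
    (hc : ∀ u < N, ∀ v < N, c u v ≤ c' u v) : Solves N n k s c D := by
  refine ⟨le_trans (dsum_le fun u hu v hv => ?_) h.1, fun u hu => le_trans (wt_mono fun v _ hv => ?_)
    (h.2 u hu)⟩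
  · split
    · exact hc u hu v hv
    · exact le_rfl
  · exact ⟨hv.1.mono hc, hv.2.mono hc⟩

theorem TwinArcs.mono {c c' : ℕ → ℕ → ℕ} (h : TwinArcs N n c')
    (hc : ∀ u < N, ∀ v < N, c u v ≤ c' u v) : TwinArcs N n c := by
  intro u hu hne
  rcases h u hu hne with h1 | h1
  · exact Or.inl fun v hv h2 => h1 v hv (h2.trans_le (hc u hu v hv))
  · exact Or.inr fun v hv h2 => h1 v hv (h2.trans_le (hc v hv u hu))

/-- Each such tail contributes at least one unit to the cost. This limits the terminals that stem
from an old solution to `k`. -/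
theorem card_tails (c : ℕ → ℕ → ℕ) (D : ℕ → ℕ → Prop) :
    ((range N).filter fun u => ∃ v < N, D u v ∧ c u v ≠ 0).card ≤ cost N c D := by
  rw [card_filter]
  refine sum_le_sum fun u hu => ?_
  split
  · rename_i h
    obtain ⟨v, hv, h1, h2⟩ := h
    have := single_le_sum (f := fun v => if D u v then c u v else 0) (fun _ _ => Nat.zero_le _)
      (mem_range.2 hv)
    simp only [if_pos h1] at this
    omega
  · exact Nat.zero_le _

/-- The arcs of the solution for the previous vertices. -/
def oldSet (N : ℕ) (τ : State) (x y : ℕ) : Prop := mat (N + 1) (τ.arr aDOLD) x y ≠ 0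

def attemptMain : Cmd := prep ;; labelling ;; separation ;; verify

theorem prep_spec (h : Env N n k s σ) (hi : σ.var vROWS < N) (h0 : ∀ v, σ.arr aTERM v = 0) :
    (∀ u < N + 1, ∀ v < N + 1, mat (N + 1) ((prep.exec σ).arr aORIG) u v =
      rowsCap (σ.var vROWS + 1) (mat (N + 1) (σ.arr aCAP)) u v) ∧
    (∀ u < N + 1, ∀ v < N + 1, mat (N + 1) ((prep.exec σ).arr aCUR) u v =
      rowsCap (σ.var vROWS + 1) (mat (N + 1) (σ.arr aCAP)) u v) ∧
    (∀ u, (prep.exec σ).arr aTERM u ≠ 0 ↔ u = σ.var vROWS ∨ (u < σ.var vROWS ∧ ∃ v < N,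
      mat (N + 1) (σ.arr aDOLD) u v ≠ 0 ∧ mat (N + 1) (σ.arr aCAP) u v ≠ 0)) ∧
    (prep.exec σ).var vPA = 0 ∧ (prep.exec σ).var vPB = (k + 1) * s := by
  simp only [prep, exec_seq]
  have h1 := copyCap_spec h (a := aORIG) rfl rfl
  have hS1 := same_exec (copyCap aORIG) σ
  generalize (copyCap aORIG).exec σ = α at *
  have hE1 : Env N n k s α := h.same hS1 rfl
  have h2 := copyCap_spec hE1 (a := aCUR) rfl rfl
  rw [hS1.1 vROWS rfl, hS1.2 aCAP rfl] at h2
  have hS2 := same_exec (copyCap aCUR) α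
  generalize (copyCap aCUR).exec α = β at *
  have hE2 : Env N n k s β := hE1.same hS2 rfl
  have h3 := terms_spec hE2 (i := σ.var vROWS) (by rw [hS2.1 vROWS rfl, hS1.1 vROWS rfl]) hi
    (by rw [hS2.2 aTERM rfl, hS1.2 aTERM rfl]; exact h0)
  rw [hS2.2 aDOLD rfl, hS1.2 aDOLD rfl, hS2.2 aCAP rfl, hS1.2 aCAP rfl] at h3
  have hS3 := same_exec terms β
  generalize terms.exec β = γ at *
  have hE3 : Env N n k s γ := hE2.same hS3 rfl
  simp only [exec_assign, Expr.eval, arr_setVar, var_setVar]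
  refine ⟨fun u hu v hv => ?_, fun u hu v hv => ?_, h3, by simp, ?_⟩
  · rw [hS3.2 aORIG rfl, hS2.2 aORIG rfl]; exact h1 u v hu hv
  · rw [hS3.2 aCUR rfl]; exact h2 u v hu hv
  · simpa using hE3.rm

/-- The advice describes the terminal components of `D` and a separator for them. The set found need
not be `D`, but it keeps the same classes apart within the same budget. -/
theorem attemptMain_ang (h : Env N n k s σ) (hN : SplitSize N n) (hs : 1 ≤ s) {C : ℕ → ℕ → ℕ}
    (hC : mat (N + 1) (σ.arr aCAP) = C) (htw : TwinArcs N n C) {i : ℕ} (hi : σ.var vROWS = i)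
    (hiN : i < N) (hold : Solves N n k s (rowsCap i C) (oldSet N σ)) (h1 : ∀ v, σ.arr aTERM v = 0)
    (h2 : ∀ v, σ.arr aLAB v = 0) (h3 : ∀ v, σ.arr aBASE v = 0) (h4 : ∀ v, σ.arr aDNEW v = 0)
    {D : ℕ → ℕ → Prop} (hD : Solves N n k s (rowsCap (i + 1) C) D) :
    ∃ (ρ : State) (l l' : List ℕ), (∀ d ∈ l, d < 2 * (k + 1)) ∧ (∀ d ∈ l', d < 2) ∧
      l.length ≤ (k + 1) * s ∧ l'.length ≤ 2 * ((k + 1) * s) + 2 * k ∧ ρ.var vOK = 1 ∧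
      ∀ f, Matches f 0 l → Matches f ((k + 1) * s) l' →
        attemptMain.exec (setDig σ f) = setDig ρ f := by
  have hn : n ≤ N := by rcases hN with h | h <;> omega
  obtain ⟨p1, p2, p3, p4, p5⟩ := prep_spec h (by omega) h1
  rw [hC, hi] at p1 p2 p3
  have hS1 := same_exec prep σ
  have hpre : ∀ f, prep.exec (setDig σ f) = setDig (prep.exec σ) f := exec_setDig prep rfl σ
  generalize prep.exec σ = α at *
  have hE1 : Env N n k s α := h.same hS1 rfl
  set c := mat (N + 1) (α.arr aCUR) with hc
  have hcr : ∀ u < N, ∀ v < N, rowsCap (i + 1) C u v = c u v := fun u hu v hv =>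
    (p2 u (by omega) v (by omega)).symm
  have hcle : ∀ u < N, ∀ v < N, c u v ≤ C u v := fun u hu v hv => by
    rw [← hcr u hu v hv, rowsCap]; split
    · exact le_rfl
    · exact Nat.zero_le _
  have hDc : Solves N n k s c D := hD.congr hcr fun _ _ _ _ => Iff.rfl
  have hT : ((range N).filter (α.arr aTERM · ≠ 0)).card ≤ k + 1 := by
    have h5 : (range N).filter (α.arr aTERM · ≠ 0) ⊆ insert i ((range N).filter
        fun u => ∃ v < N, oldSet N σ u v ∧ rowsCap i C u v ≠ 0) := by
      intro u hu
      simp only [mem_filter, mem_range, mem_insert] at hu ⊢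
      rcases (p3 u).1 hu.2 with h6 | ⟨h6, v, hv, h7, h8⟩
      · exact Or.inl h6
      · exact Or.inr ⟨hu.1, v, hv, h7, by rw [rowsCap, if_pos h6]; exact h8⟩
    refine (card_le_card h5).trans ((card_insert_le _ _).trans ?_)
    have := card_tails (N := N) (rowsCap i C) (oldSet N σ)
    have := hold.1
    omega
  obtain ⟨lab, hlab, hle⟩ := exists_labels N k c D (α.arr aTERM · ≠ 0)
    (by convert hT)
  obtain ⟨β, hA1, hl, hpa, hpb⟩ := labelling_spec hE1 hN rfl (htw.mono hcle) hDc.1 hDc.2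
    (by rw [hS1.2 aBASE rfl]; exact h3) (by rw [hS1.2 aLAB rfl]; exact h2) hlab hle hs hT
  have hS2 := hA1.1
  have hE2 : Env N n k s β := hE1.same hS2 rfl
  have hlab' : Labels N c D (α.arr aTERM · ≠ 0) (β.arr aLAB) := hlab.of_eq fun v hv => by
    rw [hl v, if_pos hv]
  obtain ⟨γ, hA2, g1, g2, g3, g4⟩ := separation_spec (rr := 2 * (k + 1)) hE2 (c0 := c) rfl
    (by rw [hS2.2 aBASE rfl, hS1.2 aBASE rfl]; exact h3)
    (fun x hx y hy => by rw [hS2.2 aCUR rfl])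
    (by rw [hS2.2 aDNEW rfl, hS1.2 aDNEW rfl]; exact h4) (hlab'.valid hDc.1 (k + 1))
  have hS3 := hA2.1
  have hE3 : Env N n k s γ := hE2.same hS3 rfl
  have hA3 : Ang (2 * (k + 1)) verify γ (verify.exec γ) := Ang.of_noDig rfl rfl rfl γ
  -- An arc whose tail is no terminal has a tail below `i` and avoids the old solution, which is the
  -- hypothesis `hT` of `Labels.small`.
  have hsm : SmallComps N n s c (delSet N γ) := by
    refine hlab'.small (D0 := oldSet N σ) (c0 := rowsCap i C) (k := k) hDc.2 hold.2
      (fun v hv => by rw [hl v, if_pos hv]; exact hle v hv) ?_ ?_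
    · rintro u v ⟨hu, hv, h5, h6⟩ h7
      have h8 : ¬ (u = i ∨ (u < i ∧ ∃ v < N, mat (N + 1) (σ.arr aDOLD) u v ≠ 0 ∧ C u v ≠ 0)) :=
        fun h => h7 ((p3 u).2 h)
      rw [← hcr u hu v hv, rowsCap] at h5
      have hui : u < i + 1 := by by_contra h; rw [if_neg h] at h5; omega
      rw [if_pos hui] at h5
      have hui' : u < i := by
        by_contra h; exact h8 (Or.inl (by omega))
      refine ⟨hu, hv, by rw [rowsCap, if_pos hui']; exact h5, fun h9 => h8 (Or.inr ⟨hui', v, hv, h9, ?_⟩)⟩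
      omega
    · intro p hp hp'
      obtain ⟨B, hB, hcl⟩ := g3 p hp hp'
      refine ⟨B, hB, fun u hu v hv h5 h6 => ?_⟩
      by_contra h7
      have := hcl u hu v hv h5
      rw [g1 u hu v hv, if_neg h7] at this
      omega
  have hok := verify_spec hE3 hn
  have hsol : Solves N n k s (mat (N + 1) (γ.arr aORIG)) (delSet N γ) := by
    refine Solves.congr ⟨g2, hsm⟩ (fun u hu v hv => ?_) fun _ _ _ _ => Iff.rfl
    rw [hS3.2 aORIG rfl, hS2.2 aORIG rfl, p1 u (by omega) v (by omega), hcr u hu v hv]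
  rw [if_pos hsol] at hok
  have e1 : (verify.exec γ).var vPA = β.var vPA := by rw [hA3.1.1 vPA rfl, hS3.1 vPA rfl]
  have e2 : (verify.exec γ).var vPB = γ.var vPB := by rw [hA3.1.1 vPB rfl]
  obtain ⟨-, l, l', m1, m2, m3, m4, m5⟩ := hA1.seq (hA2.seq hA3)
  rw [p4] at m3 m5 hpa
  rw [p5] at m4 m5 hpb
  refine ⟨verify.exec γ, l, l', m1, m2, by omega, by omega, hok, fun f hf hf' => ?_⟩
  simp only [attemptMain]
  rw [exec_seq, hpre]
  exact m5 f hf hf'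

/-- A successful attempt finds a solution. -/
theorem attemptMain_sound (h : Env N n k s σ) (hn : n ≤ N) {C : ℕ → ℕ → ℕ}
    (hC : mat (N + 1) (σ.arr aCAP) = C) {i : ℕ} (hi : σ.var vROWS = i) (hiN : i < N)
    (h1 : ∀ v, σ.arr aTERM v = 0) :
    (Solves N n k s (rowsCap (i + 1) C) (delSet N (attemptMain.exec σ)) ∧
      (attemptMain.exec σ).var vOK = 1) ∨ (attemptMain.exec σ).var vOK = 0 := by
  obtain ⟨p1, -⟩ := prep_spec h (by omega) h1
  simp only [attemptMain, exec_seq]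
  have hS1 := same_exec prep σ
  generalize prep.exec σ = α at *
  have hE1 : Env N n k s α := h.same hS1 rfl
  have hS2 := same_exec labelling α
  generalize labelling.exec α = β at *
  have hE2 : Env N n k s β := hE1.same hS2 rfl
  have hS3 := same_exec separation β
  generalize separation.exec β = γ at *
  have hE3 : Env N n k s γ := hE2.same hS3 rfl
  have hv := verify_spec hE3 hn
  have hS4 := same_exec verify γ
  generalize verify.exec γ = δ at *
  by_cases c : Solves N n k s (mat (N + 1) (γ.arr aORIG)) (delSet N γ)
  · left
    rw [if_pos c] at hv
    refine ⟨c.congr (fun u hu v hv => ?_) fun u _ v _ => ?_, hv⟩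
    · rw [hS3.2 aORIG rfl, hS2.2 aORIG rfl, p1 u (by omega) v (by omega), hC, hi]
    · simp only [delSet, hS4.2 aDNEW rfl]
  · right
    rw [if_neg c] at hv; exact hv

/-! ## Reset -/

/-- What attempts may change, including the advice pointers, and the counters of `increment`. The
missing `14`, `15` and `16` are `vROWS`, `vRUN` and `vANS`, which persist between attempts. -/
def scratchVars : List ℕ :=
  [12, 13, 17, 18, 20, 21, 22, 23, 24, 25, 26, 27, 28, 29, 30, 31, 32, 33, 34, 35, 36, 37, 38, 39, 40, 41, 42,
    43, 44, 45, 46]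

def scratchArrs : List ℕ := [10, 11, 12, 13, 14, 15, 16, 17, 18, 19, 20, 21, 22, 23]

def zeroVars : List ℕ → Cmd
  | [] => skip
  | x :: l => assign x (.const 0) ;; zeroVars l

def zeroArrs : List ℕ → Cmd
  | [] => skip
  | a :: l => write a (.var vZ) (.const 0) ;; zeroArrs l

theorem zeroVars_spec (l : List ℕ) (σ : State) :
    (∀ y, ((zeroVars l).exec σ).var y = if y ∈ l then 0 else σ.var y) ∧
      ((zeroVars l).exec σ).arr = σ.arr := by
  induction l generalizing σ with
  | nil => simp [zeroVars]
  | cons x l ih =>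
    obtain ⟨h1, h2⟩ := ih (σ.setVar x 0)
    refine ⟨fun y => ?_, ?_⟩
    · simp only [zeroVars, exec_seq, exec_assign, Expr.eval, h1, var_setVar, List.mem_cons]
      by_cases c1 : y ∈ l <;> by_cases c2 : y = x <;> simp [c1, c2]
    · simp only [zeroVars, exec_seq, exec_assign, Expr.eval, h2, arr_setVar]

theorem zeroArrs_spec (l : List ℕ) (σ : State) (hz : σ.var vZ < σ.var vSZ) :
    (∀ a j, ((zeroArrs l).exec σ).arr a j = if a ∈ l ∧ j = σ.var vZ then 0 else σ.arr a j) ∧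
      ((zeroArrs l).exec σ).var = σ.var := by
  induction l generalizing σ with
  | nil => simp [zeroArrs]
  | cons x l ih =>
    obtain ⟨h1, h2⟩ := ih (σ.setArr x (σ.var vZ) 0) hz
    have e : (zeroArrs (x :: l)).exec σ = (zeroArrs l).exec (σ.setArr x (σ.var vZ) 0) := by
      simp only [zeroArrs, exec_seq, exec_write, Expr.eval, hz, if_true]
    refine ⟨fun a j => ?_, ?_⟩
    · simp only [e, h1, var_setArr, arr_setArr, List.mem_cons]
      by_cases c1 : a ∈ l <;> by_cases c2 : a = x <;> by_cases c3 : j = σ.var vZ <;>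
        simp [c1, c2, c3]
    · rw [e, h2, var_setArr]

def reset : Cmd := loop vZ vSZ (zeroArrs scratchArrs) ;; zeroVars scratchVars

theorem reset_spec (σ : State) :
    (∀ y, (reset.exec σ).var y = if y ∈ scratchVars then 0 else σ.var y) ∧
      ∀ a j, (reset.exec σ).arr a j = if a ∈ scratchArrs ∧ j < σ.var vSZ then 0 else σ.arr a j := by
  obtain ⟨τ, ⟨h1, h2⟩, h4, h3⟩ := loop_rule (x := vZ) (b := vSZ) (p := zeroArrs scratchArrs) (σ := σ)
    (fun i τ => (∀ a j, τ.arr a j = if a ∈ scratchArrs ∧ j < i then 0 else σ.arr a j) ∧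
      ∀ y, y ≠ vZ → τ.var y = σ.var y)
    (by simp) (fun i τ hi hS hI => by
      obtain ⟨g1, g2⟩ := zeroArrs_spec scratchArrs (τ.setVar vZ i)
        (by simp [hI.2 vSZ (by decide), hi])
      refine ⟨fun a j => ?_, fun y hy => ?_⟩
      · rw [g1, arr_setVar, hI.1, var_setVar, if_pos rfl]
        by_cases c1 : a ∈ scratchArrs
        · by_cases c2 : j = i
          · simp [c1, c2]
          · have : j < i + 1 ↔ j < i := by omega
            simp [c2, this]
        · simp [c1]
      · rw [g2, var_setVar, if_neg hy, hI.2 y hy])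
  obtain ⟨g1, g2⟩ := zeroVars_spec scratchVars ((loop vZ vSZ (zeroArrs scratchArrs)).exec σ)
  refine ⟨fun y => ?_, fun a j => ?_⟩
  · simp only [reset, exec_seq, g1]
    split
    · rfl
    · rename_i hy
      have : y ≠ vZ := by rintro rfl; exact hy (by decide)
      rw [h3, var_setVar, if_neg this, h2 y this]
  · simp only [reset, exec_seq, g2]
    rw [h3, arr_setVar, h1]

namespace Cmd

/-- The variables that a program may change. -/
def vars : Cmd → List ℕ
  | skip => []
  | assign x _ => [x]
  | write _ _ _ => []
  | seq p q => vars p ++ vars q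
  | cond _ p q => vars p ++ vars q
  | loop x _ p => x :: vars p

/-- The arrays that a program may change. -/
def arrs : Cmd → List ℕ
  | skip => []
  | assign _ _ => []
  | write a _ _ => [a]
  | seq p q => arrs p ++ arrs q
  | cond _ p q => arrs p ++ arrs q
  | loop _ _ p => arrs p

theorem wv_of_not_mem (p : Cmd) {y : ℕ} (h : y ∉ p.vars) : p.wv y = false := by
  have beq : ∀ x, x ≠ y → Nat.beq x y = false := fun x hx =>
    Bool.eq_false_iff.2 fun h => hx (Nat.eq_of_beq_eq_true h)
  induction p with
  | skip => rfl
  | assign x e => exact beq x fun e => h (by simp [vars, e])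
  | write a i e => rfl
  | seq p q hp hq =>
    simp only [vars, List.mem_append, not_or] at h
    simp [wv, hp h.1, hq h.2]
  | cond e p q hp hq =>
    simp only [vars, List.mem_append, not_or] at h
    simp [wv, hp h.1, hq h.2]
  | loop x b p hp =>
    simp only [vars, List.mem_cons, not_or] at h
    simp [wv, hp h.2, beq x (Ne.symm h.1)]

theorem wa_of_not_mem (p : Cmd) {y : ℕ} (h : y ∉ p.arrs) : p.wa y = false := by
  induction p with
  | skip => rfl
  | assign x e => rfl
  | write a i e =>
    exact Bool.eq_false_iff.2 fun h' => h (by simp [arrs, Nat.eq_of_beq_eq_true h'])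
  | seq p q hp hq =>
    simp only [arrs, List.mem_append, not_or] at h
    simp [wa, hp h.1, hq h.2]
  | cond e p q hp hq =>
    simp only [arrs, List.mem_append, not_or] at h
    simp [wa, hp h.1, hq h.2]
  | loop x b p hp => exact hp h

end Cmd

/-- The two states differ only in scratch memory and advice. -/
structure Eqv (σ τ : State) : Prop where
  var : ∀ y, y ∉ scratchVars → τ.var y = σ.var y
  arr : ∀ a, a ∉ scratchArrs → a ≠ aDIG → τ.arr a = σ.arr a
  arr_ge : ∀ a, a ≠ aDIG → ∀ j, σ.var vSZ ≤ j → τ.arr a j = σ.arr a j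

theorem eqv_exec (p : Cmd) (hv : (p.vars.all (scratchVars.contains ·)) = true)
    (ha : (p.arrs.all (scratchArrs.contains ·)) = true) (σ : State) : Eqv σ (p.exec σ) := by
  simp only [List.all_eq_true, List.contains_iff_mem] at hv ha
  refine ⟨fun y hy => exec_var _ _ _ (wv_of_not_mem _ fun h => hy (hv y h)),
    fun a ha' _ => exec_arr _ _ _ (wa_of_not_mem _ fun h => ha' (ha a h)),
    fun a _ j hj => exec_arr_ge _ _ _ _ (wv_of_not_mem _ fun h => ?_) hj⟩
  exact absurd (hv _ h) (by decide)

/-- Scratch memory below `vSZ` is erased; everywhere else the two states agree, up to the advice,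
which is set to `f` in both. -/
theorem reset_eqv {σ τ : State} (h : Eqv σ τ) (f : ℕ → ℕ) :
    reset.exec (setDig τ f) = reset.exec (setDig σ f) := by
  obtain ⟨g1, g2⟩ := reset_spec (setDig τ f)
  obtain ⟨h1, h2⟩ := reset_spec (setDig σ f)
  have hv : (reset.exec (setDig τ f)).var = (reset.exec (setDig σ f)).var := by
    funext y
    rw [g1, h1]
    split
    · rfl
    · exact h.var y (by assumption)
  have ha : (reset.exec (setDig τ f)).arr = (reset.exec (setDig σ f)).arr := by
    funext a j
    rw [g2, h2]
    have e : (setDig τ f).var vSZ = (setDig σ f).var vSZ := h.var vSZ (by decide)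
    rw [e]
    split
    · rfl
    · rename_i hc
      by_cases hd : a = aDIG
      · subst hd; simp [setDig]
      · simp only [setDig, Function.update_of_ne hd]
        by_cases hs : a ∈ scratchArrs
        · refine h.arr_ge a hd j ?_
          by_contra hlt
          exact hc ⟨hs, by simpa [setDig] using hlt⟩
        · rw [h.arr a hs hd]
  cases h3 : reset.exec (setDig τ f)
  cases h4 : reset.exec (setDig σ f)
  rw [h3, h4] at hv ha
  simp only at hv ha
  rw [hv, ha]

def attempt : Cmd := reset ;; attemptMain

theorem attempt_eqv {σ τ : State} (h : Eqv σ τ) (f : ℕ → ℕ) :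
    attempt.exec (setDig τ f) = attempt.exec (setDig σ f) := by
  simp only [attempt, exec_seq]
  rw [reset_eqv h]

theorem eqv_attempt (σ : State) : Eqv σ (attempt.exec σ) := eqv_exec attempt rfl rfl σ

notation "vCAR" => 17
notation "vI" => 18

/-! ## Enumeration of the advice -/

/-- The place values of a number system with the given radices. -/
def placeVal (rad : ℕ → ℕ) (i : ℕ) : ℕ := ∏ j ∈ range i, rad j

/-- The number with the digits `f 0`, …, `f (i - 1)`. -/
def digVal (rad f : ℕ → ℕ) (i : ℕ) : ℕ := ∑ j ∈ range i, f j * placeVal rad j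

theorem placeVal_succ (rad : ℕ → ℕ) (i : ℕ) : placeVal rad (i + 1) = rad i * placeVal rad i := by
  unfold placeVal; rw [prod_range_succ, mul_comm]

theorem digVal_succ (rad f : ℕ → ℕ) (i : ℕ) :
    digVal rad f (i + 1) = digVal rad f i + f i * placeVal rad i := by
  unfold digVal; rw [sum_range_succ]

theorem digVal_congr {rad f g : ℕ → ℕ} {i : ℕ} (h : ∀ j < i, f j = g j) :
    digVal rad f i = digVal rad g i :=
  sum_congr rfl fun j hj => by rw [h j (mem_range.1 hj)]

theorem digVal_lt {rad f : ℕ → ℕ} {i : ℕ} (h : ∀ j < i, f j < rad j) :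
    digVal rad f i < placeVal rad i := by
  induction i with
  | zero => simp [digVal, placeVal]
  | succ i ih =>
    rw [digVal_succ, placeVal_succ]
    have h1 := ih fun j hj => h j (by omega)
    have h2 := Nat.mul_le_mul_right (placeVal rad i) (h i (by omega) : f i + 1 ≤ rad i)
    rw [Nat.succ_mul] at h2; omega

/-- Uniqueness of mixed radix expansions: the lower digits stay below the next place value. Thus a
counter that takes every value runs through every advice. -/
theorem digVal_inj {rad f g : ℕ → ℕ} {i : ℕ} (hf : ∀ j < i, f j < rad j) (hg : ∀ j < i, g j < rad j)
    (h : digVal rad f i = digVal rad g i) : ∀ j < i, f j = g j := by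
  induction i with
  | zero => intro j hj; omega
  | succ i ih =>
    rw [digVal_succ, digVal_succ] at h
    have h1 := digVal_lt fun j hj => hf j (Nat.lt_succ_of_lt hj)
    have h2 := digVal_lt fun j hj => hg j (Nat.lt_succ_of_lt hj)
    have h3 : f i = g i := by
      rcases lt_trichotomy (f i) (g i) with h3 | h3 | h3
      · have := Nat.mul_le_mul_right (placeVal rad i) (h3 : f i + 1 ≤ g i)
        rw [Nat.succ_mul] at this; omega
      · exact h3
      · have := Nat.mul_le_mul_right (placeVal rad i) (h3 : g i + 1 ≤ f i)
        rw [Nat.succ_mul] at this; omega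
    intro j hj
    by_cases hji : j = i
    · rw [hji, h3]
    · exact ih (fun j hj => hf j (by omega)) (fun j hj => hg j (by omega)) (by rw [h3] at h; omega) j
        (by omega)

def incrementBody : Cmd :=
  cond (.var vCAR) (cond (.sub (.read aRAD (.var vI)) (.add (.read aDIG (.var vI)) (.const 1)))
    (write aDIG (.var vI) (.add (.read aDIG (.var vI)) (.const 1)) ;; assign vCAR (.const 0))
    (write aDIG (.var vI) (.const 0))) skip

/-- Pass to the next advice. -/
def increment : Cmd := assign vCAR (.const 1) ;; loop vI vL incrementBody

/-- While the carry is pending, all lower digits were maximal and have become zero. A carry that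
survives all digits means that the advice was the last one. -/
theorem increment_spec {rad : ℕ → ℕ} {L : ℕ} (hL : σ.var vL = L) (hsz : L ≤ σ.var vSZ)
    (hrad : ∀ i < L, σ.arr aRAD i = rad i) (hd : ∀ i < L, σ.arr aDIG i < rad i) :
    (∀ i < L, (increment.exec σ).arr aDIG i < rad i) ∧
      (((increment.exec σ).var vCAR = 0 ∧
          digVal rad ((increment.exec σ).arr aDIG) L = digVal rad (σ.arr aDIG) L + 1) ∨
        ((increment.exec σ).var vCAR ≠ 0 ∧ digVal rad (σ.arr aDIG) L + 1 = placeVal rad L)) := by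
  have hlv : (σ.setVar vCAR 1).var vL = L := by simpa using hL
  obtain ⟨τ, ⟨h1, h2, h3⟩, hS, hex⟩ := loop_rule (x := vI) (b := vL) (p := incrementBody)
    (σ := σ.setVar vCAR 1)
    (fun i τ => (∀ j, i ≤ j → τ.arr aDIG j = σ.arr aDIG j) ∧ (∀ j < i, τ.arr aDIG j < rad j) ∧
      ((τ.var vCAR = 0 ∧ digVal rad (τ.arr aDIG) i = digVal rad (σ.arr aDIG) i + 1) ∨
        (τ.var vCAR = 1 ∧ (∀ j < i, τ.arr aDIG j = 0) ∧
          digVal rad (σ.arr aDIG) i + 1 = placeVal rad i)))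
    (by simp [digVal, placeVal]) (fun i τ hi hS ⟨h1, h2, h3⟩ => by
      rw [hlv] at hi
      have e1 : τ.arr aRAD i = rad i := by rw [hS.2 aRAD rfl, arr_setVar, hrad i hi]
      have e2 : i < τ.var vSZ := by rw [hS.1 vSZ rfl]; simp; omega
      have e3 : τ.arr aDIG i = σ.arr aDIG i := h1 i le_rfl
      have hdi := hd i hi
      have hex : incrementBody.exec (τ.setVar vI i) =
          if τ.var vCAR = 0 then τ.setVar vI i else
            if rad i - (σ.arr aDIG i + 1) = 0 then (τ.setVar vI i).setArr aDIG i 0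
            else ((τ.setVar vI i).setArr aDIG i (σ.arr aDIG i + 1)).setVar vCAR 0 := by
        simp [incrementBody, e1, e2, e3]
      rw [hex]
      have hcong : ∀ v, digVal rad (Function.update (τ.arr aDIG) i v) i = digVal rad (τ.arr aDIG) i :=
        fun v => digVal_congr fun j hj => Function.update_of_ne (by omega) _ _
      rcases h3 with ⟨h3, h4⟩ | ⟨h3, h4, h5⟩
      · rw [if_pos h3]
        refine ⟨fun j hj => h1 j (by omega), fun j hj => ?_, Or.inl ⟨by simpa using h3, ?_⟩⟩
        · by_cases hji : j = i
          · rw [hji, arr_setVar, e3]; exact hdi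
          · exact h2 j (by omega)
        · rw [arr_setVar, digVal_succ, digVal_succ, h4, e3]; omega
      · rw [if_neg (by omega)]
        have h0 : digVal rad (τ.arr aDIG) i = 0 :=
          sum_eq_zero fun j hj => by rw [h4 j (mem_range.1 hj), zero_mul]
        by_cases c : rad i - (σ.arr aDIG i + 1) = 0
        · rw [if_pos c]
          simp only [arr_setArr, if_true, arr_setVar, var_setArr, var_setVar]
          refine ⟨fun j hj => ?_, fun j hj => ?_, Or.inr ⟨by simpa using h3, fun j hj => ?_, ?_⟩⟩
          · rw [Function.update_of_ne (by omega)]; exact h1 j (by omega)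
          · rw [Function.update_apply]; split
            · rename_i h; rw [h]; omega
            · exact h2 j (by omega)
          · rw [Function.update_apply]; split
            · rfl
            · exact h4 j (by omega)
          · have : rad i = σ.arr aDIG i + 1 := by omega
            rw [digVal_succ, placeVal_succ, this, add_mul]; omega
        · rw [if_neg c]
          simp only [arr_setArr, if_true, arr_setVar, var_setArr, var_setVar]
          refine ⟨fun j hj => ?_, fun j hj => ?_, Or.inl ⟨trivial, ?_⟩⟩
          · rw [Function.update_of_ne (by omega)]; exact h1 j (by omega)
          · rw [Function.update_apply]; split
            · rename_i h; rw [h]; omega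
            · exact h2 j (by omega)
          · rw [digVal_succ, digVal_succ, hcong, h0, Function.update_self, add_mul]; omega)
  rw [hlv] at h1 h2 h3
  have e : increment.exec σ = τ.setVar vI L := by
    simp only [increment, exec_seq, exec_assign, Expr.eval]
    rw [hex, hlv]
  rw [e]
  refine ⟨h2, ?_⟩
  rcases h3 with ⟨h3, h4⟩ | ⟨h3, h4, h5⟩
  · exact Or.inl ⟨by simpa using h3, h4⟩
  · exact Or.inr ⟨by simp [h3], h5⟩

/-! ## Iterative compression -/

def adoptBody : Cmd := wr aDOLD vU vV (rd aDNEW vU vV)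

/-- Adopt the solution found, and go on to the next vertex. -/
def onSuccess : Cmd :=
  loop vU vM (loop vV vM adoptBody) ;; loop vI vL (write aDIG (.var vI) (.const 0)) ;;
    assign vROWS (.add (.var vROWS) (.const 1)) ;;
    cond (.sub (.var vN) (.var vROWS)) skip (assign vANS (.const 1) ;; assign vRUN (.const 0))

def onFailure : Cmd :=
  increment ;; cond (.var vCAR) (assign vANS (.const 0) ;; assign vRUN (.const 0)) skip

def mainBody : Cmd := attempt ;; cond (.var vOK) onSuccess onFailure

theorem Env.of_eq {τ : State} (h : Env N n k s σ)
    (hv : ∀ y ∈ [0, 1, 3, vN, vM, vKP, vSZ, vTK, vOFF, vRM], τ.var y = σ.var y)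
    (ha : τ.arr aROW = σ.arr aROW) : Env N n k s τ := by
  simp only [List.mem_cons, List.not_mem_nil, or_false, forall_eq_or_imp, forall_eq] at hv
  obtain ⟨h0, h1, h2, h3, h4, h5, h6, h7, h8, h9⟩ := hv
  constructor
  · rw [h0]; exact h.n_eq
  · rw [h1]; exact h.k_eq
  · rw [h2]; exact h.s_eq
  · rw [h3]; exact h.N_eq
  · rw [h4]; exact h.M_eq
  · rw [h5]; exact h.kp
  · rw [h6]; exact h.sz
  · rw [h7]; exact h.tk
  · rw [h8]; exact h.off
  · rw [h9]; exact h.rm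
  · rw [ha]; exact h.row
  · rw [h6]; exact h.cand

/-- The number of values of the advice digits. -/
def radix (k m i : ℕ) : ℕ := if i < m then 2 * (k + 1) else 2

/-- The number of advice digits. -/
def adviceLen (k s : ℕ) : ℕ := (k + 1) * s + (2 * ((k + 1) * s) + 2 * k)

theorem radix_pos (k m i : ℕ) : 0 < radix k m i := by unfold radix; split <;> omega

theorem placeVal_radix (k m b : ℕ) : placeVal (radix k m) (m + b) = (2 * (k + 1)) ^ m * 2 ^ b := by
  have h1 : ∏ j ∈ range m, radix k m j = (2 * (k + 1)) ^ m := by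
    rw [prod_congr rfl fun j hj => (by rw [radix, if_pos (mem_range.1 hj)] :
      radix k m j = 2 * (k + 1))]
    simp
  have h2 : ∏ j ∈ range b, radix k m (m + j) = 2 ^ b := by
    rw [prod_congr rfl fun j _ => (by rw [radix, if_neg (by omega)] : radix k m (m + j) = 2)]
    simp
  rw [placeVal, prod_range_add, h1, h2]

/-- With the advice `g`, the attempt succeeds. -/
def Target (σ : State) (L : ℕ) (g : ℕ → ℕ) : Prop :=
  ∀ f : ℕ → ℕ, (∀ j < L, f j = g j) → (attempt.exec (setDig σ f)).var vOK = 1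

theorem Target.eqv {τ : State} {L : ℕ} {g : ℕ → ℕ} (h : Target σ L g) (he : Eqv σ τ) :
    Target τ L g := fun f hf => by rw [attempt_eqv he]; exact h f hf

/-- The part of the memory that describes the instance and its advice. -/
structure Setup (N n k s Z : ℕ) (C : ℕ → ℕ → ℕ) (σ : State) : Prop where
  env : Env N n k s σ
  sz : σ.var vSZ = Z
  len : σ.var vL = adviceLen k s
  len_le : adviceLen k s ≤ Z
  rad : ∀ i < adviceLen k s, σ.arr aRAD i = radix k ((k + 1) * s) i
  cap : mat (N + 1) (σ.arr aCAP) = C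
  dig : ∀ i < adviceLen k s, σ.arr aDIG i < radix k ((k + 1) * s) i
  clean : ∀ a ∈ scratchArrs, ∀ j, Z ≤ j → σ.arr a j = 0

theorem Setup.exec_reset {Z : ℕ} {C : ℕ → ℕ → ℕ} (h : Setup N n k s Z C σ) (f : ℕ → ℕ) :
    Env N n k s (reset.exec (setDig σ f)) ∧
      (reset.exec (setDig σ f)).var vROWS = σ.var vROWS ∧
      (reset.exec (setDig σ f)).arr aCAP = σ.arr aCAP ∧
      (reset.exec (setDig σ f)).arr aDOLD = σ.arr aDOLD ∧
      (reset.exec (setDig σ f)).arr aDIG = f ∧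
      ∀ a ∈ scratchArrs, ∀ j, (reset.exec (setDig σ f)).arr a j = 0 := by
  obtain ⟨h1, h2⟩ := reset_spec (setDig σ f)
  have hv : ∀ y, y ∉ scratchVars → (reset.exec (setDig σ f)).var y = σ.var y := fun y hy => by
    rw [h1, if_neg hy]; rfl
  have ha : ∀ a, a ∉ scratchArrs → a ≠ aDIG → (reset.exec (setDig σ f)).arr a = σ.arr a :=
    fun a ha hd => by
      funext j; rw [h2, if_neg fun h => ha h.1]; simp [setDig, Function.update_of_ne hd]
  refine ⟨h.env.of_eq (fun y hy => hv y ?_) (ha _ (by decide) (by decide)), hv _ (by decide),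
    ha _ (by decide) (by decide), ha _ (by decide) (by decide), ?_, fun a has j => ?_⟩
  · revert y; decide
  · funext j; rw [h2, if_neg fun h => absurd h.1 (by decide)]; simp [setDig]
  · rw [h2]
    split
    · rfl
    · rename_i hc
      have hd : a ≠ aDIG := by rintro rfl; exact absurd has (by decide)
      simp only [setDig, Function.update_of_ne hd]
      refine h.clean a has j ?_
      rw [← h.sz]
      by_contra hlt
      exact hc ⟨has, by simpa [setDig] using hlt⟩

theorem Setup.target {Z : ℕ} {C : ℕ → ℕ → ℕ} (h : Setup N n k s Z C σ) (hN : SplitSize N n)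
    (hs : 1 ≤ s) (htw : TwinArcs N n C) {i : ℕ} (hi : σ.var vROWS = i) (hiN : i < N)
    (hold : Solves N n k s (rowsCap i C) (oldSet N σ)) {D : ℕ → ℕ → Prop}
    (hD : Solves N n k s (rowsCap (i + 1) C) D) :
    ∃ g : ℕ → ℕ, (∀ i < adviceLen k s, g i < radix k ((k + 1) * s) i) ∧
      Target σ (adviceLen k s) g := by
  obtain ⟨r1, r2, r3, r4, -, r6⟩ := h.exec_reset (fun _ => 0)
  have hre : ∀ f, reset.exec (setDig σ f) = setDig (reset.exec (setDig σ fun _ => 0)) f := by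
    intro f
    rw [← exec_setDig reset rfl]
    congr 1
    simp [setDig]
  generalize reset.exec (setDig σ fun _ => 0) = α at *
  obtain ⟨ρ, l, l', h1, h2, h3, h4, h5, h6⟩ := attemptMain_ang r1 hN hs (by rw [r3]; exact h.cap) htw
    (by rw [r2, hi]) hiN (by unfold oldSet at hold ⊢; rw [r4]; exact hold)
    (r6 _ (by decide)) (r6 _ (by decide)) (r6 _ (by decide)) (r6 _ (by decide)) hD
  set m := (k + 1) * s with hm
  -- Positions that are never read are filled with `0`, a legal digit for every radix.
  refine ⟨fun j => if j < m then l.getD j 0 else l'.getD (j - m) 0, fun j hj => ?_, fun f hf => ?_⟩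
  · unfold radix
    by_cases c : j < m
    · simp only [if_pos c]
      by_cases c1 : j < l.length
      · rw [List.getD_eq_getElem _ _ c1]; exact h1 _ (List.getElem_mem c1)
      · rw [List.getD_eq_default _ _ (by omega)]; omega
    · simp only [if_neg c]
      by_cases c1 : j - m < l'.length
      · rw [List.getD_eq_getElem _ _ c1]; exact h2 _ (List.getElem_mem c1)
      · rw [List.getD_eq_default _ _ (by omega)]; omega
  · simp only [attempt, exec_seq]
    rw [hre f, h6 f]
    · exact h5
    · intro j hj
      rw [hf _ (by unfold adviceLen; omega)]
      simp only [zero_add]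
      rw [if_pos (by omega), List.getD_eq_getElem _ _ hj]
    · intro j hj
      rw [hf _ (by unfold adviceLen; omega)]
      simp only [Nat.add_sub_cancel_left]
      rw [if_neg (by omega), List.getD_eq_getElem _ _ hj]

/-- The invariant of the main loop. -/
structure Core (N n k s Z : ℕ) (C : ℕ → ℕ → ℕ) (σ : State) : Prop extends Setup N n k s Z C σ where
  run : σ.var vRUN ≠ 0 → σ.var vROWS < N ∧ Solves N n k s (rowsCap (σ.var vROWS) C) (oldSet N σ) ∧
    ∀ D, Solves N n k s (rowsCap (σ.var vROWS + 1) C) D →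
      ∃ g : ℕ → ℕ, (∀ i < adviceLen k s, g i < radix k ((k + 1) * s) i) ∧
        Target σ (adviceLen k s) g ∧
        digVal (radix k ((k + 1) * s)) (σ.arr aDIG) (adviceLen k s) ≤
          digVal (radix k ((k + 1) * s)) g (adviceLen k s)
  halt : σ.var vRUN = 0 → (σ.var vANS = 1 ∧ Solves N n k s C (oldSet N σ)) ∨
    (σ.var vANS = 0 ∧ ∀ D, ¬ Solves N n k s C D)

/-- A bound on the number of remaining attempts. -/
noncomputable def remaining (N k s : ℕ) (σ : State) : ℕ :=
  if σ.var vRUN = 0 then 0 else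
    (N - σ.var vROWS) * placeVal (radix k ((k + 1) * s)) (adviceLen k s) -
      digVal (radix k ((k + 1) * s)) (σ.arr aDIG) (adviceLen k s)

theorem onSuccess_spec {Z : ℕ} {C : ℕ → ℕ → ℕ} (h : Setup N n k s Z C σ) :
    (∀ i < adviceLen k s, (onSuccess.exec σ).arr aDIG i = 0) ∧
    (∀ u < N, ∀ v < N, oldSet N (onSuccess.exec σ) u v ↔ delSet N σ u v) ∧
    (onSuccess.exec σ).var vROWS = σ.var vROWS + 1 ∧
    ((σ.var vROWS + 1 < N ∧ (onSuccess.exec σ).var vRUN = σ.var vRUN) ∨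
      (N ≤ σ.var vROWS + 1 ∧ (onSuccess.exec σ).var vRUN = 0 ∧ (onSuccess.exec σ).var vANS = 1)) := by
  simp only [onSuccess, exec_seq]
  have h1 : ∀ u < N, ∀ v < N, mat (N + 1) (((loop vU vM (loop vV vM adoptBody)).exec σ).arr aDOLD) u v =
      mat (N + 1) (σ.arr aDNEW) u v := by
    intro u hu v hv
    have hInv := loop2_rule (x := vU) (y := vV) (b := vM) (d := vM) (p := adoptBody) (σ := σ)
      (fun i j τ => ∀ u < N + 1, ∀ v < N + 1, (u < i ∨ (u = i ∧ v < j)) →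
        mat (N + 1) (τ.arr aDOLD) u v = mat (N + 1) (σ.arr aDNEW) u v)
      rfl (by decide) (by decide) (by decide) rfl (fun _ _ _ _ _ _ h => h)
      (fun u _ v _ h => by omega)
      (fun i τ _ hI u hu v hv huv => hI u hu v hv (by rw [h.env.M_eq]; omega))
      (fun i j τ hi hj hS hx hy hI u hu v hv huv => by
        rw [h.env.M_eq] at hi hj
        have hE : Env N n k s τ := h.env.of_eq (fun y hy => hS.1 y (by revert y; decide)) (hS.2 _ rfl)
        simp only [adoptBody]
        rw [exec_wr hE (by omega) (by omega), eval_rd hE (by omega), hx, hy, arr_setArr, if_pos rfl,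
          mat_update _ _ hj hv, hS.2 aDNEW rfl]
        by_cases c : u = i ∧ v = j
        · rw [if_pos c, c.1, c.2]
        · rw [if_neg c]; exact hI u hu v hv (by omega))
    rw [h.env.M_eq] at hInv
    exact hInv u (by omega) v (by omega) (by omega)
  have hS1 := same_exec (loop vU vM (loop vV vM adoptBody)) σ
  generalize (loop vU vM (loop vV vM adoptBody)).exec σ = α at *
  have hl : α.var vL = adviceLen k s := by rw [hS1.1 vL rfl, h.len]
  have hz : α.var vSZ = Z := by rw [hS1.1 vSZ rfl, h.sz]
  have h2 := fill1 (x := vI) (b := vL) (a := aDIG) (p := write aDIG (.var vI) (.const 0)) (σ := α)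
    (fun _ => 0) (fun i τ hi hS _ => by
      rw [hl] at hi
      have := h.len_le
      have : i < τ.var vSZ := by rw [hS.1 vSZ rfl, hz]; omega
      simp [this])
  have hS2 := same_exec (loop vI vL (write aDIG (.var vI) (.const 0))) α
  generalize (loop vI vL (write aDIG (.var vI) (.const 0))).exec α = β at *
  have hr : β.var vROWS = σ.var vROWS := by rw [hS2.1 vROWS rfl, hS1.1 vROWS rfl]
  have hn : β.var vN = N := by rw [hS2.1 vN rfl, hS1.1 vN rfl, h.env.N_eq]
  have hrun : β.var vRUN = σ.var vRUN := by rw [hS2.1 vRUN rfl, hS1.1 vRUN rfl]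
  have ho : ∀ u < N, ∀ v < N, oldSet N β u v ↔ delSet N σ u v := fun u hu v hv => by
    unfold oldSet delSet; rw [hS2.2 aDOLD rfl, h1 u hu v hv]
  have hd : ∀ i < adviceLen k s, β.arr aDIG i = 0 := fun i hi => by rw [h2 i, if_pos (by omega)]
  have hsub : (Expr.sub (.var vN) (.var vROWS)).eval
      ((assign vROWS (.add (.var vROWS) (.const 1))).exec β) = N - (σ.var vROWS + 1) := by
    simp [hn, hr]
  rw [exec_cond, hsub]
  by_cases c : σ.var vROWS + 1 < N
  · rw [if_neg (by omega)]
    refine ⟨hd, ho, by simp [hr], Or.inl ⟨c, by simp [hrun]⟩⟩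
  · rw [if_pos (by omega)]
    refine ⟨hd, ho, by simp [hr], Or.inr ⟨by omega, by simp, by simp⟩⟩

theorem Setup.of_same {Z : ℕ} {C : ℕ → ℕ → ℕ} {τ : State} (h : Setup N n k s Z C σ)
    (hv : ∀ y ∈ [0, 1, 3, vN, vM, vKP, vSZ, vL, vTK, vOFF, vRM], τ.var y = σ.var y)
    (ha : ∀ a ∈ [aROW, aCAP, aRAD], τ.arr a = σ.arr a)
    (hd : ∀ i < adviceLen k s, τ.arr aDIG i < radix k ((k + 1) * s) i)
    (hc : ∀ a ∈ scratchArrs, ∀ j, Z ≤ j → τ.arr a j = 0) : Setup N n k s Z C τ where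
  env := h.env.of_eq (fun y hy => hv y (by revert y; decide)) (ha _ (by decide))
  sz := by rw [hv _ (by decide), h.sz]
  len := by rw [hv _ (by decide), h.len]
  len_le := h.len_le
  rad := by rw [ha aRAD (by decide)]; exact h.rad
  cap := by rw [ha aCAP (by decide)]; exact h.cap
  dig := hd
  clean := hc

theorem Setup.of_eqv {Z : ℕ} {C : ℕ → ℕ → ℕ} {τ : State} (h : Setup N n k s Z C σ) (he : Eqv σ τ)
    (hd : τ.arr aDIG = σ.arr aDIG) : Setup N n k s Z C τ :=
  h.of_same (fun y hy => he.var y (by revert y; decide))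
    (fun a ha => he.arr a (by revert a; decide) (by revert a; decide)) (by rw [hd]; exact h.dig)
    (fun a ha j hj => by
      rw [he.arr_ge a (by rintro rfl; exact absurd ha (by decide)) j (by rw [h.sz]; exact hj)]
      exact h.clean a ha j hj)

/-- A success starts the next vertex with advice zero, or ends the search after the last vertex. A
failure passes to the next advice. If the advices are exhausted, the present subgraph has no
solution, and neither has the graph. The number of remaining attempts drops in each case, as the
counter is below the number of advices. -/
theorem Core.step {Z : ℕ} {C : ℕ → ℕ → ℕ} (h : Core N n k s Z C σ) (hN : SplitSize N n)
    (hs : 1 ≤ s) (htw : TwinArcs N n C) (hrun : σ.var vRUN ≠ 0) :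
    Core N n k s Z C (mainBody.exec σ) ∧ remaining N k s (mainBody.exec σ) < remaining N k s σ := by
  have hn : n ≤ N := by rcases hN with h | h <;> omega
  obtain ⟨hiN, hold, htar⟩ := h.run hrun
  set i := σ.var vROWS with hi
  set rad := radix k ((k + 1) * s) with hradd
  set L := adviceLen k s with hLd
  have hdl : digVal rad (σ.arr aDIG) L < placeVal rad L := digVal_lt h.dig
  have hσ : setDig σ (σ.arr aDIG) = σ := by simp [setDig]
  have hsound : (Solves N n k s (rowsCap (i + 1) C) (delSet N (attempt.exec σ)) ∧
      (attempt.exec σ).var vOK = 1) ∨ (attempt.exec σ).var vOK = 0 := by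
    obtain ⟨r1, r2, r3, r4, -, r6⟩ := h.toSetup.exec_reset (σ.arr aDIG)
    rw [hσ] at r1 r2 r3 r4 r6
    simp only [attempt, exec_seq]
    exact attemptMain_sound r1 hn (by rw [r3]; exact h.cap) r2 hiN (r6 _ (by decide))
  have hE := eqv_attempt σ
  have hat : ∀ g, Target σ L g → (∀ j < L, σ.arr aDIG j = g j) → (attempt.exec σ).var vOK = 1 :=
    fun g hg hj => by have := hg (σ.arr aDIG) hj; rwa [hσ] at this
  have hdig : (attempt.exec σ).arr aDIG = σ.arr aDIG := exec_arr attempt σ _ rfl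
  have hrem : remaining N k s σ = (N - i) * placeVal rad L - digVal rad (σ.arr aDIG) L := by
    rw [remaining, if_neg hrun]
  have hNi : (N - i) * placeVal rad L = (N - (i + 1)) * placeVal rad L + placeVal rad L := by
    rw [show N - i = N - (i + 1) + 1 by omega, add_mul, one_mul]
  simp only [mainBody, exec_seq]
  generalize attempt.exec σ = α at *
  have hset : Setup N n k s Z C α := h.toSetup.of_eqv hE hdig
  have hαi : α.var vROWS = i := hE.var _ (by decide)
  have hαr : α.var vRUN = σ.var vRUN := hE.var _ (by decide)
  have hαo : oldSet N α = oldSet N σ := by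
    funext x y; simp only [oldSet, hE.arr aDOLD (by decide) (by decide)]
  rw [exec_cond]
  rcases hsound with ⟨hsol, hok⟩ | hok
  · rw [if_neg (by simp only [Expr.eval, hok]; decide)]
    obtain ⟨s1, s2, s3, s4⟩ := onSuccess_spec hset
    have hS := same_exec onSuccess α
    have hge : ∀ a j, Z ≤ j → (onSuccess.exec α).arr a j = α.arr a j := fun a j hj =>
      exec_arr_ge _ _ _ _ rfl (by rw [hset.sz]; exact hj)
    generalize onSuccess.exec α = β at *
    have hset' : Setup N n k s Z C β := hset.of_same (fun y hy => hS.1 y (by revert y; decide))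
      (fun a ha => hS.2 a (by revert a; decide)) (fun j hj => by rw [s1 j hj]; exact radix_pos _ _ _)
      (fun a ha j hj => by rw [hge a j hj]; exact hset.clean a ha j hj)
    have hnew : Solves N n k s (rowsCap (i + 1) C) (oldSet N β) :=
      hsol.congr (fun _ _ _ _ => rfl) fun u hu v hv => (s2 u hu v hv).symm
    have hd0 : digVal rad (β.arr aDIG) L = 0 :=
      sum_eq_zero fun j hj => by rw [s1 j (mem_range.1 hj), zero_mul]
    rw [hαi] at s3 s4
    rcases s4 with ⟨s4, s5⟩ | ⟨s4, s5, s6⟩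
    · refine ⟨{ hset' with
        run := fun _ => ?_
        halt := fun h0 => absurd (s5.symm.trans h0) (by rw [hαr]; exact hrun) }, ?_⟩
      · rw [s3]
        refine ⟨s4, hnew, fun D hD => ?_⟩
        obtain ⟨g, hg, hg'⟩ := hset'.target hN hs htw s3 s4 hnew hD
        exact ⟨g, hg, hg', by rw [hd0]; exact Nat.zero_le _⟩
      · rw [hrem, remaining, if_neg (by rw [s5, hαr]; exact hrun), s3]
        change _ - digVal rad (β.arr aDIG) L < _
        rw [hd0]
        change (N - (i + 1)) * placeVal rad L - 0 < _
        omega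
    · refine ⟨{ hset' with
        run := fun h0 => absurd s5 h0
        halt := fun _ => Or.inl ⟨s6, hnew.congr (fun u hu v hv => ?_) fun _ _ _ _ => Iff.rfl⟩ }, ?_⟩
      · rw [rowsCap, if_pos (by omega)]
      · rw [hrem, remaining, if_pos s5]; omega
  · rw [if_pos (by simp only [Expr.eval, hok])]
    -- The current advice has just failed, so it differs from any successful `g`, and `digVal_inj`
    -- makes the inequality strict.
    have hne : ∀ g : ℕ → ℕ, (∀ i < L, g i < rad i) → Target σ L g →
        digVal rad (σ.arr aDIG) L ≤ digVal rad g L →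
        digVal rad (σ.arr aDIG) L + 1 ≤ digVal rad g L := by
      intro g hg hg' hle
      by_contra hlt
      have heq : digVal rad (σ.arr aDIG) L = digVal rad g L := by omega
      have := hat g hg' (digVal_inj h.dig hg heq)
      omega
    obtain ⟨i1, i2⟩ := increment_spec (rad := rad) (L := L) hset.len (by rw [hset.sz]; exact h.len_le)
      hset.rad hset.dig
    rw [hdig] at i2
    have hS1 := same_exec increment α
    have hge1 : ∀ a j, Z ≤ j → (increment.exec α).arr a j = α.arr a j := fun a j hj =>
      exec_arr_ge _ _ _ _ rfl (by rw [hset.sz]; exact hj)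
    simp only [onFailure, exec_seq]
    generalize increment.exec α = β at *
    have hset' : Setup N n k s Z C β := hset.of_same (fun y hy => hS1.1 y (by revert y; decide))
      (fun a ha => hS1.2 a (by revert a; decide)) i1
      (fun a ha j hj => by rw [hge1 a j hj]; exact hset.clean a ha j hj)
    rw [exec_cond]
    rcases i2 with ⟨i2, i3⟩ | ⟨i2, i3⟩
    · rw [if_pos (by simp only [Expr.eval, i2]), exec_skip]
      have hβr : β.var vRUN = σ.var vRUN := by rw [hS1.1 vRUN rfl, hαr]
      have hβi : β.var vROWS = i := by rw [hS1.1 vROWS rfl, hαi]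
      have hβo : oldSet N β = oldSet N σ := by
        rw [← hαo]; funext x y; simp only [oldSet, hS1.2 aDOLD rfl]
      have hEβ : Eqv σ β := by
        refine ⟨fun y hy => ?_, fun a ha hd => ?_, fun a ha j hj => ?_⟩
        · rw [← hE.var y hy]
          exact hS1.1 y (wv_of_not_mem _ fun h => hy (by clear hy; revert y; decide))
        · rw [← hE.arr a ha hd]
          exact hS1.2 a (wa_of_not_mem _ (by
            have : increment.arrs = [aDIG, aDIG] := rfl
            rw [this]; simpa using hd))
        · rw [hS1.2 a (wa_of_not_mem _ (by
            have : increment.arrs = [aDIG, aDIG] := rfl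
            rw [this]; simpa using ha)), hE.arr_ge a ha j hj]
      refine ⟨{ hset' with
        run := fun _ => ?_
        halt := fun h0 => absurd (hβr.symm.trans h0) hrun }, ?_⟩
      · rw [hβi, hβo]
        refine ⟨hiN, hold, fun D hD => ?_⟩
        obtain ⟨g, hg, hg', hle⟩ := htar D hD
        exact ⟨g, hg, hg'.eqv hEβ, by rw [i3]; exact hne g hg hg' hle⟩
      · rw [hrem, remaining, if_neg (by rw [hβr]; exact hrun), hβi]
        change (N - i) * placeVal rad L - digVal rad (β.arr aDIG) L < _
        rw [i3]
        omega
    · rw [if_neg (by simpa only [Expr.eval] using i2)]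
      simp only [exec_seq, exec_assign, Expr.eval]
      have hset'' : Setup N n k s Z C ((β.setVar vANS 0).setVar vRUN 0) :=
        hset'.of_same (fun y hy => by
          have h1 : y ≠ vRUN := by revert y; decide
          have h2 : y ≠ vANS := by revert y; decide
          rw [var_setVar, if_neg h1, var_setVar, if_neg h2]) (fun a ha => rfl) hset'.dig hset'.clean
      refine ⟨{ hset'' with
        run := fun h0 => absurd (by simp) h0
        halt := fun _ => Or.inr ⟨by simp, fun D hD => ?_⟩ }, ?_⟩
      -- A solution of the whole graph also solves the subgraph, so a successful advice would exist
      -- beyond the last one.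
      · obtain ⟨g, hg, hg', hle⟩ := htar D (hD.mono fun u _ v _ => by
          unfold rowsCap; split
          · exact le_rfl
          · exact Nat.zero_le _)
        have h1 : digVal rad (σ.arr aDIG) L + 1 ≤ digVal rad g L := hne g hg hg' hle
        have h2 : digVal rad g L < placeVal rad L := digVal_lt hg
        omega
      · rw [hrem, remaining, if_pos (by simp)]; omega

/-! ## Running time of the main loop -/

/-- The variables that bound loops. -/
def boundVars : List ℕ := [0, 1, 3, vN, vM, vKP, vSZ, vL, vTK, vOFF, vRM]

theorem Setup.bound {Z : ℕ} {C : ℕ → ℕ → ℕ} (h : Setup N n k s Z C σ) (hn : n ≤ N) :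
    ∀ b ∈ boundVars, σ.var b ≤ Z := by
  have h1 : (N + 1) * (N + 1) ≤ Z := h.sz ▸ h.env.sz
  have h2 : 2 * (k + 1) ≤ Z := h.sz ▸ h.env.cand
  have h3 := h.len_le
  have h4 : N + 1 ≤ (N + 1) * (N + 1) := Nat.le_mul_of_pos_left _ (by omega)
  have h5 : s ≤ (k + 1) * s := Nat.le_mul_of_pos_left _ (by omega)
  have h6 : (k + 1) * s ≤ adviceLen k s := Nat.le_add_right _ _
  intro b hb
  simp only [boundVars, List.mem_cons, List.not_mem_nil, or_false] at hb
  rcases hb with rfl | rfl | rfl | rfl | rfl | rfl | rfl | rfl | rfl | rfl | rfl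
  · rw [h.env.n_eq]; omega
  · rw [h.env.k_eq]; omega
  · rw [h.env.s_eq]; omega
  · rw [h.env.N_eq]; omega
  · rw [h.env.M_eq]; omega
  · rw [h.env.kp]; omega
  · rw [h.sz]
  · rw [h.len]; omega
  · rw [h.env.tk]; omega
  · rw [h.env.off]; omega
  · rw [h.env.rm]; omega

theorem Core.exec_loop {Z : ℕ} {C : ℕ → ℕ → ℕ} (hN : SplitSize N n) (hs : 1 ≤ s)
    (htw : TwinArcs N n C) (r : ℕ) (h : Core N n k s Z C σ) (hr : remaining N k s σ ≤ r) :
    ∃ t τ, Run (.loop (.var vRUN) mainBody.compile) σ t τ ∧ Core N n k s Z C τ ∧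
      τ.var vRUN = 0 ∧ t ≤ r * (mainBody.time Z + 2) + 2 := by
  have hn : n ≤ N := by rcases hN with h | h <;> omega
  induction r generalizing σ with
  | zero =>
    by_cases h0 : σ.var vRUN = 0
    · exact ⟨_, σ, Run.loop_false h0, h, h0, by simp [Expr.cost]⟩
    · have := (h.step hN hs htw h0).2; omega
  | succ r ih =>
    by_cases h0 : σ.var vRUN = 0
    · exact ⟨_, σ, Run.loop_false h0, h, h0, by simp [Expr.cost]⟩
    · obtain ⟨h1, h2⟩ := h.step hN hs htw h0
      obtain ⟨t, τ, hR, hC, hz, ht⟩ := ih h1 (by omega)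
      obtain ⟨⟨u, hu, hut⟩, -⟩ := compile_run boundVars Z mainBody (by decide) σ (h.toSetup.bound hn)
      refine ⟨_, τ, Run.loop_true h0 hu hR, hC, hz, ?_⟩
      rw [add_mul, one_mul]
      simp only [Expr.cost]
      omega

/-! ### The number of advices and the total time -/

/-- `y ^ m / m!` is a term of the series of `exp y`, and `e < 3`. It is applied with large `m` to
the advices, and with fixed exponent to trade powers and exponentials for `k!`. -/
theorem pow_le_factorial_mul (y m : ℕ) : y ^ m ≤ m.factorial * 3 ^ y := by
  have h1 := Real.pow_div_factorial_le_exp (y : ℝ) (Nat.cast_nonneg y) m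
  have h2 : Real.exp y ≤ 3 ^ y := by
    rw [show (y : ℝ) = y * 1 by ring, Real.exp_nat_mul]
    exact pow_le_pow_left₀ (Real.exp_pos 1).le Real.exp_one_lt_three.le y
  have h3 : (y : ℝ) ^ m ≤ m.factorial * 3 ^ y := by
    rw [div_le_iff₀ (by positivity)] at h1
    nlinarith [h1, h2, (by positivity : (0 : ℝ) < m.factorial)]
  exact_mod_cast h3

/-- The number of possible advices. -/
theorem placeVal_adviceLen (k s : ℕ) : placeVal (radix k ((k + 1) * s)) (adviceLen k s) ≤
    4 ^ k * (((k + 1) * s).factorial * 3 ^ (8 * (k + 1))) := by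
  rw [adviceLen, placeVal_radix]
  calc (2 * (k + 1)) ^ ((k + 1) * s) * 2 ^ (2 * ((k + 1) * s) + 2 * k)
      = 4 ^ k * (8 * (k + 1)) ^ ((k + 1) * s) := by
        rw [pow_add, pow_mul 2 2, pow_mul 2 2, ← mul_assoc, ← mul_pow, mul_comm]
        norm_num
        ring
    _ ≤ _ := Nat.mul_le_mul_left _ (pow_le_factorial_mul _ _)

/-- The total time in terms of the parameters. -/
theorem total_time_le (c : ℕ) : ∃ d, ∀ n k s' s N Z : ℕ, s' ≤ s → s' ≤ n → N ≤ 2 * n →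
    Z ≤ (N + 1) * (N + 1) + 2 * (k + 1) + adviceLen k s' →
    (N * placeVal (radix k ((k + 1) * s')) (adviceLen k s') + 1) * (c * Z ^ c) ≤
      4 ^ k * (k * s + k + s).factorial * (d * (n + 1) ^ d) := by
  -- The exponent 9 is 8 from the bound on the number of advices plus 1 from `(k + 1) ^ c ≤ c! * 3 ^
  -- (k + 1)`. The power `3 ^ 9` is hidden behind an equation to keep it from being evaluated.
  obtain ⟨K, hK⟩ : ∃ K : ℕ, K = 3 ^ 9 := ⟨_, rfl⟩
  refine ⟨2 * c * 8 ^ c * (c.factorial * K * 3 ^ K) + 2 * c + 1,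
    fun n k s' s N Z h1 h2 h3 h4 => ?_⟩
  set m := (k + 1) * s' with hm
  set E := placeVal (radix k m) (adviceLen k s') with hE
  set d := 2 * c * 8 ^ c * (c.factorial * K * 3 ^ K) + 2 * c + 1 with hd
  have hE1 : 1 ≤ E := Finset.prod_pos fun i _ => radix_pos k m i
  have e1 : N * E + 1 ≤ 2 * (n + 1) * E := by nlinarith
  -- Here the truncation `s' ≤ n` is used: the memory size, and with it the time of one attempt,
  -- does not depend on `s`.
  have e2 : Z ≤ 8 * ((n + 1) ^ 2 * (k + 1)) := by
    have : (k + 1) * s' ≤ (k + 1) * n := Nat.mul_le_mul_left _ h2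
    have h5 : (N + 1) * (N + 1) ≤ (2 * n + 1) * (2 * n + 1) := Nat.mul_le_mul (by omega) (by omega)
    unfold adviceLen at h4
    nlinarith [Nat.zero_le (n * n * k), Nat.zero_le (n * k), Nat.zero_le (n * n)]
  have e3 : E ≤ 4 ^ k * (m.factorial * 3 ^ (8 * (k + 1))) := placeVal_adviceLen k s'
  -- The exponential excess and the polynomial in `k` from a single attempt are absorbed together by
  -- `k!`, which `e5` can spare.
  have e4 : 3 ^ (8 * (k + 1)) * (k + 1) ^ c ≤ k.factorial * (c.factorial * K * 3 ^ K) := by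
    calc 3 ^ (8 * (k + 1)) * (k + 1) ^ c ≤ 3 ^ (8 * (k + 1)) * (c.factorial * 3 ^ (k + 1)) :=
          Nat.mul_le_mul_left _ (pow_le_factorial_mul _ _)
      _ = c.factorial * K * K ^ k := by
          rw [hK, ← pow_mul]; ring
      _ ≤ c.factorial * K * (k.factorial * 3 ^ K) :=
          Nat.mul_le_mul_left _ (pow_le_factorial_mul _ _)
      _ = _ := by ring
  have e5 : m.factorial * k.factorial ≤ (k * s + k + s).factorial := by
    calc m.factorial * k.factorial ≤ (m + k).factorial :=
          Nat.le_of_dvd (Nat.factorial_pos _) (Nat.factorial_mul_factorial_dvd_factorial_add _ _)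
      _ ≤ _ := Nat.factorial_le (by rw [hm]; nlinarith [Nat.mul_le_mul_left k h1])
  calc (N * E + 1) * (c * Z ^ c)
      ≤ (2 * (n + 1) * (4 ^ k * (m.factorial * 3 ^ (8 * (k + 1))))) *
          (c * (8 * ((n + 1) ^ 2 * (k + 1))) ^ c) :=
        Nat.mul_le_mul (e1.trans (Nat.mul_le_mul_left _ e3))
          (Nat.mul_le_mul_left _ (Nat.pow_le_pow_left e2 c))
    _ = 4 ^ k * m.factorial * (3 ^ (8 * (k + 1)) * (k + 1) ^ c) *
          (2 * c * 8 ^ c * (n + 1) ^ (2 * c + 1)) := by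
        rw [mul_pow, mul_pow, ← pow_mul]; ring
    _ ≤ 4 ^ k * m.factorial * (k.factorial * (c.factorial * K * 3 ^ K)) *
          (2 * c * 8 ^ c * (n + 1) ^ (2 * c + 1)) :=
        Nat.mul_le_mul_right _ (Nat.mul_le_mul_left _ e4)
    _ = 4 ^ k * (m.factorial * k.factorial) * ((2 * c * 8 ^ c * (c.factorial * K * 3 ^ K)) *
          (n + 1) ^ (2 * c + 1)) := by ring
    _ ≤ 4 ^ k * (k * s + k + s).factorial * (d * (n + 1) ^ d) :=
        Nat.mul_le_mul (Nat.mul_le_mul_left _ e5) (Nat.mul_le_mul (by omega)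
          (Nat.pow_le_pow_right (by omega) (by omega)))

/-! ## Initialization -/

/-- `s - (s - n)` is `min s n`. Components have at most `n` vertices of weight one, so larger values
of `s` make no difference. -/
def initSizes (e : Expr) : Cmd :=
  assign 3 (.sub (.var 2) (.sub (.var 2) (.var 0))) ;; assign vN e ;;
    assign vM (.add (.var vN) (.const 1)) ;; assign vKP (.add (.var 1) (.const 1)) ;;
    assign vTK (.add (.var vKP) (.var 1)) ;; assign vOFF (.sub (.var vN) (.var 0))

/-- The products `(k + 1) * s` and `(N + 1) * (N + 1)` are formed by repeated addition. -/
def initSums : Cmd :=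
  loop vI vKP (assign vRM (.add (.var vRM) (.var 3))) ;;
    loop vI vM (assign vSZ (.add (.var vSZ) (.var vM))) ;;
    assign vL (.add (.var vRM) (.add (.add (.var vRM) (.var vRM)) (.add (.var 1) (.var 1)))) ;;
    assign vSZ (.add (.add (.var vSZ) (.add (.var vKP) (.var vKP))) (.var vL))

def rowStartBody : Cmd :=
  write aROW (.var vU) (.var vCUR) ;; assign vCUR (.add (.var vCUR) (.var vM))

/-- The run flag is the truncated `s`, so the main loop is skipped when this is zero. -/
def initArrays : Cmd :=
  loop vU vM rowStartBody ;; loop vI vL (write aRAD (.var vI) (.const 2)) ;;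
    loop vI vRM (write aRAD (.var vI) (.add (.var vKP) (.var vKP))) ;; assign vCUR (.const 0) ;;
    assign vRUN (.var 3)

/-- The size of the memory. -/
def memSize (N k s : ℕ) : ℕ := (N + 1) * (N + 1) + 2 * (k + 1) + adviceLen k s

/-- The memory after the initialization, but for the capacities. -/
structure Blank (N n k s : ℕ) (inp : ℕ → ℕ) (σ : State) : Prop where
  env : Env N n k s σ
  sz : σ.var vSZ = memSize N k s
  len : σ.var vL = adviceLen k s
  rad : ∀ i < adviceLen k s, σ.arr aRAD i = radix k ((k + 1) * s) i
  rows : σ.var vROWS = 0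
  run : σ.var vRUN = s
  cur : σ.var vCUR = 0
  inp : σ.arr 0 = inp
  zero : ∀ a, a ≠ 0 → a ≠ aROW → a ≠ aRAD → ∀ i, σ.arr a i = 0

/-- The memory at the start. -/
structure Fresh (n k s : ℕ) (inp : ℕ → ℕ) (σ : State) : Prop where
  n_eq : σ.var 0 = n
  k_eq : σ.var 1 = k
  s_eq : σ.var 2 = s
  var : ∀ y, 3 ≤ y → σ.var y = 0
  inp : σ.arr 0 = inp
  arr : ∀ a, a ≠ 0 → ∀ i, σ.arr a i = 0

theorem initSizes_spec {inp : ℕ → ℕ} {e : Expr} (h : Fresh n k s inp σ)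
    (he : ∀ τ, τ.var 0 = n → e.eval τ = N) :
    ((initSizes e).exec σ).arr = σ.arr ∧ ∀ y, ((initSizes e).exec σ).var y =
      if y = 3 then min s n else if y = vN then N else if y = vM then N + 1 else
      if y = vKP then k + 1 else if y = vTK then 2 * k + 1 else if y = vOFF then N - n else
      σ.var y := by
  refine ⟨rfl, fun y => ?_⟩
  have hN : e.eval (σ.setVar 3 (s - (s - n))) = N := he _ (by simp [h.n_eq])
  simp only [initSizes, exec_seq, exec_assign, Expr.eval, h.n_eq, h.s_eq, hN, var_setVar]
  have h1 := h.k_eq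
  by_cases c1 : y = vOFF
  · subst c1; simp
  by_cases c2 : y = vTK
  · subst c2; simp [h1]; omega
  by_cases c3 : y = vKP
  · subst c3; simp [h1]
  by_cases c4 : y = vM
  · subst c4; simp
  by_cases c5 : y = vN
  · subst c5; simp
  by_cases c6 : y = 3
  · subst c6; simp; omega
  simp only [if_neg c1, if_neg c2, if_neg c3, if_neg c4, if_neg c5, if_neg c6]

theorem initSums_spec {m q z : ℕ} (hk : σ.var 1 = k) (hs : σ.var 3 = s) (hM : σ.var vM = m)
    (hK : σ.var vKP = q) (hr : σ.var vRM = 0) (hz : σ.var vSZ = z) (hz : z = 0) :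
    (initSums.exec σ).arr = σ.arr ∧ (initSums.exec σ).var vRM = q * s ∧
      (initSums.exec σ).var vL = q * s + (2 * (q * s) + 2 * k) ∧
      (initSums.exec σ).var vSZ = m * m + 2 * q + (q * s + (2 * (q * s) + 2 * k)) ∧
      ∀ y, y ≠ vRM → y ≠ vL → y ≠ vSZ → y ≠ vI → (initSums.exec σ).var y = σ.var y := by
  subst hz
  obtain ⟨τ, a1, a2, a3⟩ := loop_rule (x := vI) (b := vKP)
    (p := assign vRM (.add (.var vRM) (.var 3))) (σ := σ) (fun i τ => τ.var vRM = i * s)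
    (by simp [hr]) (fun i τ _ hS hI => by
      have := hS.1 3 rfl
      simp [hI, this, hs, add_mul])
  rw [hK] at a1 a3
  obtain ⟨ρ, b1, b2, b3⟩ := loop_rule (x := vI) (b := vM)
    (p := assign vSZ (.add (.var vSZ) (.var vM))) (σ := τ.setVar vI q) (fun i τ => τ.var vSZ = i * m)
    (by have := a2.1 vSZ rfl; simp [this, hz]) (fun i ρ _ hS hI => by
      have h1 := hS.1 vM rfl
      have h2 := a2.1 vM rfl
      simp at h1
      simp [hI, h1, h2, hM, add_mul])
  have hτM : (τ.setVar vI q).var vM = m := by have := a2.1 vM rfl; simp [this, hM]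
  rw [hτM] at b1 b3
  have e : initSums.exec σ = (assign vSZ (.add (.add (.var vSZ) (.add (.var vKP) (.var vKP)))
      (.var vL))).exec ((assign vL (.add (.var vRM) (.add (.add (.var vRM) (.var vRM))
      (.add (.var 1) (.var 1))))).exec (ρ.setVar vI m)) := by
    simp only [initSums, exec_seq]
    rw [a3, b3]
  have v : ∀ y, y ≠ vI → y ≠ vRM → y ≠ vSZ → ρ.var y = σ.var y := fun y h1 h2 h3 => by
    rw [b2.1 y (wv_of_not_mem _ (by simp [Cmd.vars, h1, h3])), var_setVar, if_neg h1,
      a2.1 y (wv_of_not_mem _ (by simp [Cmd.vars, h1, h2]))]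
  have vr : ρ.var vRM = q * s := by rw [b2.1 vRM rfl]; simpa using a1
  have vk := v 1 (by decide) (by decide) (by decide)
  have vq := v vKP (by decide) (by decide) (by decide)
  rw [e]
  refine ⟨?_, ?_, ?_, ?_, fun y h1 h2 h3 h4 => ?_⟩
  · change ρ.arr = σ.arr
    funext a
    rw [b2.2 a rfl]
    exact a2.2 a rfl
  · simp [vr]
  · simp [vr, vk, hk]; ring
  · simp [vr, vk, hk, vq, hK, b1]; ring
  · simp [h2, h3, h4, v y h4 h1 h3]

theorem initArrays_spec {inp : ℕ → ℕ} (hn : σ.var 0 = n) (hk : σ.var 1 = k) (hs : σ.var 3 = s)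
    (hN : σ.var vN = N) (hM : σ.var vM = N + 1) (hK : σ.var vKP = k + 1)
    (ht : σ.var vTK = 2 * k + 1) (ho : σ.var vOFF = N - n) (hr : σ.var vRM = (k + 1) * s)
    (hl : σ.var vL = adviceLen k s) (hz : σ.var vSZ = memSize N k s) (hc : σ.var vCUR = 0)
    (hw : σ.var vROWS = 0) (hi : σ.arr 0 = inp) (ha : ∀ a, a ≠ 0 → ∀ i, σ.arr a i = 0) :
    Blank N n k s inp (initArrays.exec σ) := by
  have hz1 : (N + 1) * (N + 1) ≤ memSize N k s := by unfold memSize; omega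
  have hz2 : adviceLen k s ≤ memSize N k s := by unfold memSize; omega
  have hz3 : 2 * (k + 1) ≤ memSize N k s := by unfold memSize; omega
  have hz4 : N + 1 ≤ memSize N k s := le_trans (Nat.le_mul_of_pos_left _ (by omega)) hz1
  have hml : (k + 1) * s ≤ adviceLen k s := Nat.le_add_right _ _
  simp only [initArrays, exec_seq]
  obtain ⟨τ, ⟨-, a1⟩, -, a3⟩ := loop_rule (x := vU) (b := vM) (p := rowStartBody) (σ := σ)
    (fun i τ => τ.var vCUR = i * (N + 1) ∧ ∀ u < i, τ.arr aROW u = u * (N + 1))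
    (by simp [hc]) (fun i τ hi hS ⟨h1, h2⟩ => by
      have e1 := hS.1 vM rfl
      have e2 := hS.1 vSZ rfl
      have e3 : i < τ.var vSZ := by omega
      simp only [rowStartBody, exec_seq, exec_write, Expr.eval, var_setVar, if_true,
        show vSZ ≠ vU by decide, if_false, e3, exec_assign, show vCUR ≠ vU by decide,
        show vM ≠ vU by decide, arr_setVar, arr_setArr, var_setArr, h1, e1, hM]
      refine ⟨by ring, fun u hu => ?_⟩
      rw [Function.update_apply]
      split
      · rename_i h; rw [h]
      · exact h2 u (by omega))
  have hrow : ∀ u < N + 1, ((loop vU vM rowStartBody).exec σ).arr aROW u = u * (N + 1) := by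
    rw [a3, hM] at *; exact a1
  clear a1 a3
  have hS1 := same_exec (loop vU vM rowStartBody) σ
  generalize (loop vU vM rowStartBody).exec σ = α at *
  have hαl := (hS1.1 vL rfl).trans hl
  have hαz := (hS1.1 vSZ rfl).trans hz
  have f2 := fill1 (x := vI) (b := vL) (a := aRAD) (p := write aRAD (.var vI) (.const 2)) (σ := α)
    (fun _ => 2) (fun i τ hi hS _ => by
      have e2 := hS.1 vSZ rfl
      have : i < τ.var vSZ := by omega
      simp [this])
  rw [hαl] at f2
  have hS2 := same_exec (loop vI vL (write aRAD (.var vI) (.const 2))) α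
  generalize (loop vI vL (write aRAD (.var vI) (.const 2))).exec α = β at *
  have hβz := (hS2.1 vSZ rfl).trans hαz
  have hβr := ((hS2.1 vRM rfl).trans (hS1.1 vRM rfl)).trans hr
  have hβk := ((hS2.1 vKP rfl).trans (hS1.1 vKP rfl)).trans hK
  have f3 := fill1 (x := vI) (b := vRM) (a := aRAD)
    (p := write aRAD (.var vI) (.add (.var vKP) (.var vKP))) (σ := β)
    (fun _ => 2 * (k + 1)) (fun i τ hi hS _ => by
      have e2 := hS.1 vSZ rfl
      have e3 := hS.1 vKP rfl
      have : i < τ.var vSZ := by omega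
      simp [this, e3, hβk]; congr 1; ring)
  rw [hβr] at f3
  have hS3 := same_exec (loop vI vRM (write aRAD (.var vI) (.add (.var vKP) (.var vKP)))) β
  generalize (loop vI vRM (write aRAD (.var vI) (.add (.var vKP) (.var vKP)))).exec β = γ at *
  have v : ∀ y, y ≠ vU → y ≠ vI → y ≠ vCUR → γ.var y = σ.var y := fun y h1 h2 h3 => by
    rw [hS3.1 y (wv_of_not_mem _ (by simp [Cmd.vars, h2])),
      hS2.1 y (wv_of_not_mem _ (by simp [Cmd.vars, h2])),
      hS1.1 y (wv_of_not_mem _ (by simp [Cmd.vars, rowStartBody, h1, h3]))]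
  have w : ∀ a, a ≠ aROW → a ≠ aRAD → γ.arr a = σ.arr a := fun a h1 h2 => by
    rw [hS3.2 a (wa_of_not_mem _ (by simp [Cmd.arrs, h2])),
      hS2.2 a (wa_of_not_mem _ (by simp [Cmd.arrs, h2])),
      hS1.2 a (wa_of_not_mem _ (by simp [Cmd.arrs, rowStartBody, h1]))]
  have hγr : γ.arr aROW = α.arr aROW := by rw [hS3.2 aROW rfl, hS2.2 aROW rfl]
  have v' : ∀ y ∈ [0, 1, 3, vN, vM, vKP, vSZ, vL, vTK, vOFF, vRM, vROWS], γ.var y = σ.var y :=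
    fun y hy => v y (by revert y; decide) (by revert y; decide) (by revert y; decide)
  simp only [List.mem_cons, List.not_mem_nil, or_false, forall_eq_or_imp, forall_eq] at v'
  obtain ⟨v0, v1, v2, v3, v4, v5, v6, v7, v8, v9, v10, v11⟩ := v'
  simp only [exec_assign, Expr.eval]
  constructor
  · constructor
    · simp [v0, hn]
    · simp [v1, hk]
    · simp [v2, hs]
    · simp [v3, hN]
    · simp [v4, hM]
    · simp [v5, hK]
    · simpa [v6, hz] using hz1
    · simp [v8, ht]
    · simp [v9, ho]
    · simp [v10, hr]
    · intro u hu
      change γ.arr aROW u = _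
      rw [hγr]; exact hrow u (by omega)
    · simpa [v6, hz] using hz3
  · simp [v6, hz]
  · simp [v7, hl]
  · intro i hi
    change γ.arr aRAD i = _
    rw [f3, f2, radix, if_pos hi]
  · simp [v11, hw]
  · simp [v2, hs]
  · simp
  · rw [← hi]; exact w 0 (by decide) (by decide)
  · intro a h1 h2 h3 i
    change γ.arr a i = 0
    rw [w a h2 h3]; exact ha a h1 i

theorem TwinArcs.congr {c c' : ℕ → ℕ → ℕ} (h : TwinArcs N n c)
    (hc : ∀ u < N, ∀ v < N, c u v = c' u v) : TwinArcs N n c' := fun u hu ht =>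
  (h u hu ht).imp (fun g v hv hp => g v hv (by rwa [hc u hu v hv]))
    fun g v hv hp => g v hv (by rwa [hc v hv u hu])

/-- Without arcs every component is a single vertex. This is the start of the compression, and `1 ≤
s` is essential for it. -/
theorem solves_empty (hs : 1 ≤ s) {c : ℕ → ℕ → ℕ} {D : ℕ → ℕ → Prop} (hD : ∀ u v, ¬ D u v)
    (hc : ∀ u v, c u v = 0) : Solves N n k s c D := by
  refine ⟨?_, fun u hu => ?_⟩
  · unfold cost
    rw [sum_eq_zero fun u _ => sum_eq_zero fun v _ => by rw [if_neg (hD u v)]]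
    exact Nat.zero_le _
  · refine le_trans (card_le_card (t := {u}) fun v hv => ?_) (by simpa using hs)
    simp only [mem_filter, Set.mem_ofPred_eq] at hv
    rw [mem_singleton]
    rcases hv.2.2.cases_head with h | ⟨w, h, -⟩
    · exact h
    · have := h.2.2.1; rw [hc] at this; omega

/-- The memory once the capacities are written. -/
theorem Blank.fill {inp : ℕ → ℕ} (h : Blank N n k s inp σ) {q : Cmd} {C : ℕ → ℕ → ℕ}
    (hv : (q.vars.all (scratchVars.contains ·)) = true) (ha : (q.arrs.all (Nat.beq aCAP ·)) = true)
    (hC : mat (N + 1) ((q.exec σ).arr aCAP) = C) : Setup N n k s (memSize N k s) C (q.exec σ) ∧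
      (q.exec σ).var vRUN = s ∧ (1 ≤ s → s ≤ N → SplitSize N n → TwinArcs N n C →
        Core N n k s (memSize N k s) C (q.exec σ)) := by
  simp only [List.all_eq_true, List.contains_iff_mem] at hv ha
  have v : ∀ y, y ∉ scratchVars → (q.exec σ).var y = σ.var y := fun y hy =>
    exec_var _ _ _ (wv_of_not_mem _ fun h => hy (hv y h))
  have w : ∀ a, a ≠ aCAP → (q.exec σ).arr a = σ.arr a := fun a h1 =>
    exec_arr _ _ _ (wa_of_not_mem _ fun h => h1 (Nat.eq_of_beq_eq_true (ha a h)).symm)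
  generalize q.exec σ = τ at *
  have hd : ∀ i, τ.arr aDIG i = 0 := fun i => by
    rw [w _ (by decide)]; exact h.zero _ (by decide) (by decide) (by decide) i
  have hset : Setup N n k s (memSize N k s) C τ :=
    { env := h.env.of_eq (fun y hy => v y (by revert y; decide)) (w _ (by decide))
      sz := by rw [v _ (by decide), h.sz]
      len := by rw [v _ (by decide), h.len]
      len_le := Nat.le_add_left _ _
      rad := by rw [w _ (by decide)]; exact h.rad
      cap := hC
      dig := fun i _ => by rw [hd]; exact radix_pos _ _ _
      clean := fun a ha j _ => by
        rw [w a (by rintro rfl; exact absurd ha (by decide))]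
        refine h.zero a ?_ ?_ ?_ j <;> (rintro rfl; exact absurd ha (by decide)) }
  have hr : τ.var vRUN = s := by rw [v _ (by decide), h.run]
  have hrows : τ.var vROWS = 0 := by rw [v _ (by decide), h.rows]
  have hold : ∀ u v, ¬ oldSet N τ u v := fun x y hxy => hxy (by
    unfold mat; rw [w _ (by decide)]; exact h.zero _ (by decide) (by decide) (by decide) _)
  refine ⟨hset, hr, fun hs hsN hN htw => ?_⟩
  have h0 : Solves N n k s (rowsCap 0 C) (oldSet N τ) :=
    solves_empty hs hold fun u v => by simp [rowsCap]
  refine { hset with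
    run := fun _ => ?_
    halt := fun h => by omega }
  rw [hrows]
  refine ⟨by omega, h0, fun D hD => ?_⟩
  obtain ⟨g, hg, hg'⟩ := hset.target hN hs htw hrows (by omega) h0 hD
  refine ⟨g, hg, hg', le_of_eq_of_le ?_ (Nat.zero_le _)⟩
  exact sum_eq_zero fun j _ => by rw [hd, zero_mul]

/-! ### The complete solver -/

/-- The algorithm: initialize, write the capacities with `q`, solve, and write the answer with
`out`. -/
def solver (e : Expr) (q out : Cmd) : Prog :=
  .seq (initSizes e).compile (.seq initSums.compile (.seq initArrays.compile (.seq q.compile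
    (.seq (.loop (.var vRUN) mainBody.compile) out.compile))))

theorem memSize_bounds (N k s : ℕ) : N + 1 ≤ memSize N k s ∧ k + 1 ≤ memSize N k s ∧
    adviceLen k s ≤ memSize N k s ∧ (k + 1) * s ≤ memSize N k s := by
  have h4 : N + 1 ≤ (N + 1) * (N + 1) := Nat.le_mul_of_pos_left _ (by omega)
  unfold memSize adviceLen
  refine ⟨?_, ?_, ?_, ?_⟩ <;> omega

/-- Stated for an arbitrary continuation `p`, since the rest of the solver is nested inside the
initial sequence. -/
theorem init_run {inp : ℕ → ℕ} {e : Expr} {s' : ℕ} (h : Fresh n k s' inp σ)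
    (he : ∀ τ, τ.var 0 = n → e.eval τ = N) (hs : s = min s' n) (Z : ℕ) (hZ : Z = memSize N k s) :
    ∃ t τ, Blank N n k s inp τ ∧ t ≤ (initSizes e ;; initSums ;; initArrays).time Z ∧
      ∀ p u ρ, Run p τ u ρ → Run (.seq (initSizes e).compile (.seq initSums.compile
        (.seq initArrays.compile p))) σ (t + u) ρ := by
  obtain ⟨b1, b2, b3, b4⟩ := memSize_bounds N k s
  obtain ⟨a1, a2⟩ := initSizes_spec h he
  obtain ⟨⟨t1, r1, c1⟩, -⟩ := compile_run [] Z (initSizes e) rfl σ (by simp)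
  generalize (initSizes e).exec σ = α at *
  have hα3 : α.var 3 = s := by rw [a2, hs]; rfl
  have hα1 : α.var 1 = k := by rw [a2]; exact h.k_eq
  have hαM : α.var vM = N + 1 := a2 vM
  have hαK : α.var vKP = k + 1 := a2 vKP
  have hαr : α.var vRM = 0 := (a2 vRM).trans (h.var _ (by decide))
  have hαz : α.var vSZ = 0 := (a2 vSZ).trans (h.var _ (by decide))
  obtain ⟨s1, s2, s3, s4, s5⟩ := initSums_spec hα1 hα3 hαM hαK hαr hαz rfl
  obtain ⟨⟨t2, r2, c2⟩, -⟩ := compile_run [vKP, vM] Z initSums (by decide) α (by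
    simp only [List.mem_cons, List.not_mem_nil, or_false, forall_eq_or_imp, forall_eq, hαK, hαM]
    omega)
  generalize initSums.exec α = β at *
  have v : ∀ y, y ≠ vRM → y ≠ vL → y ≠ vSZ → y ≠ vI → y ≠ 3 → y ≠ vN → y ≠ vM → y ≠ vKP →
      y ≠ vTK → y ≠ vOFF → β.var y = σ.var y := fun y h1 h2 h3 h4 h5 h6 h7 h8 h9 h10 => by
    rw [s5 y h1 h2 h3 h4, a2, if_neg h5, if_neg h6, if_neg h7, if_neg h8, if_neg h9, if_neg h10]
  have w : β.arr = σ.arr := s1.trans a1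
  have g : ∀ y, y ≠ vRM → y ≠ vL → y ≠ vSZ → y ≠ vI → β.var y = α.var y := s5
  have hβM : β.var vM = N + 1 := (g _ (by decide) (by decide) (by decide) (by decide)).trans hαM
  have hB : Blank N n k s inp (initArrays.exec β) := by
    refine initArrays_spec ?_ ?_ ?_ ?_ ?_ ?_ ?_ ?_ s2 s3 s4 ?_ ?_ ?_ ?_
    · rw [v] <;> first | exact h.n_eq | decide
    · rw [v] <;> first | exact h.k_eq | decide
    · rw [g] <;> first | exact hα3 | decide
    · rw [g] <;> first | exact a2 vN | decide
    · exact hβM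
    · rw [g] <;> first | exact hαK | decide
    · rw [g] <;> first | exact a2 vTK | decide
    · rw [g] <;> first | exact a2 vOFF | decide
    · rw [v] <;> first | exact h.var _ (by decide) | decide
    · rw [v] <;> first | exact h.var _ (by decide) | decide
    · rw [w]; exact h.inp
    · rw [w]; exact h.arr
  obtain ⟨⟨t3, r3, c3⟩, -⟩ := compile_run [vM, vL, vRM] Z initArrays (by decide) β (by
    simp only [List.mem_cons, List.not_mem_nil, or_false, forall_eq_or_imp, forall_eq, hβM, s2, s3]
    refine ⟨by omega, ?_, by omega⟩
    rw [hZ]; exact b3)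
  refine ⟨t1 + (t2 + t3), _, hB, ?_, fun p u ρ hp => ?_⟩
  · simp only [time]; omega
  · have := Run.seq r1 (Run.seq r2 (Run.seq r3 hp))
    rwa [show t1 + (t2 + t3) + u = t1 + (t2 + (t3 + u)) by omega]

/-- `out` announces the answer in variable `0`, the head of `boundVars`; its own loops may therefore
be bounded only by the variables in the tail. -/
theorem solver_spec (e : Expr) (q out : Cmd) (hqw : q.wf boundVars = true)
    (how : out.wf boundVars.tail = true)
    (hv : (q.vars.all (scratchVars.contains ·)) = true)
    (ha : (q.arrs.all (Nat.beq aCAP ·)) = true) :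
    ∃ c, ∀ (N n k s : ℕ) (inp : ℕ → ℕ) (C : ℕ → ℕ → ℕ) (σ : State), Fresh n k s inp σ →
      (∀ τ, τ.var 0 = n → e.eval τ = N) → SplitSize N n →
      (∀ τ, Blank N n k (min s n) inp τ → ∀ u < N, ∀ v < N,
        mat (N + 1) ((q.exec τ).arr aCAP) u v = C u v) → TwinArcs N n C →
      ∃ t τ C', Run (solver e q out) σ t (out.exec τ) ∧
        t ≤ 4 ^ k * (k * s + k + s).factorial * (c * (n + 1) ^ c) ∧
        Setup N n k (min s n) (memSize N k (min s n)) C' τ ∧ (∀ u < N, ∀ v < N, C' u v = C u v) ∧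
        (1 ≤ min s n → (τ.var vANS = 1 ∧ Solves N n k (min s n) C (oldSet N τ)) ∨
          (τ.var vANS = 0 ∧ ∀ D, ¬ Solves N n k (min s n) C D)) := by
  -- One polynomial is taken for the sum of all parts, so that it bounds both the body of the main
  -- loop and everything else. The three `skip`s pay for the tests of the loop.
  obtain ⟨c, hc⟩ := time_poly ((initSizes e ;; initSums ;; initArrays) ;; q ;; mainBody ;; out ;;
    skip ;; skip ;; skip)
  obtain ⟨d, hd⟩ := total_time_le c
  refine ⟨d, fun N n k s inp C σ hF he hN hC htw => ?_⟩
  have hn : n ≤ N := by rcases hN with h | h <;> omega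
  set s' := min s n with hs'
  set Z := memSize N k s' with hZ
  obtain ⟨t1, α, hB, ht1, hrun⟩ := init_run hF he hs' Z hZ
  have hC' := hC α hB
  obtain ⟨hset, hR, hcore⟩ := hB.fill hv ha rfl
  set C' := mat (N + 1) ((q.exec α).arr aCAP) with hCd
  have htw' : TwinArcs N n C' := htw.congr fun u hu v hv => (hC' u hu v hv).symm
  have hbα : ∀ b ∈ boundVars, α.var b ≤ Z :=
    (hB.fill (q := skip) rfl rfl rfl).1.bound hn
  obtain ⟨⟨t2, r2, ht2⟩, -⟩ := compile_run boundVars Z q hqw α hbα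
  generalize q.exec α = β at *
  obtain ⟨t3, τ, r3, ht3, hsτ, hfin⟩ : ∃ t τ, Run (.loop (.var vRUN) mainBody.compile) β t τ ∧
      t ≤ N * placeVal (radix k ((k + 1) * s')) (adviceLen k s') * (mainBody.time Z + 2) + 2 ∧
      Setup N n k s' Z C' τ ∧ (1 ≤ s' → (τ.var vANS = 1 ∧ Solves N n k s' C' (oldSet N τ)) ∨
          (τ.var vANS = 0 ∧ ∀ D, ¬ Solves N n k s' C' D)) := by
    by_cases h1 : 1 ≤ s'
    · obtain ⟨t, τ, g1, g2, g3, g4⟩ := (hcore h1 ((min_le_right _ _).trans hn) hN htw').exec_loop hN h1 htw'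
        (N * placeVal (radix k ((k + 1) * s')) (adviceLen k s')) (by
          unfold remaining
          split
          · exact Nat.zero_le _
          · exact (Nat.sub_le _ _).trans (Nat.mul_le_mul_right _ (Nat.sub_le _ _)))
      exact ⟨t, τ, g1, g4, g2.toSetup, fun _ => g2.halt g3⟩
    · refine ⟨_, β, Run.loop_false (by rw [Expr.eval, hR]; omega), ?_, hset, fun h => absurd h h1⟩
      simp [Expr.cost]
  obtain ⟨⟨t4, r4, ht4⟩, -⟩ := compile_run boundVars.tail Z out how τ fun b hb =>
    hsτ.bound hn b (List.mem_of_mem_tail hb)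
  refine ⟨_, τ, C', hrun _ _ _ (Run.seq r2 (Run.seq r3 r4)), ?_, hsτ, hC', fun h1 => ?_⟩
  · refine le_trans ?_ (hd n k s' s N Z (min_le_left _ _) (min_le_right _ _)
      (by rcases hN with h | h <;> omega) le_rfl)
    refine le_trans ?_ (Nat.mul_le_mul_left _ (hc Z ?_))
    · simp only [time] at ht1 ⊢
      generalize N * placeVal (radix k ((k + 1) * s')) (adviceLen k s') = E at *
      have : ∀ a : ℕ, E * (mainBody.time Z + 2) ≤ E * (mainBody.time Z + 2 + a) := fun a =>
        Nat.mul_le_mul_left _ (by omega)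
      generalize hX : (initSizes e).time Z + (initSums.time Z + initArrays.time Z) +
        (q.time Z + (mainBody.time Z + (out.time Z + (1 + (1 + 1))))) = X
      have h1 : E * (mainBody.time Z + 2) ≤ E * X := Nat.mul_le_mul_left _ (by omega)
      rw [add_mul, one_mul]
      omega
    · have := (memSize_bounds N k s').1; omega
  · have hiff : ∀ D, Solves N n k s' C' D ↔ Solves N n k s' C D := fun D =>
      ⟨fun h => h.congr hC' fun _ _ _ _ => Iff.rfl,
        fun h => h.congr (fun u hu v hv => (hC' u hu v hv).symm) fun _ _ _ _ => Iff.rfl⟩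
    have := hfin h1
    simpa only [hiff] using this

/-! ## Reading the instance and writing the answer -/

def next : Cmd := assign vCUR (.add (.var vCUR) (.const 1))

/-- Read the multiplicities. -/
def arcFill : Cmd := loop vU vN (loop vV vN (wr aCAP vU vV (.read 0 (.var vCUR)) ;; next))

theorem arcFill_spec {inp : ℕ → ℕ} (h : Blank n n k s inp σ) (u v : ℕ) (hu : u < n) (hv : v < n) :
    mat (n + 1) ((arcFill.exec σ).arr aCAP) u v = inp (u * n + v) := by
  have hInv := loop2_rule (x := vU) (y := vV) (b := vN) (d := vN)
    (p := wr aCAP vU vV (.read 0 (.var vCUR)) ;; next) (σ := σ)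
    (fun i j τ => τ.var vCUR = i * n + j ∧ ∀ u < n, ∀ v < n, (u < i ∨ (u = i ∧ v < j)) →
      mat (n + 1) (τ.arr aCAP) u v = inp (u * n + v))
    rfl (by decide) (by decide) (by decide) rfl
    (fun i j τ z v hz ⟨h1, h2⟩ => ⟨by rcases hz with rfl | rfl <;> simpa using h1, h2⟩)
    ⟨by simp [h.cur], fun u _ v _ h => by omega⟩
    (fun i τ _ ⟨h1, h2⟩ => by
      rw [h.env.N_eq] at h1 h2
      exact ⟨by rw [h1]; ring, fun u hu v hv huv => h2 u hu v hv (by omega)⟩)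
    (fun i j τ hi hj hS hx hy ⟨h1, h2⟩ => by
      rw [h.env.N_eq] at hi hj
      have hE : Env n n k s τ :=
        h.env.of_eq (fun y hy => hS.1 y (by revert y; decide)) (hS.2 _ rfl)
      have e0 : τ.arr 0 = inp := by rw [hS.2 0 rfl, h.inp]
      have e : (wr aCAP vU vV (.read 0 (.var vCUR)) ;; next).exec τ =
          (τ.setArr aCAP (i * (n + 1) + j) (inp (i * n + j))).setVar vCUR (i * n + j + 1) := by
        simp only [exec_seq]
        rw [exec_wr hE (by omega) (by omega), hx, hy]
        simp [next, h1, e0]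
      rw [e]
      refine ⟨by simp; ring, fun u hu v hv huv => ?_⟩
      rw [arr_setVar, arr_setArr, if_pos rfl, mat_update _ _ (by omega) (by omega)]
      by_cases c : u = i ∧ v = j
      · rw [if_pos c, c.1, c.2]
      · rw [if_neg c]; exact h2 u hu v hv (by omega))
  rw [h.env.N_eq] at hInv
  exact hInv.2 u hu v hv (by omega)

def splitBody : Cmd := assign vV (.add (.var vU) (.var vOFF)) ;; wr aCAP vU vV (.const 1)

def headBody : Cmd :=
  assign vZ (.add (.var vU) (.var vOFF)) ;;
    cond (.read 0 (.var vCUR)) (wr aCAP vZ vV (.var vKP)) skip ;; next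

/-- Split every vertex, so that it becomes an arc of capacity one; arcs of the graph cannot be
deleted. -/
def vertexFill : Cmd := loop vU vOFF splitBody ;; loop vU vOFF (loop vV vOFF headBody)

/-- The capacities of the graph in which every vertex has been split. -/
def splitCap (n k : ℕ) (inp : ℕ → ℕ) (u v : ℕ) : ℕ :=
  if u < n then (if v = u + n then 1 else 0)
  else if v < n ∧ inp ((u - n) * n + v) ≠ 0 then k + 1 else 0

theorem vertexFill_spec {inp : ℕ → ℕ} (h : Blank (2 * n) n k s inp σ) (u v : ℕ) (hu : u < 2 * n)
    (hv : v < 2 * n) :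
    mat (2 * n + 1) ((vertexFill.exec σ).arr aCAP) u v = splitCap n k inp u v := by
  have hoff : σ.var vOFF = n := by rw [h.env.off]; omega
  obtain ⟨α, a1, a2, a3⟩ := loop_rule (x := vU) (b := vOFF) (p := splitBody) (σ := σ)
    (fun i τ => ∀ u < 2 * n + 1, ∀ v < 2 * n + 1, mat (2 * n + 1) (τ.arr aCAP) u v =
      if u < i ∧ v = u + n then 1 else 0)
    (fun u _ v _ => by
      simp only [mat]; rw [h.zero aCAP (by decide) (by decide) (by decide)]; simp)
    (fun i τ hi hS hI u hu v hv => by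
      rw [hoff] at hi
      have hE : Env (2 * n) n k s ((τ.setVar vU i).setVar vV (i + n)) :=
        ((h.env.of_eq (fun y hy => hS.1 y (by revert y; decide)) (hS.2 _ rfl)).setVar _ _ (by decide)).setVar _ _ (by decide)
      have e0 : τ.var vOFF = n := by rw [hS.1 vOFF rfl, hoff]
      have e : splitBody.exec (τ.setVar vU i) = ((τ.setVar vU i).setVar vV (i + n)).setArr aCAP
          (i * (2 * n + 1) + (i + n)) 1 := by
        have e1 : (Expr.add (.var vU) (.var vOFF)).eval (τ.setVar vU i) = i + n := by simp [e0]
        simp only [splitBody, exec_seq, exec_assign, e1]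
        rw [exec_wr hE (by simp; omega) (by simp; omega)]
        simp
      rw [e, arr_setArr, if_pos rfl, mat_update _ _ (by omega) hv, arr_setVar, arr_setVar,
        hI u hu v hv]
      split_ifs <;> first | rfl | omega)
  rw [hoff] at a1 a3
  have hE' : Env (2 * n) n k s (α.setVar vU n) := (h.env.of_eq (fun y hy => a2.1 y (by revert y; decide)) (a2.2 _ rfl)).setVar _ _ (by decide)
  have hcur : (α.setVar vU n).var vCUR = 0 := by simp [a2.1 vCUR rfl, h.cur]
  have hoff' : (α.setVar vU n).var vOFF = n := by simp [a2.1 vOFF rfl, hoff]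
  have hinp : (α.setVar vU n).arr 0 = inp := by rw [arr_setVar, a2.2 0 rfl, h.inp]
  have hcap : ∀ u < 2 * n + 1, ∀ v < 2 * n + 1, mat (2 * n + 1) ((α.setVar vU n).arr aCAP) u v =
      if u < n ∧ v = u + n then 1 else 0 := a1
  simp only [vertexFill, exec_seq]
  rw [a3]
  generalize α.setVar vU n = β at *
  have hInv := loop2_rule (x := vU) (y := vV) (b := vOFF) (d := vOFF) (p := headBody) (σ := β)
    (fun i j τ => τ.var vCUR = i * n + j ∧ ∀ u < 2 * n + 1, ∀ v < 2 * n + 1,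
      mat (2 * n + 1) (τ.arr aCAP) u v =
        if u < n then (if v = u + n then 1 else 0) else
        if (u < i + n ∨ (u = i + n ∧ v < j)) ∧ v < n ∧ inp ((u - n) * n + v) ≠ 0 then k + 1 else 0)
    rfl (by decide) (by decide) (by decide) rfl
    (fun i j τ z v hz ⟨h1, h2⟩ => ⟨by rcases hz with rfl | rfl <;> simpa using h1, h2⟩)
    ⟨by simp [hcur], fun u hu v hv => by
      rw [hcap u hu v hv]
      by_cases c : u < n
      · simp [c]
      · rw [if_neg (by omega), if_neg c, if_neg (by omega)]⟩
    (fun i τ _ ⟨h1, h2⟩ => by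
      rw [hoff'] at h1 h2
      refine ⟨by rw [h1]; ring, fun u hu v hv => ?_⟩
      rw [h2 u hu v hv]
      by_cases c : u < n
      · rw [if_pos c, if_pos c]
      · rw [if_neg c, if_neg c]
        congr 1
        apply propext
        constructor <;> (rintro ⟨g1, g2, g3⟩; exact ⟨by omega, g2, g3⟩))
    (fun i j τ hi hj hS hx hy ⟨h1, h2⟩ => by
      rw [hoff'] at hi hj
      have hE : Env (2 * n) n k s (τ.setVar vZ (i + n)) := (hE'.of_eq (fun y hy => hS.1 y (by revert y; decide)) (hS.2 _ rfl)).setVar _ _ (by decide)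
      have e0 : τ.arr 0 = inp := by rw [hS.2 0 rfl, hinp]
      have e1 : (Expr.add (.var vU) (.var vOFF)).eval τ = i + n := by
        simp [hx, hS.1 vOFF rfl, hoff']
      have e2 : (Expr.read 0 (.var vCUR)).eval (τ.setVar vZ (i + n)) = inp (i * n + j) := by
        simp [h1, e0]
      have e3 : (wr aCAP vZ vV (.var vKP)).exec (τ.setVar vZ (i + n)) =
          (τ.setVar vZ (i + n)).setArr aCAP ((i + n) * (2 * n + 1) + j) (k + 1) := by
        rw [exec_wr hE (by simp; omega) (by simp [hy]; omega)]
        simp only [Expr.eval, hE.kp]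
        simp [hy]
      have e4 : (headBody.exec τ).var vCUR = i * n + j + 1 := by
        simp only [headBody, exec_seq, exec_assign, e1, exec_cond, e2, e3, next, exec_skip]
        split <;> simp [h1]
      have e5 : (headBody.exec τ).arr aCAP = if inp (i * n + j) = 0 then τ.arr aCAP else
          Function.update (τ.arr aCAP) ((i + n) * (2 * n + 1) + j) (k + 1) := by
        simp only [headBody, exec_seq, exec_assign, e1, exec_cond, e2, e3, next, exec_skip]
        split <;> simp
      refine ⟨by rw [e4]; ring, fun u hu v hv => ?_⟩
      have e6 : mat (2 * n + 1) ((headBody.exec τ).arr aCAP) u v =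
          if u = i + n ∧ v = j ∧ inp (i * n + j) ≠ 0 then k + 1 else
            mat (2 * n + 1) (τ.arr aCAP) u v := by
        rw [e5]
        by_cases c : inp (i * n + j) = 0
        · rw [if_pos c, if_neg (by tauto)]
        · rw [if_neg c, mat_update _ _ (by omega) hv]
          simp [c]
      rw [e6, h2 u hu v hv]
      by_cases c : u = i + n ∧ v = j
      · obtain ⟨rfl, rfl⟩ := c
        have : ¬ i + n < n := by omega
        simp [this, hj]
      · rw [if_neg (by tauto)]
        by_cases c1 : u < n
        · rw [if_pos c1, if_pos c1]
        · rw [if_neg c1, if_neg c1]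
          congr 1
          apply propext
          constructor <;> (rintro ⟨g1, g2, g3⟩; exact ⟨by omega, g2, g3⟩))
  rw [hoff'] at hInv
  rw [hInv.2 u (by omega) v (by omega), splitCap]
  by_cases c1 : u < n
  · rw [if_pos c1, if_pos c1]
  · rw [if_neg c1, if_neg c1]
    congr 1
    apply propext
    constructor
    · rintro ⟨g1, g2, g3⟩; exact ⟨g2, g3⟩
    · rintro ⟨g2, g3⟩; exact ⟨by omega, g2, g3⟩

def arcOutBody : Cmd :=
  cond (rd aDOLD vU vV) (write 1 (.var vCUR) (rd aCAP vU vV)) (write 1 (.var vCUR) (.const 0)) ;; next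

/-- Write the answer for arc deletion. -/
def arcOut : Cmd :=
  cond (.var 3)
    (cond (.var vANS) (assign vCUR (.const 0) ;; loop vU vN (loop vV vN arcOutBody) ;;
      assign 0 (.const 1)) (assign 0 (.const 0)))
    (cond (.var 0) (assign 0 (.const 0)) (assign 0 (.const 1)))

theorem arcOut_solution {Z : ℕ} {C : ℕ → ℕ → ℕ} (h : Setup n n k s Z C σ) (hs : 1 ≤ s)
    (hans : σ.var vANS = 1) : (arcOut.exec σ).var 0 = 1 ∧ ∀ u < n, ∀ v < n,
      (arcOut.exec σ).arr 1 (u * n + v) = if oldSet n σ u v then C u v else 0 := by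
  have e : arcOut.exec σ =
      ((loop vU vN (loop vV vN arcOutBody)).exec (σ.setVar vCUR 0)).setVar 0 1 := by
    simp only [arcOut, exec_cond, Expr.eval, h.env.s_eq, hans]
    rw [if_neg (by omega), if_neg (by decide)]
    simp
  have hE0 : Env n n k s (σ.setVar vCUR 0) := h.env.setVar _ _ (by decide)
  have hInv := loop2_rule (x := vU) (y := vV) (b := vN) (d := vN) (p := arcOutBody)
    (σ := σ.setVar vCUR 0)
    (fun i j τ => τ.var vCUR = i * n + j ∧ ∀ u < n, ∀ v < n, (u < i ∨ (u = i ∧ v < j)) →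
      mat n (τ.arr 1) u v = if oldSet n σ u v then C u v else 0)
    rfl (by decide) (by decide) (by decide) rfl
    (fun i j τ z v hz ⟨h1, h2⟩ => ⟨by rcases hz with rfl | rfl <;> simpa using h1, h2⟩)
    ⟨by simp, fun u _ v _ h => by omega⟩
    (fun i τ _ ⟨h1, h2⟩ => by
      rw [hE0.N_eq] at h1 h2
      exact ⟨by rw [h1]; ring, fun u hu v hv huv => h2 u hu v hv (by omega)⟩)
    (fun i j τ hi hj hS hx hy ⟨h1, h2⟩ => by
      rw [hE0.N_eq] at hi hj
      have hE : Env n n k s τ := hE0.same hS rfl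
      have e1 : (rd aDOLD vU vV).eval τ = mat (n + 1) (σ.arr aDOLD) i j := by
        rw [eval_rd hE (by omega), hx, hy, hS.2 aDOLD rfl, arr_setVar]
      have e2 : (rd aCAP vU vV).eval τ = C i j := by
        rw [eval_rd hE (by omega), hx, hy, hS.2 aCAP rfl, arr_setVar, h.cap]
      have e3 : i * n + j < τ.var vSZ := by
        have := cell_lt hi hj
        have := hE.sz
        nlinarith
      have e4 : (arcOutBody.exec τ).var vCUR = i * n + j + 1 := by
        simp only [arcOutBody, exec_seq, exec_cond, e1, exec_write, Expr.eval, h1, e3, if_true, next,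
          exec_assign]
        split <;> simp [h1]
      have e5 : (arcOutBody.exec τ).arr 1 = Function.update (τ.arr 1) (i * n + j)
          (if oldSet n σ i j then C i j else 0) := by
        simp only [arcOutBody, exec_seq, exec_cond, e1, e2, exec_write, Expr.eval, h1, e3, if_true,
          next, exec_assign, oldSet]
        split
        · rename_i hz; simp [hz]
        · rename_i hz; simp [hz]
      refine ⟨by rw [e4]; ring, fun u hu v hv huv => ?_⟩
      rw [e5, mat_update _ _ hj hv]
      by_cases c : u = i ∧ v = j
      · rw [if_pos c, c.1, c.2]
      · rw [if_neg c]; exact h2 u hu v hv (by omega))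
  rw [hE0.N_eq] at hInv
  rw [e]
  exact ⟨by simp, fun u hu v hv => hInv.2 u hu v hv (by omega)⟩

theorem arcOut_failure {Z : ℕ} {C : ℕ → ℕ → ℕ} (h : Setup n n k s Z C σ) (hs : 1 ≤ s)
    (hans : σ.var vANS = 0) : (arcOut.exec σ).var 0 = 0 := by
  simp only [arcOut, exec_cond, Expr.eval, h.env.s_eq, hans]
  rw [if_neg (by omega), if_true]
  simp

/-- With `min s n = 0` and a vertex present, no component may exist, which deleting arcs cannot
achieve. -/
theorem arcOut_zero {Z : ℕ} {C : ℕ → ℕ → ℕ} (h : Setup n n k 0 Z C σ) :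
    (arcOut.exec σ).var 0 = if n = 0 then 1 else 0 := by
  simp only [arcOut, exec_cond, Expr.eval, h.env.s_eq, h.env.n_eq, if_true]
  split <;> simp

def vertexOutBody : Cmd :=
  assign vV (.add (.var vU) (.var vOFF)) ;;
    cond (rd aDOLD vU vV) (write 1 (.var vU) (.const 1)) (write 1 (.var vU) (.const 0))

/-- Write the answer for vertex deletion. -/
def vertexOut : Cmd :=
  cond (.var 3)
    (cond (.var vANS) (loop vU vOFF vertexOutBody ;; assign 0 (.const 1)) (assign 0 (.const 0)))
    (cond (.sub (.var 0) (.var 1)) (assign 0 (.const 0))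
      (loop vU vOFF (write 1 (.var vU) (.const 1)) ;; assign 0 (.const 1)))

theorem vertexOut_solution {Z : ℕ} {C : ℕ → ℕ → ℕ} (h : Setup (2 * n) n k s Z C σ) (hs : 1 ≤ s)
    (hans : σ.var vANS = 1) : (vertexOut.exec σ).var 0 = 1 ∧ ∀ u < n,
      (vertexOut.exec σ).arr 1 u = if oldSet (2 * n) σ u (u + n) then 1 else 0 := by
  have hoff : σ.var vOFF = n := by rw [h.env.off]; omega
  have e : vertexOut.exec σ = ((loop vU vOFF vertexOutBody).exec σ).setVar 0 1 := by
    simp only [vertexOut, exec_cond, Expr.eval, h.env.s_eq, hans]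
    rw [if_neg (by omega), if_neg (by decide)]
    simp
  have f := fill1 (x := vU) (b := vOFF) (a := 1) (p := vertexOutBody) (σ := σ)
    (fun u => if oldSet (2 * n) σ u (u + n) then 1 else 0) (fun i τ hi hS _ => by
      rw [hoff] at hi
      have hE : Env (2 * n) n k s ((τ.setVar vU i).setVar vV (i + n)) :=
        ((h.env.same hS rfl).setVar _ _ (by decide)).setVar _ _ (by decide)
      have e0 : (Expr.add (.var vU) (.var vOFF)).eval (τ.setVar vU i) = i + n := by
        simp [hS.1 vOFF rfl, hoff]
      have e1 : (rd aDOLD vU vV).eval ((τ.setVar vU i).setVar vV (i + n)) =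
          mat (2 * n + 1) (σ.arr aDOLD) i (i + n) := by
        rw [eval_rd hE (by simp; omega)]
        simp [hS.2 aDOLD rfl]
      have e2 : i < ((τ.setVar vU i).setVar vV (i + n)).var vSZ := by
        have := hE.sz
        nlinarith
      have e3 : ((τ.setVar vU i).setVar vV (i + n)).var vU = i := by simp
      have e4 : vertexOutBody.exec (τ.setVar vU i) = (cond (rd aDOLD vU vV)
          (write 1 (.var vU) (.const 1)) (write 1 (.var vU) (.const 0))).exec
          ((τ.setVar vU i).setVar vV (i + n)) := by
        simp only [vertexOutBody, exec_seq, exec_assign, e0]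
      have e5 : ((τ.setVar vU i).setVar vV (i + n)).arr = τ.arr := rfl
      rw [e4]
      generalize (τ.setVar vU i).setVar vV (i + n) = ρ at *
      simp only [exec_cond, e1, exec_write, Expr.eval, e3, e2, if_true, oldSet]
      split
      · rename_i hz; simp [hz, e5]
      · rename_i hz; simp [hz, e5])
  rw [hoff] at f
  rw [e]
  exact ⟨by simp, fun u hu => (f u).trans (if_pos hu)⟩

theorem vertexOut_failure {Z : ℕ} {C : ℕ → ℕ → ℕ} (h : Setup (2 * n) n k s Z C σ) (hs : 1 ≤ s)
    (hans : σ.var vANS = 0) : (vertexOut.exec σ).var 0 = 0 := by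
  simp only [vertexOut, exec_cond, Expr.eval, h.env.s_eq, hans]
  rw [if_neg (by omega), if_true]
  simp

/-- When no component may remain, all `n` vertices have to be deleted. -/
theorem vertexOut_zero {Z : ℕ} {C : ℕ → ℕ → ℕ} (h : Setup (2 * n) n k 0 Z C σ) :
    (k < n → (vertexOut.exec σ).var 0 = 0) ∧ (n ≤ k → (vertexOut.exec σ).var 0 = 1 ∧
      ∀ u < n, (vertexOut.exec σ).arr 1 u = 1) := by
  have hoff : σ.var vOFF = n := by rw [h.env.off]; omega
  simp only [vertexOut, exec_cond, Expr.eval, h.env.s_eq, h.env.n_eq, h.env.k_eq, if_true]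
  refine ⟨fun hk => by rw [if_neg (by omega)]; simp, fun hk => ?_⟩
  rw [if_pos (by omega)]
  have f := fill1 (x := vU) (b := vOFF) (a := 1) (p := write 1 (.var vU) (.const 1)) (σ := σ)
    (fun _ => 1) (fun i τ hi hS _ => by
      have := h.env.sz
      have e2 : i < τ.var vSZ := by rw [hS.1 vSZ rfl]; nlinarith
      simp [e2])
  rw [hoff] at f
  exact ⟨by simp, fun u hu => (f u).trans (if_pos hu)⟩

/-! ## Strong components as classes of mutually reachable vertices -/

namespace MultiDigraph

variable {V A : Type} (G : MultiDigraph V A)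

/-- The vertices that reach `u` and are reached from `u`. -/
def strongClass (u : V) : Set V := {v | G.Reachable u v ∧ G.Reachable v u}

theorem mem_strongClass (u : V) : u ∈ G.strongClass u := ⟨.refl, .refl⟩

variable {G}

theorem Reachable.of_induce {D : Set V} {u v : {v : V // v ∈ D}} (h : (G.induce D).Reachable u v) :
    G.Reachable u v :=
  Relation.ReflTransGen.lift (p := G.Adj) Subtype.val (fun _ _ ⟨e, h1, h2⟩ =>
    ⟨e.1, congrArg Subtype.val h1, congrArg Subtype.val h2⟩) _ _ h

/-- A walk between two vertices of the class passes only through vertices of the class, so it is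
also a walk in the induced subgraph. -/
theorem strong_strongClass (u : V) : (G.induce (G.strongClass u)).Strong := by
  suffices ∀ v w : V, G.Reachable v w → ∀ (hv : v ∈ G.strongClass u) (hw : w ∈ G.strongClass u),
      (G.induce (G.strongClass u)).Reachable ⟨v, hv⟩ ⟨w, hw⟩ from
    fun v w _ => this v w (v.2.2.trans w.2.1) v.2 w.2
  intro v w hvw
  induction hvw using Relation.ReflTransGen.head_induction_on with
  | refl => exact fun _ _ => .refl
  | head hab hbw ih =>
    rename_i a b
    intro ha hw
    have hb : b ∈ G.strongClass u := ⟨ha.1.tail hab, hbw.trans hw.2⟩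
    obtain ⟨e, h1, h2⟩ := hab
    have hadj : (G.induce (G.strongClass u)).Adj ⟨a, ha⟩ ⟨b, hb⟩ :=
      ⟨⟨e, by rw [h1]; exact ha, by rw [h2]; exact hb⟩, Subtype.ext h1, Subtype.ext h2⟩
    exact .head hadj (ih hb hw)

theorem subset_strongClass {D : Set V} (h : (G.induce D).Strong) {u : V} (hu : u ∈ D) :
    D ⊆ G.strongClass u := fun v hv => by
  by_cases huv : u = v
  · rw [huv]; exact G.mem_strongClass v
  · exact ⟨(h ⟨u, hu⟩ ⟨v, hv⟩ fun e => huv (congrArg Subtype.val e)).of_induce,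
      (h ⟨v, hv⟩ ⟨u, hu⟩ fun e => huv (congrArg Subtype.val e).symm).of_induce⟩

theorem strongComponentsBounded_iff {s : ℕ} :
    G.StrongComponentsBounded s ↔ ∀ u, (G.strongClass u).encard ≤ s := by
  constructor
  · intro h u
    refine h _ ⟨⟨⟨u, G.mem_strongClass u⟩, strong_strongClass u⟩, fun D hD hle => ?_⟩
    exact subset_strongClass hD.2 (hle (G.mem_strongClass u))
  · intro h C hC
    obtain ⟨u, hu⟩ := hC.prop.1
    exact (Set.encard_le_encard (subset_strongClass hC.prop.2 hu)).trans (h u)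

/-- No component has more than `n` vertices, so the truncated problem has the same solutions. -/
theorem strongComponentsBounded_min {s n : ℕ} (hn : ENat.card V ≤ n) :
    G.StrongComponentsBounded (min s n) ↔ G.StrongComponentsBounded s := by
  refine forall₂_congr fun C _ => ?_
  have : C.encard ≤ n := ((Set.encard_le_encard (Set.subset_univ C)).trans
    (Set.encard_univ V).le).trans hn
  refine ⟨fun h => h.trans (Nat.cast_le.2 (min_le_left _ _)), fun h => ?_⟩
  rcases min_choice s n with e | e <;> rw [e] <;> assumption

theorem not_strongComponentsBounded_zero (u : V) : ¬ G.StrongComponentsBounded 0 := fun h => by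
  have := strongComponentsBounded_iff.1 h u
  rw [Nat.cast_zero, nonpos_iff_eq_zero, Set.encard_eq_zero] at this
  exact this.le (G.mem_strongClass u)

theorem strongComponentsBounded_of_isEmpty [IsEmpty V] (s : ℕ) : G.StrongComponentsBounded s :=
  strongComponentsBounded_iff.2 fun u => isEmptyElim u

end MultiDigraph

open MultiDigraph

theorem encard_eq_wt {n : ℕ} (S : Set ℕ) : {v : Fin n | (v : ℕ) ∈ S}.encard = wt n S := by
  have h : {v : Fin n | (v : ℕ) ∈ S} = ((univ.filter fun v : Fin n => (v : ℕ) ∈ S : Finset (Fin n)) :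
      Set (Fin n)) := by ext; simp
  rw [h, Set.encard_coe_eq_coe_finsetCard, wt]
  congr 1
  rw [← card_map Fin.valEmbedding]
  congr 1
  ext x
  simp only [mem_map, mem_filter, mem_univ, true_and, mem_range, Fin.valEmbedding_apply]
  constructor
  · rintro ⟨a, h1, rfl⟩; exact ⟨a.2, h1⟩
  · rintro ⟨h1, h2⟩; exact ⟨⟨x, h1⟩, h2, rfl⟩

/-! ## Arc deletion -/

section

variable {n : ℕ} {A : Type} {C : ℕ → ℕ → ℕ} {D : ℕ → ℕ → Prop}

theorem reachable_iff_reach {H : MultiDigraph (Fin n) A}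
    (hAdj : ∀ u v : Fin n, H.Adj u v ↔ Edge n C D u v) (u v : Fin n) :
    H.Reachable u v ↔ Reach n C D u v := by
  constructor
  · exact fun h => Relation.ReflTransGen.lift (p := Edge n C D) Fin.val
      (fun a b => (hAdj a b).1) _ _ h
  · intro h
    suffices ∀ w : ℕ, Reach n C D u w → ∀ v : Fin n, (v : ℕ) = w → H.Reachable u v from this _ h v rfl
    intro w hw
    induction hw with
    | refl => intro v hv; rw [Fin.ext hv]; exact .refl
    | tail _ hbc ih =>
      intro v hv
      exact (ih ⟨_, hbc.1⟩ rfl).tail ((hAdj _ _).2 (by rw [hv]; exact hbc))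

theorem strongComponentsBounded_iff_smallComps {H : MultiDigraph (Fin n) A} {s : ℕ}
    (hAdj : ∀ u v : Fin n, H.Adj u v ↔ Edge n C D u v) :
    H.StrongComponentsBounded s ↔ SmallComps n n s C D := by
  rw [strongComponentsBounded_iff]
  have h : ∀ u : Fin n, (H.strongClass u).encard ≤ s ↔ wt n {v | Conn n C D u v} ≤ s := fun u => by
    rw [← Nat.cast_le (α := ℕ∞), ← encard_eq_wt]
    have : H.strongClass u = {v : Fin n | (v : ℕ) ∈ {v | Conn n C D u v}} := by
      ext v
      simp only [strongClass, Set.mem_ofPred_eq, Conn, reachable_iff_reach hAdj]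
    rw [this]
  exact ⟨fun g u hu => (h ⟨u, hu⟩).1 (g _), fun g u => (h u).2 (g u u.2)⟩

variable (G : MultiDigraph (Fin n) A)

/-- The number of arcs from `u` to `v`. -/
noncomputable def arcMult (u v : Fin n) : ℕ := Set.ncard {e : A | G.src e = u ∧ G.tgt e = v}

theorem input_cell (u v : Fin n) (k s : ℕ) :
    (RAM.input G k s).arr 0 ((u : ℕ) * n + v) = arcMult G u v := by
  simp only [RAM.input, if_true, arcMult]
  congr 1
  ext e
  simp only [Set.mem_ofPred_eq]
  constructor
  · intro h
    obtain ⟨h1, h2⟩ := cell_inj (G.tgt e).2 v.2 h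
    exact ⟨Fin.ext h1, Fin.ext h2⟩
  · rintro ⟨rfl, rfl⟩; rfl

variable {G}
-- Parallel arcs act as one arc with a capacity. The bundle disappears only when all of its arcs are
-- deleted, which is what membership in `D` means.
theorem adj_deleteArcs [Finite A] (hC : ∀ u v : Fin n, C u v = arcMult G u v) {S : Finset A} (hD : ∀ u v : Fin n, (∃ e, G.src e = u ∧ G.tgt e = v) →
    (D u v ↔ ∀ e, G.src e = u → G.tgt e = v → e ∈ S)) (u v : Fin n) :
    (G.deleteArcs (S : Set A)).Adj u v ↔ Edge n C D u v := by
  have hpos : 0 < C u v ↔ ∃ e, G.src e = u ∧ G.tgt e = v := by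
    rw [hC, arcMult, Set.ncard_pos]; rfl
  constructor
  · rintro ⟨⟨e, he⟩, h1, h2⟩
    have hex : ∃ e, G.src e = u ∧ G.tgt e = v := ⟨e, h1, h2⟩
    exact ⟨u.2, v.2, hpos.2 hex, fun h => he (mem_coe.2 ((hD u v hex).1 h e h1 h2))⟩
  · rintro ⟨-, -, h1, h2⟩
    rw [hD u v (hpos.1 h1)] at h2
    push Not at h2
    obtain ⟨e, g1, g2, g3⟩ := h2
    exact ⟨⟨e, by simpa using g3⟩, g1, g2⟩

theorem cost_eq_sum (C : ℕ → ℕ → ℕ) (D : ℕ → ℕ → Prop) :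
    cost n C D = ∑ u : Fin n, ∑ v : Fin n, if D u v then C u v else 0 := by
  unfold cost
  rw [sum_range]
  exact sum_congr rfl fun u _ => by rw [sum_range]

theorem card_eq_sum_fibers (S : Finset A) :
    S.card = ∑ u : Fin n, ∑ v : Fin n, (S.filter fun e => G.src e = u ∧ G.tgt e = v).card := by
  rw [card_eq_sum_card_fiberwise (f := fun e => (G.src e, G.tgt e)) (t := univ) (by simp),
    ← univ_product_univ, sum_product]
  simp only [Prod.mk.injEq]

theorem isArcSolution_of_solves [Finite A] (hC : ∀ u v : Fin n, C u v = arcMult G u v) {k s : ℕ}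
    (h : Solves n n k s C D) : ∃ S : Finset A, G.IsArcSolution k s S ∧ ∀ u v : Fin n,
      (if D u v then C u v else 0) = Set.ncard {e : A | e ∈ S ∧ G.src e = u ∧ G.tgt e = v} := by
  set S : Finset A := (Set.toFinite {e : A | D (G.src e) (G.tgt e)}).toFinset with hS
  have hmem : ∀ e, e ∈ S ↔ D (G.src e) (G.tgt e) := fun e => by simp [hS]
  have hf : ∀ u v : Fin n, (if D u v then C u v else 0) =
      Set.ncard {e : A | e ∈ S ∧ G.src e = u ∧ G.tgt e = v} := by
    intro u v
    by_cases c : D u v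
    · rw [if_pos c, hC, arcMult]
      congr 1
      ext e
      simp only [Set.mem_ofPred_eq, hmem]
      constructor
      · rintro ⟨rfl, rfl⟩; exact ⟨c, rfl, rfl⟩
      · rintro ⟨-, h⟩; exact h
    · rw [if_neg c, eq_comm, Set.ncard_eq_zero, Set.eq_empty_iff_forall_notMem]
      rintro e ⟨h1, rfl, rfl⟩
      exact c ((hmem e).1 h1)
  refine ⟨S, ⟨?_, ?_⟩, hf⟩
  · refine le_trans (le_of_eq ?_) h.1
    rw [card_eq_sum_fibers (G := G), cost_eq_sum]
    refine sum_congr rfl fun u _ => sum_congr rfl fun v _ => ?_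
    rw [hf, ← Set.ncard_coe_finset]
    congr 1
    ext e; simp
  · refine (strongComponentsBounded_iff_smallComps (adj_deleteArcs hC fun u v hex => ?_)).2 h.2
    constructor
    · rintro hD e rfl rfl; exact (hmem e).2 hD
    · intro h
      obtain ⟨e, rfl, rfl⟩ := hex
      exact (hmem e).1 (h e rfl rfl)

/-- Only the bundles that lie completely in `S` go into `D`. Incomplete ones do not affect
adjacency, and leaving them out can only lower the cost. -/
theorem IsArcSolution.solves [Finite A] (hC : ∀ u v : Fin n, C u v = arcMult G u v) {k s : ℕ}
    {S : Finset A} (h : G.IsArcSolution k s S) : ∃ D, Solves n n k s C D := by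
  refine ⟨fun a b => ∀ e, (G.src e : ℕ) = a → (G.tgt e : ℕ) = b → e ∈ S, le_trans ?_ h.1,
    (strongComponentsBounded_iff_smallComps (adj_deleteArcs hC fun u v _ => ?_)).1 h.2⟩
  · rw [card_eq_sum_fibers (G := G), cost_eq_sum]
    refine sum_le_sum fun u _ => sum_le_sum fun v _ => ?_
    split
    · rename_i c
      rw [hC, arcMult, ← Set.ncard_coe_finset]
      refine Set.ncard_le_ncard ?_
      rintro e ⟨h1, h2⟩
      simp only [coe_filter, Set.mem_ofPred_eq]
      exact ⟨c e (by rw [h1]) (by rw [h2]), h1, h2⟩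
    · exact Nat.zero_le _
  · exact ⟨fun h e h1 h2 => h e (by rw [h1]) (by rw [h2]),
      fun h e h1 h2 => h e (Fin.ext h1) (Fin.ext h2)⟩

end

theorem fresh_input {n : ℕ} {A : Type} (G : MultiDigraph (Fin n) A) (k s : ℕ) :
    Fresh n k s ((RAM.input G k s).arr 0) (RAM.input G k s) where
  n_eq := rfl
  k_eq := rfl
  s_eq := rfl
  var y hy := by
    simp only [RAM.input]
    rw [if_neg (by omega), if_neg (by omega), if_neg (by omega)]
  inp := rfl
  arr a ha i := if_neg ha

theorem card_fin_le (n : ℕ) : ENat.card (Fin n) ≤ n := by simp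

theorem arc_deletion : ∃ (P : Prog) (c : ℕ), ∀ (n : ℕ) (A : Type) [Finite A]
    (G : MultiDigraph (Fin n) A) (k s : ℕ), ∃ (t : ℕ) (τ : State), Run P (RAM.input G k s) t τ ∧
      t ≤ 4 ^ k * (k * s + k + s).factorial * (c * (n + 1) ^ c) ∧ RAM.ArcAnswer G k s τ := by
  obtain ⟨c, hc⟩ := solver_spec (.var 0) arcFill arcOut (by decide) (by decide) rfl rfl
  refine ⟨solver (.var 0) arcFill arcOut, c, fun n A _ G k s => ?_⟩
  set C : ℕ → ℕ → ℕ := fun u v => (RAM.input G k s).arr 0 (u * n + v) with hCd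
  have hC : ∀ u v : Fin n, C u v = arcMult G u v := fun u v => input_cell G u v k s
  have hmin : ∀ S, G.IsArcSolution k (min s n) S ↔ G.IsArcSolution k s S := fun S =>
    and_congr_right fun _ => strongComponentsBounded_min (card_fin_le n)
  obtain ⟨t, τ, C', hR, ht, hset, hC', hfin⟩ := hc n n k s _ C _ (fresh_input G k s)
    (fun τ h => h) (Or.inl rfl) (fun τ h u hu v hv => arcFill_spec h u v hu hv)
    -- Without splitting, every vertex is its own twin and the condition on twins is vacuous.
    (fun u hu h => absurd (by unfold twin; split <;> omega) h)
  refine ⟨t, _, hR, ht, ?_⟩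
  by_cases h1 : 1 ≤ min s n
  · rcases hfin h1 with ⟨ha, hs⟩ | ⟨ha, hs⟩
    · obtain ⟨o1, o2⟩ := arcOut_solution hset h1 ha
      obtain ⟨S, hS, hS'⟩ := isArcSolution_of_solves hC hs
      refine Or.inl ⟨o1, S, (hmin S).1 hS, fun u v => ?_⟩
      rw [o2 u u.2 v v.2, hC' u u.2 v v.2, ← hS']
    · refine Or.inr ⟨arcOut_failure hset h1 ha, ?_⟩
      rintro ⟨S, hS⟩
      obtain ⟨D, hD⟩ := IsArcSolution.solves hC ((hmin S).2 hS)
      exact hs D hD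
  · have h0 : min s n = 0 := by omega
    rw [h0] at hset
    have ho := arcOut_zero hset
    by_cases hn : n = 0
    · subst hn
      exact Or.inl ⟨by simpa using ho, ∅, ⟨by simp, strongComponentsBounded_of_isEmpty s⟩,
        fun u => u.elim0⟩
    · refine Or.inr ⟨by simpa [hn] using ho, ?_⟩
      rintro ⟨S, -, hS⟩
      have : s = 0 := by omega
      subst this
      exact not_strongComponentsBounded_zero ⟨0, by omega⟩ hS

/-! ## Vertex deletion -/

section

variable {n : ℕ} {A : Type} {C : ℕ → ℕ → ℕ} {D : ℕ → ℕ → Prop} {G : MultiDigraph (Fin n) A}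
  {S : Finset (Fin n)}

/-- The arcs in the split graph: vertex `v` becomes the arc from `v` to `v + n`, which is present
unless `v` is in `S`. -/
def SplitEdges (G : MultiDigraph (Fin n) A) (S : Finset (Fin n)) (C : ℕ → ℕ → ℕ)
    (D : ℕ → ℕ → Prop) : Prop :=
  ∀ x y, Edge (2 * n) C D x y ↔ (∃ u : Fin n, x = u ∧ y = u + n ∧ u ∉ S) ∨
    ∃ u v : Fin n, x = u + n ∧ y = v ∧ G.Adj u v

theorem mem_compl_coe {v : Fin n} : v ∈ (S : Set (Fin n))ᶜ ↔ v ∉ S := by simp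

theorem adj_deleteVertices {u v : {v : Fin n // v ∈ (S : Set (Fin n))ᶜ}} :
    (G.deleteVertices (S : Set (Fin n))).Adj u v ↔ G.Adj u v := by
  constructor
  · rintro ⟨e, h1, h2⟩
    exact ⟨e.1, congrArg Subtype.val h1, congrArg Subtype.val h2⟩
  · rintro ⟨e, h1, h2⟩
    exact ⟨⟨e, by rw [h1]; exact u.2, by rw [h2]; exact v.2⟩, Subtype.ext h1, Subtype.ext h2⟩

theorem SplitEdges.reach_iff (h : SplitEdges G S C D)
    (u v : {v : Fin n // v ∈ (S : Set (Fin n))ᶜ}) :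
    (G.deleteVertices (S : Set (Fin n))).Reachable u v ↔ Reach (2 * n) C D u.1 v.1 := by
  constructor
  · intro hr
    induction hr with
    | refl => exact .refl
    | @tail b c _ hbc ih =>
      exact (ih.tail ((h _ _).2 (Or.inl ⟨b.1, rfl, rfl, mem_compl_coe.1 b.2⟩))).tail
        ((h _ _).2 (Or.inr ⟨b.1, c.1, rfl, rfl, adj_deleteVertices.1 hbc⟩))
  · intro hr
    -- A walk in the split graph alternates between first and second halves. The induction also
    -- follows walks that end in a second half, and these show that the vertex has not been deleted.
    suffices ∀ w : ℕ, Reach (2 * n) C D u.1 w →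
        (∀ x : {v : Fin n // v ∈ (S : Set (Fin n))ᶜ}, w = x.1 →
          (G.deleteVertices (S : Set (Fin n))).Reachable u x) ∧
        ∀ x : Fin n, w = x + n → ∃ hx : x ∈ (S : Set (Fin n))ᶜ,
          (G.deleteVertices (S : Set (Fin n))).Reachable u ⟨x, hx⟩ from (this _ hr).1 v rfl
    intro w hw
    induction hw with
    | refl =>
      refine ⟨fun x hx => ?_, fun x hx => ?_⟩
      · rw [Subtype.ext (Fin.ext hx)]; exact .refl
      · have := u.1.2; omega
    | tail _ hbc ih =>
      rcases (h _ _).1 hbc with ⟨a, rfl, rfl, ha⟩ | ⟨a, b, rfl, rfl, hab⟩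
      · refine ⟨fun x hx => ?_, fun x hx => ?_⟩
        · have := x.1.2; omega
        · have : x = a := Fin.ext (by omega)
          subst this
          exact ⟨mem_compl_coe.2 ha, ih.1 ⟨x, mem_compl_coe.2 ha⟩ rfl⟩
      · refine ⟨fun x hx => ?_, fun x hx => ?_⟩
        · obtain ⟨ha, hr⟩ := ih.2 a rfl
          refine hr.tail (adj_deleteVertices.2 ?_)
          rw [← Fin.ext hx]; exact hab
        · have := b.2; omega

theorem SplitEdges.wt_eq (h : SplitEdges G S C D) (u : {v : Fin n // v ∈ (S : Set (Fin n))ᶜ}) :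
    (wt n {v | Conn (2 * n) C D u.1 v} : ℕ∞) =
      ((G.deleteVertices (S : Set (Fin n))).strongClass u).encard := by
  rw [← encard_eq_wt, ← Function.Injective.encard_image Subtype.val_injective]
  congr 1
  ext v
  simp only [Set.mem_ofPred_eq, Set.mem_image, strongClass, h.reach_iff]
  constructor
  · intro hv
    have hvS : v ∈ (S : Set (Fin n))ᶜ := by
      rcases hv.2.cases_head with e | ⟨w, hw, -⟩
      · rw [Fin.ext e]; exact u.2
      · rcases (h _ _).1 hw with ⟨a, e, -, ha⟩ | ⟨a, b, e, -⟩
        · rw [Fin.ext e]; exact mem_compl_coe.2 ha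
        · have := v.2; omega
    exact ⟨⟨v, hvS⟩, hv, rfl⟩
  · rintro ⟨x, hx, rfl⟩; exact hx

/-- The first half of a deleted vertex has no outgoing arc and forms a component of weight one,
whence `1 ≤ s`. Components without first halves have weight zero. All others correspond to strong
components of the graph that remains. -/
theorem SplitEdges.smallComps_iff (h : SplitEdges G S C D) {s : ℕ} (hs : 1 ≤ s) :
    SmallComps (2 * n) n s C D ↔
      (G.deleteVertices (S : Set (Fin n))).StrongComponentsBounded s := by
  rw [strongComponentsBounded_iff]
  constructor
  · intro hsm u
    rw [← h.wt_eq, Nat.cast_le]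
    exact hsm _ (by have := u.1.2; omega)
  · intro hsm
    have hin : ∀ u < n, wt n {v | Conn (2 * n) C D u v} ≤ s := by
      intro u hu
      by_cases hS : (⟨u, hu⟩ : Fin n) ∈ S
      · refine le_trans (card_le_card (t := {u}) fun v hv => ?_) (by simpa using hs)
        simp only [mem_filter, Set.mem_ofPred_eq] at hv
        rw [mem_singleton]
        rcases hv.2.1.cases_head with e | ⟨w, hw, -⟩
        · exact e.symm
        · rcases (h _ _).1 hw with ⟨a, e, -, ha⟩ | ⟨a, b, e, -⟩
          · exact absurd hS (by rwa [show (⟨u, hu⟩ : Fin n) = a from Fin.ext e])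
          · omega
      · have := hsm ⟨⟨u, hu⟩, mem_compl_coe.2 hS⟩
        rwa [← h.wt_eq, Nat.cast_le] at this
    intro u _
    by_cases hex : ∃ v < n, Conn (2 * n) C D u v
    · obtain ⟨v, hv, huv⟩ := hex
      refine le_trans (wt_mono fun w _ hw => ?_) (hin v hv)
      exact ⟨huv.2.trans hw.1, hw.2.trans huv.1⟩
    · have : wt n {v | Conn (2 * n) C D u v} = 0 := by
        unfold wt
        rw [card_eq_zero, filter_eq_empty_iff]
        exact fun v hv hc => hex ⟨v, mem_range.1 hv, hc⟩
      omega

variable {k : ℕ} {inp : ℕ → ℕ}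

theorem le_cost {N : ℕ} {u v : ℕ} (hu : u < N) (hv : v < N) (hD : D u v) : C u v ≤ cost N C D := by
  unfold cost
  refine le_trans ?_ (single_le_sum (f := fun u => ∑ v ∈ range N, if D u v then C u v else 0)
    (fun _ _ => Nat.zero_le _) (mem_range.2 hu))
  refine le_trans (le_of_eq ?_) (single_le_sum (f := fun v => if D u v then C u v else 0)
    (fun _ _ => Nat.zero_le _) (mem_range.2 hv))
  rw [if_pos hD]

/-- If `D` contains only arcs that stand for vertices, then its cost is the number of these. -/
theorem cost_splitCap (hD : ∀ u < 2 * n, ∀ v < 2 * n, n ≤ u → 0 < splitCap n k inp u v → ¬ D u v) :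
    cost (2 * n) (splitCap n k inp) D = (univ.filter fun v : Fin n => D v (v + n)).card := by
  have h1 : ∀ u ∈ range (2 * n), (∑ v ∈ range (2 * n), if D u v then splitCap n k inp u v else 0) =
      if u < n ∧ D u (u + n) then 1 else 0 := by
    intro u hu
    rw [mem_range] at hu
    by_cases c : u < n
    · rw [sum_eq_single (u + n)]
      · simp [splitCap, c]
      · intro v _ hv; simp [splitCap, c, hv]
      · intro hv; exact absurd (mem_range.2 (by omega)) hv
    · rw [if_neg (by tauto)]
      refine sum_eq_zero fun v hv => ?_
      split
      · rename_i hd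
        by_contra hp
        exact hD u hu v (mem_range.1 hv) (by omega) (Nat.pos_of_ne_zero hp) hd
      · rfl
  unfold cost
  rw [sum_congr rfl h1, ← card_filter, ← card_map Fin.valEmbedding]
  congr 1
  ext x
  simp only [mem_map, mem_filter, mem_univ, true_and, mem_range, Fin.valEmbedding_apply]
  constructor
  · rintro ⟨-, h1, h2⟩; exact ⟨⟨x, h1⟩, h2, rfl⟩
  · rintro ⟨a, h1, rfl⟩; exact ⟨by have := a.2; omega, a.2, h1⟩

theorem splitEdges (hinp : ∀ u v : Fin n, inp ((u : ℕ) * n + v) ≠ 0 ↔ G.Adj u v)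
    (hD : ∀ u < 2 * n, ∀ v < 2 * n, n ≤ u → 0 < splitCap n k inp u v → ¬ D u v)
    (hS : ∀ v : Fin n, v ∈ S ↔ D v (v + n)) : SplitEdges G S (splitCap n k inp) D := by
  intro x y
  constructor
  · rintro ⟨hx, hy, hc, hd⟩
    by_cases c : x < n
    · simp only [splitCap, if_pos c] at hc
      split at hc
      · rename_i e
        subst e
        exact Or.inl ⟨⟨x, c⟩, rfl, rfl, fun h => hd ((hS _).1 h)⟩
      · omega
    · simp only [splitCap, if_neg c] at hc
      split at hc
      · rename_i e
        exact Or.inr ⟨⟨x - n, by omega⟩, ⟨y, e.1⟩, by simp; omega, rfl, (hinp _ _).1 e.2⟩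
      · omega
  · rintro (⟨u, rfl, rfl, hu⟩ | ⟨u, v, rfl, rfl, huv⟩)
    · have := u.2
      exact ⟨by omega, by omega, by simp [splitCap], fun h => hu ((hS u).2 h)⟩
    · have := u.2
      have := v.2
      have hc : 0 < splitCap n k inp (u + n) v := by
        have := (hinp u v).2 huv
        simp [splitCap, this]
      exact ⟨by omega, by omega, hc, hD _ (by omega) _ (by omega) (by omega) hc⟩

/-- Arcs that come from the graph have capacity `k + 1`, which exceeds the budget, so a solution
consists of splitting arcs only and costs one per deleted vertex. -/
theorem isVertexSolution_of_solves (hinp : ∀ u v : Fin n, inp ((u : ℕ) * n + v) ≠ 0 ↔ G.Adj u v)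
    {s : ℕ} (hs : 1 ≤ s) (h : Solves (2 * n) n k s (splitCap n k inp) D) :
    G.IsVertexSolution k s (univ.filter fun v : Fin n => D v (v + n)) := by
  have hD : ∀ u < 2 * n, ∀ v < 2 * n, n ≤ u → 0 < splitCap n k inp u v → ¬ D u v := by
    intro u hu v hv hn hp hd
    have h1 := (le_cost (C := splitCap n k inp) hu hv hd).trans h.1
    unfold splitCap at h1 hp
    rw [if_neg (by omega)] at h1 hp
    split at h1
    · omega
    · rename_i c; rw [if_neg c] at hp; omega
  exact ⟨by rw [← cost_splitCap hD]; exact h.1,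
    ((splitEdges hinp hD fun v => by simp).smallComps_iff hs).1 h.2⟩

theorem IsVertexSolution.solves (hinp : ∀ u v : Fin n, inp ((u : ℕ) * n + v) ≠ 0 ↔ G.Adj u v)
    {s : ℕ} (hs : 1 ≤ s) (h : G.IsVertexSolution k s S) :
    ∃ D, Solves (2 * n) n k s (splitCap n k inp) D := by
  -- Taking all pairs with a first half in `S` as tail is harmless: only the splitting arc among
  -- them has positive capacity.
  obtain ⟨D, hDd⟩ : ∃ D : ℕ → ℕ → Prop, D = fun x _ => ∃ v ∈ S, x = (v : ℕ) := ⟨_, rfl⟩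
  have hD : ∀ u < 2 * n, ∀ v < 2 * n, n ≤ u → 0 < splitCap n k inp u v → ¬ D u v := by
    subst hDd
    rintro u hu v hv hn hp ⟨w, -, rfl⟩
    have := w.2; omega
  have hS : ∀ v : Fin n, v ∈ S ↔ D v (v + n) := fun v => by
    subst hDd
    exact ⟨fun h => ⟨v, h, rfl⟩, fun ⟨w, hw, e⟩ => by rwa [Fin.ext e]⟩
  refine ⟨D, ?_, ((splitEdges hinp hD hS).smallComps_iff hs).2 h.2⟩
  rw [cost_splitCap hD]
  refine le_trans (card_le_card fun v hv => ?_) h.1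
  exact (hS v).2 (mem_filter.1 hv).2

end

theorem twinArcs_splitCap (n k : ℕ) (inp : ℕ → ℕ) : TwinArcs (2 * n) n (splitCap n k inp) := by
  intro u hu _
  have e : 2 * n - n = n := by omega
  unfold twin
  rw [e]
  by_cases c : u < n
  · left
    intro v _ hp
    rw [if_pos c]
    simp only [splitCap, if_pos c] at hp
    split at hp
    · assumption
    · omega
  · right
    intro v _ hp
    rw [if_neg c]
    unfold splitCap at hp
    split at hp
    · split at hp <;> omega
    · rw [if_neg (by omega)] at hp; omega

theorem vertex_deletion : ∃ (P : Prog) (c : ℕ), ∀ (n : ℕ) (A : Type) [Finite A]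
    (G : MultiDigraph (Fin n) A) (k s : ℕ), ∃ (t : ℕ) (τ : State), Run P (RAM.input G k s) t τ ∧
      t ≤ 4 ^ k * (k * s + k + s).factorial * (c * (n + 1) ^ c) ∧ RAM.VertexAnswer G k s τ := by
  obtain ⟨c, hc⟩ := solver_spec (.add (.var 0) (.var 0)) vertexFill vertexOut (by decide) (by decide)
    rfl rfl
  refine ⟨solver (.add (.var 0) (.var 0)) vertexFill vertexOut, c, fun n A _ G k s => ?_⟩
  set inp := (RAM.input G k s).arr 0 with hi
  have hinp : ∀ u v : Fin n, inp ((u : ℕ) * n + v) ≠ 0 ↔ G.Adj u v := fun u v => by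
    rw [hi, input_cell, arcMult, ← Nat.pos_iff_ne_zero, Set.ncard_pos]; rfl
  have hmin : ∀ S, G.IsVertexSolution k (min s n) S ↔ G.IsVertexSolution k s S := fun S =>
    and_congr_right fun _ => strongComponentsBounded_min
      ((ENat.card_le_card_of_injective Subtype.val_injective).trans (card_fin_le n))
  obtain ⟨t, τ, C', hR, ht, hset, hC', hfin⟩ := hc (2 * n) n k s inp (splitCap n k inp) _
    (fresh_input G k s) (fun τ h => by simp only [Expr.eval, h]; omega) (Or.inr rfl)
    (fun τ h u hu v hv => vertexFill_spec h u v hu hv) (twinArcs_splitCap n k inp)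
  refine ⟨t, _, hR, ht, ?_⟩
  by_cases h1 : 1 ≤ min s n
  · rcases hfin h1 with ⟨ha, hs⟩ | ⟨ha, hs⟩
    · obtain ⟨o1, o2⟩ := vertexOut_solution hset h1 ha
      refine Or.inl ⟨o1, _, (hmin _).1 (isVertexSolution_of_solves hinp h1 hs), fun v => ?_⟩
      rw [o2 v v.2]
      simp
    · refine Or.inr ⟨vertexOut_failure hset h1 ha, ?_⟩
      rintro ⟨S, hS⟩
      obtain ⟨D, hD⟩ := IsVertexSolution.solves hinp h1 ((hmin S).2 hS)
      exact hs D hD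
  · have h0 : min s n = 0 := by omega
    rw [h0] at hset
    obtain ⟨ho1, ho2⟩ := vertexOut_zero hset
    by_cases hk : n ≤ k
    · obtain ⟨o1, o2⟩ := ho2 hk
      have : IsEmpty {v : Fin n // v ∈ ((univ : Finset (Fin n)) : Set (Fin n))ᶜ} :=
        ⟨fun v => mem_compl_coe.1 v.2 (mem_univ _)⟩
      exact Or.inl ⟨o1, univ, ⟨by simpa using hk, strongComponentsBounded_of_isEmpty s⟩,
        fun v => by rw [o2 v v.2]; simp⟩
    · refine Or.inr ⟨ho1 (by omega), ?_⟩
      rintro ⟨S, hS, hS'⟩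
      have : s = 0 := by omega
      subst this
      obtain ⟨v, hv⟩ : ∃ v, v ∉ S := by
        by_contra hall
        push Not at hall
        have : S = univ := eq_univ_iff_forall.2 hall
        rw [this] at hS
        simp at hS; omega
      exact not_strongComponentsBounded_zero ⟨v, mem_compl_coe.2 hv⟩ hS'

theorem theorem2 :
    (∃ (P : RAM.Prog) (c : ℕ), ∀ (n : ℕ) (A : Type) [Finite A] (G : MultiDigraph (Fin n) A)
      (k s : ℕ), ∃ (t : ℕ) (τ : RAM.State), RAM.Run P (RAM.input G k s) t τ ∧
        t ≤ 4 ^ k * (k * s + k + s).factorial * (c * (n + 1) ^ c) ∧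
        RAM.ArcAnswer G k s τ) ∧
    (∃ (P : RAM.Prog) (c : ℕ), ∀ (n : ℕ) (A : Type) [Finite A] (G : MultiDigraph (Fin n) A)
      (k s : ℕ), ∃ (t : ℕ) (τ : RAM.State), RAM.Run P (RAM.input G k s) t τ ∧
        t ≤ 4 ^ k * (k * s + k + s).factorial * (c * (n + 1) ^ c) ∧
        RAM.VertexAnswer G k s τ) :=
  ⟨arc_deletion, vertex_deletion⟩
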